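/- Let $q\in\mathbb{C}^*$ not be a root of unity and $\mathfrak g=sl_2$. Identify a coweight $\mu$ with the integer $\alpha_1(\mu)$ (so $\alpha_1^\vee=2$), and write $\mu'\preceq\mu$ if $\mu-\mu'\in\mathbb{Z}_{\ge 0}\,\alpha_1^\vee$. Let $N,a\geq 0$ be integers, $\lambda=N\omega_1^\vee$, $\mu=\lambda-a\alpha_1^\vee$, let $Z(z)=\prod_{s=1}^N(1-qzz_s)$ with $z_s\in\mathbb{C}^*$, let $z'\in\mathbb{C}^*$ satisfy $(z')^2=(-q)^Nz_1\cdots z_N$, and put $\mathcal Z=(Z,z')$. Let $\mathcal U_q^\mu=\mathcal U_q^{\mu}(\hat{sl}_2)$ be the shifted quantum affine algebra, with Drinfeld generators $x^\pm_m$, $\phi^\pm_m$ ($m\in\mathbb Z$), $h_r$ ($r\neq0$), where $\phi^+(z)=\phi^+_0\exp((q-q^{-1})\sum_{r>0}h_rz^r)$ and $\phi^-(z)=z^{\alpha_1(\mu)}\phi^-_{\alpha_1(\mu)}\exp(-(q-q^{-1})\sum_{r>0}h_{-r}z^{-r})$ with $\phi_0^+$, $\phi^-_{\alpha_1(\mu)}$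 invertible, and relations: the $\phi^\pm_m$ commute, $\phi^+_0x^\pm_r=q^{\pm2}x^\pm_r\phi^+_0$, $\phi^-_{\alpha_1(\mu)}x^\pm_r=q^{\mp2}x^\pm_r\phi^-_{\alpha_1(\mu)}$, $[h_m,x^\pm_r]=\pm\frac1m[2m]_qx^\pm_{m+r}$, $[x^+_r,x^-_s]=\frac{\phi^+_{r+s}-\phi^-_{r+s}}{q-q^{-1}}$, $x^\pm_{r+1}x^\pm_s-q^{\pm2}x^\pm_sx^\pm_{r+1}=q^{\pm2}x^\pm_rx^\pm_{s+1}-x^\pm_{s+1}x^\pm_r$. Let $\mathcal U_q^{\mu,ad}$ be its adjoint version, with additional invertible generators $\overline\phi^\pm$ such that $(\overline\phi^+)^2=\phi^+_0$, $(\overline\phi^-)^2=\phi^-_{\alpha_1(\mu)}$, commuting with each other and with the $\phi^\pm_m$, and $\overline\phi^+x^\pm_m=q^{\pm1}x^\pm_m\overline\phi^+$, $\overline\phi^-x^\pm_m=q^{\mp1}x^\pm_m\overline\phi^-$. For a rational function $\Psi=\Psi(0)\prod_{b\in\mathbb{C}^*}(1-zb)^{\nu_b}$ put $$\overline Y^\pm_{\Psi}(z)=\exp\Big(-\sum_{m>0}\frac{\sum_b\nu_bb^{\pm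 m}}{m(q^m+q^{-m})}z^{\pm m}\Big),\qquad Y^\pm(z)=\overline\phi^\pm\exp\Big(\pm(q-q^{-1})\sum_{m>0}\frac{h_{\pm m}}{q^m+q^{-m}}z^{\pm m}\Big),$$ $A^+(z)=\overline Y^+_Z(zq^{-1})/Y^+(zq^{-1})$ and $A^-(z)=z'\,\overline Y^-_Z(zq^{-1})/Y^-(zq^{-1})$. The truncation $\mathcal U_{q,\lambda}^{\mu,\mathcal Z}$ is the quotient of $\mathcal U_q^{\mu,ad}$ by the relations that $A^\pm(z)$ is a polynomial of degree $a$ in $z^{\pm1}$, $A^+_0A^-_0=(-q)^a$ and $A^+(z)=(zq^{-1})^aA^-(z)$. Let $\mathcal O_\mu$ be the category of $\mathcal U_q^\mu$-modules that are the sum of the eigenspaces $V^+_\omega=\{\phi_0^+=\omega\}$ and also of the eigenspaces $V^-_\omega=\{\phi^-_{\alpha_1(\mu)}=\omega^{-1}\}$ ($\omega\in\mathbb{C}^*$), all finite-dimensional, the $\omega$ with $V^+_\omega\ne0$ or $V^-_\omega\neq0$ lying in finitely many sets $\omega_jq^{-2\mathbb{Z}_{\ge0}}$. For a rational function $\Psi$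 of degree $\alpha_1(\mu)$, regular and non-zero at $0$, let $L(\Psi)$ denote the simple module in $\mathcal O_\mu$ of highest $\ell$-weight $\Psi$ (generated by a vector $v$ with $x^+_mv=0$ for all $m$, on which $\phi^\pm(z)$ act by the expansions of $\Psi$ at $0$ and $\infty$). A module in $\mathcal O_\mu$ descends to the truncation if its $\mathcal U_q^\mu$-action is induced by a $\mathcal U_{q,\lambda}^{\mu,\mathcal Z}$-module structure; let $\mathcal O^\lambda_{\mu,\mathcal Z}\subset\mathcal O_\mu$ be the full subcategory of these modules. (1) Choose $c\in\mathbb{C}^*$ with $c^2=\Psi(0)$ and let $P(z)=c^{-1}\,\overline Y^+_{Z\Psi^{-1}}(zq^{-1})$ (the eigenvalue of $A^+(z)$ on a highest weight vector of $L(\Psi)$ on which $\overline\phi^+$ acts by $c$). Then $L(\Psi)$ descends to $\mathcal U_{q,\lambda}^{\mu,\mathcal Z}$ if and only if $P(z)$ and $P(z)\Psi(z)$ are polynomials and $P(z)\sim_{z\to\infty}(-z)^aP(0)^{-1}$. (2) If $\mathcal O^\lambda_{\mu,\mathcal Z}$ contains a non-zero module, then $-\lambda\preceq\mu\preceq\lambda$.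 (3) The simple representations in $\mathcal O^\lambda_{\mu,\mathcal Z}$ are, up to isomorphism of $\mathcal U_q^\mu$-modules, in bijection with the divisors $\tilde Z(z)$ of $Z(zq^{-2})$ of degree $a=\omega_1(\lambda-\mu)$ with $\tilde Z(0)=1$; the highest $\ell$-weight of the simple representation corresponding to $\tilde Z$ satisfies $$\Psi(z)=\Psi(0)\frac{Z(z)}{\tilde Z(zq^{2})\tilde Z(z)}.$$ -/

import Mathlib

open Polynomial

universe u

noncomputable section

namespace ShiftedSl2

/-! ## Power series over a (possibly non-commutative) complex algebra -/

section Series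

variable {A : Type*} [Ring A] [Algebra ℂ A]

/-- `exp(f) = ∑ₙ fⁿ / n!` for a power series `f` without constant term; the coefficient of
degree `m` only involves the powers `fⁿ` with `n ≤ m`. -/
def expSeries (f : PowerSeries A) : PowerSeries A :=
  PowerSeries.mk fun m =>
    ∑ n ∈ Finset.range (m + 1), ((n.factorial : ℂ)⁻¹) • PowerSeries.coeff m (f ^ n)

/-- `f(z) ↦ f(c z)`. -/
def scaleArg (c : ℂ) (f : PowerSeries A) : PowerSeries A :=
  PowerSeries.mk fun m => c ^ m • PowerSeries.coeff m f

/-- The power series `∑_{m > 0} c m zᵐ`. -/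
def positiveSeries (c : ℕ → A) : PowerSeries A :=
  PowerSeries.mk fun m => if m = 0 then 0 else c m

end Series

/-- The quantum integer `[m]_q`. -/
def qInt (q : ℂ) (m : ℤ) : ℂ := (q ^ m - q ^ (-m)) / (q - q⁻¹)

/-! ## The shifted quantum affine algebra of `sl₂`

A coweight `k ω₁^∨` of `sl₂` is given by the integer `k = α₁(k ω₁^∨)`, so `α₁^∨` is `2`. -/

/-- The dominance order on coweights: `m ⪯ n` if `n - m` is a nonnegative multiple of `α₁^∨`. -/
def CoweightLE (m n : ℤ) : Prop := ∃ j : ℕ, n - m = 2 * (j : ℤ)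

/-- Drinfeld generators, with formal inverses of `φ⁺_0` and of `φ⁻_{α₁(μ)}`. -/
inductive Gen : Type
  | xPlus (m : ℤ)
  | xMinus (m : ℤ)
  | phiPlus (m : ℤ)
  | phiMinus (m : ℤ)
  | h (m : ℤ)
  | phiPlusInv
  | phiMinusInv

namespace Gen

/-- A generator as an element of the free algebra. -/
abbrev el (g : Gen) : FreeAlgebra ℂ Gen := FreeAlgebra.ι ℂ g

end Gen

open Gen in
/-- Defining relations of `U_q^μ(ŝl₂) = U_q^{0,μ}(ŝl₂)`, where `μ` stands for the integer `α₁(μ)`.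
There is no generator `h_0`: it is set to zero. -/
inductive Rel (q : ℂ) (μ : ℤ) : FreeAlgebra ℂ Gen → FreeAlgebra ℂ Gen → Prop
  | h_zero : Rel q μ (el (h 0)) 0
  | phiPlus_inv_right : Rel q μ (el (phiPlus 0) * el phiPlusInv) 1
  | phiPlus_inv_left : Rel q μ (el phiPlusInv * el (phiPlus 0)) 1
  | phiMinus_inv_right : Rel q μ (el (phiMinus μ) * el phiMinusInv) 1
  | phiMinus_inv_left : Rel q μ (el phiMinusInv * el (phiMinus μ)) 1
  /- `φ⁺(z) = φ⁺_0 exp((q - q⁻¹) ∑_{r>0} h_r z^r)` -/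
  | phiPlus_neg (m : ℤ) (hm : m < 0) : Rel q μ (el (phiPlus m)) 0
  | phiPlus_exp (m : ℕ) : Rel q μ (el (phiPlus m))
      (el (phiPlus 0) * PowerSeries.coeff m
        (expSeries (positiveSeries fun r => (q - q⁻¹) • el (h r))))
  /- `φ⁻(z) = z^μ φ⁻_μ exp(-(q - q⁻¹) ∑_{r>0} h_{-r} z^{-r})` -/
  | phiMinus_big (m : ℤ) (hm : μ < m) : Rel q μ (el (phiMinus m)) 0
  | phiMinus_exp (m : ℕ) : Rel q μ (el (phiMinus (μ - m)))
      (el (phiMinus μ) * PowerSeries.coeff m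
        (expSeries (positiveSeries fun r => (-(q - q⁻¹)) • el (h (-(r : ℤ))))))
  | phiPlus_comm (r s : ℤ) :
      Rel q μ (el (phiPlus r) * el (phiPlus s)) (el (phiPlus s) * el (phiPlus r))
  | phiMinus_comm (r s : ℤ) :
      Rel q μ (el (phiMinus r) * el (phiMinus s)) (el (phiMinus s) * el (phiMinus r))
  | phiPlus_phiMinus_comm (r s : ℤ) :
      Rel q μ (el (phiPlus r) * el (phiMinus s)) (el (phiMinus s) * el (phiPlus r))
  | phiPlus_xPlus (r : ℤ) :
      Rel q μ (el (phiPlus 0) * el (xPlus r)) (q ^ (2 : ℤ) • (el (xPlus r) * el (phiPlus 0)))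
  | phiPlus_xMinus (r : ℤ) :
      Rel q μ (el (phiPlus 0) * el (xMinus r)) (q ^ (-2 : ℤ) • (el (xMinus r) * el (phiPlus 0)))
  | phiMinus_xPlus (r : ℤ) :
      Rel q μ (el (phiMinus μ) * el (xPlus r)) (q ^ (-2 : ℤ) • (el (xPlus r) * el (phiMinus μ)))
  | phiMinus_xMinus (r : ℤ) :
      Rel q μ (el (phiMinus μ) * el (xMinus r)) (q ^ (2 : ℤ) • (el (xMinus r) * el (phiMinus μ)))
  | h_xPlus (m r : ℤ) (hm : m ≠ 0) :
      Rel q μ (el (h m) * el (xPlus r) - el (xPlus r) * el (h m))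
        ((qInt q (2 * m) / (m : ℂ)) • el (xPlus (m + r)))
  | h_xMinus (m r : ℤ) (hm : m ≠ 0) :
      Rel q μ (el (h m) * el (xMinus r) - el (xMinus r) * el (h m))
        ((-(qInt q (2 * m) / (m : ℂ))) • el (xMinus (m + r)))
  | xPlus_xMinus (r s : ℤ) :
      Rel q μ (el (xPlus r) * el (xMinus s) - el (xMinus s) * el (xPlus r))
        ((q - q⁻¹)⁻¹ • (el (phiPlus (r + s)) - el (phiMinus (r + s))))
  | xPlus_quad (r s : ℤ) :
      Rel q μ (el (xPlus (r + 1)) * el (xPlus s) - q ^ (2 : ℤ) • (el (xPlus s) * el (xPlus (r + 1))))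
        (q ^ (2 : ℤ) • (el (xPlus r) * el (xPlus (s + 1))) - el (xPlus (s + 1)) * el (xPlus r))
  | xMinus_quad (r s : ℤ) :
      Rel q μ
        (el (xMinus (r + 1)) * el (xMinus s) - q ^ (-2 : ℤ) • (el (xMinus s) * el (xMinus (r + 1))))
        (q ^ (-2 : ℤ) • (el (xMinus r) * el (xMinus (s + 1))) - el (xMinus (s + 1)) * el (xMinus r))

/-- The shifted quantum affine algebra `U_q^μ(ŝl₂)`. -/
abbrev ShiftedAlg (q : ℂ) (μ : ℤ) : Type := RingQuot (Rel q μ)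

/-- The image of a generator in `U_q^μ(ŝl₂)`. -/
def gen (q : ℂ) (μ : ℤ) (g : Gen) : ShiftedAlg q μ := RingQuot.mkAlgHom ℂ (Rel q μ) g.el

/-! ## The adjoint version -/

/-- Generators of the adjoint version: those of `U_q^μ(ŝl₂)` and `(φ̄⁺)^{±1}`, `(φ̄⁻)^{±1}`. -/
inductive AdGen : Type
  | base (g : Gen)
  | barPlus
  | barMinus
  | barPlusInv
  | barMinusInv

namespace AdGen

/-- A generator as an element of the free algebra. -/
abbrev el (g : AdGen) : FreeAlgebra ℂ AdGen := FreeAlgebra.ι ℂ g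

/-- Inclusion of the free algebra on the smaller set of generators. -/
def incl : FreeAlgebra ℂ Gen →ₐ[ℂ] FreeAlgebra ℂ AdGen :=
  FreeAlgebra.lift ℂ fun g => el (base g)

end AdGen

open Gen AdGen in
/-- Defining relations of `U_q^{μ,ad}(ŝl₂)`. -/
inductive AdRel (q : ℂ) (μ : ℤ) : FreeAlgebra ℂ AdGen → FreeAlgebra ℂ AdGen → Prop
  | base {u v : FreeAlgebra ℂ Gen} (huv : Rel q μ u v) : AdRel q μ (incl u) (incl v)
  | barPlus_inv_right : AdRel q μ (AdGen.el barPlus * AdGen.el barPlusInv) 1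
  | barPlus_inv_left : AdRel q μ (AdGen.el barPlusInv * AdGen.el barPlus) 1
  | barMinus_inv_right : AdRel q μ (AdGen.el barMinus * AdGen.el barMinusInv) 1
  | barMinus_inv_left : AdRel q μ (AdGen.el barMinusInv * AdGen.el barMinus) 1
  | barPlus_sq : AdRel q μ (AdGen.el barPlus ^ 2) (AdGen.el (base (phiPlus 0)))
  | barMinus_sq : AdRel q μ (AdGen.el barMinus ^ 2) (AdGen.el (base (phiMinus μ)))
  | bar_comm : AdRel q μ (AdGen.el barPlus * AdGen.el barMinus) (AdGen.el barMinus * AdGen.el barPlus)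
  | barPlus_phiPlus (r : ℤ) : AdRel q μ (AdGen.el (base (phiPlus r)) * AdGen.el barPlus)
      (AdGen.el barPlus * AdGen.el (base (phiPlus r)))
  | barPlus_phiMinus (r : ℤ) : AdRel q μ (AdGen.el (base (phiMinus r)) * AdGen.el barPlus)
      (AdGen.el barPlus * AdGen.el (base (phiMinus r)))
  | barMinus_phiPlus (r : ℤ) : AdRel q μ (AdGen.el (base (phiPlus r)) * AdGen.el barMinus)
      (AdGen.el barMinus * AdGen.el (base (phiPlus r)))
  | barMinus_phiMinus (r : ℤ) : AdRel q μ (AdGen.el (base (phiMinus r)) * AdGen.el barMinus)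
      (AdGen.el barMinus * AdGen.el (base (phiMinus r)))
  | barPlus_xPlus (r : ℤ) : AdRel q μ (AdGen.el barPlus * AdGen.el (base (xPlus r)))
      (q • (AdGen.el (base (xPlus r)) * AdGen.el barPlus))
  | barPlus_xMinus (r : ℤ) : AdRel q μ (AdGen.el barPlus * AdGen.el (base (xMinus r)))
      (q⁻¹ • (AdGen.el (base (xMinus r)) * AdGen.el barPlus))
  | barMinus_xPlus (r : ℤ) : AdRel q μ (AdGen.el barMinus * AdGen.el (base (xPlus r)))
      (q⁻¹ • (AdGen.el (base (xPlus r)) * AdGen.el barMinus))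
  | barMinus_xMinus (r : ℤ) : AdRel q μ (AdGen.el barMinus * AdGen.el (base (xMinus r)))
      (q • (AdGen.el (base (xMinus r)) * AdGen.el barMinus))

/-- The adjoint version `U_q^{μ,ad}(ŝl₂)`. -/
abbrev AdAlg (q : ℂ) (μ : ℤ) : Type := RingQuot (AdRel q μ)

/-- The image of a generator in `U_q^{μ,ad}(ŝl₂)`. -/
def adGen (q : ℂ) (μ : ℤ) (g : AdGen) : AdAlg q μ := RingQuot.mkAlgHom ℂ (AdRel q μ) g.el

/-- The canonical morphism `U_q^μ(ŝl₂) → U_q^{μ,ad}(ŝl₂)`. -/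
def toAd (q : ℂ) (μ : ℤ) : ShiftedAlg q μ →ₐ[ℂ] AdAlg q μ :=
  RingQuot.liftAlgHom ℂ ⟨(RingQuot.mkAlgHom ℂ (AdRel q μ)).comp AdGen.incl,
    fun _ _ huv => RingQuot.mkAlgHom_rel ℂ (AdRel.base huv)⟩

/-- `φ̄⁺` as a unit. -/
def barPlusUnit (q : ℂ) (μ : ℤ) : (AdAlg q μ)ˣ where
  val := adGen q μ .barPlus
  inv := adGen q μ .barPlusInv
  val_inv := by
    have := RingQuot.mkAlgHom_rel ℂ (AdRel.barPlus_inv_right (q := q) (μ := μ))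
    rwa [map_mul, map_one] at this
  inv_val := by
    have := RingQuot.mkAlgHom_rel ℂ (AdRel.barPlus_inv_left (q := q) (μ := μ))
    rwa [map_mul, map_one] at this

/-- `φ̄⁻` as a unit. -/
def barMinusUnit (q : ℂ) (μ : ℤ) : (AdAlg q μ)ˣ where
  val := adGen q μ .barMinus
  inv := adGen q μ .barMinusInv
  val_inv := by
    have := RingQuot.mkAlgHom_rel ℂ (AdRel.barMinus_inv_right (q := q) (μ := μ))
    rwa [map_mul, map_one] at this
  inv_val := by
    have := RingQuot.mkAlgHom_rel ℂ (AdRel.barMinus_inv_left (q := q) (μ := μ))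
    rwa [map_mul, map_one] at this

/-! ## `ℓ`-weights and the series `Ȳ` -/

/-- The inverse `1 / (q^m + q^{-m})` of the quantum Cartan matrix of `sl₂` at `q^m`. -/
def invCartan (q : ℂ) (m : ℕ) : ℂ := (q ^ m + (q ^ m)⁻¹)⁻¹

/-- For `Ψ = Ψ(0) ∏_a (1 - a z)^{ν_a}`, the sum `∑_a ν_a a^m`. The `a` are the inverses of the
zeros (counted positively) and poles (counted negatively) of `Ψ`. -/
def powerSum (Ψ : RatFunc ℂ) (m : ℤ) : ℂ :=
  (Ψ.num.roots.map fun b => b⁻¹ ^ m).sum - (Ψ.denom.roots.map fun b => b⁻¹ ^ m).sum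

/-- `Ȳ⁺_Ψ(z) = exp(-∑_{m>0} C̃(q^m) (∑_a ν_a a^m) z^m / m)`, with constant term `1`. -/
def YbarPlus (q : ℂ) (Ψ : RatFunc ℂ) : PowerSeries ℂ :=
  expSeries (positiveSeries fun m => -(invCartan q m * powerSum Ψ m / (m : ℂ)))

/-- `Ȳ⁻_Ψ(z) = exp(-∑_{m>0} C̃(q^m) (∑_a ν_a a^{-m}) z^{-m} / m)`, a series in `z⁻¹`. -/
def YbarMinus (q : ℂ) (Ψ : RatFunc ℂ) : PowerSeries ℂ :=
  expSeries (positiveSeries fun m => -(invCartan q m * powerSum Ψ (-(m : ℤ)) / (m : ℂ)))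

/-- The expansion of a rational function at `z = 0`, a Laurent series in `z`. -/
def expandZero (Ψ : RatFunc ℂ) : LaurentSeries ℂ :=
  aeval (HahnSeries.single (1 : ℤ) (1 : ℂ) : LaurentSeries ℂ) Ψ.num /
    aeval (HahnSeries.single (1 : ℤ) (1 : ℂ) : LaurentSeries ℂ) Ψ.denom

/-- The expansion of a rational function at `z = ∞`, a Laurent series in `z⁻¹`. -/
def expandInfty (Ψ : RatFunc ℂ) : LaurentSeries ℂ :=
  aeval (HahnSeries.single (-1 : ℤ) (1 : ℂ) : LaurentSeries ℂ) Ψ.num /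
    aeval (HahnSeries.single (-1 : ℤ) (1 : ℂ) : LaurentSeries ℂ) Ψ.denom

/-- `Ψ(0)`. -/
def valueAtZero (Ψ : RatFunc ℂ) : ℂ := Ψ.num.eval 0 / Ψ.denom.eval 0

/-- The set `𝔯_μ`: rational functions of degree `α₁(μ)`, regular and non-zero at `0`. -/
def IsLWeight (μ : ℤ) (Ψ : RatFunc ℂ) : Prop :=
  Ψ.num.eval 0 ≠ 0 ∧ Ψ.denom.eval 0 ≠ 0 ∧ Ψ.intDegree = μ

/-! ## Truncation -/

/-- `Z(z) = ∏_s (1 - q z z_s)`. -/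
def Zpoly (q : ℂ) {N : ℕ} (zs : Fin N → ℂˣ) : ℂ[X] := ∏ s, (1 - C (q * (zs s : ℂ)) * X)

/-- `Z` as a rational function. -/
def Zrat (q : ℂ) {N : ℕ} (zs : Fin N → ℂˣ) : RatFunc ℂ :=
  algebraMap ℂ[X] (RatFunc ℂ) (Zpoly q zs)

/-- `Y⁺(z) = φ̄⁺ exp((q - q⁻¹) ∑_{m>0} h̃_m z^m)` with `h̃_m = C̃(q^m) h_m`. -/
def YPlus (q : ℂ) (μ : ℤ) : PowerSeries (AdAlg q μ) :=
  PowerSeries.C (adGen q μ .barPlus) * expSeries (positiveSeries fun m =>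
    ((q - q⁻¹) * invCartan q m) • adGen q μ (.base (.h m)))

/-- `Y⁻(z) = φ̄⁻ exp(-(q - q⁻¹) ∑_{m>0} h̃_{-m} z^{-m})`, a series in `z⁻¹`. -/
def YMinus (q : ℂ) (μ : ℤ) : PowerSeries (AdAlg q μ) :=
  PowerSeries.C (adGen q μ .barMinus) * expSeries (positiveSeries fun m =>
    (-((q - q⁻¹) * invCartan q m)) • adGen q μ (.base (.h (-(m : ℤ)))))

/-- `A⁺(z) = Ȳ⁺_Z(z q⁻¹) / Y⁺(z q⁻¹)`. -/
def APlus (q : ℂ) (μ : ℤ) {N : ℕ} (zs : Fin N → ℂˣ) : PowerSeries (AdAlg q μ) :=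
  scaleArg q⁻¹ (PowerSeries.map (algebraMap ℂ (AdAlg q μ)) (YbarPlus q (Zrat q zs)) *
    PowerSeries.invOfUnit (YPlus q μ) (barPlusUnit q μ))

/-- `A⁻(z) = z' Ȳ⁻_Z(z q⁻¹) / Y⁻(z q⁻¹)`, a series in `z⁻¹`. -/
def AMinus (q : ℂ) (μ : ℤ) {N : ℕ} (zs : Fin N → ℂˣ) (z' : ℂˣ) : PowerSeries (AdAlg q μ) :=
  (z' : ℂ) • scaleArg q (PowerSeries.map (algebraMap ℂ (AdAlg q μ)) (YbarMinus q (Zrat q zs)) *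
    PowerSeries.invOfUnit (YMinus q μ) (barMinusUnit q μ))

/-- The truncation relations: `A^±(z)` is a polynomial of degree `a` in `z^{±1}`,
`A⁺_0 A⁻_0 = (-q)^a` and `A⁺(z) = (z q⁻¹)^a A⁻(z)`. (The last two make `A⁺_a` and `A⁻_{-a}`
invertible, so that the degrees are `a`.) -/
inductive TruncRel (q : ℂ) (μ : ℤ) (a : ℕ) {N : ℕ} (zs : Fin N → ℂˣ) (z' : ℂˣ) :
    AdAlg q μ → AdAlg q μ → Prop
  | plus_vanish (r : ℕ) (hr : a < r) :
      TruncRel q μ a zs z' (PowerSeries.coeff r (APlus q μ zs)) 0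
  | minus_vanish (r : ℕ) (hr : a < r) :
      TruncRel q μ a zs z' (PowerSeries.coeff r (AMinus q μ zs z')) 0
  | const : TruncRel q μ a zs z'
      (PowerSeries.coeff 0 (APlus q μ zs) * PowerSeries.coeff 0 (AMinus q μ zs z'))
      (algebraMap ℂ (AdAlg q μ) ((-q) ^ a))
  | compare (r : ℕ) (hr : r ≤ a) : TruncRel q μ a zs z'
      (PowerSeries.coeff r (APlus q μ zs))
      ((q⁻¹ ^ a) • PowerSeries.coeff (a - r) (AMinus q μ zs z'))

/-- The truncated shifted quantum affine algebra `U_{q,λ}^{μ,𝒵}(ŝl₂)`, with `λ - μ = a α₁^∨`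
and `𝒵 = (Z, z')`. -/
abbrev TruncAlg (q : ℂ) (μ : ℤ) (a : ℕ) {N : ℕ} (zs : Fin N → ℂˣ) (z' : ℂˣ) : Type :=
  RingQuot (TruncRel q μ a zs z')

/-- The canonical morphism `U_q^μ(ŝl₂) → U_{q,λ}^{μ,𝒵}(ŝl₂)`. -/
def toTrunc (q : ℂ) (μ : ℤ) (a : ℕ) {N : ℕ} (zs : Fin N → ℂˣ) (z' : ℂˣ) :
    ShiftedAlg q μ →ₐ[ℂ] TruncAlg q μ a zs z' :=
  (RingQuot.mkAlgHom ℂ (TruncRel q μ a zs z')).comp (toAd q μ)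

/-! ## Representations -/

section Modules

variable (q : ℂ) (μ : ℤ) (V : Type*) [AddCommGroup V] [Module ℂ V] [Module (ShiftedAlg q μ) V]
  [IsScalarTower ℂ (ShiftedAlg q μ) V]

/-- The operator on `V` given by a generator. -/
def op (g : Gen) : Module.End ℂ V := Algebra.lsmul ℂ ℂ V (gen q μ g)

/-- `V_ω⁺`, the `ω`-eigenspace of `φ⁺_0`. -/
def weightPlus (ω : ℂˣ) : Submodule ℂ V :=
  (op q μ V (.phiPlus 0)).eigenspace (ω : ℂ)

/-- `V_ω⁻`, the `ω⁻¹`-eigenspace of `φ⁻_{α₁(μ)}`. -/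
def weightMinus (ω : ℂˣ) : Submodule ℂ V :=
  (op q μ V (.phiMinus μ)).eigenspace ((ω⁻¹ : ℂˣ) : ℂ)

/-- The category `𝒪_μ`. (The sum of the eigenspaces of an operator is always direct.) -/
structure InCategoryO : Prop where
  sum_plus : ⨆ ω : ℂˣ, weightPlus q μ V ω = ⊤
  sum_minus : ⨆ ω : ℂˣ, weightMinus q μ V ω = ⊤
  finite_plus : ∀ ω : ℂˣ, FiniteDimensional ℂ (weightPlus q μ V ω)
  finite_minus : ∀ ω : ℂˣ, FiniteDimensional ℂ (weightMinus q μ V ω)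
  bounded : ∃ S : Finset ℂˣ, ∀ ω : ℂˣ, weightPlus q μ V ω ≠ ⊥ ∨ weightMinus q μ V ω ≠ ⊥ →
    ∃ ω' ∈ S, ∃ n : ℕ, (ω' : ℂ) = (ω : ℂ) * (q ^ 2) ^ n

/-- `V` is of highest `ℓ`-weight `Ψ`. -/
def HasHighestLWeight (Ψ : RatFunc ℂ) : Prop :=
  ∃ v : V, Submodule.span (ShiftedAlg q μ) {v} = ⊤ ∧
    (∀ m : ℤ, gen q μ (.xPlus m) • v = 0) ∧
    (∀ m : ℤ, gen q μ (.phiPlus m) • v = (expandZero Ψ).coeff m • v) ∧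
    (∀ m : ℤ, gen q μ (.phiMinus m) • v = (expandInfty Ψ).coeff (-m) • v)

/-- `V` descends to the truncation: its structure of `U_q^μ(ŝl₂)`-module comes from a structure of
`U_q^{μ,ad}(ŝl₂)`-module that satisfies the truncation relations. -/
def Descends (a : ℕ) {N : ℕ} (zs : Fin N → ℂˣ) (z' : ℂˣ) : Prop :=
  ∃ ρ : TruncAlg q μ a zs z' →ₐ[ℂ] Module.End ℂ V,
    ∀ (u : ShiftedAlg q μ) (v : V), ρ (toTrunc q μ a zs z' u) v = u • v

end Modules

/-- `Ȳ⁺_{ZΨ⁻¹}(z q⁻¹)`, normalized as the eigenvalue of `A⁺(z)` on a highest weight vector on which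
`φ̄⁺` acts by `c` (so `c² = Ψ(0)`); its constant term is `c⁻¹`. -/
def highestEigenvalue (q : ℂ) {N : ℕ} (zs : Fin N → ℂˣ) (Ψ : RatFunc ℂ) (c : ℂ) :
    PowerSeries ℂ :=
  c⁻¹ • scaleArg q⁻¹ (YbarPlus q (Zrat q zs / Ψ))

/-- `Ȳ⁺_{ZΨ⁻¹}(z q⁻¹)` and `Ȳ⁺_{ZΨ⁻¹}(z q⁻¹) Ψ(z)` are polynomials and
`Ȳ⁺_{ZΨ⁻¹}(z q⁻¹) ∼ (-z)^a Ȳ⁺_{ZΨ⁻¹}(0)⁻¹` when `z → ∞`. -/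
def PolynomialityCondition (q : ℂ) (a : ℕ) {N : ℕ} (zs : Fin N → ℂˣ) (Ψ : RatFunc ℂ) (c : ℂ) :
    Prop :=
  ∃ P Q : ℂ[X], (P : PowerSeries ℂ) = highestEigenvalue q zs Ψ c ∧
    algebraMap ℂ[X] (RatFunc ℂ) Q = algebraMap ℂ[X] (RatFunc ℂ) P * Ψ ∧
    P.natDegree = a ∧ P.leadingCoeff = (-1) ^ a * (P.eval 0)⁻¹

/-- Simple representations in `𝒪_{μ,𝒵}^λ`. -/
structure SimpleObj (q : ℂ) (μ : ℤ) (a : ℕ) {N : ℕ} (zs : Fin N → ℂˣ) (z' : ℂˣ) where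
  V : Type u
  [addCommGroup : AddCommGroup V]
  [moduleC : Module ℂ V]
  [moduleU : Module (ShiftedAlg q μ) V]
  [tower : IsScalarTower ℂ (ShiftedAlg q μ) V]
  simple : IsSimpleModule (ShiftedAlg q μ) V
  inO : InCategoryO q μ V
  descends : Descends q μ V a zs z'

attribute [instance] SimpleObj.addCommGroup SimpleObj.moduleC SimpleObj.moduleU SimpleObj.tower

/-- Isomorphism of `U_q^μ(ŝl₂)`-modules. -/
instance SimpleObj.setoid (q : ℂ) (μ : ℤ) (a : ℕ) {N : ℕ} (zs : Fin N → ℂˣ) (z' : ℂˣ) :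
    Setoid (SimpleObj.{u} q μ a zs z') where
  r S T := Nonempty (S.V ≃ₗ[ShiftedAlg q μ] T.V)
  iseqv := ⟨fun _ => ⟨LinearEquiv.refl _ _⟩, fun ⟨e⟩ => ⟨e.symm⟩, fun ⟨e⟩ ⟨f⟩ => ⟨e.trans f⟩⟩

/-- Isomorphism classes of simple representations in `𝒪_{μ,𝒵}^λ`. -/
def SimpleClasses (q : ℂ) (μ : ℤ) (a : ℕ) {N : ℕ} (zs : Fin N → ℂˣ) (z' : ℂˣ) : Type (u + 1) :=
  Quotient (SimpleObj.setoid.{u} q μ a zs z')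

/-- Divisors `Z̃(z)` of `Z(z q⁻²)` of degree `a` with `Z̃(0) = 1`. -/
def Divisors (q : ℂ) (a : ℕ) {N : ℕ} (zs : Fin N → ℂˣ) : Type :=
  {W : ℂ[X] // W ∣ (Zpoly q zs).comp (C (q ^ (-2 : ℤ)) * X) ∧ W.natDegree = a ∧ W.eval 0 = 1}

/-- The rational function `c Z(z) / (W(z q²) W(z))`. -/
def divisorLWeight (q : ℂ) {N : ℕ} (zs : Fin N → ℂˣ) (W : ℂ[X]) (c : ℂ) : RatFunc ℂ :=
  RatFunc.C c * Zrat q zs /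
    (algebraMap ℂ[X] (RatFunc ℂ) (W.comp (C (q ^ 2) * X)) * algebraMap ℂ[X] (RatFunc ℂ) W)

end ShiftedSl2

end

/-! Once the square roots `φ̄^±` are stripped off, truncation concerns only the Cartan currents. The
series `a(z) = φ̄⁺ A⁺(z)` has coefficients in the shifted algebra and satisfies `a(z) a(q² z) φ⁺(z)
= φ⁺_0 Z(z)`. Truncation asks that `a(z)`, and its analogue `b` at infinity, have degree at most
`a`, and that `a_k = (-1)^a φ⁺_0 b_{a-k}`. This is `IsTruncated`. The relation `A⁺_0 A⁻_0 = (-q)^a`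
forces `φ̄⁻` to be a multiple of the inverse of `φ̄⁺`; conversely, `φ̄⁺` can be rebuilt as a square
root of `φ⁺_0` when `φ⁺_0` is diagonalizable on a single `q²`-string of eigenvalues and the central
element `φ⁺_0 φ⁻_μ` acts by the right scalar (`Descends.isTruncated`, `IsTruncated.descends`).

Necessity. The commutation of `a(z)` with `x⁻(w)` and the vanishing of the coefficient of degree `a
+ 1` give `x⁻(z) a(z) = 0` (`sum_xMinus_mul_aSeries`). Let `W` be the polynomial by which `a(z)`
acts on a highest weight vector. Applying `x⁺_0` gives `W φ⁺ = W φ⁻` on that vector. The left side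
is supported in degrees bounded below, the right side in degrees bounded above, so both are a
polynomial `Q` and the highest `ℓ`-weight is `Q / W`. The defining equation of `a(z)` becomes `W(q²
z) Q(z) = Ψ(0) Z(z)`, and the top coefficient of `W` is `(-1)^a Ψ(0)`. These facts are recorded in
`IsFactor`. Thus `W` divides `Z(z q⁻²)`, the degree of `Q` is `N - a ≥ 0`, which bounds `μ`, and `Ψ
= Ψ(0) Z / (W(q² z) W)`.

Sufficiency. The point is to show that the simple module attached to a divisor `W` is truncated. Let
`β_i` be the inverses of the roots of `W`. When no two of them differ by a power of `q²`, there is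
an explicit Gelfand-Tsetlin representation on functions on `ℤ^a`: `a(z)` is diagonal with eigenvalue
`∏ (1 - β_i q^{-2 n_i} z)`, and `x^±` are difference operators. The relation between `x⁺` and `x⁻`
is a partial fraction expansion (`gtOp_rel`). The truncation relations hold there for all vectors.
The delta function at the origin is killed by `x⁺` because `W(q² z)` divides `Z`, and the matrix
coefficient at the origin is a vacuum functional (`exists_gtVacuum`).

For arbitrary `β` the parameters, and `Z` with them, are deformed along a line. All but countably
many parameters on it are generic. The spanning half of the triangular decomposition shows that a
vacuum functional is determined by its `ℓ`-weight and depends continuously on it, so vacuum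
functionals have limits, and the identities `χ(Y y X) = 0` that express truncation survive
(`exists_truncated_vacuum`). In the simple quotient of the algebra by the radical of `χ` these
identities say that `y` acts by zero. Linear independence in the triangular decomposition is never
needed.

Finiteness in category `𝒪` follows from `x⁻(z) a(z) = 0`: its end coefficients act invertibly on
weight vectors, so the modes `x⁻_0, …, x⁻_{a-1}` generate the module from the highest weight vector.
For the bijection, `W` recovers `Ψ(0)` from its top coefficient, hence `Q` and `Ψ`. Conversely `Ψ`
recovers `W` because a series `S` with `S(0) = 1` is determined by `S(z) S(q² z)`. The same
uniqueness identifies `W` with `Ȳ⁺_{ZΨ⁻¹}(z q⁻¹)`, which gives the polynomiality criterion. -/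

set_option linter.unusedSectionVars false

noncomputable section
namespace ShiftedSl2

/-! ## The exponential of a power series with commuting coefficients -/

section ExpSeries

variable {A : Type*} [Ring A] [Algebra ℂ A]



/-- The Euler operator `z d/dz`. -/
def euler (f : PowerSeries A) : PowerSeries A := PowerSeries.mk fun m => (m : ℂ) • PowerSeries.coeff m f

@[simp] lemma coeff_euler (f : PowerSeries A) (m : ℕ) :
    PowerSeries.coeff m (euler f) = (m : ℂ) • PowerSeries.coeff m f := PowerSeries.coeff_mk _ _

@[simp] lemma coeff_scaleArg (c : ℂ) (f : PowerSeries A) (m : ℕ) :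
    PowerSeries.coeff m (scaleArg c f) = c ^ m • PowerSeries.coeff m f := PowerSeries.coeff_mk _ _

@[simp] lemma coeff_positiveSeries (c : ℕ → A) (m : ℕ) :
    PowerSeries.coeff m (positiveSeries c) = if m = 0 then 0 else c m := PowerSeries.coeff_mk _ _

lemma coeff_expSeries (f : PowerSeries A) (m : ℕ) :
    PowerSeries.coeff m (expSeries f) =
      ∑ n ∈ Finset.range (m + 1), ((n.factorial : ℂ)⁻¹) • PowerSeries.coeff m (f ^ n) :=
  PowerSeries.coeff_mk _ _

lemma euler_mul (f g : PowerSeries A) : euler (f * g) = euler f * g + f * euler g := by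
  ext m
  simp only [coeff_euler, map_add, PowerSeries.coeff_mul, Finset.smul_sum,
    ← Finset.sum_add_distrib]
  refine Finset.sum_congr rfl fun p hp => ?_
  rw [smul_mul_assoc, mul_smul_comm, ← add_smul, ← Finset.HasAntidiagonal.mem_antidiagonal.1 hp]
  push_cast
  rfl

lemma commute_of_coeff {f g : PowerSeries A} (h : ∀ i j, Commute (PowerSeries.coeff i f) (PowerSeries.coeff j g)) :
    Commute f g := by
  ext m
  rw [PowerSeries.coeff_mul, PowerSeries.coeff_mul, ← Finset.Nat.sum_antidiagonal_swap]
  exact Finset.sum_congr rfl fun p _ => (h p.2 p.1).eq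

/-- Commuting coefficients make `f` commute with its derivative, which is what the power rule needs
over a non-commutative ring. -/
lemma euler_pow {f : PowerSeries A} (h : ∀ i j, Commute (PowerSeries.coeff i f) (PowerSeries.coeff j f)) (n : ℕ) :
    euler (f ^ (n + 1)) = ((n : ℂ) + 1) • (euler f * f ^ n) := by
  have hc : Commute f (euler f) :=
    commute_of_coeff fun i j => by rw [coeff_euler]; exact (h i j).smul_right _
  induction n with
  | zero => simp
  | succ n ih =>
    rw [pow_succ', euler_mul, ih, mul_smul_comm, ← mul_assoc, hc.eq, mul_assoc, ← pow_succ']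
    push_cast
    module

lemma coeff_pow_eq_zero {f : PowerSeries A} (h0 : PowerSeries.coeff 0 f = 0) {n m : ℕ} (h : m < n) :
    PowerSeries.coeff m (f ^ n) = 0 := by
  induction n generalizing m with
  | zero => omega
  | succ n ih =>
    rw [pow_succ', PowerSeries.coeff_mul]
    refine Finset.sum_eq_zero fun p hp => ?_
    rw [Finset.HasAntidiagonal.mem_antidiagonal] at hp
    rcases Nat.eq_zero_or_pos p.1 with h1 | h1
    · rw [h1, h0, zero_mul]
    · rw [ih (by omega), mul_zero]

/-- Without constant term, `f ^ n` starts in degree `n`, so lengthening the defining sum changes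
nothing. A common length is needed to compare coefficients of different degrees. -/
lemma coeff_expSeries_of_le {f : PowerSeries A} (h0 : PowerSeries.coeff 0 f = 0) {m M : ℕ} (h : m ≤ M) :
    PowerSeries.coeff m (expSeries f) =
      ∑ n ∈ Finset.range (M + 1), ((n.factorial : ℂ)⁻¹) • PowerSeries.coeff m (f ^ n) := by
  rw [coeff_expSeries]
  refine Finset.sum_subset (by intro x; simp; omega) fun n _ hn => ?_
  rw [coeff_pow_eq_zero h0 (by simpa using hn), smul_zero]

@[simp] lemma coeff_zero_expSeries (f : PowerSeries A) : PowerSeries.coeff 0 (expSeries f) = 1 := by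
  rw [coeff_expSeries]; simp

lemma euler_expSeries {f : PowerSeries A} (h0 : PowerSeries.coeff 0 f = 0)
    (h : ∀ i j, Commute (PowerSeries.coeff i f) (PowerSeries.coeff j f)) :
    euler (expSeries f) = euler f * expSeries f := by
  ext m
  have key : ∀ n : ℕ, (m : ℂ) • PowerSeries.coeff m (f ^ (n + 1)) =
      ((n : ℂ) + 1) • PowerSeries.coeff m (euler f * f ^ n) := fun n => by
    rw [← coeff_euler, euler_pow h, PowerSeries.coeff_smul]
  -- The sum is taken one term too long: differentiation kills `n = 0` and lowers every other index
  -- by one, which leaves exactly the range of `expSeries`.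
  rw [coeff_euler, coeff_expSeries_of_le h0 (Nat.le_succ m), Finset.sum_range_succ', smul_add,
    Finset.smul_sum]
  have h1 : (m : ℂ) • (((Nat.factorial 0 : ℕ) : ℂ)⁻¹ • PowerSeries.coeff m (f ^ 0)) = 0 := by
    rcases m with _ | m
    · simp
    · rw [pow_zero, PowerSeries.coeff_one]; simp
  rw [h1, add_zero, PowerSeries.coeff_mul]
  have h2 : ∀ p ∈ Finset.HasAntidiagonal.antidiagonal m, PowerSeries.coeff p.1 (euler f) * PowerSeries.coeff p.2 (expSeries f) =
      ∑ n ∈ Finset.range (m + 1),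
        ((n.factorial : ℂ)⁻¹) • (PowerSeries.coeff p.1 (euler f) * PowerSeries.coeff p.2 (f ^ n)) := fun p hp => by
    rw [coeff_expSeries_of_le h0 (Finset.HasAntidiagonal.antidiagonal.snd_le hp), Finset.mul_sum]
    exact Finset.sum_congr rfl fun n _ => mul_smul_comm _ _ _
  rw [Finset.sum_congr rfl h2, Finset.sum_comm]
  refine Finset.sum_congr rfl fun n _ => ?_
  rw [← Finset.smul_sum, ← PowerSeries.coeff_mul, smul_comm, key, smul_smul, Nat.factorial_succ]
  congr 1
  have : ((n : ℂ) + 1) ≠ 0 := by exact_mod_cast Nat.succ_ne_zero n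
  have : ((n.factorial : ℕ) : ℂ) ≠ 0 := by exact_mod_cast n.factorial_ne_zero
  push_cast
  field_simp

/-- A power series with constant term `1` is determined by its logarithmic derivative. -/
lemma eq_of_euler_eq {u G G' : PowerSeries A} (hu : PowerSeries.coeff 0 u = 0) (h0 : PowerSeries.coeff 0 G = PowerSeries.coeff 0 G')
    (hG : euler G = u * G) (hG' : euler G' = u * G') : G = G' := by
  ext m
  induction m using Nat.strong_induction_on with
  | _ m ih =>
    rcases Nat.eq_zero_or_pos m with rfl | hm
    · exact h0
    have hm' : (m : ℂ) ≠ 0 := by exact_mod_cast hm.ne'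
    have e : (m : ℂ) • PowerSeries.coeff m G = (m : ℂ) • PowerSeries.coeff m G' := by
      rw [← coeff_euler, ← coeff_euler, hG, hG', PowerSeries.coeff_mul, PowerSeries.coeff_mul]
      refine Finset.sum_congr rfl fun p hp => ?_
      rw [Finset.HasAntidiagonal.mem_antidiagonal] at hp
      -- As `u` has no constant term, only coefficients of `G` and `G'` of degree below `m` enter.
      rcases Nat.eq_zero_or_pos p.1 with h1 | h1
      · rw [h1, hu, zero_mul, zero_mul]
      · rw [ih _ (by omega)]
    exact smul_right_injective _ hm' e

lemma coeff_zero_euler (f : PowerSeries A) : PowerSeries.coeff 0 (euler f) = 0 := by simp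

/-- `exp f` is characterized by its logarithmic derivative. -/
lemma eq_expSeries_of_euler {f G : PowerSeries A} (h0 : PowerSeries.coeff 0 f = 0)
    (h : ∀ i j, Commute (PowerSeries.coeff i f) (PowerSeries.coeff j f)) (hG0 : PowerSeries.coeff 0 G = 1)
    (hG : euler G = euler f * G) : G = expSeries f :=
  eq_of_euler_eq (coeff_zero_euler f) (by rw [hG0, coeff_zero_expSeries]) hG (euler_expSeries h0 h)

lemma coeff_pow_mem (B : Subalgebra ℂ A) {f : PowerSeries A} (m : ℕ)
    (hf : ∀ i ≤ m, PowerSeries.coeff i f ∈ B) (n : ℕ) : PowerSeries.coeff m (f ^ n) ∈ B := by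
  induction n generalizing m with
  | zero =>
    rw [pow_zero, PowerSeries.coeff_one]
    split_ifs
    exacts [one_mem _, zero_mem _]
  | succ n ih =>
    rw [pow_succ', PowerSeries.coeff_mul]
    exact sum_mem fun p hp => mul_mem (hf _ (Finset.HasAntidiagonal.antidiagonal.fst_le hp))
      (ih _ fun i hi => hf i (hi.trans (Finset.HasAntidiagonal.antidiagonal.snd_le hp)))

lemma coeff_expSeries_mem (B : Subalgebra ℂ A) {f : PowerSeries A} (m : ℕ)
    (hf : ∀ i ≤ m, PowerSeries.coeff i f ∈ B) : PowerSeries.coeff m (expSeries f) ∈ B := by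
  rw [coeff_expSeries]
  exact sum_mem fun n _ => B.smul_mem (coeff_pow_mem B m hf n) _

/-- A subalgebra that contains the coefficients of `exp f` contains those of `f`. -/
lemma mem_of_coeff_expSeries_mem (B : Subalgebra ℂ A) {f : PowerSeries A} (h0 : PowerSeries.coeff 0 f = 0)
    (h : ∀ m, PowerSeries.coeff m (expSeries f) ∈ B) (m : ℕ) : PowerSeries.coeff m f ∈ B := by
  induction m using Nat.strong_induction_on with
  | _ m ih =>
    rcases Nat.eq_zero_or_pos m with rfl | hm
    · rw [h0]; exact zero_mem _
    obtain ⟨k, rfl⟩ : ∃ k, m = k + 1 := ⟨m - 1, by omega⟩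
    have e := h (k + 1)
    -- The term `n = 1` is the coefficient of `f` itself; the terms `n ≥ 2` involve only lower
    -- coefficients of `f`, to which the induction applies.
    rw [coeff_expSeries, Finset.sum_range_succ', Finset.sum_range_succ'] at e
    have hz : PowerSeries.coeff (k + 1) (f ^ 0) = 0 := by rw [pow_zero, PowerSeries.coeff_one]; simp
    rw [hz, smul_zero, add_zero, zero_add, pow_one, Nat.factorial_one, Nat.cast_one, inv_one,
      one_smul] at e
    have hs : ∑ n ∈ Finset.range k, (((n + 1 + 1).factorial : ℂ)⁻¹) •
        PowerSeries.coeff (k + 1) (f ^ (n + 1 + 1)) ∈ B := by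
      refine sum_mem fun n _ => B.smul_mem ?_ _
      rw [pow_succ', PowerSeries.coeff_mul]
      refine sum_mem fun p hp => ?_
      rw [Finset.HasAntidiagonal.mem_antidiagonal] at hp
      rcases Nat.eq_zero_or_pos p.1 with h1 | h1
      · rw [h1, h0, zero_mul]; exact zero_mem _
      rcases Nat.eq_zero_or_pos p.2 with h2 | h2
      · rw [h2, coeff_pow_eq_zero h0 (Nat.succ_pos n), mul_zero]; exact zero_mem _
      exact mul_mem (ih _ (by omega)) (coeff_pow_mem B _ (fun i hi => ih i (by omega)) _)
    simpa using sub_mem e hs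

/-- Coefficients of `exp f` commute with whatever commutes with the coefficients of `f`. -/
lemma commute_coeff_expSeries {x : A} {f : PowerSeries A} (h : ∀ i, Commute x (PowerSeries.coeff i f))
    (m : ℕ) : Commute x (PowerSeries.coeff m (expSeries f)) := by
  have := coeff_expSeries_mem (Subalgebra.centralizer ℂ {x}) (f := f) m fun i _ => by
    rw [Subalgebra.mem_centralizer_iff]; rintro g rfl; exact h i
  exact (Subalgebra.mem_centralizer_iff ℂ).1 this x rfl

lemma euler_add (f g : PowerSeries A) : euler (f + g) = euler f + euler g := by
  ext m; simp

/-- The product has logarithmic derivative `euler f + euler g`, once `exp f` is moved past `euler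
g`. -/
lemma expSeries_add {f g : PowerSeries A} (hf0 : PowerSeries.coeff 0 f = 0) (hg0 : PowerSeries.coeff 0 g = 0)
    (hf : ∀ i j, Commute (PowerSeries.coeff i f) (PowerSeries.coeff j f)) (hg : ∀ i j, Commute (PowerSeries.coeff i g) (PowerSeries.coeff j g))
    (hfg : ∀ i j, Commute (PowerSeries.coeff i f) (PowerSeries.coeff j g)) :
    expSeries (f + g) = expSeries f * expSeries g := by
  symm
  refine eq_expSeries_of_euler (by rw [map_add, hf0, hg0, add_zero]) (fun i j => ?_) ?_ ?_
  · simp only [map_add]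
    exact ((hf i j).add_right (hfg i j)).add_left ((hfg j i).symm.add_right (hg i j))
  · rw [PowerSeries.coeff_mul]; simp
  · have hc : Commute (expSeries f) (euler g) := commute_of_coeff fun i j => by
      rw [coeff_euler]
      exact ((commute_coeff_expSeries (fun k => (hfg k j).symm) i).symm).smul_right _
    rw [euler_mul, euler_expSeries hf0 hf, euler_expSeries hg0 hg, euler_add, add_mul,
      ← mul_assoc, hc.eq, mul_assoc, mul_assoc]

lemma expSeries_zero : expSeries (0 : PowerSeries A) = 1 := by
  symm
  refine eq_expSeries_of_euler (by simp) (by simp) (by simp) ?_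
  ext m
  rcases m with _ | m
  · simp
  · simp [PowerSeries.coeff_one]

lemma expSeries_mul_neg {f : PowerSeries A} (hf0 : PowerSeries.coeff 0 f = 0)
    (hf : ∀ i j, Commute (PowerSeries.coeff i f) (PowerSeries.coeff j f)) : expSeries f * expSeries (-f) = 1 := by
  rw [← expSeries_add hf0 (by rw [map_neg, hf0, neg_zero]) hf (fun i j => by simpa using hf i j)
    (fun i j => by simpa using hf i j), add_neg_cancel, expSeries_zero]

lemma scaleArg_mul (c : ℂ) (f g : PowerSeries A) :
    scaleArg c (f * g) = scaleArg c f * scaleArg c g := by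
  ext m
  simp only [coeff_scaleArg, PowerSeries.coeff_mul, Finset.smul_sum]
  refine Finset.sum_congr rfl fun p hp => ?_
  rw [smul_mul_smul_comm, ← pow_add, Finset.HasAntidiagonal.mem_antidiagonal.1 hp]

lemma scaleArg_one (c : ℂ) : scaleArg c (1 : PowerSeries A) = 1 := by
  ext m
  rcases m with _ | m <;> simp [PowerSeries.coeff_one]

lemma scaleArg_pow (c : ℂ) (f : PowerSeries A) (n : ℕ) : scaleArg c (f ^ n) = scaleArg c f ^ n := by
  induction n with
  | zero => simp [scaleArg_one]
  | succ n ih => rw [pow_succ, scaleArg_mul, ih, pow_succ]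

lemma scaleArg_expSeries (c : ℂ) (f : PowerSeries A) :
    scaleArg c (expSeries f) = expSeries (scaleArg c f) := by
  ext m
  simp only [coeff_scaleArg, coeff_expSeries, Finset.smul_sum, ← scaleArg_pow]
  exact Finset.sum_congr rfl fun n _ => smul_comm _ _ _

lemma map_expSeries {B : Type*} [Ring B] [Algebra ℂ B] (φ : A →ₐ[ℂ] B) (f : PowerSeries A) :
    PowerSeries.map (φ : A →+* B) (expSeries f) = expSeries (PowerSeries.map (φ : A →+* B) f) := by
  ext m
  simp only [PowerSeries.coeff_map, coeff_expSeries, ← map_pow, map_sum]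
  refine Finset.sum_congr rfl fun n _ => ?_
  simp

lemma map_positiveSeries {B : Type*} [Ring B] [Algebra ℂ B] (φ : A →ₐ[ℂ] B) (c : ℕ → A) :
    PowerSeries.map (φ : A →+* B) (positiveSeries c) = positiveSeries fun m => φ (c m) := by
  ext m
  simp only [PowerSeries.coeff_map, coeff_positiveSeries]
  split_ifs <;> simp

lemma coeff_expSeries_map {B : Type*} [Ring B] [Algebra ℂ B] (φ : A →ₐ[ℂ] B) (c : ℕ → A) (n : ℕ) :
    φ (PowerSeries.coeff n (expSeries (positiveSeries c))) =
      PowerSeries.coeff n (expSeries (positiveSeries fun m => φ (c m))) := by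
  rw [← map_positiveSeries, ← map_expSeries, PowerSeries.coeff_map]
  rfl

lemma scaleArg_positiveSeries (s : ℂ) (c : ℕ → A) :
    scaleArg s (positiveSeries c) = positiveSeries fun m => s ^ m • c m := by
  ext m
  simp only [coeff_scaleArg, coeff_positiveSeries]
  split_ifs <;> simp

lemma positiveSeries_add (c d : ℕ → A) :
    positiveSeries c + positiveSeries d = positiveSeries fun m => c m + d m := by
  ext m
  simp only [map_add, coeff_positiveSeries]
  split_ifs <;> simp

lemma positiveSeries_neg (c : ℕ → A) : -positiveSeries c = positiveSeries fun m => -c m := by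
  ext m
  simp only [map_neg, coeff_positiveSeries]
  split_ifs <;> simp

lemma commute_positiveSeries {c d : ℕ → A} (h : ∀ i j, 0 < i → 0 < j → Commute (c i) (d j))
    (i j : ℕ) : Commute (PowerSeries.coeff i (positiveSeries c)) (PowerSeries.coeff j (positiveSeries d)) := by
  simp only [coeff_positiveSeries]
  split_ifs with h1 h2 h2
  · exact Commute.zero_left _
  · exact Commute.zero_left _
  · exact Commute.zero_right _
  · exact h i j (Nat.pos_of_ne_zero h1) (Nat.pos_of_ne_zero h2)

/-- A common eigenvector of the coefficients of `f` is one for those of `exp f`. -/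
lemma expSeries_smul {V : Type*} [AddCommGroup V] [Module ℂ V] [Module A V] [IsScalarTower ℂ A V]
    {f : PowerSeries A} {η : PowerSeries ℂ} {v : V} (h : ∀ i, PowerSeries.coeff i f • v = PowerSeries.coeff i η • v)
    (m : ℕ) : PowerSeries.coeff m (expSeries f) • v = PowerSeries.coeff m (expSeries η) • v := by
  have key : ∀ n m, PowerSeries.coeff m (f ^ n) • v = PowerSeries.coeff m (η ^ n) • v := by
    intro n
    induction n with
    | zero =>
      intro m
      rw [pow_zero, pow_zero, PowerSeries.coeff_one, PowerSeries.coeff_one]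
      split_ifs <;> simp
    | succ n ih =>
      intro m
      -- `f ^ (n + 1)` is split with a single `f` on the right, since that factor meets `v` before
      -- the others.
      rw [pow_succ, pow_succ', PowerSeries.coeff_mul, PowerSeries.coeff_mul, Finset.sum_smul,
        Finset.sum_smul, ← Finset.Nat.sum_antidiagonal_swap]
      refine Finset.sum_congr rfl fun p _ => ?_
      simp only [Prod.fst_swap, Prod.snd_swap]
      rw [mul_smul, h, ← algebraMap_smul A (PowerSeries.coeff p.1 η) v, ← mul_smul, ← Algebra.commutes,
        mul_smul, ih, algebraMap_smul, mul_smul]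
  rw [coeff_expSeries, coeff_expSeries, Finset.sum_smul, Finset.sum_smul]
  refine Finset.sum_congr rfl fun n _ => ?_
  rw [smul_assoc, key, smul_assoc]

/-- If `[g_m, x_r] = c_m x_{r+m}`, then `exp(g)(z) x(w) = exp(c)(z/w) x(w) exp(g)(z)`. -/
lemma coeff_expSeries_mul {g : ℕ → A} {c : ℕ → ℂ} {x : ℤ → A}
    (hg : ∀ i j, 0 < i → 0 < j → Commute (g i) (g j))
    (hx : ∀ m : ℕ, 0 < m → ∀ r : ℤ, g m * x r = x r * g m + c m • x (r + m)) (n : ℕ) (r : ℤ) :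
    PowerSeries.coeff n (expSeries (positiveSeries g)) * x r =
      ∑ p ∈ Finset.HasAntidiagonal.antidiagonal n, PowerSeries.coeff p.1 (expSeries (positiveSeries c)) •
        (x (r + p.1) * PowerSeries.coeff p.2 (expSeries (positiveSeries g))) := by
  have hg' := euler_expSeries (f := positiveSeries g) (by simp) (commute_positiveSeries hg)
  have hc' := euler_expSeries (f := positiveSeries c) (by simp)
    (commute_positiveSeries fun _ _ _ _ => Commute.all _ _)
  set G := expSeries (positiveSeries g)
  set E := expSeries (positiveSeries c)
  -- the series `∑ E_j x_{r+j} z^j`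
  set X : ℤ → PowerSeries A := fun r => PowerSeries.mk fun j => PowerSeries.coeff j E • x (r + j) with hX
  -- Both sides have the same constant term and solve `euler y = euler g * y`, so no manipulation of
  -- exponentials is needed.
  suffices h : G * PowerSeries.C (x r) = X r * G by
    have := congrArg (PowerSeries.coeff n) h
    rw [PowerSeries.coeff_mul_C] at this
    rw [this, PowerSeries.coeff_mul]
    refine Finset.sum_congr rfl fun p _ => ?_
    rw [hX, PowerSeries.coeff_mk, smul_mul_assoc]
  refine eq_of_euler_eq (u := euler (positiveSeries g)) (coeff_zero_euler _) ?_ ?_ ?_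
  · simp [PowerSeries.coeff_mul, hX, G, E]
  · rw [euler_mul, hg', mul_assoc]
    have : euler (PowerSeries.C (x r)) = 0 := by
      ext m; rcases m with _ | m <;> simp [PowerSeries.coeff_C]
    rw [this, mul_zero, add_zero]
  · have h2 : euler (X r) = euler (positiveSeries g) * X r - X r * euler (positiveSeries g) := by
      ext n
      rw [map_sub, PowerSeries.coeff_mul, PowerSeries.coeff_mul,
        ← Finset.Nat.sum_antidiagonal_swap (n := n) (f := fun p => PowerSeries.coeff p.1 (X r) * _),
        ← Finset.sum_sub_distrib]
      have e := congrArg (PowerSeries.coeff n) hc'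
      rw [coeff_euler, PowerSeries.coeff_mul] at e
      rw [coeff_euler, hX, PowerSeries.coeff_mk, smul_smul, ← smul_eq_mul, e, Finset.sum_smul]
      refine Finset.sum_congr rfl fun p hp => ?_
      simp only [coeff_euler, PowerSeries.coeff_mk, Prod.fst_swap, Prod.snd_swap,
        coeff_positiveSeries]
      split_ifs with h1
      · simp
      · have h3 : r + (n : ℤ) = r + p.2 + p.1 := by
          rw [← Finset.HasAntidiagonal.mem_antidiagonal.1 hp]; push_cast; ring
        rw [smul_mul_smul_comm, smul_mul_smul_comm, hx _ (Nat.pos_of_ne_zero h1), smul_add,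
          mul_comm (PowerSeries.coeff p.2 E), add_sub_cancel_left, smul_smul, h3, smul_eq_mul]
        ring_nf
    rw [euler_mul, hg', h2, sub_mul, mul_assoc, mul_assoc (X r)]
    abel

end ExpSeries

/-! ## Products of linear factors as exponentials -/

/-- This is `log (1 - b z) = -∑ b^m z^m / m`, checked through the logarithmic derivative with the
denominator cleared. -/
lemma coe_one_sub_eq_expSeries (b : ℂ) : ((1 - C b * X : ℂ[X]) : PowerSeries ℂ) =
    expSeries (positiveSeries fun m => -(b ^ m / (m : ℂ))) := by
  refine eq_expSeries_of_euler (by simp) (fun _ _ => Commute.all _ _) (by simp) ?_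
  have h : ((1 - C b * X : ℂ[X]) : PowerSeries ℂ) = 1 - PowerSeries.C b * PowerSeries.X := by
    simp
  rw [h, mul_sub, mul_one, mul_left_comm]
  ext n
  have hn : ∀ n : ℕ, ((n : ℂ) + 1) ≠ 0 := fun n => by exact_mod_cast n.succ_ne_zero
  rcases n with _ | _ | n
  · rw [map_sub, coeff_euler, coeff_euler]; simp
  · simp [← mul_assoc, PowerSeries.coeff_succ_mul_X, PowerSeries.coeff_one]
  · have h1 := hn (n + 1)
    have h2 := hn n
    push_cast at h1
    simp [← mul_assoc, PowerSeries.coeff_succ_mul_X, PowerSeries.coeff_one]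
    field_simp
    ring

/-- `∏_{b ∈ s} (1 - b z)`. -/
def linProd (s : Multiset ℂ) : ℂ[X] := (s.map fun b => 1 - C b * X).prod

/-- `∑_{b ∈ s} b^m`. -/
def pSum (s : Multiset ℂ) (m : ℤ) : ℂ := (s.map fun b => b ^ m).sum

@[simp] lemma linProd_zero : linProd 0 = 1 := rfl

@[simp] lemma linProd_cons (b : ℂ) (s : Multiset ℂ) :
    linProd (b ::ₘ s) = (1 - C b * X) * linProd s := by simp [linProd]

@[simp] lemma linProd_add (s t : Multiset ℂ) : linProd (s + t) = linProd s * linProd t := by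
  simp [linProd]

@[simp] lemma pSum_add (s t : Multiset ℂ) (m : ℤ) : pSum (s + t) m = pSum s m + pSum t m := by
  simp [pSum]

@[simp] lemma pSum_cons (b : ℂ) (s : Multiset ℂ) (m : ℤ) :
    pSum (b ::ₘ s) m = b ^ m + pSum s m := by simp [pSum]

@[simp] lemma pSum_zero (m : ℤ) : pSum 0 m = 0 := by simp [pSum]

lemma eval_zero_linProd (s : Multiset ℂ) : (linProd s).eval 0 = 1 := by
  induction s using Multiset.induction_on with
  | empty => simp
  | cons b s ih => simp [ih]

lemma linProd_ne_zero (s : Multiset ℂ) : linProd s ≠ 0 := fun h => by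
  have := eval_zero_linProd s
  simp [h] at this

lemma expSeries_positiveSeries_add (c d : ℕ → ℂ) :
    expSeries (positiveSeries fun m => c m + d m) =
      expSeries (positiveSeries c) * expSeries (positiveSeries d) := by
  rw [← positiveSeries_add]
  exact expSeries_add (by simp) (by simp) (fun _ _ => Commute.all _ _)
    (fun _ _ => Commute.all _ _) fun _ _ => Commute.all _ _

lemma positiveSeries_congr {A : Type*} [Ring A] {c d : ℕ → A}
    (h : ∀ m : ℕ, 0 < m → c m = d m) : positiveSeries c = positiveSeries d := by
  ext m
  rw [positiveSeries, positiveSeries, PowerSeries.coeff_mk, PowerSeries.coeff_mk]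
  split_ifs with h0
  · rfl
  · exact h m (Nat.pos_of_ne_zero h0)

/-- Newton's identities in exponential form. Through them, eigenvalues of the `h_m` given by power
sums become polynomial eigenvalues of `A(z)`. -/
lemma coe_linProd (s : Multiset ℂ) : (linProd s : PowerSeries ℂ) =
    expSeries (positiveSeries fun m => -(pSum s m / (m : ℂ))) := by
  induction s using Multiset.induction_on with
  | empty =>
    rw [linProd_zero, Polynomial.coe_one, ← expSeries_zero]
    congr 1
    ext m
    simp
  | cons b s ih =>
    rw [linProd_cons, Polynomial.coe_mul, coe_one_sub_eq_expSeries, ih,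
      ← expSeries_positiveSeries_add]
    congr 1
    refine positiveSeries_congr fun m _ => ?_
    rw [pSum_cons, zpow_natCast]
    ring

lemma eq_linProd_of_eval_zero_ne {p : ℂ[X]} (hp : p.eval 0 ≠ 0) :
    p = C (p.eval 0) * linProd (p.roots.map fun b => b⁻¹) := by
  have hs := (IsAlgClosed.splits p).eq_prod_roots
  have h0 : ∀ b ∈ p.roots, b ≠ 0 := by
    rintro b hb rfl
    exact hp (Polynomial.isRoot_of_mem_roots hb)
  have key : ∀ s : Multiset ℂ, (∀ b ∈ s, b ≠ 0) → ∃ c : ℂ,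
      (s.map fun b => X - C b).prod = C c * linProd (s.map fun b => b⁻¹) := by
    intro s
    induction s using Multiset.induction_on with
    | empty => exact fun _ => ⟨1, by simp⟩
    | cons b s ih =>
      intro h
      obtain ⟨c, hc⟩ := ih fun b' hb' => h b' (Multiset.mem_cons_of_mem hb')
      have hb := h b (Multiset.mem_cons_self b s)
      refine ⟨-b * c, ?_⟩
      rw [Multiset.map_cons, Multiset.prod_cons, hc, Multiset.map_cons, linProd_cons]
      have : (X - C b : ℂ[X]) = C (-b) * (1 - C b⁻¹ * X) := by
        rw [mul_sub, ← mul_assoc, ← C_mul]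
        simp [hb]
        ring
      rw [this, C_mul]
      ring
  obtain ⟨c, hc⟩ := key _ h0
  rw [hc, ← mul_assoc, ← C_mul] at hs
  have he := congrArg (Polynomial.eval 0) hs
  rw [eval_mul, eval_C, eval_zero_linProd, mul_one] at he
  rw [he]
  exact hs

lemma roots_linProd (s : Multiset ℂ) (hs : ∀ b ∈ s, b ≠ 0) :
    (linProd s).roots = s.map fun b => b⁻¹ := by
  induction s using Multiset.induction_on with
  | empty => simp
  | cons b s ih =>
    have hb := hs b (Multiset.mem_cons_self b s)
    have e : (1 - C b * X : ℂ[X]) = C (-b) * (X - C b⁻¹) := by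
      rw [mul_sub, ← C_mul]
      simp [hb]
      ring
    rw [linProd_cons, Polynomial.roots_mul, ih fun b' hb' => hs b' (Multiset.mem_cons_of_mem hb'),
      e, Polynomial.roots_C_mul _ (neg_ne_zero.2 hb), Polynomial.roots_X_sub_C, Multiset.map_cons]
    · rfl
    · rw [← linProd_cons]; exact linProd_ne_zero _

lemma natDegree_linProd (s : Multiset ℂ) (hs : ∀ b ∈ s, b ≠ 0) :
    (linProd s).natDegree = Multiset.card s := by
  rw [(IsAlgClosed.splits (linProd s)).natDegree_eq_card_roots, roots_linProd s hs,
    Multiset.card_map]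

lemma leadingCoeff_linProd (s : Multiset ℂ) (hs : ∀ b ∈ s, b ≠ 0) :
    (linProd s).leadingCoeff = (s.map fun b => -b).prod := by
  induction s using Multiset.induction_on with
  | empty => simp
  | cons b s ih =>
    have hb := hs b (Multiset.mem_cons_self b s)
    have e : (1 - C b * X : ℂ[X]) = C (-b) * X + C 1 := by simp; ring
    rw [linProd_cons, leadingCoeff_mul, ih fun b' hb' => hs b' (Multiset.mem_cons_of_mem hb'), e,
      leadingCoeff_linear (neg_ne_zero.2 hb), Multiset.map_cons, Multiset.prod_cons]

lemma linProd_comp (s : Multiset ℂ) (c : ℂ) :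
    (linProd s).comp (C c * X) = linProd (s.map fun b => b * c) := by
  induction s using Multiset.induction_on with
  | empty => simp
  | cons b s ih =>
    rw [linProd_cons, mul_comp, ih, Multiset.map_cons, linProd_cons]
    simp [mul_assoc]

lemma coe_comp_C_mul_X (p : ℂ[X]) (c : ℂ) :
    ((p.comp (C c * X) : ℂ[X]) : PowerSeries ℂ) = scaleArg c (p : PowerSeries ℂ) := by
  ext n
  rw [coeff_scaleArg, Polynomial.coeff_coe, Polynomial.coeff_coe, comp_C_mul_X_coeff, smul_eq_mul,
    mul_comm]

/-! ## Power sums of rational functions -/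

/-- The fraction need not be reduced: comparing the roots of `num * r = p * denom` makes the common
roots cancel. -/
lemma powerSum_div {p r : ℂ[X]} (hp : p ≠ 0) (hr : r ≠ 0) (m : ℤ) :
    powerSum (algebraMap ℂ[X] (RatFunc ℂ) p / algebraMap ℂ[X] (RatFunc ℂ) r) m =
      (p.roots.map fun b => b⁻¹ ^ m).sum - (r.roots.map fun b => b⁻¹ ^ m).sum := by
  set Ψ := algebraMap ℂ[X] (RatFunc ℂ) p / algebraMap ℂ[X] (RatFunc ℂ) r with hΨ
  have hp' : algebraMap ℂ[X] (RatFunc ℂ) p ≠ 0 := RatFunc.algebraMap_ne_zero hp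
  have hr' : algebraMap ℂ[X] (RatFunc ℂ) r ≠ 0 := RatFunc.algebraMap_ne_zero hr
  have hΨ0 : Ψ ≠ 0 := div_ne_zero hp' hr'
  have hn : Ψ.num ≠ 0 := RatFunc.num_ne_zero hΨ0
  have hd : Ψ.denom ≠ 0 := RatFunc.denom_ne_zero Ψ
  have e : Ψ.num * r = p * Ψ.denom := by
    apply RatFunc.algebraMap_injective ℂ
    have := RatFunc.num_div_denom Ψ
    rw [div_eq_iff (RatFunc.algebraMap_ne_zero hd)] at this
    rw [map_mul, map_mul, this, hΨ]
    field_simp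
  have e2 := congrArg Polynomial.roots e
  rw [Polynomial.roots_mul (mul_ne_zero hn hr), Polynomial.roots_mul (mul_ne_zero hp hd)] at e2
  have e3 := congrArg (fun s : Multiset ℂ => (s.map fun b => b⁻¹ ^ m).sum) e2
  simp only [Multiset.map_add, Multiset.sum_add] at e3
  rw [powerSum]
  linear_combination e3

lemma powerSum_algebraMap {p : ℂ[X]} (hp : p ≠ 0) (m : ℤ) :
    powerSum (algebraMap ℂ[X] (RatFunc ℂ) p) m = (p.roots.map fun b => b⁻¹ ^ m).sum := by
  have := powerSum_div hp one_ne_zero m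
  simpa using this

lemma powerSum_linProd (s : Multiset ℂ) (hs : ∀ b ∈ s, b ≠ 0) (m : ℤ) :
    powerSum (algebraMap ℂ[X] (RatFunc ℂ) (linProd s)) m = pSum s m := by
  rw [powerSum_algebraMap (linProd_ne_zero s), roots_linProd s hs, Multiset.map_map, pSum]
  simp

/-! ## The action of polynomials on bi-infinite sequences -/

/-- The shift of a bi-infinite sequence, multiplication by `z` of formal Laurent distributions. -/
def shift : (ℤ → ℂ) →ₗ[ℂ] (ℤ → ℂ) where
  toFun g s := g (s - 1)
  map_add' _ _ := rfl
  map_smul' _ _ := rfl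

/-- Multiplication of the distribution `∑ g_s z^s` by a polynomial. -/
def act (p : ℂ[X]) : (ℤ → ℂ) →ₗ[ℂ] (ℤ → ℂ) := aeval shift p

lemma act_mul (p r : ℂ[X]) (g : ℤ → ℂ) : act (p * r) g = act p (act r g) := by
  simp [act]

lemma act_add (p r : ℂ[X]) (g : ℤ → ℂ) : act (p + r) g = act p g + act r g := by
  simp [act]

lemma act_C (c : ℂ) (g : ℤ → ℂ) : act (C c) g = c • g := by
  simp [act]

lemma act_one (g : ℤ → ℂ) : act 1 g = g := by simp [act]

lemma act_C_mul (c : ℂ) (p : ℂ[X]) (g : ℤ → ℂ) : act (C c * p) g = c • act p g := by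
  rw [act_mul, act_C]

lemma act_X (g : ℤ → ℂ) (s : ℤ) : act X g s = g (s - 1) := by simp [act, shift]

lemma act_one_sub (b : ℂ) (g : ℤ → ℂ) (s : ℤ) : act (1 - C b * X) g s = g s - b * g (s - 1) := by
  have : act (1 - C b * X) g = g - b • act X g := by
    rw [sub_eq_add_neg, act_add, ← neg_mul, ← C_neg, act_C_mul, act_one, neg_smul, sub_eq_add_neg]
  rw [this, Pi.sub_apply, Pi.smul_apply, act_X, smul_eq_mul]

lemma shift_pow_apply (k : ℕ) (g : ℤ → ℂ) (s : ℤ) : (shift ^ k) g s = g (s - k) := by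
  induction k generalizing s with
  | zero => simp
  | succ k ih =>
    rw [pow_succ', Module.End.mul_apply]
    change (shift ^ k) g (s - 1) = _
    rw [ih]
    congr 1
    push_cast
    ring

lemma act_apply {p : ℂ[X]} {n : ℕ} (hn : p.natDegree ≤ n) (g : ℤ → ℂ) (s : ℤ) :
    act p g s = ∑ k ∈ Finset.range (n + 1), p.coeff k * g (s - k) := by
  rw [act, aeval_eq_sum_range' (Nat.lt_succ_of_le hn)]
  simp [shift_pow_apply]

/-- The sequence `δ_{s,0}`. -/
def unitSeq : ℤ → ℂ := Pi.single 0 1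

lemma act_unitSeq (p : ℂ[X]) (n : ℕ) : act p unitSeq n = p.coeff n := by
  rw [act_apply (Nat.le_max_left p.natDegree n)]
  rw [Finset.sum_eq_single n]
  · simp [unitSeq]
  · intro k _ hk
    have : (n : ℤ) - k ≠ 0 := by omega
    simp [unitSeq, this]
  · intro h
    simp at h

lemma act_unitSeq_neg (p : ℂ[X]) {s : ℤ} (hs : s < 0) : act p unitSeq s = 0 := by
  rw [act_apply le_rfl]
  refine Finset.sum_eq_zero fun k _ => ?_
  have : s - k ≠ 0 := by omega
  simp [unitSeq, this]

lemma act_unitSeq_injective {p r : ℂ[X]} (h : act p unitSeq = act r unitSeq) : p = r := by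
  ext n
  rw [← act_unitSeq, h, act_unitSeq]

/-- A power series in `z` as a bi-infinite sequence. -/
def seqZero (F : PowerSeries ℂ) : ℤ → ℂ := fun m => if 0 ≤ m then PowerSeries.coeff m.toNat F else 0

lemma seqZero_natCast (F : PowerSeries ℂ) (n : ℕ) : seqZero F n = PowerSeries.coeff n F := by
  simp [seqZero]

lemma seqZero_neg (F : PowerSeries ℂ) {m : ℤ} (h : m < 0) : seqZero F m = 0 := by
  simp [seqZero, h]

lemma seqZero_eq {F : PowerSeries ℂ} {f : ℤ → ℂ} (h : ∀ m < 0, f m = 0)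
    (h' : ∀ n : ℕ, f n = PowerSeries.coeff n F) : f = seqZero F := by
  ext m
  rcases lt_or_ge m 0 with hm | hm
  · rw [h m hm, seqZero_neg _ hm]
  · lift m to ℕ using hm
    rw [h', seqZero_natCast]

lemma act_seqZero (p : ℂ[X]) (F : PowerSeries ℂ) : act p (seqZero F) = seqZero (p * F) := by
  induction p using Polynomial.induction_on generalizing F with
  | C c =>
    refine seqZero_eq (fun m hm => ?_) fun n => ?_
    · rw [act_C, Pi.smul_apply, seqZero_neg _ hm, smul_zero]
    · rw [act_C, Pi.smul_apply, seqZero_natCast]; simp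
  | add p r hp hr =>
    rw [act_add, hp, hr]
    refine seqZero_eq (fun m hm => ?_) fun n => ?_
    · rw [Pi.add_apply, seqZero_neg _ hm, seqZero_neg _ hm, add_zero]
    · rw [Pi.add_apply, seqZero_natCast, seqZero_natCast, Polynomial.coe_add, add_mul, map_add]
  | monomial n a h =>
    have hX : ∀ F : PowerSeries ℂ, act X (seqZero F) = seqZero (PowerSeries.X * F) := fun F => by
      refine seqZero_eq (fun m hm => ?_) fun n => ?_
      · rw [act_X, seqZero_neg _ (by omega)]
      · rw [act_X]
        rcases n with _ | n
        · rw [seqZero_neg _ (by simp)]; simp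
        · rw [PowerSeries.coeff_succ_X_mul, ← seqZero_natCast]
          congr 1
          push_cast
          ring
    rw [pow_succ, ← mul_assoc, act_mul, hX, h]
    simp [mul_assoc]

lemma seqZero_one : seqZero 1 = unitSeq := by
  symm
  refine seqZero_eq (fun m hm => ?_) fun n => ?_
  · simp [unitSeq, hm.ne]
  · simp [unitSeq, PowerSeries.coeff_one, Pi.single_apply]

lemma act_unitSeq_eq (p : ℂ[X]) : act p unitSeq = seqZero p := by
  rw [← seqZero_one, act_seqZero, mul_one]

/-- The series `z^d F(z⁻¹)` as a bi-infinite sequence. -/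
def seqInfty (d : ℤ) (F : PowerSeries ℂ) : ℤ → ℂ :=
  fun m => if m ≤ d then PowerSeries.coeff (d - m).toNat F else 0

lemma seqInfty_sub (d : ℤ) (F : PowerSeries ℂ) (n : ℕ) :
    seqInfty d F (d - n) = PowerSeries.coeff n F := by
  simp [seqInfty]

lemma seqInfty_big (d : ℤ) (F : PowerSeries ℂ) {m : ℤ} (h : d < m) : seqInfty d F m = 0 := by
  simp [seqInfty, h]

lemma seqInfty_eq {d : ℤ} {F : PowerSeries ℂ} {f : ℤ → ℂ} (h : ∀ m, d < m → f m = 0)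
    (h' : ∀ n : ℕ, f (d - n) = PowerSeries.coeff n F) : f = seqInfty d F := by
  ext m
  rcases lt_or_ge d m with hm | hm
  · rw [h m hm, seqInfty_big _ _ hm]
  · obtain ⟨n, rfl⟩ : ∃ n : ℕ, m = d - n := ⟨(d - m).toNat, by omega⟩
    rw [h', seqInfty_sub]

lemma seqInfty_smul (d : ℤ) (c : ℂ) (F : PowerSeries ℂ) :
    seqInfty d (c • F) = c • seqInfty d F := by
  symm
  refine seqInfty_eq (fun m hm => ?_) fun n => ?_
  · rw [Pi.smul_apply, seqInfty_big _ _ hm, smul_zero]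
  · rw [Pi.smul_apply, seqInfty_sub, PowerSeries.coeff_smul]

lemma seqInfty_zero_one : seqInfty 0 1 = unitSeq := by
  symm
  refine seqInfty_eq (fun m hm => ?_) fun n => ?_
  · simp [unitSeq, hm.ne']
  · simp [unitSeq, PowerSeries.coeff_one, Pi.single_apply]

/-- Since `1 - b z = -b z (1 - b⁻¹ z⁻¹)`, each linear factor raises the order at infinity by one and
contributes the scalar `-b`. -/
lemma act_one_sub_seqInfty (d : ℤ) (F : PowerSeries ℂ) {b : ℂ} (hb : b ≠ 0) :
    act (1 - C b * X) (seqInfty d F) =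
      (-b) • seqInfty (d + 1) (((1 - C b⁻¹ * X : ℂ[X]) : PowerSeries ℂ) * F) := by
  rw [← seqInfty_smul]
  refine seqInfty_eq (fun m hm => ?_) fun n => ?_
  · rw [act_one_sub, seqInfty_big _ _ (by omega), seqInfty_big _ _ (by omega)]; simp
  · have e : ((1 - C b⁻¹ * X : ℂ[X]) : PowerSeries ℂ) = 1 - PowerSeries.C b⁻¹ * PowerSeries.X := by
      simp
    rw [act_one_sub, e, show d + 1 - (n : ℤ) - 1 = d - n by ring, seqInfty_sub,
      PowerSeries.coeff_smul, sub_mul, one_mul, map_sub, mul_assoc, PowerSeries.coeff_C_mul]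
    rcases n with _ | n
    · rw [seqInfty_big _ _ (by simp)]
      simp
    · rw [show d + 1 - ((n + 1 : ℕ) : ℤ) = d - n by push_cast; ring, seqInfty_sub,
        PowerSeries.coeff_succ_X_mul]
      simp only [smul_eq_mul]
      field_simp
      ring

lemma act_linProd_seqInfty (s : Multiset ℂ) (hs : ∀ b ∈ s, b ≠ 0) (d : ℤ) (F : PowerSeries ℂ) :
    act (linProd s) (seqInfty d F) = (s.map fun b => -b).prod •
      seqInfty (d + Multiset.card s) ((linProd (s.map fun b => b⁻¹) : PowerSeries ℂ) * F) := by
  induction s using Multiset.induction_on with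
  | empty => simp [act_one]
  | cons b s ih =>
    have hb := hs b (Multiset.mem_cons_self b s)
    rw [linProd_cons, act_mul, ih fun b' hb' => hs b' (Multiset.mem_cons_of_mem hb'), map_smul,
      act_one_sub_seqInfty _ _ hb, smul_smul, Multiset.map_cons, Multiset.map_cons, linProd_cons,
      Multiset.prod_cons, Polynomial.coe_mul, Multiset.card_cons, mul_assoc, mul_comm (-b)]
    congr 2
    push_cast
    ring

/-! ## Expansions of rational functions -/

lemma coeff_aeval_single_mul (p : ℂ[X]) (x : LaurentSeries ℂ) (e : ℤ) :
    ∀ n : ℤ, (aeval (HahnSeries.single e (1 : ℂ) : LaurentSeries ℂ) p * x).coeff n =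
      ∑ k ∈ Finset.range (p.natDegree + 1), p.coeff k * x.coeff (n - e * k) := by
  intro n
  have hp : ∀ k : ℕ, (HahnSeries.single e (1 : ℂ) : LaurentSeries ℂ) ^ k =
      HahnSeries.single (e * k) 1 := fun k => by
    rw [HahnSeries.single_pow, one_pow, nsmul_eq_mul, mul_comm]
  rw [aeval_eq_sum_range, Finset.sum_mul, HahnSeries.coeff_sum]
  refine Finset.sum_congr rfl fun k _ => ?_
  have hC : algebraMap ℂ (LaurentSeries ℂ) (p.coeff k) = HahnSeries.C (p.coeff k) := by
    rw [HahnSeries.algebraMap_apply']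
    simp
  rw [hp, Algebra.smul_def, hC, mul_assoc, HahnSeries.C_apply, HahnSeries.coeff_single_mul,
    HahnSeries.coeff_single_mul, one_mul, sub_zero]

lemma coeff_aeval_zero (p : ℂ[X]) (x : LaurentSeries ℂ) :
    (aeval (HahnSeries.single (1 : ℤ) (1 : ℂ) : LaurentSeries ℂ) p * x).coeff = act p x.coeff := by
  ext n
  rw [coeff_aeval_single_mul, act_apply le_rfl]
  simp

/-- Reversing the index turns a Laurent series in `z⁻¹` into a sequence indexed by powers of `z`.
Expansions at `0` and at `∞` thus live in one module over `ℂ[X]`, where they can be subtracted. -/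
lemma coeff_aeval_infty (p : ℂ[X]) (x : LaurentSeries ℂ) :
    (fun m : ℤ => (aeval (HahnSeries.single (-1 : ℤ) (1 : ℂ) : LaurentSeries ℂ) p * x).coeff (-m)) =
      act p fun m => x.coeff (-m) := by
  ext n
  rw [coeff_aeval_single_mul, act_apply le_rfl]
  refine Finset.sum_congr rfl fun k _ => ?_
  congr 2
  ring

lemma one_coeff_eq_unitSeq : (1 : LaurentSeries ℂ).coeff = unitSeq := by
  ext n
  rw [HahnSeries.coeff_one, unitSeq, Pi.single_apply]
  congr

lemma one_coeff_neg_eq_unitSeq : (fun m : ℤ => (1 : LaurentSeries ℂ).coeff (-m)) = unitSeq := by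
  ext n
  rw [HahnSeries.coeff_one, unitSeq, Pi.single_apply]
  simp

lemma aeval_single_one_injective :
    Function.Injective (aeval (R := ℂ) (HahnSeries.single (1 : ℤ) (1 : ℂ) : LaurentSeries ℂ)) := by
  intro p r h
  apply act_unitSeq_injective
  rw [← one_coeff_eq_unitSeq, ← coeff_aeval_zero, ← coeff_aeval_zero, h]

lemma aeval_single_neg_one_injective :
    Function.Injective (aeval (R := ℂ) (HahnSeries.single (-1 : ℤ) (1 : ℂ) : LaurentSeries ℂ)) := by
  intro p r h
  apply act_unitSeq_injective
  rw [← one_coeff_neg_eq_unitSeq, ← coeff_aeval_infty, ← coeff_aeval_infty, h]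

lemma num_mul_eq {Q W : ℂ[X]} (hW : W ≠ 0) {Ψ : RatFunc ℂ}
    (hΨ : Ψ = algebraMap ℂ[X] (RatFunc ℂ) Q / algebraMap ℂ[X] (RatFunc ℂ) W) :
    Ψ.num * W = Q * Ψ.denom := by
  apply RatFunc.algebraMap_injective ℂ
  have := RatFunc.num_div_denom Ψ
  rw [div_eq_iff (RatFunc.algebraMap_ne_zero (RatFunc.denom_ne_zero Ψ))] at this
  have hW' : algebraMap ℂ[X] (RatFunc ℂ) W ≠ 0 := RatFunc.algebraMap_ne_zero hW
  rw [map_mul, map_mul, this, hΨ]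
  field_simp

/-- A sequence bounded below is a Laurent series, and in the field of Laurent series the equation `W
f = Q` has only one solution. The analogue at infinity uses sequences bounded above. -/
lemma expandZero_div {Q W : ℂ[X]} (hW : W ≠ 0) {f : ℤ → ℂ} (hf : ∀ m < 0, f m = 0)
    (h : act W f = act Q unitSeq) :
    (expandZero (algebraMap ℂ[X] (RatFunc ℂ) Q / algebraMap ℂ[X] (RatFunc ℂ) W)).coeff = f := by
  set Ψ := algebraMap ℂ[X] (RatFunc ℂ) Q / algebraMap ℂ[X] (RatFunc ℂ) W with hΨ
  have hne : ∀ {p : ℂ[X]}, p ≠ 0 →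
      aeval (HahnSeries.single (1 : ℤ) (1 : ℂ) : LaurentSeries ℂ) p ≠ 0 := fun hp h0 =>
    hp (aeval_single_one_injective (by rw [h0, map_zero]))
  set F : LaurentSeries ℂ := HahnSeries.ofSuppBddBelow f
    ⟨0, fun m hm => not_lt.1 fun h => (Function.mem_support.1 hm) (hf m h)⟩ with hF
  have hFc : F.coeff = f := rfl
  have e1 : aeval (HahnSeries.single (1 : ℤ) (1 : ℂ) : LaurentSeries ℂ) W * F =
      aeval (HahnSeries.single (1 : ℤ) (1 : ℂ) : LaurentSeries ℂ) Q := by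
    rw [← mul_one (aeval _ Q)]
    apply HahnSeries.ext
    rw [coeff_aeval_zero, coeff_aeval_zero, one_coeff_eq_unitSeq, hFc, h]
  have e2 := congrArg (aeval (HahnSeries.single (1 : ℤ) (1 : ℂ) : LaurentSeries ℂ))
    (num_mul_eq hW hΨ)
  rw [map_mul, map_mul, ← e1] at e2
  have e3 : expandZero Ψ = F := by
    rw [expandZero, div_eq_iff (hne (RatFunc.denom_ne_zero Ψ))]
    apply mul_right_cancel₀ (hne hW)
    rw [e2]
    ring
  rw [e3, hFc]

lemma expandInfty_div {Q W : ℂ[X]} (hW : W ≠ 0) {g : ℤ → ℂ} {d : ℤ} (hg : ∀ m, d < m → g m = 0)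
    (h : act W g = act Q unitSeq) (m : ℤ) :
    (expandInfty (algebraMap ℂ[X] (RatFunc ℂ) Q / algebraMap ℂ[X] (RatFunc ℂ) W)).coeff (-m) =
      g m := by
  set Ψ := algebraMap ℂ[X] (RatFunc ℂ) Q / algebraMap ℂ[X] (RatFunc ℂ) W with hΨ
  have hne : ∀ {p : ℂ[X]}, p ≠ 0 →
      aeval (HahnSeries.single (-1 : ℤ) (1 : ℂ) : LaurentSeries ℂ) p ≠ 0 := fun hp h0 =>
    hp (aeval_single_neg_one_injective (by rw [h0, map_zero]))
  set F : LaurentSeries ℂ := HahnSeries.ofSuppBddBelow (fun m => g (-m))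
    ⟨-d, fun m hm => not_lt.1 fun h => (Function.mem_support.1 hm) (hg _ (by omega))⟩ with hF
  have hF' : (fun m => F.coeff (-m)) = g := by
    ext m
    exact congrArg g (neg_neg m)
  have e1 : aeval (HahnSeries.single (-1 : ℤ) (1 : ℂ) : LaurentSeries ℂ) W * F =
      aeval (HahnSeries.single (-1 : ℤ) (1 : ℂ) : LaurentSeries ℂ) Q := by
    rw [← mul_one (aeval _ Q)]
    have := coeff_aeval_infty W F
    rw [hF', h, ← one_coeff_neg_eq_unitSeq, ← coeff_aeval_infty] at this
    ext m
    simpa using congrFun this (-m)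
  have e2 := congrArg (aeval (HahnSeries.single (-1 : ℤ) (1 : ℂ) : LaurentSeries ℂ))
    (num_mul_eq hW hΨ)
  rw [map_mul, map_mul, ← e1] at e2
  have e3 : expandInfty Ψ = F := by
    rw [expandInfty, div_eq_iff (hne (RatFunc.denom_ne_zero Ψ))]
    apply mul_right_cancel₀ (hne hW)
    rw [e2]
    ring
  rw [e3]
  exact congrFun hF' m

lemma act_denom_expandZero (Ψ : RatFunc ℂ) :
    act Ψ.denom (expandZero Ψ).coeff = act Ψ.num unitSeq := by
  rw [← one_coeff_eq_unitSeq, ← coeff_aeval_zero, ← coeff_aeval_zero, mul_one, expandZero,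
    mul_div_cancel₀]
  exact fun h0 => RatFunc.denom_ne_zero Ψ (aeval_single_one_injective (by rw [h0, map_zero]))

lemma act_denom_expandInfty (Ψ : RatFunc ℂ) :
    act Ψ.denom (fun m => (expandInfty Ψ).coeff (-m)) = act Ψ.num unitSeq := by
  rw [← one_coeff_neg_eq_unitSeq, ← coeff_aeval_infty, ← coeff_aeval_infty, mul_one, expandInfty,
    mul_div_cancel₀]
  exact fun h0 => RatFunc.denom_ne_zero Ψ (aeval_single_neg_one_injective (by rw [h0, map_zero]))

/-- A rational function is determined by its expansion at `0`. -/
lemma eq_div_of_expandZero {Q W : ℂ[X]} (hW : W ≠ 0) {Ψ : RatFunc ℂ}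
    (h : act W (expandZero Ψ).coeff = act Q unitSeq) :
    Ψ = algebraMap ℂ[X] (RatFunc ℂ) Q / algebraMap ℂ[X] (RatFunc ℂ) W := by
  have e : Ψ.denom * Q = W * Ψ.num := by
    apply act_unitSeq_injective
    rw [act_mul, ← h, ← act_mul, mul_comm, act_mul, act_denom_expandZero, act_mul]
  rw [eq_div_iff (RatFunc.algebraMap_ne_zero hW)]
  have h1 := RatFunc.num_div_denom Ψ
  have hd : algebraMap ℂ[X] (RatFunc ℂ) Ψ.denom ≠ 0 :=
    RatFunc.algebraMap_ne_zero (RatFunc.denom_ne_zero Ψ)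
  rw [div_eq_iff hd] at h1
  have h2 := congrArg (algebraMap ℂ[X] (RatFunc ℂ)) e
  rw [map_mul, map_mul, h1] at h2
  apply mul_left_cancel₀ hd
  rw [h2]
  ring

/-- A distribution supported in degrees `≥ 0` and in degrees `≤ d` is a polynomial. -/
lemma exists_polynomial {F : ℤ → ℂ} {d : ℤ} (h0 : ∀ m < 0, F m = 0) (hd : ∀ m, d < m → F m = 0) :
    ∃ Q : ℂ[X], act Q unitSeq = F := by
  refine ⟨∑ k ∈ Finset.range (d.toNat + 1), monomial k (F k), ?_⟩
  ext s
  rcases lt_or_ge s 0 with hs | hs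
  · rw [act_unitSeq_neg _ hs, h0 s hs]
  · lift s to ℕ using hs
    rw [act_unitSeq, Polynomial.finsetSum_coeff]
    simp only [coeff_monomial, Finset.sum_ite_eq', Finset.mem_range]
    split_ifs with h
    · rfl
    · exact (hd _ (by omega)).symm

lemma act_support_nonneg (p : ℂ[X]) {f : ℤ → ℂ} (h : ∀ m < 0, f m = 0) :
    ∀ m < 0, act p f m = 0 := fun m hm => by
  rw [act_apply le_rfl]
  exact Finset.sum_eq_zero fun k _ => by rw [h _ (by omega), mul_zero]

lemma act_support_le (p : ℂ[X]) {f : ℤ → ℂ} {d : ℤ} (h : ∀ m, d < m → f m = 0) :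
    ∀ m, d + p.natDegree < m → act p f m = 0 := fun m hm => by
  rw [act_apply le_rfl]
  refine Finset.sum_eq_zero fun k hk => ?_
  have : k ≤ p.natDegree := by simpa [Nat.lt_succ_iff] using hk
  rw [h _ (by omega), mul_zero]

/-- A power series `S` with non-zero constant term is determined by `S(z) S(cz)` and `S(0)`. -/
lemma eq_of_mul_scaleArg_eq {c : ℂ} (hc : ∀ n : ℕ, 0 < n → 1 + c ^ n ≠ 0) {S T : PowerSeries ℂ}
    (h0 : PowerSeries.coeff 0 S = PowerSeries.coeff 0 T) (hS : PowerSeries.coeff 0 S ≠ 0)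
    (h : S * scaleArg c S = T * scaleArg c T) : S = T := by
  ext n
  induction n using Nat.strong_induction_on with
  | _ n ih =>
    rcases Nat.eq_zero_or_pos n with rfl | hn
    · exact h0
    have e := congrArg (PowerSeries.coeff n) h
    rw [PowerSeries.coeff_mul, PowerSeries.coeff_mul] at e
    obtain ⟨k, rfl⟩ : ∃ k, n = k + 1 := ⟨n - 1, by omega⟩
    -- The two extreme terms add up to `(1 + c ^ n) S_0 S_n`; the others involve only lower
    -- coefficients. Degree `1` is separate because it has no other terms.
    rw [Finset.Nat.sum_antidiagonal_succ', Finset.Nat.sum_antidiagonal_succ'] at e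
    rcases k with _ | k
    · simp only [Finset.Nat.antidiagonal_zero, Finset.sum_singleton, coeff_scaleArg,
        smul_eq_mul, h0] at e
      have h1 := hc 1 one_pos
      rw [h0] at hS
      simp only [zero_add, pow_one, pow_zero, one_mul] at e h1 ⊢
      apply mul_left_cancel₀ (mul_ne_zero h1 hS)
      linear_combination e
    · rw [Finset.Nat.sum_antidiagonal_succ, Finset.Nat.sum_antidiagonal_succ] at e
      have hs : ∀ p ∈ Finset.HasAntidiagonal.antidiagonal k,
          PowerSeries.coeff (p.1 + 1) S * PowerSeries.coeff (p.2 + 1) (scaleArg c S) =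
          PowerSeries.coeff (p.1 + 1) T * PowerSeries.coeff (p.2 + 1) (scaleArg c T) := by
        intro p hp
        rw [Finset.HasAntidiagonal.mem_antidiagonal] at hp
        rw [coeff_scaleArg, coeff_scaleArg, ih _ (by omega), ih _ (by omega)]
      rw [Finset.sum_congr rfl hs] at e
      simp only [coeff_scaleArg, smul_eq_mul, h0] at e
      have h1 := hc (k + 1 + 1) (Nat.succ_pos _)
      rw [h0] at hS
      apply mul_left_cancel₀ (mul_ne_zero h1 hS)
      linear_combination e

/-! ## Partial fractions -/

/-- The Lagrange basis at the nodes `y_i⁻¹` sums to `1`. Divided by `∏ (1 - y_j z)`, this is the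
partial fraction decomposition of its inverse. -/
lemma lagrange_sum_one {ι : Type*} [Fintype ι] [DecidableEq ι] [Nonempty ι] {y : ι → ℂ}
    (hy : ∀ i, y i ≠ 0) (hinj : Function.Injective y) :
    ∑ i, C (∏ j ∈ Finset.univ.erase i, (1 - y j / y i))⁻¹ *
      ∏ j ∈ Finset.univ.erase i, (1 - C (y j) * X : ℂ[X]) = 1 := by
  have hinj' : Set.InjOn (fun i => (y i)⁻¹) (Finset.univ : Finset ι) :=
    fun i _ j _ h => hinj (inv_injective h)
  refine Eq.trans ?_ (Lagrange.sum_basis hinj' Finset.univ_nonempty)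
  refine Finset.sum_congr rfl fun i _ => ?_
  rw [Lagrange.basis, ← Finset.prod_inv_distrib, map_prod, ← Finset.prod_mul_distrib]
  refine Finset.prod_congr rfl fun j hj => ?_
  have hij : y i - y j ≠ 0 := sub_ne_zero.2 fun h => Finset.ne_of_mem_erase hj (hinj h).symm
  have hji : y j - y i ≠ 0 := sub_ne_zero.2 fun h => Finset.ne_of_mem_erase hj (hinj h)
  have h1 := hy i
  have h2 := hy j
  have e1 : (1 - y j / y i)⁻¹ = y i / (y i - y j) := by
    rw [one_sub_div h1, inv_div]
  have e2 : ((y i)⁻¹ - (y j)⁻¹)⁻¹ = y i * y j / (y j - y i) := by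
    rw [inv_sub_inv h1 h2, inv_div]
  rw [Lagrange.basisDivisor, e1, e2, mul_sub, mul_sub, ← mul_assoc, ← C_mul, ← C_mul, mul_one]
  have e3 : y i / (y i - y j) * y j = -(y i * y j / (y j - y i)) := by field_simp; ring
  have e4 : y i * y j / (y j - y i) * (y j)⁻¹ = -(y i / (y i - y j)) := by field_simp; ring
  rw [e3, e4, C_neg, C_neg]
  ring

/-- If `(1 - y z)` times `f`, `g` is a polynomial, for expansions `f` at `0` and `g` at `∞`,
then `f - g` is the value of the polynomial at `y⁻¹` times the delta distribution. -/
lemma sub_eq_eval_of_act_one_sub {y : ℂ} (hy : y ≠ 0) {p : ℂ[X]} {f g : ℤ → ℂ} {d : ℤ}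
    (hf : ∀ m < 0, f m = 0) (hg : ∀ m, d < m → g m = 0)
    (hpf : act (1 - C y * X) f = act p unitSeq) (hpg : act (1 - C y * X) g = act p unitSeq)
    (m : ℤ) : f m - g m = p.eval y⁻¹ * y ^ m := by
  -- The difference is annihilated by `1 - y z`, hence is a geometric sequence; its constant remains
  -- to be found.
  have hstep : ∀ s : ℤ, f s - g s = y * (f (s - 1) - g (s - 1)) := fun s => by
    have := congrFun (hpf.trans hpg.symm) s
    rw [act_one_sub, act_one_sub] at this
    linear_combination this
  have hup : ∀ (s : ℤ) (n : ℕ), f (s + n) - g (s + n) = y ^ n * (f s - g s) := by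
    intro s n
    induction n with
    | zero => simp
    | succ n ih =>
      rw [hstep, show s + ((n + 1 : ℕ) : ℤ) - 1 = s + n by push_cast; ring, ih]
      ring
  -- The expansion at `0` of `p / (1 - y z)`: in large degree its coefficient is `p(y⁻¹) y^n`, and
  -- there `g` vanishes.
  have hfn : ∀ n : ℕ, f n = ∑ k ∈ Finset.range (n + 1), p.coeff k * y⁻¹ ^ k * y ^ n := by
    intro n
    induction n with
    | zero =>
      have := congrFun hpf (0 : ℕ)
      rw [act_unitSeq, act_one_sub, hf (((0 : ℕ) : ℤ) - 1) (by simp)] at this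
      simpa using this
    | succ n ih =>
      have := congrFun hpf (n + 1 : ℕ)
      rw [act_unitSeq, act_one_sub, show (((n + 1 : ℕ) : ℤ) - 1) = n by push_cast; ring, ih] at this
      rw [Finset.sum_range_succ, eq_add_of_sub_eq this, Finset.mul_sum, add_comm]
      congr 1
      · exact Finset.sum_congr rfl fun k _ => by ring
      · rw [mul_assoc, ← mul_pow, inv_mul_cancel₀ hy, one_pow, mul_one]
  have hbig : ∀ n : ℕ, p.natDegree ≤ n → d < n → f n - g n = p.eval y⁻¹ * y ^ n := by
    intro n hn hd
    rw [hg _ hd, sub_zero, hfn, ← Finset.sum_mul, Polynomial.eval_eq_sum_range'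
      (Nat.lt_succ_of_le hn)]
  -- A degree beyond that of `p`, the support of `g` and `m`; the geometric recursion descends from
  -- it to `m`.
  obtain ⟨n, h1, h2, h3⟩ : ∃ n : ℕ, p.natDegree ≤ n ∧ d < n ∧ m ≤ n :=
    ⟨p.natDegree + d.toNat + m.toNat + 1, by omega, by omega, by omega⟩
  have e := hup m (n - m).toNat
  have e' : m + ((n - m).toNat : ℤ) = n := by omega
  rw [e', hbig n h1 h2] at e
  have hk : y ^ (n - m).toNat ≠ 0 := pow_ne_zero _ hy
  apply mul_left_cancel₀ hk
  rw [← e, ← zpow_natCast y (n - m).toNat, mul_left_comm, ← zpow_add₀ hy]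
  rw [← zpow_natCast y n]
  congr 2
  omega

/-- The difference of the expansions at `0` and at `∞` of `p / ∏ (1 - y_i z)`. -/
lemma sub_eq_sum_residues {ι : Type*} [Fintype ι] [DecidableEq ι] {y : ι → ℂ}
    (hy : ∀ i, y i ≠ 0) (hinj : Function.Injective y) {p : ℂ[X]} {f g : ℤ → ℂ} {d : ℤ}
    (hf : ∀ m < 0, f m = 0) (hg : ∀ m, d < m → g m = 0)
    (hpf : act (∏ i, (1 - C (y i) * X)) f = act p unitSeq)
    (hpg : act (∏ i, (1 - C (y i) * X)) g = act p unitSeq) (m : ℤ) :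
    f m - g m =
      ∑ i, p.eval (y i)⁻¹ / (∏ j ∈ Finset.univ.erase i, (1 - y j / y i)) * y i ^ m := by
  rcases isEmpty_or_nonempty ι with h | h
  · simp only [Finset.univ_eq_empty, Finset.prod_empty, act_one] at hpf hpg
    simp [hpf, hpg]
  have hD : ∀ i, (∏ i, (1 - C (y i) * X : ℂ[X])) =
      (1 - C (y i) * X) * ∏ j ∈ Finset.univ.erase i, (1 - C (y j) * X) := fun i =>
    (Finset.mul_prod_erase _ _ (Finset.mem_univ i)).symm
  have h1 : ∀ i m, act (∏ j ∈ Finset.univ.erase i, (1 - C (y j) * X)) f m -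
      act (∏ j ∈ Finset.univ.erase i, (1 - C (y j) * X)) g m = p.eval (y i)⁻¹ * y i ^ m :=
    fun i m => sub_eq_eval_of_act_one_sub (hy i) (act_support_nonneg _ hf) (act_support_le _ hg)
      (by rw [← act_mul, ← hD, hpf]) (by rw [← act_mul, ← hD, hpg]) m
  -- Writing the identity as the Lagrange sum reduces the claim to one pole at a time.
  have hone : ∀ e : ℤ → ℂ, e = ∑ i, (∏ j ∈ Finset.univ.erase i, (1 - y j / y i))⁻¹ •
      act (∏ j ∈ Finset.univ.erase i, (1 - C (y j) * X)) e := by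
    intro e
    conv_lhs => rw [← act_one e, ← lagrange_sum_one hy hinj]
    rw [act, map_sum, LinearMap.sum_apply]
    exact Finset.sum_congr rfl fun i _ => act_C_mul _ _ _
  rw [hone f, hone g, Finset.sum_apply, Finset.sum_apply, ← Finset.sum_sub_distrib]
  refine Finset.sum_congr rfl fun i _ => ?_
  rw [Pi.smul_apply, Pi.smul_apply, ← smul_sub, h1, smul_eq_mul]
  ring

/-! ## Elementary facts on a parameter that is not a root of unity -/

section Parameter

variable {q : ℂ}

lemma q_zpow_ne_one (hq : ∀ n : ℕ, 0 < n → q ^ n ≠ 1) {n : ℤ} (hn : n ≠ 0) :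
    q ^ n ≠ 1 := by
  rcases lt_or_gt_of_ne hn with h | h
  · intro e
    apply hq (-n).toNat (by omega)
    rw [← zpow_natCast, Int.toNat_of_nonneg (by omega), zpow_neg, e, inv_one]
  · intro e
    apply hq n.toNat (by omega)
    rw [← zpow_natCast, Int.toNat_of_nonneg (by omega), e]

lemma q_zpow_injective (hq0 : q ≠ 0) (hq : ∀ n : ℕ, 0 < n → q ^ n ≠ 1) {m n : ℤ}
    (h : q ^ m = q ^ n) : m = n := by
  by_contra hne
  apply q_zpow_ne_one hq (sub_ne_zero.2 hne)
  rw [zpow_sub₀ hq0, h, div_self (zpow_ne_zero _ hq0)]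

lemma q_sub_inv_ne_zero (hq0 : q ≠ 0) (hq : ∀ n : ℕ, 0 < n → q ^ n ≠ 1) : q - q⁻¹ ≠ 0 := by
  intro h
  apply hq 2 two_pos
  field_simp at h
  linear_combination h

lemma one_add_q_sq_pow_ne_zero (hq : ∀ n : ℕ, 0 < n → q ^ n ≠ 1) {n : ℕ} (hn : 0 < n) :
    1 + (q ^ 2) ^ n ≠ 0 := by
  intro h
  apply hq (4 * n) (by omega)
  have : q ^ (4 * n) = ((q ^ 2) ^ n) ^ 2 := by rw [← pow_mul, ← pow_mul]; congr 1; ring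
  rw [this, eq_neg_of_add_eq_zero_right h]
  norm_num

/-- The quantum Cartan matrix is invertible at every `q^n`, so `invCartan` is a true inverse and not
the default value `0⁻¹ = 0`. -/
lemma q_add_inv_ne_zero (hq0 : q ≠ 0) (hq : ∀ n : ℕ, 0 < n → q ^ n ≠ 1) {n : ℕ} (hn : 0 < n) :
    q ^ n + (q ^ n)⁻¹ ≠ 0 := by
  intro h
  apply one_add_q_sq_pow_ne_zero hq hn
  have hn0 : q ^ n ≠ 0 := pow_ne_zero _ hq0
  field_simp at h
  rw [← pow_mul, mul_comm 2 n, pow_mul]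
  linear_combination h

end Parameter

/-! ## Relations in the shifted quantum affine algebra -/

section Relations

variable {q : ℂ} {μ : ℤ}

lemma mk_el (g : Gen) : RingQuot.mkAlgHom ℂ (Rel q μ) g.el = gen q μ g := rfl

lemma gen_h_zero : gen q μ (.h 0) = 0 := by
  simpa [mk_el] using RingQuot.mkAlgHom_rel ℂ (Rel.h_zero (q := q) (μ := μ))

/-- `φ⁺_0` as a unit. -/
def phiPlusUnit (q : ℂ) (μ : ℤ) : (ShiftedAlg q μ)ˣ where
  val := gen q μ (.phiPlus 0)
  inv := gen q μ .phiPlusInv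
  val_inv := by
    simpa [mk_el] using RingQuot.mkAlgHom_rel ℂ (Rel.phiPlus_inv_right (q := q) (μ := μ))
  inv_val := by
    simpa [mk_el] using RingQuot.mkAlgHom_rel ℂ (Rel.phiPlus_inv_left (q := q) (μ := μ))

/-- `φ⁻_μ` as a unit. -/
def phiMinusUnit (q : ℂ) (μ : ℤ) : (ShiftedAlg q μ)ˣ where
  val := gen q μ (.phiMinus μ)
  inv := gen q μ .phiMinusInv
  val_inv := by
    simpa [mk_el] using RingQuot.mkAlgHom_rel ℂ (Rel.phiMinus_inv_right (q := q) (μ := μ))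
  inv_val := by
    simpa [mk_el] using RingQuot.mkAlgHom_rel ℂ (Rel.phiMinus_inv_left (q := q) (μ := μ))

lemma phiPlus_mul_inv : gen q μ (.phiPlus 0) * gen q μ .phiPlusInv = 1 := (phiPlusUnit q μ).val_inv
lemma phiPlus_inv_mul : gen q μ .phiPlusInv * gen q μ (.phiPlus 0) = 1 := (phiPlusUnit q μ).inv_val
lemma phiMinus_mul_inv : gen q μ (.phiMinus μ) * gen q μ .phiMinusInv = 1 :=
  (phiMinusUnit q μ).val_inv
lemma phiMinus_inv_mul : gen q μ .phiMinusInv * gen q μ (.phiMinus μ) = 1 :=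
  (phiMinusUnit q μ).inv_val

lemma gen_phiPlus_neg {m : ℤ} (hm : m < 0) : gen q μ (.phiPlus m) = 0 := by
  simpa [mk_el] using RingQuot.mkAlgHom_rel ℂ (Rel.phiPlus_neg (q := q) (μ := μ) m hm)

lemma gen_phiMinus_big {m : ℤ} (hm : μ < m) : gen q μ (.phiMinus m) = 0 := by
  simpa [mk_el] using RingQuot.mkAlgHom_rel ℂ (Rel.phiMinus_big (q := q) (μ := μ) m hm)

/-- The series `(q - q⁻¹) ∑_{r>0} h_r z^r`. -/
def hPlusSeries (q : ℂ) (μ : ℤ) : PowerSeries (ShiftedAlg q μ) :=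
  positiveSeries fun r => (q - q⁻¹) • gen q μ (.h r)

/-- The series `-(q - q⁻¹) ∑_{r>0} h_{-r} z^r`. -/
def hMinusSeries (q : ℂ) (μ : ℤ) : PowerSeries (ShiftedAlg q μ) :=
  positiveSeries fun r => (-(q - q⁻¹)) • gen q μ (.h (-(r : ℤ)))

lemma gen_phiPlus_natCast (m : ℕ) : gen q μ (.phiPlus m) =
    gen q μ (.phiPlus 0) * PowerSeries.coeff m (expSeries (hPlusSeries q μ)) := by
  have := RingQuot.mkAlgHom_rel ℂ (Rel.phiPlus_exp (q := q) (μ := μ) m)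
  rw [map_mul, coeff_expSeries_map] at this
  simpa [mk_el, hPlusSeries] using this

lemma gen_phiMinus_sub (m : ℕ) : gen q μ (.phiMinus (μ - m)) =
    gen q μ (.phiMinus μ) * PowerSeries.coeff m (expSeries (hMinusSeries q μ)) := by
  have := RingQuot.mkAlgHom_rel ℂ (Rel.phiMinus_exp (q := q) (μ := μ) m)
  rw [map_mul, coeff_expSeries_map] at this
  simpa only [mk_el, hMinusSeries, map_smul] using this

lemma commute_phiPlus (r s : ℤ) : Commute (gen q μ (.phiPlus r)) (gen q μ (.phiPlus s)) := by
  simpa [mk_el, Commute, SemiconjBy] using RingQuot.mkAlgHom_rel ℂ (Rel.phiPlus_comm (q := q) (μ := μ) r s)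

lemma commute_phiMinus (r s : ℤ) : Commute (gen q μ (.phiMinus r)) (gen q μ (.phiMinus s)) := by
  simpa [mk_el, Commute, SemiconjBy] using RingQuot.mkAlgHom_rel ℂ (Rel.phiMinus_comm (q := q) (μ := μ) r s)

lemma commute_phiPlus_phiMinus (r s : ℤ) :
    Commute (gen q μ (.phiPlus r)) (gen q μ (.phiMinus s)) := by
  simpa [mk_el, Commute, SemiconjBy] using RingQuot.mkAlgHom_rel ℂ (Rel.phiPlus_phiMinus_comm (q := q) (μ := μ) r s)

lemma phiPlus_mul_xPlus (r : ℤ) : gen q μ (.phiPlus 0) * gen q μ (.xPlus r) =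
    q ^ (2 : ℤ) • (gen q μ (.xPlus r) * gen q μ (.phiPlus 0)) := by
  simpa only [mk_el, map_mul, map_smul] using
    RingQuot.mkAlgHom_rel ℂ (Rel.phiPlus_xPlus (q := q) (μ := μ) r)

lemma phiPlus_mul_xMinus (r : ℤ) : gen q μ (.phiPlus 0) * gen q μ (.xMinus r) =
    q ^ (-2 : ℤ) • (gen q μ (.xMinus r) * gen q μ (.phiPlus 0)) := by
  simpa only [mk_el, map_mul, map_smul] using
    RingQuot.mkAlgHom_rel ℂ (Rel.phiPlus_xMinus (q := q) (μ := μ) r)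

lemma phiMinus_mul_xPlus (r : ℤ) : gen q μ (.phiMinus μ) * gen q μ (.xPlus r) =
    q ^ (-2 : ℤ) • (gen q μ (.xPlus r) * gen q μ (.phiMinus μ)) := by
  simpa only [mk_el, map_mul, map_smul] using
    RingQuot.mkAlgHom_rel ℂ (Rel.phiMinus_xPlus (q := q) (μ := μ) r)

lemma phiMinus_mul_xMinus (r : ℤ) : gen q μ (.phiMinus μ) * gen q μ (.xMinus r) =
    q ^ (2 : ℤ) • (gen q μ (.xMinus r) * gen q μ (.phiMinus μ)) := by
  simpa only [mk_el, map_mul, map_smul] using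
    RingQuot.mkAlgHom_rel ℂ (Rel.phiMinus_xMinus (q := q) (μ := μ) r)

lemma h_mul_xPlus {m : ℤ} (hm : m ≠ 0) (r : ℤ) : gen q μ (.h m) * gen q μ (.xPlus r) =
    gen q μ (.xPlus r) * gen q μ (.h m) + (qInt q (2 * m) / (m : ℂ)) • gen q μ (.xPlus (m + r)) := by
  have := RingQuot.mkAlgHom_rel ℂ (Rel.h_xPlus (q := q) (μ := μ) m r hm)
  simp only [mk_el, map_mul, map_smul, map_sub] at this
  rw [← this]
  abel

lemma h_mul_xMinus {m : ℤ} (hm : m ≠ 0) (r : ℤ) : gen q μ (.h m) * gen q μ (.xMinus r) =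
    gen q μ (.xMinus r) * gen q μ (.h m) +
      (-(qInt q (2 * m) / (m : ℂ))) • gen q μ (.xMinus (m + r)) := by
  have := RingQuot.mkAlgHom_rel ℂ (Rel.h_xMinus (q := q) (μ := μ) m r hm)
  simp only [mk_el, map_mul, map_smul, map_sub] at this
  rw [← this]
  abel

lemma xPlus_mul_xMinus (r s : ℤ) : gen q μ (.xPlus r) * gen q μ (.xMinus s) =
    gen q μ (.xMinus s) * gen q μ (.xPlus r) +
      (q - q⁻¹)⁻¹ • (gen q μ (.phiPlus (r + s)) - gen q μ (.phiMinus (r + s))) := by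
  have := RingQuot.mkAlgHom_rel ℂ (Rel.xPlus_xMinus (q := q) (μ := μ) r s)
  simp only [mk_el, map_mul, map_smul, map_sub] at this
  rw [← this]
  abel

lemma coeff_zero_hPlusSeries : PowerSeries.coeff 0 (hPlusSeries q μ) = 0 := by
  simp [hPlusSeries]

lemma coeff_zero_hMinusSeries : PowerSeries.coeff 0 (hMinusSeries q μ) = 0 := by
  simp [hMinusSeries]

lemma coeff_expSeries_hPlus (m : ℕ) : PowerSeries.coeff m (expSeries (hPlusSeries q μ)) =
    gen q μ .phiPlusInv * gen q μ (.phiPlus m) := by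
  rw [gen_phiPlus_natCast, ← mul_assoc, phiPlus_inv_mul, one_mul]

lemma coeff_expSeries_hMinus (m : ℕ) : PowerSeries.coeff m (expSeries (hMinusSeries q μ)) =
    gen q μ .phiMinusInv * gen q μ (.phiMinus (μ - m)) := by
  rw [gen_phiMinus_sub, ← mul_assoc, phiMinus_inv_mul, one_mul]

/-- A subalgebra that contains the `φ^±_m` and the inverses contains the `h_m`. -/
lemma h_mem_of_phi_mem (hqq : q - q⁻¹ ≠ 0) (B : Subalgebra ℂ (ShiftedAlg q μ))
    (h1 : ∀ m, gen q μ (.phiPlus m) ∈ B) (h2 : ∀ m, gen q μ (.phiMinus m) ∈ B)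
    (h3 : gen q μ .phiPlusInv ∈ B) (h4 : gen q μ .phiMinusInv ∈ B) (m : ℤ) :
    gen q μ (.h m) ∈ B := by
  have key : ∀ {c : ℂ} {x : ShiftedAlg q μ}, c ≠ 0 → c • x ∈ B → x ∈ B := fun {c x} hc hx => by
    have := B.smul_mem hx c⁻¹
    rwa [smul_smul, inv_mul_cancel₀ hc, one_smul] at this
  rcases lt_trichotomy m 0 with hm | rfl | hm
  · have := mem_of_coeff_expSeries_mem B coeff_zero_hMinusSeries
      (fun n => by rw [coeff_expSeries_hMinus]; exact mul_mem h4 (h2 _)) (-m).toNat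
    rw [hMinusSeries, coeff_positiveSeries, if_neg (by omega),
      show -((-m).toNat : ℤ) = m by omega] at this
    exact key (neg_ne_zero.2 hqq) this
  · rw [gen_h_zero]; exact zero_mem _
  · have := mem_of_coeff_expSeries_mem B coeff_zero_hPlusSeries
      (fun n => by rw [coeff_expSeries_hPlus]; exact mul_mem h3 (h1 _)) m.toNat
    rw [hPlusSeries, coeff_positiveSeries, if_neg (by omega),
      show (m.toNat : ℤ) = m by omega] at this
    exact key hqq this

/-- The presentation contains no relation among the `h_m`; they lie in every subalgebra containing
the `φ^±_m` and the two inverses, in particular in the centralizer of `x`. -/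
lemma commute_h_of_commute_phi (hqq : q - q⁻¹ ≠ 0) {x : ShiftedAlg q μ}
    (h1 : ∀ m, Commute x (gen q μ (.phiPlus m))) (h2 : ∀ m, Commute x (gen q μ (.phiMinus m)))
    (m : ℤ) : Commute x (gen q μ (.h m)) := by
  have hmem : ∀ y, y ∈ Subalgebra.centralizer ℂ {x} ↔ Commute x y := fun y => by
    rw [Subalgebra.mem_centralizer_iff]
    simp [Commute, SemiconjBy]
  rw [← hmem]
  refine h_mem_of_phi_mem hqq _ (fun m => (hmem _).2 (h1 m)) (fun m => (hmem _).2 (h2 m))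
    ((hmem _).2 ?_) ((hmem _).2 ?_) m
  · exact Commute.units_inv_right (u := phiPlusUnit q μ) (h1 0)
  · exact Commute.units_inv_right (u := phiMinusUnit q μ) (h2 μ)

lemma commute_phiPlus_h (hqq : q - q⁻¹ ≠ 0) (r m : ℤ) :
    Commute (gen q μ (.phiPlus r)) (gen q μ (.h m)) :=
  commute_h_of_commute_phi hqq (commute_phiPlus r) (commute_phiPlus_phiMinus r) m

lemma commute_phiMinus_h (hqq : q - q⁻¹ ≠ 0) (r m : ℤ) :
    Commute (gen q μ (.phiMinus r)) (gen q μ (.h m)) :=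
  commute_h_of_commute_phi hqq (fun s => (commute_phiPlus_phiMinus s r).symm)
    (commute_phiMinus r) m

lemma commute_h (hqq : q - q⁻¹ ≠ 0) (r m : ℤ) : Commute (gen q μ (.h r)) (gen q μ (.h m)) :=
  commute_h_of_commute_phi hqq (fun s => (commute_phiPlus_h hqq s r).symm)
    (fun s => (commute_phiMinus_h hqq s r).symm) m

end Relations

/-! ## Triangular decomposition -/

section Triangular

variable (q : ℂ) (μ : ℤ)

/-- The subalgebra generated by the `x⁻_r`. -/
def negAlg : Subalgebra ℂ (ShiftedAlg q μ) :=
  Algebra.adjoin ℂ (Set.range fun r => gen q μ (.xMinus r))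

/-- The subalgebra generated by the `x⁺_r`. -/
def posAlg : Subalgebra ℂ (ShiftedAlg q μ) :=
  Algebra.adjoin ℂ (Set.range fun r => gen q μ (.xPlus r))

/-- Generators of the Cartan subalgebra. -/
inductive IsCartanGen : Gen → Prop
  | h (m : ℤ) : IsCartanGen (.h m)
  | phiPlus : IsCartanGen (.phiPlus 0)
  | phiMinus : IsCartanGen (.phiMinus μ)
  | phiPlusInv : IsCartanGen .phiPlusInv
  | phiMinusInv : IsCartanGen .phiMinusInv

/-- The Cartan subalgebra. -/
def zeroAlg : Subalgebra ℂ (ShiftedAlg q μ) := Algebra.adjoin ℂ (gen q μ '' {g | IsCartanGen μ g})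

/-- The span of the `x⁻_r n h` and of the `Y x⁺_r`, where `n` is in the negative and `h` in the
Cartan subalgebra. -/
def vacKer : Submodule ℂ (ShiftedAlg q μ) :=
  Submodule.span ℂ ({y | ∃ r, ∃ n ∈ negAlg q μ, ∃ h ∈ zeroAlg q μ,
    y = gen q μ (.xMinus r) * (n * h)} ∪ {y | ∃ r Y, y = Y * gen q μ (.xPlus r)})

variable {q μ}

lemma xMinus_mem (r : ℤ) : gen q μ (.xMinus r) ∈ negAlg q μ := Algebra.subset_adjoin ⟨r, rfl⟩
lemma xPlus_mem (r : ℤ) : gen q μ (.xPlus r) ∈ posAlg q μ := Algebra.subset_adjoin ⟨r, rfl⟩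
lemma cartan_mem {g : Gen} (hg : IsCartanGen μ g) : gen q μ g ∈ zeroAlg q μ :=
  Algebra.subset_adjoin ⟨g, hg, rfl⟩

lemma hPlusSeries_mem (m : ℕ) : PowerSeries.coeff m (hPlusSeries q μ) ∈ zeroAlg q μ := by
  rw [hPlusSeries, coeff_positiveSeries]
  split_ifs
  · exact zero_mem _
  · exact Subalgebra.smul_mem _ (cartan_mem (.h _)) _

lemma hMinusSeries_mem (m : ℕ) : PowerSeries.coeff m (hMinusSeries q μ) ∈ zeroAlg q μ := by
  rw [hMinusSeries, coeff_positiveSeries]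
  split_ifs
  · exact zero_mem _
  · exact Subalgebra.smul_mem _ (cartan_mem (.h _)) _

lemma phiPlus_mem (m : ℤ) : gen q μ (.phiPlus m) ∈ zeroAlg q μ := by
  rcases lt_or_ge m 0 with hm | hm
  · rw [gen_phiPlus_neg hm]; exact zero_mem _
  · lift m to ℕ using hm
    rw [gen_phiPlus_natCast]
    exact mul_mem (cartan_mem .phiPlus)
      (coeff_expSeries_mem _ _ fun i _ => hPlusSeries_mem i)

lemma phiMinus_mem (m : ℤ) : gen q μ (.phiMinus m) ∈ zeroAlg q μ := by
  rcases lt_or_ge μ m with hm | hm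
  · rw [gen_phiMinus_big hm]; exact zero_mem _
  · obtain ⟨n, rfl⟩ : ∃ n : ℕ, m = μ - n := ⟨(μ - m).toNat, by omega⟩
    rw [gen_phiMinus_sub]
    exact mul_mem (cartan_mem .phiMinus)
      (coeff_expSeries_mem _ _ fun i _ => hMinusSeries_mem i)

lemma inv_mul_of_mul {A : Type*} [Ring A] [Algebra ℂ A] {c : ℂ} (hc : c ≠ 0) {s t x : A}
    (hst : s * t = 1) (hts : t * s = 1) (h : s * x = c • (x * s)) : t * x = c⁻¹ • (x * t) := by
  have : x * t = c • (t * x) := by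
    calc x * t = t * (s * x) * t := by rw [← mul_assoc t, hts, one_mul]
    _ = c • (t * x * (s * t)) := by rw [h]; simp [mul_assoc]
    _ = c • (t * x) := by rw [hst, mul_one]
  rw [this, smul_smul, inv_mul_cancel₀ hc, one_smul]

/-- A Cartan generator either `q`-commutes with `x⁻_r` or differs from commuting by a multiple of
`x⁻_{m+r}`. The form `n * g + n'` covers both cases and is stable under products. -/
lemma cartan_mul_xMinus (hq0 : q ≠ 0) {g : Gen} (hg : IsCartanGen μ g) (r : ℤ) :
    ∃ n ∈ negAlg q μ, ∃ n' ∈ negAlg q μ,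
      gen q μ g * gen q μ (.xMinus r) = n * gen q μ g + n' := by
  have hs : ∀ {c : ℂ}, gen q μ g * gen q μ (.xMinus r) = c • (gen q μ (.xMinus r) * gen q μ g) →
      ∃ n ∈ negAlg q μ, ∃ n' ∈ negAlg q μ,
        gen q μ g * gen q μ (.xMinus r) = n * gen q μ g + n' := fun {c} h =>
    ⟨c • gen q μ (.xMinus r), Subalgebra.smul_mem _ (xMinus_mem r) _, 0, zero_mem _, by
      rw [h, smul_mul_assoc, add_zero]⟩
  cases hg with
  | h m =>
    rcases eq_or_ne m 0 with rfl | hm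
    · exact ⟨0, zero_mem _, 0, zero_mem _, by simp [gen_h_zero]⟩
    · exact ⟨_, xMinus_mem r, _, Subalgebra.smul_mem _ (xMinus_mem (m + r)) _, h_mul_xMinus hm r⟩
  | phiPlus => exact hs (phiPlus_mul_xMinus r)
  | phiMinus => exact hs (phiMinus_mul_xMinus r)
  | phiPlusInv => exact hs (inv_mul_of_mul (zpow_ne_zero _ hq0) phiPlus_mul_inv phiPlus_inv_mul
      (phiPlus_mul_xMinus r))
  | phiMinusInv => exact hs (inv_mul_of_mul (zpow_ne_zero _ hq0) phiMinus_mul_inv phiMinus_inv_mul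
      (phiMinus_mul_xMinus r))

lemma xPlus_mul_cartan (hq0 : q ≠ 0) {g : Gen} (hg : IsCartanGen μ g) (r : ℤ) :
    ∃ n ∈ posAlg q μ, ∃ n' ∈ posAlg q μ,
      gen q μ (.xPlus r) * gen q μ g = gen q μ g * n + n' := by
  have hs : ∀ {c : ℂ}, c ≠ 0 →
      gen q μ g * gen q μ (.xPlus r) = c • (gen q μ (.xPlus r) * gen q μ g) →
      ∃ n ∈ posAlg q μ, ∃ n' ∈ posAlg q μ,
        gen q μ (.xPlus r) * gen q μ g = gen q μ g * n + n' := fun {c} hc h =>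
    ⟨c⁻¹ • gen q μ (.xPlus r), Subalgebra.smul_mem _ (xPlus_mem r) _, 0, zero_mem _, by
      rw [mul_smul_comm, h, smul_smul, inv_mul_cancel₀ hc, one_smul, add_zero]⟩
  have h2 : ∀ n : ℤ, q ^ n ≠ 0 := fun n => zpow_ne_zero n hq0
  cases hg with
  | h m =>
    rcases eq_or_ne m 0 with rfl | hm
    · exact ⟨0, zero_mem _, 0, zero_mem _, by simp [gen_h_zero]⟩
    · refine ⟨_, xPlus_mem r, _, neg_mem (Subalgebra.smul_mem _ (xPlus_mem (m + r))
        (qInt q (2 * m) / (m : ℂ))), ?_⟩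
      rw [h_mul_xPlus hm r, add_neg_cancel_right]
  | phiPlus => exact hs (h2 _) (phiPlus_mul_xPlus r)
  | phiMinus => exact hs (h2 _) (phiMinus_mul_xPlus r)
  | phiPlusInv => exact hs (inv_ne_zero (h2 _)) (inv_mul_of_mul (h2 _) phiPlus_mul_inv
      phiPlus_inv_mul (phiPlus_mul_xPlus r))
  | phiMinusInv => exact hs (inv_ne_zero (h2 _)) (inv_mul_of_mul (h2 _) phiMinus_mul_inv
      phiMinus_inv_mul (phiMinus_mul_xPlus r))

/-- A rule `s x = n s + n'` on generators propagates to words, because `s` is pushed past one factor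
at a time. -/
lemma mul_adjoin_of_mul {A : Type*} [Ring A] [Algebra ℂ A] {S : Set A} {s : A}
    (h : ∀ x ∈ S, ∃ n ∈ Algebra.adjoin ℂ S, ∃ n' ∈ Algebra.adjoin ℂ S, s * x = n * s + n')
    {y : A} (hy : y ∈ Algebra.adjoin ℂ S) :
    ∃ n ∈ Algebra.adjoin ℂ S, ∃ n' ∈ Algebra.adjoin ℂ S, s * y = n * s + n' := by
  induction hy using Algebra.adjoin_induction with
  | mem x hx => exact h x hx
  | algebraMap c =>
    exact ⟨_, Subalgebra.algebraMap_mem _ c, 0, zero_mem _, by rw [← Algebra.commutes, add_zero]⟩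
  | add x y _ _ hx hy =>
    obtain ⟨a, ha, b, hb, e⟩ := hx
    obtain ⟨a', ha', b', hb', e'⟩ := hy
    exact ⟨_, add_mem ha ha', _, add_mem hb hb', by rw [mul_add, e, e', add_mul]; abel⟩
  | mul x y _ hy' hx hy =>
    obtain ⟨a, ha, b, hb, e⟩ := hx
    obtain ⟨a', ha', b', hb', e'⟩ := hy
    refine ⟨_, mul_mem ha ha', _, add_mem (Subalgebra.mul_mem _ ha hb') (Subalgebra.mul_mem _ hb hy'), ?_⟩
    rw [← mul_assoc, e, add_mul, mul_assoc a, e']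
    noncomm_ring

lemma adjoin_mul_of_mul {A : Type*} [Ring A] [Algebra ℂ A] {S : Set A} {s : A}
    (h : ∀ x ∈ S, ∃ n ∈ Algebra.adjoin ℂ S, ∃ n' ∈ Algebra.adjoin ℂ S, x * s = s * n + n')
    {y : A} (hy : y ∈ Algebra.adjoin ℂ S) :
    ∃ n ∈ Algebra.adjoin ℂ S, ∃ n' ∈ Algebra.adjoin ℂ S, y * s = s * n + n' := by
  induction hy using Algebra.adjoin_induction with
  | mem x hx => exact h x hx
  | algebraMap c =>
    exact ⟨_, Subalgebra.algebraMap_mem _ c, 0, zero_mem _, by rw [Algebra.commutes, add_zero]⟩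
  | add x y _ _ hx hy =>
    obtain ⟨a, ha, b, hb, e⟩ := hx
    obtain ⟨a', ha', b', hb', e'⟩ := hy
    exact ⟨_, add_mem ha ha', _, add_mem hb hb', by rw [add_mul, e, e', mul_add]; abel⟩
  | mul x y hx' _ hx hy =>
    obtain ⟨a, ha, b, hb, e⟩ := hx
    obtain ⟨a', ha', b', hb', e'⟩ := hy
    refine ⟨_, mul_mem ha ha', _, add_mem (Subalgebra.mul_mem _ hb ha') (Subalgebra.mul_mem _ hx' hb'), ?_⟩
    rw [mul_assoc, e', mul_add, ← mul_assoc x, e]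
    noncomm_ring

/-- The span of the products of an element of the negative and one of the Cartan subalgebra. -/
def negZero (q : ℂ) (μ : ℤ) : Submodule ℂ (ShiftedAlg q μ) :=
  Subalgebra.toSubmodule (negAlg q μ) * Subalgebra.toSubmodule (zeroAlg q μ)

/-- The span of the products of an element of the Cartan and one of the positive subalgebra. -/
def zeroPos (q : ℂ) (μ : ℤ) : Submodule ℂ (ShiftedAlg q μ) :=
  Subalgebra.toSubmodule (zeroAlg q μ) * Subalgebra.toSubmodule (posAlg q μ)

lemma neg_mul_negZero {y n : ShiftedAlg q μ} (hy : y ∈ negZero q μ) (hn : n ∈ negAlg q μ) :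
    n * y ∈ negZero q μ := by
  refine Submodule.mul_induction_on hy (fun n' hn' z hz => ?_) fun a b ha hb => ?_
  · rw [← mul_assoc]; exact Submodule.mul_mem_mul (Subalgebra.mul_mem _ hn hn') hz
  · rw [mul_add]; exact add_mem ha hb

lemma zeroPos_mul_pos {y p : ShiftedAlg q μ} (hy : y ∈ zeroPos q μ) (hp : p ∈ posAlg q μ) :
    y * p ∈ zeroPos q μ := by
  refine Submodule.mul_induction_on hy (fun n hn z hz => ?_) fun a b ha hb => ?_
  · rw [mul_assoc]; exact Submodule.mul_mem_mul hn (Subalgebra.mul_mem _ hz hp)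
  · rw [add_mul]; exact add_mem ha hb

lemma cartan_mul_zeroPos {y h : ShiftedAlg q μ} (hy : y ∈ zeroPos q μ) (hh : h ∈ zeroAlg q μ) :
    h * y ∈ zeroPos q μ := by
  refine Submodule.mul_induction_on hy (fun n' hn' z hz => ?_) fun a b ha hb => ?_
  · rw [← mul_assoc]; exact Submodule.mul_mem_mul (Subalgebra.mul_mem _ hh hn') hz
  · rw [mul_add]; exact add_mem ha hb

lemma cartan_mul_negZero (hq0 : q ≠ 0) {h : ShiftedAlg q μ} (hh : h ∈ zeroAlg q μ) :
    ∀ y ∈ negZero q μ, h * y ∈ negZero q μ := by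
  induction hh using Algebra.adjoin_induction with
  | mem s hs =>
    obtain ⟨g, hg, rfl⟩ := hs
    intro y hy
    refine Submodule.mul_induction_on hy (fun n hn z hz => ?_) fun a b ha hb => ?_
    · obtain ⟨n1, h1, n2, h2, e⟩ := mul_adjoin_of_mul (s := gen q μ g) (by
        rintro _ ⟨r, rfl⟩; exact cartan_mul_xMinus hq0 hg r) hn
      rw [← mul_assoc, e, add_mul, mul_assoc]
      exact add_mem (Submodule.mul_mem_mul h1 (Subalgebra.mul_mem _ (cartan_mem hg) hz))
        (Submodule.mul_mem_mul h2 hz)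
    · rw [mul_add]; exact add_mem ha hb
  | algebraMap c => intro y hy; rw [← Algebra.smul_def]; exact Submodule.smul_mem _ _ hy
  | add a b _ _ ha hb => intro y hy; rw [add_mul]; exact add_mem (ha y hy) (hb y hy)
  | mul a b _ _ ha hb => intro y hy; rw [mul_assoc]; exact ha _ (hb y hy)

lemma zeroPos_mul_cartan (hq0 : q ≠ 0) {h : ShiftedAlg q μ} (hh : h ∈ zeroAlg q μ) :
    ∀ y ∈ zeroPos q μ, y * h ∈ zeroPos q μ := by
  induction hh using Algebra.adjoin_induction with
  | mem s hs =>
    obtain ⟨g, hg, rfl⟩ := hs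
    intro y hy
    refine Submodule.mul_induction_on hy (fun z hz n hn => ?_) fun a b ha hb => ?_
    · obtain ⟨n1, h1, n2, h2, e⟩ := adjoin_mul_of_mul (s := gen q μ g) (by
        rintro _ ⟨r, rfl⟩; exact xPlus_mul_cartan hq0 hg r) hn
      rw [mul_assoc, e, mul_add, ← mul_assoc]
      exact add_mem (Submodule.mul_mem_mul (Subalgebra.mul_mem _ hz (cartan_mem hg)) h1)
        (Submodule.mul_mem_mul hz h2)
    · rw [add_mul]; exact add_mem ha hb
  | algebraMap c =>
    intro y hy; rw [← Algebra.commutes, ← Algebra.smul_def]; exact Submodule.smul_mem _ _ hy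
  | add a b _ _ ha hb => intro y hy; rw [mul_add]; exact add_mem (ha y hy) (hb y hy)
  | mul a b _ _ ha hb => intro y hy; rw [← mul_assoc]; exact hb _ (ha y hy)

lemma mem_negZero {n : ShiftedAlg q μ} (hn : n ∈ negAlg q μ) : n ∈ negZero q μ := by
  rw [← mul_one n]; exact Submodule.mul_mem_mul hn (one_mem (zeroAlg q μ))

lemma cartan_mem_negZero {h : ShiftedAlg q μ} (hh : h ∈ zeroAlg q μ) : h ∈ negZero q μ := by
  rw [← one_mul h]; exact Submodule.mul_mem_mul (one_mem (negAlg q μ)) hh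

lemma negZero_mul_neg (hq0 : q ≠ 0) {y n : ShiftedAlg q μ} (hy : y ∈ negZero q μ)
    (hn : n ∈ negAlg q μ) : y * n ∈ negZero q μ := by
  refine Submodule.mul_induction_on hy (fun n' hn' z hz => ?_) fun a b ha hb => ?_
  · rw [mul_assoc]
    exact neg_mul_negZero (cartan_mul_negZero hq0 hz _ (mem_negZero hn)) hn'
  · rw [add_mul]; exact add_mem ha hb

/-- The commutator with `x⁺_r` is a derivation, whose values on the generators `x⁻_m` are Cartan
elements; these can be collected on the right by `negZero_mul_neg`. -/
lemma xPlus_commutator_mem (hq0 : q ≠ 0) (r : ℤ) {n : ShiftedAlg q μ} (hn : n ∈ negAlg q μ) :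
    gen q μ (.xPlus r) * n - n * gen q μ (.xPlus r) ∈ negZero q μ := by
  induction hn using Algebra.adjoin_induction with
  | mem s hs =>
    obtain ⟨m, rfl⟩ := hs
    simp only [xPlus_mul_xMinus, add_sub_cancel_left]
    exact Submodule.smul_mem _ _ (cartan_mem_negZero (sub_mem (phiPlus_mem _) (phiMinus_mem _)))
  | algebraMap c => rw [Algebra.commutes, sub_self]; exact zero_mem _
  | add a b _ _ ha hb =>
    rw [mul_add, add_mul, add_sub_add_comm]; exact add_mem ha hb
  | mul a b ha' hb' ha hb =>
    have : gen q μ (.xPlus r) * (a * b) - a * b * gen q μ (.xPlus r) =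
        (gen q μ (.xPlus r) * a - a * gen q μ (.xPlus r)) * b +
          a * (gen q μ (.xPlus r) * b - b * gen q μ (.xPlus r)) := by
      simp only [sub_mul, mul_sub, mul_assoc]
      abel
    rw [this]
    exact add_mem (negZero_mul_neg hq0 ha hb') (neg_mul_negZero hb ha')

lemma adjoin_gen_eq_top : Algebra.adjoin ℂ (Set.range (gen q μ)) = ⊤ := by
  have h1 := FreeAlgebra.adjoin_range_ι (R := ℂ) (X := Gen)
  have h2 := congrArg (Subalgebra.map (RingQuot.mkAlgHom ℂ (Rel q μ))) h1
  rw [AlgHom.map_adjoin, Algebra.map_top, (AlgHom.range_eq_top _).2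
    (RingQuot.mkAlgHom_surjective ℂ (Rel q μ)), ← Set.range_comp] at h2
  exact h2

/-- The triangular decomposition. -/
lemma triangular (hq0 : q ≠ 0) (X : ShiftedAlg q μ) :
    X ∈ Subalgebra.toSubmodule (negAlg q μ) * zeroPos q μ := by
  set T := Subalgebra.toSubmodule (negAlg q μ) * zeroPos q μ with hT
  have hneg : ∀ n ∈ negAlg q μ, ∀ y ∈ T, n * y ∈ T := fun n hn y hy => by
    refine Submodule.mul_induction_on hy (fun n' hn' z hz => ?_) fun a b ha hb => ?_
    · rw [← mul_assoc]; exact Submodule.mul_mem_mul (Subalgebra.mul_mem _ hn hn') hz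
    · rw [mul_add]; exact add_mem ha hb
  have hnz : ∀ y ∈ negZero q μ, ∀ z ∈ zeroPos q μ, y * z ∈ T := fun y hy z hz => by
    refine Submodule.mul_induction_on hy (fun n' hn' h hh => ?_) fun a b ha hb => ?_
    · rw [mul_assoc]; exact Submodule.mul_mem_mul hn' (cartan_mul_zeroPos hz hh)
    · rw [add_mul]; exact add_mem ha hb
  have hzero : ∀ h ∈ zeroAlg q μ, ∀ y ∈ T, h * y ∈ T := fun h hh y hy => by
    refine Submodule.mul_induction_on hy (fun n' hn' z hz => ?_) fun a b ha hb => ?_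
    · rw [← mul_assoc]; exact hnz _ (cartan_mul_negZero hq0 hh _ (mem_negZero hn')) _ hz
    · rw [mul_add]; exact add_mem ha hb
  have hx : ∀ r, ∀ z ∈ zeroPos q μ, gen q μ (.xPlus r) * z ∈ zeroPos q μ := fun r z hz => by
    refine Submodule.mul_induction_on hz (fun h hh p hp => ?_) fun a b ha hb => ?_
    · rw [← mul_assoc]
      refine zeroPos_mul_pos (zeroPos_mul_cartan hq0 hh _ ?_) hp
      rw [← one_mul (gen q μ _)]
      exact Submodule.mul_mem_mul (one_mem (zeroAlg q μ)) (xPlus_mem r)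
    · rw [mul_add]; exact add_mem ha hb
  have hpos : ∀ r, ∀ y ∈ T, gen q μ (.xPlus r) * y ∈ T := fun r y hy => by
    refine Submodule.mul_induction_on hy (fun n hn z hz => ?_) fun a b ha hb => ?_
    · have : gen q μ (.xPlus r) * (n * z) = (gen q μ (.xPlus r) * n - n * gen q μ (.xPlus r)) * z +
        n * (gen q μ (.xPlus r) * z) := by simp only [sub_mul, mul_assoc]; abel
      rw [this]
      exact add_mem (hnz _ (xPlus_commutator_mem hq0 r hn) _ hz)
        (Submodule.mul_mem_mul hn (hx r z hz))
    · rw [mul_add]; exact add_mem ha hb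
  -- `T` contains `1` and is stable under left multiplication by every generator, so it is the whole
  -- algebra.
  have hall : ∀ y ∈ T, X * y ∈ T := by
    have hX : X ∈ Algebra.adjoin ℂ (Set.range (gen q μ)) := by
      rw [adjoin_gen_eq_top]; exact Algebra.mem_top
    induction hX using Algebra.adjoin_induction with
    | mem s hs =>
      obtain ⟨g, rfl⟩ := hs
      cases g with
      | xPlus m => exact hpos m
      | xMinus m => exact hneg _ (xMinus_mem m)
      | phiPlus m => exact hzero _ (phiPlus_mem m)
      | phiMinus m => exact hzero _ (phiMinus_mem m)
      | h m => exact hzero _ (cartan_mem (.h m))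
      | phiPlusInv => exact hzero _ (cartan_mem .phiPlusInv)
      | phiMinusInv => exact hzero _ (cartan_mem .phiMinusInv)
    | algebraMap c => intro y hy; rw [← Algebra.smul_def]; exact Submodule.smul_mem _ _ hy
    | add a b _ _ ha hb => intro y hy; rw [add_mul]; exact add_mem (ha y hy) (hb y hy)
    | mul a b _ _ ha hb => intro y hy; rw [mul_assoc]; exact ha _ (hb y hy)
  have h1 : (1 : ShiftedAlg q μ) ∈ T := by
    have h2 : (1 : ShiftedAlg q μ) * (1 * 1) ∈ T := Submodule.mul_mem_mul (one_mem (negAlg q μ))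
      (Submodule.mul_mem_mul (one_mem (zeroAlg q μ)) (one_mem (posAlg q μ)))
    simpa using h2
  simpa using hall 1 h1

/-- A word in the `x⁻_r` is either empty, which accounts for the constant, or starts with some
`x⁻_r`. This form is what a vacuum functional can evaluate. -/
lemma neg_decomp {n : ShiftedAlg q μ} (hn : n ∈ negAlg q μ) :
    ∃ c : ℂ, n - algebraMap ℂ _ c ∈ Submodule.span ℂ
      {y | ∃ r, ∃ n' ∈ negAlg q μ, y = gen q μ (.xMinus r) * n'} := by
  set S := Submodule.span ℂ {y | ∃ r, ∃ n' ∈ negAlg q μ, y = gen q μ (.xMinus r) * n'} with hS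
  have hr : ∀ y ∈ S, ∀ n ∈ negAlg q μ, y * n ∈ S := fun y hy n hn => by
    induction hy using Submodule.span_induction with
    | mem x hx =>
      obtain ⟨r, n', hn', rfl⟩ := hx
      exact Submodule.subset_span ⟨r, _, mul_mem hn' hn, mul_assoc _ _ _⟩
    | zero => rw [zero_mul]; exact zero_mem _
    | add a b _ _ ha hb => rw [add_mul]; exact add_mem ha hb
    | smul c a _ ha => rw [smul_mul_assoc]; exact Submodule.smul_mem _ _ ha
  induction hn using Algebra.adjoin_induction with
  | mem x hx =>
    obtain ⟨r, rfl⟩ := hx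
    refine ⟨0, Submodule.subset_span ⟨r, 1, one_mem _, ?_⟩⟩
    simp
  | algebraMap c => exact ⟨c, by rw [sub_self]; exact zero_mem _⟩
  | add a b _ _ ha hb =>
    obtain ⟨c, hc⟩ := ha
    obtain ⟨d, hd⟩ := hb
    refine ⟨c + d, ?_⟩
    rw [map_add, add_sub_add_comm]
    exact add_mem hc hd
  | mul a b _ hb' ha hb =>
    obtain ⟨c, hc⟩ := ha
    obtain ⟨d, hd⟩ := hb
    refine ⟨c * d, ?_⟩
    have : a * b - algebraMap ℂ _ (c * d) = (a - algebraMap ℂ _ c) * b +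
        c • (b - algebraMap ℂ _ d) := by
      rw [map_mul, sub_mul, Algebra.smul_def, mul_sub]; abel
    rw [this]
    exact add_mem (hr _ hc b hb') (Submodule.smul_mem _ _ hd)

lemma pos_decomp {p : ShiftedAlg q μ} (hp : p ∈ posAlg q μ) :
    ∃ c : ℂ, p - algebraMap ℂ _ c ∈ Submodule.span ℂ {y | ∃ r Y, y = Y * gen q μ (.xPlus r)} := by
  set S := Submodule.span ℂ {y | ∃ r Y, y = Y * gen q μ (.xPlus r)} with hS
  have hr : ∀ y ∈ S, ∀ n, n * y ∈ S := fun y hy n => by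
    induction hy using Submodule.span_induction with
    | mem x hx =>
      obtain ⟨r, Y, rfl⟩ := hx
      exact Submodule.subset_span ⟨r, n * Y, (mul_assoc _ _ _).symm⟩
    | zero => rw [mul_zero]; exact zero_mem _
    | add a b _ _ ha hb => rw [mul_add]; exact add_mem ha hb
    | smul c a _ ha => rw [mul_smul_comm]; exact Submodule.smul_mem _ _ ha
  induction hp using Algebra.adjoin_induction with
  | mem x hx =>
    obtain ⟨r, rfl⟩ := hx
    refine ⟨0, Submodule.subset_span ⟨r, 1, ?_⟩⟩
    simp
  | algebraMap c => exact ⟨c, by rw [sub_self]; exact zero_mem _⟩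
  | add a b _ _ ha hb =>
    obtain ⟨c, hc⟩ := ha
    obtain ⟨d, hd⟩ := hb
    refine ⟨c + d, ?_⟩
    rw [map_add, add_sub_add_comm]
    exact add_mem hc hd
  | mul a b _ hb' ha hb =>
    obtain ⟨c, hc⟩ := ha
    obtain ⟨d, hd⟩ := hb
    refine ⟨c * d, ?_⟩
    have : a * b - algebraMap ℂ _ (c * d) = a * (b - algebraMap ℂ _ d) +
        d • (a - algebraMap ℂ _ c) := by
      rw [map_mul, mul_sub, Algebra.smul_def, mul_sub, Algebra.commutes c, Algebra.commutes d a]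
      abel
    rw [this]
    exact add_mem (hr _ hd a) (Submodule.smul_mem _ _ hc)

/-- Modulo `∑ U x⁺_r`, every element is a combination of products `n h`. -/
lemma exists_sub_mem_span_xPlus (hq0 : q ≠ 0) (X : ShiftedAlg q μ) :
    ∃ Y ∈ negZero q μ, X - Y ∈ Submodule.span ℂ {y | ∃ r Y, y = Y * gen q μ (.xPlus r)} := by
  set S := Submodule.span ℂ {y | ∃ r Y, y = Y * gen q μ (.xPlus r)} with hS
  have hr : ∀ y ∈ S, ∀ n, n * y ∈ S := fun y hy n => by
    induction hy using Submodule.span_induction with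
    | mem x hx =>
      obtain ⟨r, Y, rfl⟩ := hx
      exact Submodule.subset_span ⟨r, n * Y, (mul_assoc _ _ _).symm⟩
    | zero => rw [mul_zero]; exact zero_mem _
    | add a b _ _ ha hb => rw [mul_add]; exact add_mem ha hb
    | smul c a _ ha => rw [mul_smul_comm]; exact Submodule.smul_mem _ _ ha
  have hadd : ∀ a b : ShiftedAlg q μ, (∃ Y ∈ negZero q μ, a - Y ∈ S) →
      (∃ Y ∈ negZero q μ, b - Y ∈ S) → ∃ Y ∈ negZero q μ, a + b - Y ∈ S := by
    rintro a b ⟨Y, hY, h1⟩ ⟨Y', hY', h2⟩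
    exact ⟨Y + Y', add_mem hY hY', by rw [add_sub_add_comm]; exact add_mem h1 h2⟩
  refine Submodule.mul_induction_on (triangular hq0 X) (fun n hn z hz => ?_) hadd
  refine Submodule.mul_induction_on hz (fun h hh p hp => ?_) fun a b ha hb => ?_
  · obtain ⟨c, hc⟩ := pos_decomp hp
    refine ⟨c • (n * h), Submodule.smul_mem _ _ (Submodule.mul_mem_mul hn hh), ?_⟩
    have : n * (h * p) - c • (n * h) = n * h * (p - algebraMap ℂ _ c) := by
      rw [mul_sub, ← Algebra.commutes, Algebra.smul_def, mul_assoc]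
    rw [this]
    exact hr _ hc _
  · rw [mul_add]; exact hadd _ _ ha hb

/-- Modulo `vacKer`, every element is in the Cartan subalgebra. -/
lemma exists_sub_mem_vacKer (hq0 : q ≠ 0) (X : ShiftedAlg q μ) :
    ∃ X₀ ∈ zeroAlg q μ, X - X₀ ∈ vacKer q μ := by
  obtain ⟨Y, hY, h⟩ := exists_sub_mem_span_xPlus hq0 X
  have h' : X - Y ∈ vacKer q μ := Submodule.span_mono Set.subset_union_right h
  suffices hs : ∃ X₀ ∈ zeroAlg q μ, Y - X₀ ∈ vacKer q μ by
    obtain ⟨X₀, h0, h1⟩ := hs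
    exact ⟨X₀, h0, by simpa using add_mem h' h1⟩
  refine Submodule.mul_induction_on hY (fun n hn h hh => ?_) fun a b ha hb => ?_
  · obtain ⟨c, hc⟩ := neg_decomp hn
    refine ⟨c • h, Subalgebra.smul_mem _ hh c, ?_⟩
    have : n * h - c • h = (n - algebraMap ℂ _ c) * h := by
      rw [sub_mul, Algebra.smul_def]
    rw [this]
    generalize n - algebraMap ℂ _ c = y at hc
    induction hc using Submodule.span_induction with
    | mem x hx =>
      obtain ⟨r, n', hn', rfl⟩ := hx
      exact Submodule.subset_span (Or.inl ⟨r, n', hn', h, hh, mul_assoc _ _ _⟩)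
    | zero => rw [zero_mul]; exact zero_mem _
    | add a b _ _ ha hb => rw [add_mul]; exact add_mem ha hb
    | smul c a _ ha => rw [smul_mul_assoc]; exact Submodule.smul_mem _ _ ha
  · obtain ⟨X₀, h0, h1⟩ := ha
    obtain ⟨X₁, h2, h3⟩ := hb
    exact ⟨X₀ + X₁, add_mem h0 h2, by rw [add_sub_add_comm]; exact add_mem h1 h3⟩

end Triangular

/-! ## The series `A^±(z)` up to normalization, in the shifted quantum affine algebra -/

section ASeries

variable (q : ℂ) (μ : ℤ)

/-- `φ̄⁺ A⁺(z)`, where `p` stands for the power sums of `Z`. -/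
def aSeries (p : ℤ → ℂ) : PowerSeries (ShiftedAlg q μ) :=
  expSeries (positiveSeries fun m => (-(q⁻¹ ^ m * invCartan q m)) •
    ((q - q⁻¹) • gen q μ (.h m) + algebraMap ℂ _ (p m / m)))

/-- `φ̄⁻ A⁻(z) / z'`, where `p` stands for the power sums of `Z`. -/
def bSeries (p : ℤ → ℂ) : PowerSeries (ShiftedAlg q μ) :=
  expSeries (positiveSeries fun m => (q ^ m * invCartan q m) •
    ((q - q⁻¹) • gen q μ (.h (-(m : ℤ))) - algebraMap ℂ _ (p (-(m : ℤ)) / m)))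

/-- `Ȳ⁺(z q⁻¹)` in terms of power sums. -/
def aScalar (p : ℤ → ℂ) : PowerSeries ℂ :=
  expSeries (positiveSeries fun m => -(q⁻¹ ^ m * invCartan q m) * (p m / m))

/-- `Ȳ⁻(z q⁻¹)` in terms of power sums. -/
def bScalar (p : ℤ → ℂ) : PowerSeries ℂ :=
  expSeries (positiveSeries fun m => -(q ^ m * invCartan q m) * (p (-(m : ℤ)) / m))

variable {q μ}

lemma coeff_expSeries_algebraMap_add {A : Type*} [Ring A] [Algebra ℂ A] (c : ℕ → ℂ) (d : ℕ → A)
    (hd : ∀ i j, 0 < i → 0 < j → Commute (d i) (d j)) :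
    expSeries (positiveSeries fun m => algebraMap ℂ A (c m) + d m) =
      PowerSeries.map (algebraMap ℂ A) (expSeries (positiveSeries c)) *
        expSeries (positiveSeries d) := by
  have h := map_expSeries (Algebra.ofId ℂ A) (positiveSeries c)
  rw [map_positiveSeries] at h
  rw [← positiveSeries_add, expSeries_add (by simp) (by simp)
    (commute_positiveSeries fun _ _ _ _ => Algebra.commutes _ _) (commute_positiveSeries hd)
    (commute_positiveSeries fun _ _ _ _ => Algebra.commutes _ _)]
  congr 1
  exact h.symm

lemma smul_smul_add_algebraMap {A : Type*} [Ring A] [Algebra ℂ A] (c k s : ℂ) (x : A) :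
    c • (k • x + algebraMap ℂ A s) = algebraMap ℂ A (c * s) + c • k • x := by
  rw [smul_add, map_mul, ← Algebra.smul_def, add_comm]

lemma smul_smul_sub_algebraMap {A : Type*} [Ring A] [Algebra ℂ A] (c k s : ℂ) (x : A) :
    c • (k • x - algebraMap ℂ A s) = algebraMap ℂ A (-c * s) + c • k • x := by
  rw [smul_sub, neg_mul, map_neg, map_mul, ← Algebra.smul_def]
  abel

lemma smul_algebraMap_add_neg_smul {A : Type*} [Ring A] [Algebra ℂ A] {c c' k k' s s' : ℂ} (x : A)
    (h1 : c * s = c' * s') (h2 : -(c * k) = c' * k') :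
    c • (algebraMap ℂ A s + -(k • x)) = c' • (k' • x + algebraMap ℂ A s') := by
  rw [smul_smul_add_algebraMap, smul_add, smul_neg, smul_smul, smul_smul, ← h1, ← h2, map_mul,
    ← Algebra.smul_def, neg_smul]

lemma smul_algebraMap_add_neg_smul_sub {A : Type*} [Ring A] [Algebra ℂ A] {c c' k k' s s' : ℂ}
    (x : A) (h1 : c * s = -c' * s') (h2 : -(c * k) = c' * k') :
    c • (algebraMap ℂ A s + -(k • x)) = c' • (k' • x - algebraMap ℂ A s') := by
  rw [smul_smul_sub_algebraMap, smul_add, smul_neg, smul_smul, smul_smul, ← h1, ← h2, map_mul,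
    ← Algebra.smul_def, neg_smul]

/-- The power sums `p` enter only through a central scalar series. When `Z` is deformed, the
elements of the algebra can therefore be kept fixed while scalars vary. -/
lemma coeff_aSeries (hqq : q - q⁻¹ ≠ 0) (p : ℤ → ℂ) (n : ℕ) :
    PowerSeries.coeff n (aSeries q μ p) = ∑ i ∈ Finset.HasAntidiagonal.antidiagonal n,
      PowerSeries.coeff i.1 (aScalar q p) • PowerSeries.coeff i.2 (aSeries q μ 0) := by
  have h : aSeries q μ p =
      PowerSeries.map (algebraMap ℂ _) (aScalar q p) * aSeries q μ 0 := by
    rw [aSeries, aScalar, aSeries, ← coeff_expSeries_algebraMap_add]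
    · congr 2
      ext m
      simp only [Pi.zero_apply, zero_div, map_zero, add_zero]
      exact smul_smul_add_algebraMap _ _ _ _
    · intro i j _ _
      simp only [Pi.zero_apply, zero_div, map_zero, add_zero]
      exact (((commute_h hqq _ _).smul_left _).smul_right _).smul_left _ |>.smul_right _
  rw [h, PowerSeries.coeff_mul]
  exact Finset.sum_congr rfl fun i _ => by rw [PowerSeries.coeff_map, Algebra.smul_def]

lemma coeff_bSeries (hqq : q - q⁻¹ ≠ 0) (p : ℤ → ℂ) (n : ℕ) :
    PowerSeries.coeff n (bSeries q μ p) = ∑ i ∈ Finset.HasAntidiagonal.antidiagonal n,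
      PowerSeries.coeff i.1 (bScalar q p) • PowerSeries.coeff i.2 (bSeries q μ 0) := by
  have h : bSeries q μ p =
      PowerSeries.map (algebraMap ℂ _) (bScalar q p) * bSeries q μ 0 := by
    rw [bSeries, bScalar, bSeries, ← coeff_expSeries_algebraMap_add]
    · congr 2
      ext m
      simp only [Pi.zero_apply, zero_div, map_zero, sub_zero]
      exact smul_smul_sub_algebraMap _ _ _ _
    · intro i j _ _
      simp only [Pi.zero_apply, zero_div, map_zero, sub_zero]
      exact (((commute_h hqq _ _).smul_left _).smul_right _).smul_left _ |>.smul_right _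
  rw [h, PowerSeries.coeff_mul]
  exact Finset.sum_congr rfl fun i _ => by rw [PowerSeries.coeff_map, Algebra.smul_def]

lemma commute_bSeries {x : ShiftedAlg q μ} (h : ∀ m, Commute x (gen q μ (.h m))) (p : ℤ → ℂ)
    (n : ℕ) : Commute x (PowerSeries.coeff n (bSeries q μ p)) := by
  refine commute_coeff_expSeries (fun i => ?_) n
  rw [coeff_positiveSeries]
  split_ifs
  · exact Commute.zero_right _
  · exact (((h _).smul_right _).sub_right (Algebra.commutes _ _).symm).smul_right _

/-- The exponential is `(1 - b z) / (1 - z) = 1 + (1 - b)(z + z² + ⋯)`; multiplying by `1 - z` gives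
a recursion for the coefficients. -/
lemma coeff_expSeries_one_sub (b : ℂ) (n : ℕ) :
    PowerSeries.coeff (n + 1) (expSeries (positiveSeries fun m => (1 - b ^ m) / (m : ℂ))) =
      1 - b := by
  have h : expSeries (positiveSeries fun m => (1 - b ^ m) / (m : ℂ)) *
      ((1 - C 1 * X : ℂ[X]) : PowerSeries ℂ) = ((1 - C b * X : ℂ[X]) : PowerSeries ℂ) := by
    rw [coe_one_sub_eq_expSeries, coe_one_sub_eq_expSeries, ← expSeries_positiveSeries_add]
    congr 2
    ext m
    rw [one_pow]
    ring
  have hs : ∀ n, PowerSeries.coeff (n + 1) (expSeries (positiveSeries fun m =>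
      (1 - b ^ m) / (m : ℂ))) = PowerSeries.coeff n (expSeries (positiveSeries fun m =>
      (1 - b ^ m) / (m : ℂ))) + if n = 0 then -b else 0 := fun n => by
    have := congrArg (PowerSeries.coeff (n + 1)) h
    simp [mul_sub, PowerSeries.coeff_succ_mul_X, PowerSeries.coeff_one,
      PowerSeries.coeff_C] at this
    rw [sub_eq_iff_eq_add] at this
    rw [this, add_comm]
    split_ifs <;> simp
  induction n with
  | zero => rw [hs, coeff_zero_expSeries, if_pos rfl]; ring
  | succ n ih => rw [hs, ih, if_neg n.succ_ne_zero, add_zero]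

lemma commutator_smul_add {A : Type*} [Ring A] [Algebra ℂ A] {c k s d t : ℂ} {x y z : A}
    (h : x * y = y * x + d • z) (hc : c * (k * d) = t) :
    c • (k • x + algebraMap ℂ A s) * y = y * (c • (k • x + algebraMap ℂ A s)) + t • z := by
  rw [smul_mul_assoc, mul_smul_comm, add_mul, mul_add, smul_mul_assoc, h, mul_smul_comm,
    Algebra.commutes, ← hc]
  module

/-- `A⁺(z) (1 - z/w) x⁻(w) = (1 - q⁻² z/w) x⁻(w) A⁺(z)`, up to normalization. -/
lemma aSeries_mul_xMinus (hq0 : q ≠ 0) (hq : ∀ n : ℕ, 0 < n → q ^ n ≠ 1) (p : ℤ → ℂ) (n : ℕ)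
    (r : ℤ) :
    PowerSeries.coeff (n + 1) (aSeries q μ p) * gen q μ (.xMinus r) =
      gen q μ (.xMinus r) * PowerSeries.coeff (n + 1) (aSeries q μ p) +
      (1 - (q⁻¹) ^ 2) • ∑ i ∈ Finset.range (n + 1), gen q μ (.xMinus (r + (n + 1) - i)) *
        PowerSeries.coeff i (aSeries q μ p) := by
  have hqq := q_sub_inv_ne_zero hq0 hq
  rw [aSeries, coeff_expSeries_mul (c := fun m => (1 - ((q⁻¹) ^ 2) ^ m) / (m : ℂ))
    (x := fun r => gen q μ (.xMinus r))]
  · rw [Finset.Nat.sum_antidiagonal_succ]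
    congr 1
    · simp
    · simp only [coeff_expSeries_one_sub, ← Finset.smul_sum]
      congr 1
      rw [← Finset.Nat.sum_antidiagonal_swap, Finset.Nat.sum_antidiagonal_eq_sum_range_succ_mk]
      refine Finset.sum_congr rfl fun i hi => ?_
      have hi' : i ≤ n := by simpa [Nat.lt_succ_iff] using hi
      simp only [Prod.fst_swap, Prod.snd_swap]
      congr 3
      push_cast [Nat.cast_sub hi']
      ring
  · intro i j _ _
    exact ((((commute_h hqq _ _).smul_left _).add_left (Algebra.commutes _ _)).smul_left _
      |>.smul_right _ |>.add_right
      (Algebra.commutes _ _).symm).smul_right _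
  · intro m hm r
    have hm' : ((m : ℕ) : ℤ) ≠ 0 := by exact_mod_cast hm.ne'
    have hmc : (m : ℂ) ≠ 0 := by exact_mod_cast hm.ne'
    have h := h_mul_xMinus (q := q) (μ := μ) hm' r
    rw [add_comm (m : ℤ) r] at h
    -- As `(q - q⁻¹) [2m]_q = (q^m - q^{-m})(q^m + q^{-m})`, the Cartan factor cancels and
    -- `q^{-m}(q^m - q^{-m}) = 1 - q^{-2m}` remains.
    have hc : -(q⁻¹ ^ m * invCartan q m) * ((q - q⁻¹) * -(qInt q (2 * (m : ℤ)) / ((m : ℤ) : ℂ))) =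
        (1 - ((q⁻¹) ^ 2) ^ m) / (m : ℂ) := by
      have h1 := q_add_inv_ne_zero hq0 hq hm
      have h2 : q ^ m ≠ 0 := pow_ne_zero _ hq0
      have h3 : q ^ (2 * (m : ℤ)) = (q ^ m) ^ 2 := by
        rw [mul_comm, zpow_mul, zpow_natCast]; rfl
      have h4 : ((q⁻¹) ^ 2) ^ m = ((q ^ m) ^ 2)⁻¹ := by
        rw [← pow_mul, inv_pow, mul_comm, pow_mul]
      rw [qInt, invCartan, zpow_neg, h3, h4, inv_pow]
      generalize q ^ m = t at *
      generalize q - q⁻¹ = k at *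
      push_cast
      have h5 : t ^ 2 + 1 ≠ 0 := fun h => h1 (by field_simp; linear_combination h)
      field_simp
      ring
    exact commutator_smul_add h hc

/-- If the coefficients of `A⁺(z)` beyond the degree `a` vanish, then `x⁻(z) A⁺(z) = 0`. -/
lemma sum_xMinus_mul_aSeries {V : Type*} [AddCommGroup V] [Module ℂ V] [Module (ShiftedAlg q μ) V]
    [IsScalarTower ℂ (ShiftedAlg q μ) V] (hq0 : q ≠ 0) (hq : ∀ n : ℕ, 0 < n → q ^ n ≠ 1)
    {p : ℤ → ℂ} {a : ℕ}
    (h : ∀ w : V, PowerSeries.coeff (a + 1) (aSeries q μ p) • w = 0) (s : ℤ) (v : V) :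
    ∑ i ∈ Finset.range (a + 1),
      gen q μ (.xMinus (s - i)) • PowerSeries.coeff i (aSeries q μ p) • v = 0 := by
  -- The shift of the mode by `a + 1` makes the surviving sum run over `x⁻_{s-i}`; both terms with
  -- the coefficient of degree `a + 1` vanish, and `1 - q⁻²` is invertible.
  have e := congrArg (fun y => y • v) (aSeries_mul_xMinus hq0 hq p (μ := μ) a (s - (a + 1)))
  simp only [mul_smul, add_smul, h, smul_zero, zero_add] at e
  rw [smul_assoc, Finset.sum_smul] at e
  have h1 : (1 - (q⁻¹) ^ 2 : ℂ) ≠ 0 := by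
    rw [sub_ne_zero, inv_pow]
    exact fun h => hq 2 two_pos (by rw [← inv_inv (q ^ 2), ← h, inv_one])
  have e2 := (smul_eq_zero.1 e.symm).resolve_left h1
  rw [← e2]
  refine Finset.sum_congr rfl fun i _ => ?_
  rw [mul_smul, sub_add_cancel]

end ASeries

/-! ## The series `A^±(z)` in the adjoint version -/

section AdSeries

variable {q : ℂ} {μ : ℤ}

lemma toAd_gen (g : Gen) : toAd q μ (gen q μ g) = adGen q μ (.base g) := by
  refine (RingQuot.liftAlgHom_mkAlgHom_apply ℂ _ _ _).trans ?_
  simp [AdGen.incl, adGen]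

lemma commute_adGen_h (hqq : q - q⁻¹ ≠ 0) (r m : ℤ) :
    Commute (adGen q μ (.base (.h r))) (adGen q μ (.base (.h m))) := by
  rw [← toAd_gen, ← toAd_gen]
  exact (commute_h hqq r m).map (toAd q μ)

lemma invOfUnit_eq {A : Type*} [Ring A] {F G : PowerSeries A} {x : Aˣ}
    (hx : PowerSeries.constantCoeff F = x) (h : F * G = 1) : PowerSeries.invOfUnit F x = G := by
  have h1 := PowerSeries.invOfUnit_mul F x hx
  calc PowerSeries.invOfUnit F x = PowerSeries.invOfUnit F x * (F * G) := by rw [h, mul_one]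
  _ = G := by rw [← mul_assoc, h1, one_mul]

lemma scaleArg_C {A : Type*} [Ring A] [Algebra ℂ A] (c : ℂ) (x : A) :
    scaleArg c (PowerSeries.C x) = PowerSeries.C x := by
  ext m
  rw [coeff_scaleArg]
  rcases m with _ | m <;> simp [PowerSeries.coeff_C]

/-- Since `Y⁺ = φ̄⁺ exp E`, its inverse is `exp (-E) (φ̄⁺)⁻¹`, with `(φ̄⁺)⁻¹` on the right. All of
`A⁺(z)` except this invertible factor comes from the shifted algebra. -/
lemma coeff_APlus (hqq : q - q⁻¹ ≠ 0) {N : ℕ} (zs : Fin N → ℂˣ) (n : ℕ) :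
    PowerSeries.coeff n (APlus q μ zs) =
      toAd q μ (PowerSeries.coeff n (aSeries q μ (powerSum (Zrat q zs)))) *
        adGen q μ .barPlusInv := by
  have hc : ∀ i j : ℕ, 0 < i → 0 < j →
      Commute (((q - q⁻¹) * invCartan q i) • adGen q μ (.base (.h i)))
        (((q - q⁻¹) * invCartan q j) • adGen q μ (.base (.h j))) := fun i j _ _ =>
    ((commute_adGen_h hqq _ _).smul_left _).smul_right _
  set E := positiveSeries fun m : ℕ => ((q - q⁻¹) * invCartan q m) • adGen q μ (.base (.h m)) with hE
  have hinv : PowerSeries.invOfUnit (YPlus q μ) (barPlusUnit q μ) =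
      expSeries (-E) * PowerSeries.C (adGen q μ .barPlusInv) := by
    apply invOfUnit_eq
    · rw [← PowerSeries.coeff_zero_eq_constantCoeff_apply, YPlus, PowerSeries.coeff_C_mul,
        coeff_zero_expSeries, mul_one]
      rfl
    · rw [YPlus, mul_assoc, ← mul_assoc (expSeries _), ← hE,
        expSeries_mul_neg (by simp) (commute_positiveSeries hc), one_mul, ← map_mul]
      have := (barPlusUnit q μ).mul_inv
      change adGen q μ .barPlus * adGen q μ .barPlusInv = 1 at this
      rw [this, map_one]
  rw [APlus, hinv, ← mul_assoc, scaleArg_mul, scaleArg_C, PowerSeries.coeff_mul_C, YbarPlus, hE,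
    positiveSeries_neg, ← coeff_expSeries_algebraMap_add, scaleArg_expSeries,
    scaleArg_positiveSeries, aSeries, coeff_expSeries_map]
  · congr 4
    ext m
    rw [map_smul, map_add, map_smul, toAd_gen, AlgHom.commutes]
    exact smul_algebraMap_add_neg_smul _ (by ring) (by ring)
  · intro i j hi hj
    exact (hc i j hi hj).neg_left.neg_right

lemma coeff_AMinus (hqq : q - q⁻¹ ≠ 0) {N : ℕ} (zs : Fin N → ℂˣ) (z' : ℂˣ) (n : ℕ) :
    PowerSeries.coeff n (AMinus q μ zs z') = (z' : ℂ) •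
      (toAd q μ (PowerSeries.coeff n (bSeries q μ (powerSum (Zrat q zs)))) *
        adGen q μ .barMinusInv) := by
  have hc : ∀ i j : ℕ, 0 < i → 0 < j →
      Commute ((-((q - q⁻¹) * invCartan q i)) • adGen q μ (.base (.h (-(i : ℤ)))))
        ((-((q - q⁻¹) * invCartan q j)) • adGen q μ (.base (.h (-(j : ℤ))))) := fun i j _ _ =>
    ((commute_adGen_h hqq _ _).smul_left _).smul_right _
  set E := positiveSeries fun m : ℕ =>
    (-((q - q⁻¹) * invCartan q m)) • adGen q μ (.base (.h (-(m : ℤ)))) with hE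
  have hinv : PowerSeries.invOfUnit (YMinus q μ) (barMinusUnit q μ) =
      expSeries (-E) * PowerSeries.C (adGen q μ .barMinusInv) := by
    apply invOfUnit_eq
    · rw [← PowerSeries.coeff_zero_eq_constantCoeff_apply, YMinus, PowerSeries.coeff_C_mul,
        coeff_zero_expSeries, mul_one]
      rfl
    · rw [YMinus, mul_assoc, ← mul_assoc (expSeries _), ← hE,
        expSeries_mul_neg (by simp) (commute_positiveSeries hc), one_mul, ← map_mul]
      have := (barMinusUnit q μ).mul_inv
      change adGen q μ .barMinus * adGen q μ .barMinusInv = 1 at this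
      rw [this, map_one]
  rw [AMinus, PowerSeries.coeff_smul, hinv, ← mul_assoc, scaleArg_mul, scaleArg_C,
    PowerSeries.coeff_mul_C, YbarMinus, hE,
    positiveSeries_neg, ← coeff_expSeries_algebraMap_add, scaleArg_expSeries,
    scaleArg_positiveSeries, bSeries, coeff_expSeries_map]
  · congr 5
    ext m
    rw [map_smul, map_sub, map_smul, toAd_gen, AlgHom.commutes]
    exact smul_algebraMap_add_neg_smul_sub _ (by ring) (by ring)
  · intro i j hi hj
    exact (hc i j hi hj).neg_left.neg_right

end AdSeries

/-! ## Vacuum functionals -/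

section Vacuum

variable {q : ℂ} {μ : ℤ}

/-- The functional `X ↦ ⟨v^*, X v⟩` of a highest `ℓ`-weight vector `v`, on which `φ⁺_m` acts
by `f m` and `φ⁻_m` by `g m`. -/
structure IsVacuum (χ : ShiftedAlg q μ →ₗ[ℂ] ℂ) (f g : ℤ → ℂ) : Prop where
  one : χ 1 = 1
  xPlus : ∀ Y r, χ (Y * gen q μ (.xPlus r)) = 0
  xMinus : ∀ r, ∀ n ∈ negAlg q μ, χ (gen q μ (.xMinus r) * n) = 0
  phiPlus : ∀ Y m, χ (Y * gen q μ (.phiPlus m)) = f m * χ Y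
  phiMinus : ∀ Y m, χ (Y * gen q μ (.phiMinus m)) = g m * χ Y

lemma IsVacuum.f_zero_ne {χ : ShiftedAlg q μ →ₗ[ℂ] ℂ} {f g : ℤ → ℂ} (h : IsVacuum χ f g) :
    f 0 ≠ 0 := fun h0 => by
  have := h.phiPlus (gen q μ .phiPlusInv) 0
  rw [phiPlus_inv_mul, h.one, h0, zero_mul] at this
  exact one_ne_zero this

lemma IsVacuum.g_mu_ne {χ : ShiftedAlg q μ →ₗ[ℂ] ℂ} {f g : ℤ → ℂ} (h : IsVacuum χ f g) :
    g μ ≠ 0 := fun h0 => by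
  have := h.phiMinus (gen q μ .phiMinusInv) μ
  rw [phiMinus_inv_mul, h.one, h0, zero_mul] at this
  exact one_ne_zero this

open Filter Topology in
/-- Vacuum functionals depend continuously on the highest `ℓ`-weight. -/
lemma IsVacuum.exists_tendsto (hq0 : q ≠ 0) (hqq : q - q⁻¹ ≠ 0) {T : Type*} {l : Filter T}
    {χ : T → ShiftedAlg q μ →ₗ[ℂ] ℂ} {f g : T → ℤ → ℂ} {f₀ g₀ : ℤ → ℂ}
    (h : ∀ t, IsVacuum (χ t) (f t) (g t)) (hf : ∀ m, Tendsto (fun t => f t m) l (𝓝 (f₀ m)))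
    (hg : ∀ m, Tendsto (fun t => g t m) l (𝓝 (g₀ m))) (hf0 : f₀ 0 ≠ 0) (hg0 : g₀ μ ≠ 0)
    (X : ShiftedAlg q μ) : ∃ L, Tendsto (fun t => χ t X) l (𝓝 L) := by
  -- Elements that act on the vacuum by a convergent scalar. Being a subalgebra, `B` contains the
  -- Cartan part as soon as it contains the `φ^±_m` and the inverses; the limits of `f 0` and `g μ`
  -- must be non-zero for the latter.
  let B : Subalgebra ℂ (ShiftedAlg q μ) :=
    { carrier := {y | ∃ F : T → ℂ, (∃ L, Tendsto F l (𝓝 L)) ∧ ∀ t Y, χ t (Y * y) = F t * χ t Y}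
      mul_mem' := by
        rintro a b ⟨F, ⟨L, hL⟩, hF⟩ ⟨G, ⟨M, hM⟩, hG⟩
        refine ⟨fun t => F t * G t, ⟨L * M, hL.mul hM⟩, fun t Y => ?_⟩
        rw [← mul_assoc, hG, hF]
        ring
      add_mem' := by
        rintro a b ⟨F, ⟨L, hL⟩, hF⟩ ⟨G, ⟨M, hM⟩, hG⟩
        refine ⟨fun t => F t + G t, ⟨L + M, hL.add hM⟩, fun t Y => ?_⟩
        rw [mul_add, map_add, hG, hF]
        ring
      algebraMap_mem' := fun c => ⟨fun _ => c, ⟨c, tendsto_const_nhds⟩, fun t Y => by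
        rw [← Algebra.commutes, ← Algebra.smul_def, map_smul, smul_eq_mul]⟩ }
  have h1 : ∀ m, gen q μ (.phiPlus m) ∈ B := fun m => ⟨_, ⟨_, hf m⟩, fun t Y => (h t).phiPlus Y m⟩
  have h2 : ∀ m, gen q μ (.phiMinus m) ∈ B := fun m =>
    ⟨_, ⟨_, hg m⟩, fun t Y => (h t).phiMinus Y m⟩
  have h3 : gen q μ .phiPlusInv ∈ B := ⟨_, ⟨_, (hf 0).inv₀ hf0⟩, fun t Y => by
    have := (h t).phiPlus (Y * gen q μ .phiPlusInv) 0
    rw [mul_assoc, phiPlus_inv_mul, mul_one] at this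
    rw [this, inv_mul_cancel_left₀ (h t).f_zero_ne]⟩
  have h4 : gen q μ .phiMinusInv ∈ B := ⟨_, ⟨_, (hg μ).inv₀ hg0⟩, fun t Y => by
    have := (h t).phiMinus (Y * gen q μ .phiMinusInv) μ
    rw [mul_assoc, phiMinus_inv_mul, mul_one] at this
    rw [this, inv_mul_cancel_left₀ (h t).g_mu_ne]⟩
  have hB : zeroAlg q μ ≤ B := by
    refine Algebra.adjoin_le ?_
    rintro _ ⟨g, hg, rfl⟩
    cases hg with
    | h m => exact h_mem_of_phi_mem hqq B h1 h2 h3 h4 m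
    | phiPlus => exact h1 0
    | phiMinus => exact h2 μ
    | phiPlusInv => exact h3
    | phiMinusInv => exact h4
  have hker : ∀ y ∈ vacKer q μ, ∀ t, χ t y = 0 := fun y hy t => by
    induction hy using Submodule.span_induction with
    | mem x hx =>
      rcases hx with ⟨r, n, hn, z, hz, rfl⟩ | ⟨r, Y, rfl⟩
      · obtain ⟨F, -, hF⟩ := hB hz
        rw [← mul_assoc, hF, (h t).xMinus r n hn, mul_zero]
      · exact (h t).xPlus Y r
    | zero => exact map_zero _
    | add a b _ _ ha hb => rw [map_add, ha, hb, add_zero]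
    | smul c a _ ha => rw [map_smul, ha, smul_zero]
  -- The Cartan representative is chosen once, independently of `t`, and `χ t X` is the scalar by
  -- which it acts.
  obtain ⟨X₀, hX₀, hX⟩ := exists_sub_mem_vacKer hq0 X
  obtain ⟨F, ⟨L, hL⟩, hF⟩ := hB hX₀
  refine ⟨L, hL.congr fun t => ?_⟩
  have e1 := hker _ hX t
  have e2 := hF t 1
  rw [one_mul, (h t).one, mul_one] at e2
  rw [map_sub, e2, sub_eq_zero] at e1
  exact e1.symm

/-- The vacuum functional is determined by the highest `ℓ`-weight. -/
lemma IsVacuum.unique (hq0 : q ≠ 0) (hqq : q - q⁻¹ ≠ 0) {χ χ' : ShiftedAlg q μ →ₗ[ℂ] ℂ}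
    {f g : ℤ → ℂ} (h : IsVacuum χ f g) (h' : IsVacuum χ' f g) : χ = χ' := by
  ext X
  -- Uniqueness is continuity along the coarsest filter on two points: a limit along `⊤` forces both
  -- values to equal `L`.
  obtain ⟨L, hL⟩ := IsVacuum.exists_tendsto (l := (⊤ : Filter Bool)) hq0 hqq
    (χ := fun b => if b then χ else χ') (f := fun _ => f) (g := fun _ => g)
    (fun t => by cases t <;> simpa) (fun m => tendsto_const_nhds) (fun m => tendsto_const_nhds)
    h.f_zero_ne h.g_mu_ne X
  have key : ∀ b : Bool, (if b then χ else χ') X = L := fun b =>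
    tendsto_nhds_unique (tendsto_pure_nhds (fun b : Bool => (if b then χ else χ') X) b)
      (hL.mono_left le_top)
  exact (key true).trans (key false).symm

open Filter Topology in
/-- The limit of vacuum functionals. -/
lemma IsVacuum.exists_limit (hq0 : q ≠ 0) (hqq : q - q⁻¹ ≠ 0) {T : Type*} {l : Filter T} [l.NeBot]
    {χ : T → ShiftedAlg q μ →ₗ[ℂ] ℂ} {f g : T → ℤ → ℂ} {f₀ g₀ : ℤ → ℂ}
    (h : ∀ t, IsVacuum (χ t) (f t) (g t)) (hf : ∀ m, Tendsto (fun t => f t m) l (𝓝 (f₀ m)))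
    (hg : ∀ m, Tendsto (fun t => g t m) l (𝓝 (g₀ m))) (hf0 : f₀ 0 ≠ 0) (hg0 : g₀ μ ≠ 0) :
    ∃ χ₀ : ShiftedAlg q μ →ₗ[ℂ] ℂ, IsVacuum χ₀ f₀ g₀ ∧
      ∀ X, Tendsto (fun t => χ t X) l (𝓝 (χ₀ X)) := by
  choose L hL using IsVacuum.exists_tendsto hq0 hqq h hf hg hf0 hg0
  let χ₀ : ShiftedAlg q μ →ₗ[ℂ] ℂ :=
    { toFun := L
      map_add' := fun X Y => tendsto_nhds_unique (hL (X + Y))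
        (((hL X).add (hL Y)).congr fun t => (map_add (χ t) X Y).symm)
      map_smul' := fun c X => tendsto_nhds_unique (hL (c • X))
        (((hL X).const_mul c).congr fun t => (map_smul (χ t) c X).symm) }
  have h0 : ∀ X, Tendsto (fun t => χ t X) l (𝓝 (χ₀ X)) := hL
  -- Every axiom of a vacuum functional is an equation between convergent quantities, so it passes
  -- to the limit.
  refine ⟨χ₀, ⟨?_, fun Y r => ?_, fun r n hn => ?_, fun Y m => ?_, fun Y m => ?_⟩, h0⟩
  · exact tendsto_nhds_unique (h0 1) (tendsto_const_nhds.congr fun t => ((h t).one).symm)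
  · exact tendsto_nhds_unique (h0 _) (tendsto_const_nhds.congr fun t => ((h t).xPlus Y r).symm)
  · exact tendsto_nhds_unique (h0 _) (tendsto_const_nhds.congr fun t => ((h t).xMinus r n hn).symm)
  · exact tendsto_nhds_unique (h0 _)
      (((hf m).mul (h0 Y)).congr fun t => ((h t).phiPlus Y m).symm)
  · exact tendsto_nhds_unique (h0 _)
      (((hg m).mul (h0 Y)).congr fun t => ((h t).phiMinus Y m).symm)

end Vacuum

/-! ## Highest weight modules -/

section HighestWeight

variable {q : ℂ} {μ : ℤ} {V : Type*} [AddCommGroup V] [Module ℂ V] [Module (ShiftedAlg q μ) V]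
  [IsScalarTower ℂ (ShiftedAlg q μ) V]

variable (q μ) in
/-- A highest `ℓ`-weight vector, with the eigenvalues of `φ⁺_m` and `φ⁻_m`. -/
structure IsHighestVec (v : V) (f g : ℤ → ℂ) : Prop where
  ne_zero : v ≠ 0
  xPlus : ∀ m, gen q μ (.xPlus m) • v = 0
  phiPlus : ∀ m, gen q μ (.phiPlus m) • v = f m • v
  phiMinus : ∀ m, gen q μ (.phiMinus m) • v = g m • v

lemma smul_smul_comm' (c : ℂ) (X : ShiftedAlg q μ) (v : V) : X • c • v = c • X • v := by
  rw [← algebraMap_smul (ShiftedAlg q μ) c v, ← mul_smul, ← Algebra.commutes, mul_smul,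
    algebraMap_smul]

variable (q μ V) in
/-- The elements that act on `v` by a scalar. -/
def lineStabilizer (v : V) : Subalgebra ℂ (ShiftedAlg q μ) where
  carrier := {y | ∃ c : ℂ, y • v = c • v}
  mul_mem' := by
    rintro a b ⟨c, hc⟩ ⟨d, hd⟩
    exact ⟨d * c, by rw [mul_smul, hd, smul_smul_comm', hc, smul_smul]⟩
  add_mem' := by
    rintro a b ⟨c, hc⟩ ⟨d, hd⟩
    exact ⟨c + d, by rw [add_smul, hc, hd, add_smul]⟩
  algebraMap_mem' := fun c => ⟨c, by rw [algebraMap_smul]⟩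

variable {v : V} {f g : ℤ → ℂ}

lemma IsHighestVec.f_zero_ne (h : IsHighestVec q μ v f g) : f 0 ≠ 0 := fun h0 => by
  apply h.ne_zero
  rw [← one_smul (ShiftedAlg q μ) v, ← phiPlus_inv_mul, mul_smul, h.phiPlus, h0, zero_smul,
    smul_zero]

lemma IsHighestVec.g_mu_ne (h : IsHighestVec q μ v f g) : g μ ≠ 0 := fun h0 => by
  apply h.ne_zero
  rw [← one_smul (ShiftedAlg q μ) v, ← phiMinus_inv_mul, mul_smul, h.phiMinus, h0, zero_smul,
    smul_zero]

lemma IsHighestVec.f_neg (h : IsHighestVec q μ v f g) {m : ℤ} (hm : m < 0) : f m = 0 := by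
  have := h.phiPlus m
  rw [gen_phiPlus_neg hm, zero_smul] at this
  exact (smul_eq_zero.1 this.symm).resolve_right h.ne_zero

lemma IsHighestVec.g_big (h : IsHighestVec q μ v f g) {m : ℤ} (hm : μ < m) : g m = 0 := by
  have := h.phiMinus m
  rw [gen_phiMinus_big hm, zero_smul] at this
  exact (smul_eq_zero.1 this.symm).resolve_right h.ne_zero

lemma inv_smul_of_smul {s t : ShiftedAlg q μ} (hts : t * s = 1) {c : ℂ} (hc : c ≠ 0)
    (h : s • v = c • v) : t • v = c⁻¹ • v := by
  have : v = c • t • v := by rw [← smul_smul_comm', ← h, ← mul_smul, hts, one_smul]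
  rw [eq_inv_smul_iff₀ hc, ← this]

lemma IsHighestVec.cartan_le (hqq : q - q⁻¹ ≠ 0) (h : IsHighestVec q μ v f g) :
    zeroAlg q μ ≤ lineStabilizer q μ V v := by
  have h1 : ∀ m, gen q μ (.phiPlus m) ∈ lineStabilizer q μ V v := fun m => ⟨_, h.phiPlus m⟩
  have h2 : ∀ m, gen q μ (.phiMinus m) ∈ lineStabilizer q μ V v := fun m => ⟨_, h.phiMinus m⟩
  have h3 : gen q μ .phiPlusInv ∈ lineStabilizer q μ V v :=
    ⟨_, inv_smul_of_smul phiPlus_inv_mul h.f_zero_ne (h.phiPlus 0)⟩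
  have h4 : gen q μ .phiMinusInv ∈ lineStabilizer q μ V v :=
    ⟨_, inv_smul_of_smul phiMinus_inv_mul h.g_mu_ne (h.phiMinus μ)⟩
  refine Algebra.adjoin_le ?_
  rintro _ ⟨g, hg, rfl⟩
  cases hg with
  | h m => exact h_mem_of_phi_mem hqq _ h1 h2 h3 h4 m
  | phiPlus => exact h1 0
  | phiMinus => exact h2 μ
  | phiPlusInv => exact h3
  | phiMinusInv => exact h4

/-- A highest weight module is generated by the negative subalgebra. -/
lemma IsHighestVec.exists_neg (hq0 : q ≠ 0) (hqq : q - q⁻¹ ≠ 0) (h : IsHighestVec q μ v f g)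
    (X : ShiftedAlg q μ) : ∃ n ∈ negAlg q μ, X • v = n • v := by
  obtain ⟨Y, hY, hX⟩ := exists_sub_mem_span_xPlus hq0 X
  have h1 : (X - Y) • v = 0 := by
    generalize X - Y = y at hX
    induction hX using Submodule.span_induction with
    | mem x hx => obtain ⟨r, Y, rfl⟩ := hx; rw [mul_smul, h.xPlus, smul_zero]
    | zero => exact zero_smul _ _
    | add a b _ _ ha hb => rw [add_smul, ha, hb, add_zero]
    | smul c a _ ha => rw [smul_assoc, ha, smul_zero]
  rw [sub_smul, sub_eq_zero] at h1
  rw [h1]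
  refine Submodule.mul_induction_on hY (fun n hn z hz => ?_) fun a b ha hb => ?_
  · obtain ⟨c, hc⟩ := h.cartan_le hqq hz
    exact ⟨c • n, Subalgebra.smul_mem _ hn c, by rw [mul_smul, hc, smul_smul_comm', smul_assoc]⟩
  · obtain ⟨n, hn, e⟩ := ha
    obtain ⟨n', hn', e'⟩ := hb
    exact ⟨n + n', add_mem hn hn', by rw [add_smul, e, e', add_smul]⟩

variable (q μ V) in
/-- The sum of the eigenspaces of `φ⁺_0` of eigenvalues `w q^{-2k}`, `k ≥ j`. -/
def lowerSum (w : ℂ) (j : ℕ) : Submodule ℂ V :=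
  Submodule.span ℂ {x | ∃ k : ℕ, j ≤ k ∧ gen q μ (.phiPlus 0) • x = (w * q ^ (-2 * (k : ℤ))) • x}

lemma lowerSum_mono (w : ℂ) {i j : ℕ} (h : i ≤ j) : lowerSum q μ V w j ≤ lowerSum q μ V w i :=
  Submodule.span_mono fun _ ⟨k, hk, e⟩ => ⟨k, h.trans hk, e⟩

lemma phiPlus_smul_xMinus_smul (hq0 : q ≠ 0) {w : ℂ} {k : ℤ} {x : V}
    (h : gen q μ (.phiPlus 0) • x = (w * q ^ (-2 * k)) • x) (r : ℤ) :
    gen q μ (.phiPlus 0) • gen q μ (.xMinus r) • x =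
      (w * q ^ (-2 * (k + 1))) • gen q μ (.xMinus r) • x := by
  rw [← mul_smul, phiPlus_mul_xMinus, smul_assoc, mul_smul, h, smul_smul_comm', smul_smul,
    mul_left_comm, ← zpow_add₀ hq0]
  congr 3
  ring

lemma phiPlus_smul_xPlus_smul (hq0 : q ≠ 0) {w : ℂ} {k : ℤ} {x : V}
    (h : gen q μ (.phiPlus 0) • x = (w * q ^ (-2 * k)) • x) (r : ℤ) :
    gen q μ (.phiPlus 0) • gen q μ (.xPlus r) • x =
      (w * q ^ (-2 * (k - 1))) • gen q μ (.xPlus r) • x := by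
  rw [← mul_smul, phiPlus_mul_xPlus, smul_assoc, mul_smul, h, smul_smul_comm', smul_smul,
    mul_left_comm, ← zpow_add₀ hq0]
  congr 3
  ring

lemma xMinus_smul_mem_lowerSum (hq0 : q ≠ 0) {w : ℂ} {j : ℕ} {x : V}
    (h : x ∈ lowerSum q μ V w j) (r : ℤ) :
    gen q μ (.xMinus r) • x ∈ lowerSum q μ V w (j + 1) := by
  induction h using Submodule.span_induction with
  | mem x hx =>
    obtain ⟨k, hk, e⟩ := hx
    exact Submodule.subset_span ⟨k + 1, by omega, by
      push_cast; exact phiPlus_smul_xMinus_smul hq0 e r⟩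
  | zero => rw [smul_zero]; exact zero_mem _
  | add a b _ _ ha hb => rw [smul_add]; exact add_mem ha hb
  | smul c a _ ha => rw [smul_smul_comm']; exact Submodule.smul_mem _ _ ha

lemma neg_smul_mem_lowerSum (hq0 : q ≠ 0) {w : ℂ} {j : ℕ} {n : ShiftedAlg q μ}
    (hn : n ∈ negAlg q μ) : ∀ x ∈ lowerSum q μ V w j, n • x ∈ lowerSum q μ V w j := by
  induction hn using Algebra.adjoin_induction with
  | mem s hs =>
    obtain ⟨r, rfl⟩ := hs
    exact fun x hx => lowerSum_mono w (Nat.le_succ j) (xMinus_smul_mem_lowerSum hq0 hx r)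
  | algebraMap c => intro x hx; rw [algebraMap_smul]; exact Submodule.smul_mem _ _ hx
  | add a b _ _ ha hb => intro x hx; rw [add_smul]; exact add_mem (ha x hx) (hb x hx)
  | mul a b _ _ ha hb => intro x hx; rw [mul_smul]; exact ha _ (hb x hx)

lemma IsHighestVec.mem_lowerSum (h : IsHighestVec q μ v f g) : v ∈ lowerSum q μ V (f 0) 0 :=
  Submodule.subset_span ⟨0, le_rfl, by simpa using h.phiPlus 0⟩

variable (q μ V) in
/-- Vectors killed by a polynomial in `φ⁺_0` that does not vanish at `w`. -/
def torsionAway (w : ℂ) : Submodule ℂ V where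
  carrier := {x | ∃ p : ℂ[X], p.eval w ≠ 0 ∧ aeval (gen q μ (.phiPlus 0)) p • x = 0}
  zero_mem' := ⟨1, by simp, smul_zero _⟩
  add_mem' := by
    rintro a b ⟨p, hp, ha⟩ ⟨r, hr, hb⟩
    refine ⟨p * r, by rw [eval_mul]; exact mul_ne_zero hp hr, ?_⟩
    rw [smul_add, map_mul, mul_smul _ _ b, hb, smul_zero, add_zero, ← map_mul, mul_comm, map_mul,
      mul_smul, ha, smul_zero]
  smul_mem' := by
    rintro c x ⟨p, hp, hx⟩
    exact ⟨p, hp, by rw [smul_smul_comm', hx, smul_zero]⟩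

lemma aeval_smul_of_smul {w : ℂ} {x : V} (h : gen q μ (.phiPlus 0) • x = w • x) (p : ℂ[X]) :
    aeval (gen q μ (.phiPlus 0)) p • x = p.eval w • x := by
  induction p using Polynomial.induction_on with
  | C a => rw [aeval_C, algebraMap_smul, eval_C]
  | add p r hp hr => rw [map_add, add_smul, hp, hr, eval_add, add_smul]
  | monomial n a hn =>
    have e : (C a * X ^ (n + 1) : ℂ[X]) = X * (C a * X ^ n) := by ring
    rw [e, map_mul, mul_smul, hn, smul_smul_comm', aeval_X, h, smul_smul,
      mul_comm _ w, eval_mul (p := X), eval_X]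

/-- For `k ≥ 1`, the eigenvalue `w q^{-2k}` differs from `w`, so `X - w q^{-2k}` is an admissible
polynomial. This separates the highest weight line from the lower weights. -/
lemma lowerSum_le_torsionAway (hq : ∀ n : ℕ, 0 < n → q ^ n ≠ 1) {w : ℂ}
    (hw : w ≠ 0) : lowerSum q μ V w 1 ≤ torsionAway q μ V w := by
  refine Submodule.span_le.2 ?_
  rintro x ⟨k, hk, e⟩
  refine ⟨X - C (w * q ^ (-2 * (k : ℤ))), ?_, ?_⟩
  · rw [eval_sub, eval_X, eval_C]
    intro h0
    have : q ^ (-2 * (k : ℤ)) = 1 := by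
      apply mul_left_cancel₀ hw
      linear_combination -h0
    exact q_zpow_ne_one hq (by omega) this
  · rw [aeval_smul_of_smul e]
    simp

lemma not_mem_torsionAway {w : ℂ} {x : V} (hx : x ≠ 0)
    (h : gen q μ (.phiPlus 0) • x = w • x) : x ∉ torsionAway q μ V w := by
  rintro ⟨p, hp, e⟩
  rw [aeval_smul_of_smul h, smul_eq_zero] at e
  exact e.elim hp hx

/-- A highest weight module is the sum of the line of `v` and of the lower weight spaces. -/
lemma IsHighestVec.exists_sub_mem_lowerSum (hq0 : q ≠ 0) (hqq : q - q⁻¹ ≠ 0)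
    (h : IsHighestVec q μ v f g) (X : ShiftedAlg q μ) :
    ∃ c : ℂ, X • v - c • v ∈ lowerSum q μ V (f 0) 1 := by
  obtain ⟨n, hn, e⟩ := h.exists_neg hq0 hqq X
  obtain ⟨c, hc⟩ := neg_decomp hn
  refine ⟨c, ?_⟩
  rw [e, ← algebraMap_smul (ShiftedAlg q μ) c v, ← sub_smul]
  generalize n - algebraMap ℂ _ c = y at hc
  induction hc using Submodule.span_induction with
  | mem x hx =>
    obtain ⟨r, n', hn', rfl⟩ := hx
    rw [mul_smul]
    exact xMinus_smul_mem_lowerSum hq0 (neg_smul_mem_lowerSum hq0 hn' _ h.mem_lowerSum) r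
  | zero => rw [zero_smul]; exact zero_mem _
  | add a b _ _ ha hb => rw [add_smul]; exact add_mem ha hb
  | smul c a _ ha => rw [smul_assoc]; exact Submodule.smul_mem _ _ ha

/-- The highest weight space is a line. -/
lemma IsHighestVec.eq_smul (hq0 : q ≠ 0) (hq : ∀ n : ℕ, 0 < n → q ^ n ≠ 1)
    (h : IsHighestVec q μ v f g) {X : ShiftedAlg q μ}
    (hX : gen q μ (.phiPlus 0) • X • v = f 0 • X • v) : ∃ c : ℂ, X • v = c • v := by
  obtain ⟨c, hc⟩ := h.exists_sub_mem_lowerSum hq0 (q_sub_inv_ne_zero hq0 hq) X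
  refine ⟨c, ?_⟩
  by_contra hne
  refine not_mem_torsionAway (w := f 0) (sub_ne_zero.2 hne) ?_
    (lowerSum_le_torsionAway hq h.f_zero_ne hc)
  rw [smul_sub, hX, smul_smul_comm', h.phiPlus, smul_comm c, smul_sub]

/-- The vacuum functional of a highest weight module. -/
lemma IsHighestVec.exists_vacuum (hq0 : q ≠ 0) (hq : ∀ n : ℕ, 0 < n → q ^ n ≠ 1)
    (h : IsHighestVec q μ v f g) :
    ∃ ℓ : V →ₗ[ℂ] ℂ, ℓ v = 1 ∧ (∀ x ∈ lowerSum q μ V (f 0) 1, ℓ x = 0) ∧ ∀ χ : ShiftedAlg q μ →ₗ[ℂ] ℂ, (∀ X, χ X = ℓ (X • v)) →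
      IsVacuum χ f g := by
  -- The functional vanishes on all vectors with torsion away from the top weight and not on `v`; it
  -- is then normalized at `v`.
  obtain ⟨ℓ, h1, h2⟩ := Submodule.exists_le_ker_of_notMem
    (not_mem_torsionAway h.ne_zero (h.phiPlus 0))
  have h3 : ∀ x ∈ lowerSum q μ V (f 0) 1, ℓ x = 0 := fun x hx =>
    LinearMap.mem_ker.1 (h2 (lowerSum_le_torsionAway hq h.f_zero_ne hx))
  refine ⟨(ℓ v)⁻¹ • ℓ, by simp [h1], fun x hx => by simp [h3 x hx], fun χ hχ => ⟨?_, fun Y r => ?_, fun r n hn => ?_,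
    fun Y m => ?_, fun Y m => ?_⟩⟩
  · rw [hχ, one_smul]; simp [h1]
  · rw [hχ, mul_smul, h.xPlus, smul_zero, map_zero]
  · rw [hχ, mul_smul, LinearMap.smul_apply]
    rw [h3 _ (xMinus_smul_mem_lowerSum hq0 (neg_smul_mem_lowerSum hq0 hn _ h.mem_lowerSum) r),
      smul_zero]
  · rw [hχ, hχ, mul_smul, h.phiPlus, smul_smul_comm', map_smul, smul_eq_mul]
  · rw [hχ, hχ, mul_smul, h.phiMinus, smul_smul_comm', map_smul, smul_eq_mul]

variable (q μ V) in
/-- The orbit map of a vector as a linear map over the complex numbers. -/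
def orbitMap (v : V) : ShiftedAlg q μ →ₗ[ℂ] V where
  toFun X := X • v
  map_add' X Y := add_smul X Y v
  map_smul' c X := smul_assoc c X v

/-- In a simple highest weight module, the annihilator of the highest weight vector is the kernel
of the form defined by the vacuum functional. -/
lemma IsHighestVec.smul_eq_zero_iff [IsSimpleModule (ShiftedAlg q μ) V] (hq0 : q ≠ 0)
    (hq : ∀ n : ℕ, 0 < n → q ^ n ≠ 1) (h : IsHighestVec q μ v f g)
    {χ : ShiftedAlg q μ →ₗ[ℂ] ℂ} (hχ : IsVacuum χ f g) (X : ShiftedAlg q μ) :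
    X • v = 0 ↔ ∀ Y, χ (Y * X) = 0 := by
  obtain ⟨ℓ, h1, -, h2⟩ := h.exists_vacuum hq0 hq
  have h3 := h2 (ℓ.comp (orbitMap q μ V v)) fun X => rfl
  rw [hχ.unique hq0 (q_sub_inv_ne_zero hq0 hq) h3]
  constructor
  · intro hX Y
    change ℓ ((Y * X) • v) = 0
    rw [mul_smul, hX, smul_zero, map_zero]
  · intro hY
    by_contra hne
    -- By simplicity, a non-zero `X • v` can be sent back to `v`, where the functional takes the
    -- value `1`.
    obtain ⟨Y, e⟩ := IsSimpleModule.toSpanSingleton_surjective (ShiftedAlg q μ) hne v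
    have := hY Y
    change ℓ ((Y * X) • v) = 0 at this
    rw [mul_smul] at this
    change Y • X • v = v at e
    rw [e, h1] at this
    exact one_ne_zero this

/-- Simple modules of the same highest `ℓ`-weight are isomorphic. -/
lemma IsHighestVec.nonempty_equiv {V' : Type*} [AddCommGroup V'] [Module ℂ V']
    [Module (ShiftedAlg q μ) V'] [IsScalarTower ℂ (ShiftedAlg q μ) V']
    [IsSimpleModule (ShiftedAlg q μ) V] [IsSimpleModule (ShiftedAlg q μ) V'] (hq0 : q ≠ 0)
    (hq : ∀ n : ℕ, 0 < n → q ^ n ≠ 1) (h : IsHighestVec q μ v f g) {v' : V'}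
    (h' : IsHighestVec q μ v' f g) : Nonempty (V ≃ₗ[ShiftedAlg q μ] V') := by
  obtain ⟨ℓ, h1, -, h2⟩ := h.exists_vacuum hq0 hq
  have h3 := h2 (ℓ.comp (orbitMap q μ V v)) fun X => rfl
  -- Both annihilators are the radical of one vacuum functional, so both modules are the same
  -- quotient of the algebra.
  have hker : LinearMap.ker (LinearMap.toSpanSingleton (ShiftedAlg q μ) V v) =
      LinearMap.ker (LinearMap.toSpanSingleton (ShiftedAlg q μ) V' v') := by
    ext X
    rw [LinearMap.mem_ker, LinearMap.mem_ker, LinearMap.toSpanSingleton_apply,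
      LinearMap.toSpanSingleton_apply, h.smul_eq_zero_iff hq0 hq h3, h'.smul_eq_zero_iff hq0 hq h3]
  exact ⟨((LinearMap.quotKerEquivOfSurjective _
    (IsSimpleModule.toSpanSingleton_surjective (ShiftedAlg q μ) h.ne_zero)).symm.trans
    (Submodule.quotEquivOfEq _ _ hker)).trans (LinearMap.quotKerEquivOfSurjective _
    (IsSimpleModule.toSpanSingleton_surjective (ShiftedAlg q μ) h'.ne_zero))⟩

lemma exists_weight_of_mem_lowerSum {w w' : ℂ} {x : V} (hx : x ∈ lowerSum q μ V w 0) (hx0 : x ≠ 0)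
    (h : gen q μ (.phiPlus 0) • x = w' • x) : ∃ k : ℕ, w' = w * q ^ (-2 * (k : ℤ)) := by
  by_contra! hne
  refine not_mem_torsionAway hx0 h ?_
  refine (Submodule.span_le.2 ?_ : lowerSum q μ V w 0 ≤ _) hx
  rintro x ⟨k, hk, ex⟩
  refine ⟨X - C (w * q ^ (-2 * (k : ℤ))), ?_, ?_⟩
  · rw [eval_sub, eval_X, eval_C]
    exact sub_ne_zero.2 (hne k)
  · rw [aeval_smul_of_smul ex]
    simp

lemma IsHighestVec.smul_mem_lowerSum (hq0 : q ≠ 0) (hqq : q - q⁻¹ ≠ 0)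
    (h : IsHighestVec q μ v f g) (Y : ShiftedAlg q μ) : Y • v ∈ lowerSum q μ V (f 0) 0 := by
  obtain ⟨n, hn, e⟩ := h.exists_neg hq0 hqq Y
  rw [e]
  exact neg_smul_mem_lowerSum hq0 hn _ h.mem_lowerSum

/-- Highest weight vectors of a simple module are proportional. -/
lemma IsHighestVec.proportional [IsSimpleModule (ShiftedAlg q μ) V] (hq0 : q ≠ 0)
    (hq : ∀ n : ℕ, 0 < n → q ^ n ≠ 1) (h : IsHighestVec q μ v f g) {v' : V} {f' g' : ℤ → ℂ}
    (h' : IsHighestVec q μ v' f' g') : ∃ c : ℂ, c ≠ 0 ∧ v' = c • v := by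
  have hqq := q_sub_inv_ne_zero hq0 hq
  -- the weight of each of the two vectors is lower than that of the other one
  have key : ∀ {v v' : V} {f g f' g' : ℤ → ℂ}, IsHighestVec q μ v f g → IsHighestVec q μ v' f' g' →
      ∃ k : ℕ, f' 0 = f 0 * q ^ (-2 * (k : ℤ)) := by
    intro v v' f g f' g' h h'
    obtain ⟨Y, e⟩ := IsSimpleModule.toSpanSingleton_surjective (ShiftedAlg q μ) h.ne_zero v'
    rw [LinearMap.toSpanSingleton_apply] at e
    refine exists_weight_of_mem_lowerSum ?_ h'.ne_zero (h'.phiPlus 0)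
    rw [← e]
    exact h.smul_mem_lowerSum hq0 hqq Y
  obtain ⟨k, hk⟩ := key h h'
  obtain ⟨k', hk'⟩ := key h' h
  -- Each weight equals the other times a non-positive power of `q²`; as `q` is not a root of unity,
  -- both exponents vanish.
  have h0 : f' 0 = f 0 := by
    rw [hk, mul_assoc, ← zpow_add₀ hq0] at hk'
    have h1 : q ^ (-2 * (k : ℤ) + -2 * (k' : ℤ)) = 1 := by
      apply mul_left_cancel₀ h.f_zero_ne
      rw [mul_one, ← hk']
    have h2 : -2 * (k : ℤ) + -2 * (k' : ℤ) = 0 := by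
      by_contra hne
      exact q_zpow_ne_one hq hne h1
    have : (k : ℤ) = 0 := by omega
    rw [hk, this]
    simp
  obtain ⟨X, e⟩ := IsSimpleModule.toSpanSingleton_surjective (ShiftedAlg q μ) h.ne_zero v'
  change X • v = v' at e
  obtain ⟨c, hc⟩ := h.eq_smul hq0 hq (X := X) (by rw [e, h'.phiPlus, h0])
  refine ⟨c, ?_, by rw [← e, hc]⟩
  rintro rfl
  rw [e, zero_smul] at hc
  exact h'.ne_zero hc

/-- A highest weight module is simple if the form defined by its vacuum functional is
nondegenerate. -/
lemma IsHighestVec.isSimpleModule (hq0 : q ≠ 0) (hq : ∀ n : ℕ, 0 < n → q ^ n ≠ 1)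
    (h : IsHighestVec q μ v f g) (hgen : ∀ x : V, ∃ X : ShiftedAlg q μ, x = X • v)
    {χ : ShiftedAlg q μ →ₗ[ℂ] ℂ} (hχ : IsVacuum χ f g)
    (hrad : ∀ X : ShiftedAlg q μ, X • v ≠ 0 → ∃ Y, χ (Y * X) ≠ 0) :
    IsSimpleModule (ShiftedAlg q μ) V := by
  have hqq := q_sub_inv_ne_zero hq0 hq
  obtain ⟨ℓ, h1, h2, h3⟩ := h.exists_vacuum hq0 hq
  have h4 := hχ.unique hq0 hqq (h3 (ℓ.comp (orbitMap q μ V v)) fun X => rfl)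
  rw [isSimpleModule_iff_toSpanSingleton_surjective]
  refine ⟨⟨⟨v, 0, h.ne_zero⟩⟩, fun x hx y => ?_⟩
  obtain ⟨X, rfl⟩ := hgen x
  obtain ⟨Y, hY⟩ := hrad X hx
  -- Nondegeneracy gives `Y X v` a non-zero component `c` along `v`; only the lower part has to be
  -- removed.
  obtain ⟨c, hc⟩ := h.exists_sub_mem_lowerSum hq0 hqq (Y * X)
  have hc0 : c ≠ 0 := by
    rintro rfl
    rw [zero_smul, sub_zero] at hc
    rw [h4] at hY
    exact hY (h2 _ hc)
  -- A polynomial in `φ⁺_0` kills the lower part and multiplies `v` by `p(f 0) ≠ 0`, so `v` is in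
  -- the submodule generated by `X • v`.
  obtain ⟨p, hp, e⟩ := lowerSum_le_torsionAway hq h.f_zero_ne hc
  rw [smul_sub, smul_smul_comm', aeval_smul_of_smul (h.phiPlus 0), sub_eq_zero, smul_smul c] at e
  obtain ⟨Y', rfl⟩ := hgen y
  refine ⟨Y' * algebraMap ℂ _ (c * p.eval (f 0))⁻¹ * aeval (gen q μ (.phiPlus 0)) p * Y, ?_⟩
  rw [LinearMap.toSpanSingleton_apply, mul_smul, mul_smul, ← mul_smul Y, e, mul_smul, algebraMap_smul, smul_smul,
    inv_mul_cancel₀ (mul_ne_zero hc0 hp), one_smul]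

end HighestWeight

/-! ## The simple module of a vacuum functional -/

section Radical

variable {q : ℂ} {μ : ℤ}

/-- The radical of a vacuum functional, a left ideal. -/
def radical (χ : ShiftedAlg q μ →ₗ[ℂ] ℂ) : Submodule (ShiftedAlg q μ) (ShiftedAlg q μ) where
  carrier := {X | ∀ Y, χ (Y * X) = 0}
  zero_mem' := fun Y => by rw [mul_zero, map_zero]
  add_mem' := fun {a b} ha hb Y => by rw [mul_add, map_add, ha, hb, add_zero]
  smul_mem' := fun c X hX Y => by rw [smul_eq_mul, ← mul_assoc]; exact hX _

lemma IsVacuum.isHighestVec {χ : ShiftedAlg q μ →ₗ[ℂ] ℂ} {f g : ℤ → ℂ} (h : IsVacuum χ f g) :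
    IsHighestVec q μ (Submodule.Quotient.mk 1 : ShiftedAlg q μ ⧸ radical χ) f g := by
  have hm : ∀ (X : ShiftedAlg q μ) (c : ℂ), (∀ Y, χ (Y * X) = c * χ Y) →
      X • (Submodule.Quotient.mk 1 : ShiftedAlg q μ ⧸ radical χ) =
        c • (Submodule.Quotient.mk 1 : ShiftedAlg q μ ⧸ radical χ) := fun X c hX => by
    rw [← Submodule.Quotient.mk_smul, ← Submodule.Quotient.mk_smul, Submodule.Quotient.eq]
    intro Y
    rw [smul_eq_mul, mul_one, mul_sub, map_sub, hX, mul_smul_comm, mul_one, map_smul, smul_eq_mul,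
      sub_self]
  refine ⟨fun h0 => ?_, fun m => ?_, fun m => hm _ _ fun Y => h.phiPlus Y m,
    fun m => hm _ _ fun Y => h.phiMinus Y m⟩
  · rw [Submodule.Quotient.mk_eq_zero] at h0
    have := h0 1
    rw [mul_one, h.one] at this
    exact one_ne_zero this
  · rw [← Submodule.Quotient.mk_smul, Submodule.Quotient.mk_eq_zero]
    intro Y
    rw [smul_eq_mul, mul_one, h.xPlus]

/-- After division by the radical the form is nondegenerate, which is the simplicity criterion. This
constructs the simple module of a given `ℓ`-weight from the functional alone. -/
lemma IsVacuum.isSimpleModule (hq0 : q ≠ 0) (hq : ∀ n : ℕ, 0 < n → q ^ n ≠ 1)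
    {χ : ShiftedAlg q μ →ₗ[ℂ] ℂ} {f g : ℤ → ℂ} (h : IsVacuum χ f g) :
    IsSimpleModule (ShiftedAlg q μ) (ShiftedAlg q μ ⧸ radical χ) := by
  have hX : ∀ X : ShiftedAlg q μ, (Submodule.Quotient.mk X : ShiftedAlg q μ ⧸ radical χ) =
      X • (Submodule.Quotient.mk 1 : ShiftedAlg q μ ⧸ radical χ) :=
    fun X => by rw [← Submodule.Quotient.mk_smul, smul_eq_mul, mul_one]
  refine h.isHighestVec.isSimpleModule hq0 hq (fun x => ?_) h fun X hne => ?_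
  · obtain ⟨X, rfl⟩ := Submodule.Quotient.mk_surjective _ x
    exact ⟨X, hX X⟩
  · by_contra! h0
    rw [← hX] at hne
    exact hne ((Submodule.Quotient.mk_eq_zero _).2 h0)

end Radical

/-! ## Operators on functions on a lattice -/

section Operators

variable {ι I : Type*} [Fintype ι] [AddCommGroup I]

/-- The operator `φ ↦ ∑ᵢ cᵢ(n) φ(n + σᵢ)`. -/
def shiftOp (σ : ι → I) (c : ι → I → ℂ) : Module.End ℂ (I → ℂ) where
  toFun φ n := ∑ i, c i n * φ (n + σ i)
  map_add' φ ψ := by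
    ext n
    simp only [Pi.add_apply, mul_add, Finset.sum_add_distrib]
  map_smul' t φ := by
    ext n
    simp only [Pi.smul_apply, smul_eq_mul, RingHom.id_apply, Finset.mul_sum]
    exact Finset.sum_congr rfl fun i _ => by ring

lemma shiftOp_apply (σ : ι → I) (c : ι → I → ℂ) (φ : I → ℂ) (n : I) :
    shiftOp σ c φ n = ∑ i, c i n * φ (n + σ i) := rfl

lemma shiftOp_shiftOp (σ τ : ι → I) (c d : ι → I → ℂ) (φ : I → ℂ) (n : I) :
    shiftOp σ c (shiftOp τ d φ) n =
      ∑ i, ∑ j, c i n * d j (n + σ i) * φ (n + σ i + τ j) := by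
  simp only [shiftOp_apply, Finset.mul_sum]
  exact Finset.sum_congr rfl fun i _ => Finset.sum_congr rfl fun j _ => by ring

lemma sum_sum_eq_zero_of_antisymm {G Φ : ι → ι → ℂ} (hG : ∀ i j, G i j = -G j i)
    (hΦ : ∀ i j, Φ i j = Φ j i) : ∑ i, ∑ j, G i j * Φ i j = 0 := by
  have h : ∑ i, ∑ j, G i j * Φ i j = -∑ i, ∑ j, G i j * Φ i j := by
    conv_lhs => rw [Finset.sum_comm]
    simp only [← Finset.sum_neg_distrib]
    exact Finset.sum_congr rfl fun i _ => Finset.sum_congr rfl fun j _ => by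
      rw [hG j i, hΦ j i]; ring
  exact self_eq_neg.1 h

/-- The quadratic relation between operators of the form `∑ᵢ eᵢ(n)^r cᵢ(n) φ(n + σᵢ)`. -/
lemma shiftOp_quadratic {σ : ι → I} {c e : ι → I → ℂ} {κ : ℂ} (hκ : κ ≠ 0)
    (he0 : ∀ i n, e i n ≠ 0) (he : ∀ i n, e i (n + σ i) = κ⁻¹ * e i n)
    (hej : ∀ i j n, i ≠ j → e j (n + σ i) = e j n)
    (hc : ∀ i j n, i ≠ j → c i n * c j (n + σ i) * (e i n - κ * e j n) =
      -(c j n * c i (n + σ j) * (e j n - κ * e i n)))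
    {x : ℤ → Module.End ℂ (I → ℂ)} (hx : ∀ r, x r = shiftOp σ fun i n => e i n ^ r * c i n)
    (r s : ℤ) :
    x (r + 1) * x s - κ • (x s * x (r + 1)) = κ • (x r * x (s + 1)) - x (s + 1) * x r := by
  rw [← sub_eq_zero]
  refine LinearMap.ext fun φ => funext fun n => ?_
  simp only [LinearMap.sub_apply, LinearMap.smul_apply, Module.End.mul_apply, Pi.sub_apply,
    Pi.smul_apply, hx, shiftOp_shiftOp, smul_eq_mul, Finset.mul_sum, ← Finset.sum_sub_distrib,
    LinearMap.zero_apply, Pi.zero_apply]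
  -- On the diagonal both sides are zero, because `e_i(n + σ_i) = κ⁻¹ e_i(n)`; off the diagonal this
  -- is `hc`.
  have key : ∀ i j, c i n * c j (n + σ i) * (e i n - κ * e j (n + σ i)) =
      -(c j n * c i (n + σ j) * (e j n - κ * e i (n + σ j))) := fun i j => by
    rcases eq_or_ne i j with rfl | hij
    · rw [he, mul_inv_cancel_left₀ hκ]; ring
    · rw [hej i j n hij, hej j i n hij.symm, hc i j n hij]
  -- The four exponents combine into `(e_i - κ e_j)(e_i^r e_j^s + e_i^s e_j^r)`. The second factor
  -- is symmetric in `i, j`, the rest is antisymmetric by `key`, and the shifted argument is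
  -- symmetric.
  refine Eq.trans ?_ (sum_sum_eq_zero_of_antisymm (ι := ι)
    (G := fun i j => c i n * c j (n + σ i) * (e i n - κ * e j (n + σ i)) *
      (e i n ^ r * e j n ^ s + e i n ^ s * e j n ^ r))
    (Φ := fun i j => φ (n + σ i + σ j)) (fun i j => ?_) fun i j => by rw [add_right_comm])
  · refine Finset.sum_congr rfl fun i _ => Finset.sum_congr rfl fun j _ => ?_
    have h1 : ∀ i n, e i n ^ (r + 1) = e i n ^ r * e i n := fun i n => zpow_add_one₀ (he0 i n) r
    have h2 : ∀ i n, e i n ^ (s + 1) = e i n ^ s * e i n := fun i n => zpow_add_one₀ (he0 i n) s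
    simp only [h1, h2]
    rcases eq_or_ne i j with rfl | hij
    · rw [he]
      have : κ * (κ⁻¹ * e i n) = e i n := mul_inv_cancel_left₀ hκ _
      linear_combination (-(c i n * c i (n + σ i)) * ((e i n) ^ s * (κ⁻¹ * e i n) ^ r +
        (e i n) ^ r * (κ⁻¹ * e i n) ^ s - 2 * (e i n) ^ r * (e i n) ^ s) * φ (n + σ i + σ i)) * this
    · rw [hej i j n hij]
      ring
  · rw [key]
    ring

/-- The commutator of a raising and a lowering operator. -/
lemma shiftOp_commutator {σ : ι → I} {c d e e' : ι → I → ℂ} {f : ℤ → I → ℂ}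
    (he : ∀ i j n, i ≠ j → e i (n + -σ j) = e i n) (he' : ∀ i j n, i ≠ j → e' j (n + σ i) = e' j n)
    (hii : ∀ i n, e' i (n + σ i) = e i n) (h0 : ∀ i n, e i n ≠ 0)
    (hcd : ∀ i j n, i ≠ j → c i n * d j (n + σ i) = d j n * c i (n + -σ j))
    (hf : ∀ m n, f m n = ∑ i, (c i n * d i (n + σ i) * e i n ^ m -
      d i n * c i (n + -σ i) * e i (n + -σ i) ^ m))
    {x y : ℤ → Module.End ℂ (I → ℂ)} (hx : ∀ r, x r = shiftOp σ fun i n => e i n ^ r * c i n)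
    (hy : ∀ r, y r = shiftOp (fun i => -σ i) fun i n => e' i n ^ r * d i n) (r s : ℤ) :
    x r * y s - y s * x r = Algebra.lmul ℂ (I → ℂ) (f (r + s)) := by
  refine LinearMap.ext fun φ => funext fun n => ?_
  classical
  simp only [LinearMap.sub_apply, Module.End.mul_apply, Pi.sub_apply, hx, hy, shiftOp_shiftOp,
    Algebra.coe_lmul_eq_mul, LinearMap.mul_apply', Pi.mul_apply, hf]
  rw [Finset.sum_comm (f := fun i j => e' i n ^ s * d i n * (e j (n + -σ i) ^ r * c j (n + -σ i)) *
    φ (n + -σ i + σ j)), ← Finset.sum_sub_distrib, Finset.sum_mul]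
  refine Finset.sum_congr rfl fun i _ => ?_
  -- Only `i = j` contributes: for `i ≠ j` the two orders of shifting agree by `hcd`, and the
  -- spectra do not interact.
  rw [← Finset.sum_sub_distrib, Finset.sum_eq_single i]
  · have h1 : e' i n = e i (n + -σ i) := by rw [← hii, neg_add_cancel_right]
    have h2 : n + -σ i + σ i = n := neg_add_cancel_right n _
    rw [hii, add_neg_cancel_right, h1, h2, zpow_add₀ (h0 i n), zpow_add₀ (h0 i _)]
    ring
  · intro j _ hj
    rw [he i j n hj.symm, he' i j n hj.symm, add_right_comm n (-σ j)]
    linear_combination (e i n ^ r * e' j n ^ s * φ (n + σ i + -σ j)) * hcd i j n hj.symm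
  · exact fun h => absurd (Finset.mem_univ i) h

end Operators

/-! ## Eigenvalues of the Cartan currents -/

section Eigenvalues

variable {ι : Type*} [Fintype ι]

/-- The multiset of the values of a finite family. -/
def family (y : ι → ℂ) : Multiset ℂ := Finset.univ.val.map y

lemma linProd_family (y : ι → ℂ) : linProd (family y) = ∏ i, (1 - C (y i) * X) := by
  rw [linProd, family, Multiset.map_map]
  rfl

lemma pSum_family (y : ι → ℂ) (m : ℤ) : pSum (family y) m = ∑ i, y i ^ m := by
  rw [pSum, family, Multiset.map_map]
  rfl

lemma card_family (y : ι → ℂ) : Multiset.card (family y) = Fintype.card ι := by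
  rw [family, Multiset.card_map]
  rfl

lemma prod_map_family (y : ι → ℂ) (g : ℂ → ℂ) : ((family y).map g).prod = ∏ i, g (y i) := by
  rw [family, Multiset.map_map]
  rfl

lemma map_family (y : ι → ℂ) (g : ℂ → ℂ) : (family y).map g = family fun i => g (y i) := by
  rw [family, Multiset.map_map]
  rfl

lemma mem_family {y : ι → ℂ} {b : ℂ} : b ∈ family y ↔ ∃ i, y i = b := by
  simp [family]

lemma family_ne_zero {y : ι → ℂ} (hy : ∀ i, y i ≠ 0) : ∀ b ∈ family y, b ≠ 0 := by
  intro b hb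
  obtain ⟨i, rfl⟩ := mem_family.1 hb
  exact hy i

variable (q : ℂ) (y : ι → ℂ) (s : Multiset ℂ)

/-- The eigenvalue of `(q - q⁻¹) h_m`, where `A(z) = ∏ (1 - y_i z)` and `s` are the inverses of
the zeros of `Z`. -/
def hVal (m : ℤ) : ℂ := ((1 + (q ^ 2) ^ m) * pSum (family y) m - pSum s m) / m

/-- The eigenvalue of `φ⁺_m`, a coefficient of `(∏ y_i) Z(z) / (A(z) A(q² z))` at `0`. -/
def phiPlusVal (m : ℤ) : ℂ :=
  (∏ i, y i) * seqZero (expSeries (positiveSeries fun k => hVal q y s k)) m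

/-- The eigenvalue of `φ⁻_m`, a coefficient of `(∏ y_i) Z(z) / (A(z) A(q² z))` at `∞`. -/
def phiMinusVal (μ m : ℤ) : ℂ :=
  (s.map fun b => -b).prod / ((q ^ 2) ^ Fintype.card ι * ∏ i, y i) *
    seqInfty μ (expSeries (positiveSeries fun k => -hVal q y s (-(k : ℤ)))) m

/-- The polynomial `A(z) A(q² z)`. -/
def denomPoly : ℂ[X] := linProd (family y + family fun i => q ^ 2 * y i)

variable {q y s}

lemma pSum_family_mul (c : ℂ) (m : ℤ) :
    pSum (family fun i => c * y i) m = c ^ m * pSum (family y) m := by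
  rw [pSum_family, pSum_family, Finset.mul_sum]
  exact Finset.sum_congr rfl fun i _ => mul_zpow _ _ _

lemma pSum_inv (s : Multiset ℂ) (m : ℤ) : pSum (s.map fun b => b⁻¹) m = pSum s (-m) := by
  rw [pSum, pSum, Multiset.map_map]
  congr 1
  exact Multiset.map_congr rfl fun b _ => by simp

lemma linProd_mul_expSeries {s t : Multiset ℂ} {c : ℕ → ℂ}
    (hc : ∀ m : ℕ, 0 < m → c m = (pSum s m - pSum t m) / m) :
    (linProd s : PowerSeries ℂ) * expSeries (positiveSeries c) = (linProd t : PowerSeries ℂ) := by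
  rw [coe_linProd, coe_linProd, ← expSeries_positiveSeries_add]
  congr 1
  exact positiveSeries_congr fun m hm => by rw [hc m hm]; ring

/-- By the definition of `hVal`, the exponent is the logarithm of `Z(z) / (A(z) A(q² z))`: the
factor `1 + q^{2m}` produces the power sums of both denominators. -/
lemma act_phiPlusVal :
    act (denomPoly q y) (phiPlusVal q y s) = act (C (∏ i, y i) * linProd s) unitSeq := by
  have : phiPlusVal q y s =
      (∏ i, y i) • seqZero (expSeries (positiveSeries fun k => hVal q y s k)) := rfl
  rw [this, map_smul, act_seqZero, act_C_mul, act_unitSeq_eq, denomPoly,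
    linProd_mul_expSeries (t := s)]
  intro m _
  rw [hVal, pSum_add, pSum_family_mul]
  push_cast
  ring

/-- The same fraction at infinity, where `hμ` says that its order is `μ`. The scalar in
`phiMinusVal` is the ratio of the leading coefficients of `(∏ y_i) Z(z)` and `A(z) A(q² z)`. -/
lemma act_phiMinusVal (hq0 : q ≠ 0) (hy : ∀ i, y i ≠ 0) (hs : ∀ b ∈ s, b ≠ 0) {μ : ℤ}
    (hμ : (Multiset.card s : ℤ) = μ + 2 * Fintype.card ι) :
    act (denomPoly q y) (phiMinusVal q y s μ) = act (C (∏ i, y i) * linProd s) unitSeq := by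
  have hQ : q ^ 2 ≠ 0 := pow_ne_zero 2 hq0
  have : phiMinusVal q y s μ = ((s.map fun b => -b).prod / ((q ^ 2) ^ Fintype.card ι * ∏ i, y i)) •
      seqInfty μ (expSeries (positiveSeries fun k => -hVal q y s (-(k : ℤ)))) := rfl
  have hD : ∀ b ∈ family y + family fun i => q ^ 2 * y i, b ≠ 0 := by
    intro b hb
    rcases Multiset.mem_add.1 hb with h | h
    exacts [family_ne_zero hy b h, family_ne_zero (fun i => mul_ne_zero hQ (hy i)) b h]
  have h1 := act_linProd_seqInfty s hs 0 1
  rw [seqInfty_zero_one, mul_one, zero_add] at h1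
  rw [this, map_smul, act_C_mul, h1, denomPoly, act_linProd_seqInfty _ hD,
    linProd_mul_expSeries (t := s.map fun b => b⁻¹), smul_smul, smul_smul, Multiset.map_add,
    Multiset.prod_add, prod_map_family, prod_map_family, Multiset.card_add, card_family,
    card_family]
  · congr 1
    · have hP : ∏ i, y i ≠ 0 := Finset.prod_ne_zero_iff.2 fun i _ => hy i
      have e : (∏ i, -y i) * (∏ i, -(q ^ 2 * y i)) =
          (∏ i, y i) * ((q ^ 2) ^ Fintype.card ι * ∏ i, y i) := by
        rw [← Finset.prod_mul_distrib]
        simp only [neg_mul_neg, Finset.prod_mul_distrib, Finset.prod_const, Finset.card_univ]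
      rw [e]
      field_simp
    · congr 1
      rw [hμ]; push_cast; ring
  · intro m _
    rw [hVal, pSum_inv, pSum_inv, pSum_add, pSum_family_mul]
    push_cast
    field_simp

variable [DecidableEq ι]

/-- `∏_{k ≠ i} (1 - y_k / t)⁻¹`. -/
def residueProd (y : ι → ℂ) (i : ι) (t : ℂ) : ℂ := ∏ k ∈ Finset.univ.erase i, (1 - y k / t)⁻¹

lemma prod_erase_inl {κ : Type*} [Fintype κ] [DecidableEq κ] (g : ι ⊕ κ → ℂ) (i : ι) :
    ∏ j ∈ Finset.univ.erase (Sum.inl i), g j =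
      (∏ j ∈ Finset.univ.erase i, g (Sum.inl j)) * ∏ j, g (Sum.inr j) := by
  rw [← Finset.prod_disjSum]
  congr 1
  ext j
  cases j <;> simp

lemma prod_erase_inr {κ : Type*} [Fintype κ] [DecidableEq κ] (g : ι ⊕ κ → ℂ) (i : κ) :
    ∏ j ∈ Finset.univ.erase (Sum.inr i), g j =
      (∏ j, g (Sum.inl j)) * ∏ j ∈ Finset.univ.erase i, g (Sum.inr j) := by
  rw [← Finset.prod_disjSum]
  congr 1
  ext j
  cases j <;> simp

/-- The difference of the expansions of `(∏ y_i) Z(z) / (A(z) A(q² z))` is a sum of residues. -/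
lemma phiPlusVal_sub_phiMinusVal (hq0 : q ≠ 0) (hy : ∀ i, y i ≠ 0)
    (hs : ∀ b ∈ s, b ≠ 0) {μ : ℤ} (hμ : (Multiset.card s : ℤ) = μ + 2 * Fintype.card ι)
    (hinj : Function.Injective y) (hne : ∀ i j, y i ≠ q ^ 2 * y j) (m : ℤ) :
    phiPlusVal q y s m - phiMinusVal q y s μ m =
      ∑ i, ((∏ i, y i) * (1 - q ^ 2)⁻¹ * (linProd s).eval (y i)⁻¹ *
          (residueProd y i (y i) * residueProd y i ((q ^ 2)⁻¹ * y i)) * y i ^ m +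
        (∏ i, y i) * (1 - (q ^ 2)⁻¹)⁻¹ * (linProd s).eval (q ^ 2 * y i)⁻¹ *
          (residueProd y i (q ^ 2 * y i) * residueProd y i (y i)) * (q ^ 2 * y i) ^ m) := by
  have hQ : q ^ 2 ≠ 0 := pow_ne_zero 2 hq0
  have hD : denomPoly q y =
      ∏ i, (1 - C (Sum.elim y (fun i => q ^ 2 * y i) i) * X) := by
    rw [denomPoly, linProd_add, linProd_family, linProd_family, Fintype.prod_sum_type]
    rfl
  -- The poles are the inverses of the `y_i` and of the `q² y_i`, indexed by two copies of `ι`; the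
  -- hypotheses `hinj` and `hne` make them simple.
  have h := sub_eq_sum_residues (ι := ι ⊕ ι) (y := Sum.elim y fun i => q ^ 2 * y i)
    (p := C (∏ i, y i) * linProd s) (f := phiPlusVal q y s) (g := phiMinusVal q y s μ) (d := μ)
    (by rintro (i | i); exacts [hy i, mul_ne_zero hQ (hy i)])
    (by
      rintro (i | i) (j | j) h
      · exact congrArg _ (hinj h)
      · exact absurd h (hne i j)
      · exact absurd h.symm (hne j i)
      · exact congrArg _ (hinj (mul_left_cancel₀ hQ h)))
    (fun m hm => by rw [phiPlusVal, seqZero_neg _ hm, mul_zero])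
    (fun m hm => by rw [phiMinusVal, seqInfty_big _ _ hm, mul_zero])
    (by rw [← hD, act_phiPlusVal]) (by rw [← hD, act_phiMinusVal hq0 hy hs hμ]) m
  rw [h, Fintype.sum_sum_type, ← Finset.sum_add_distrib]
  refine Finset.sum_congr rfl fun i _ => ?_
  have e1 : q ^ 2 * y i / y i = q ^ 2 := mul_div_cancel_right₀ _ (hy i)
  have e2 : y i / (q ^ 2 * y i) = (q ^ 2)⁻¹ := by field_simp [hy i]
  rw [prod_erase_inl, prod_erase_inr]
  simp only [Sum.elim_inl, Sum.elim_inr, eval_mul, eval_C]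
  rw [← Finset.mul_prod_erase Finset.univ (fun j => 1 - q ^ 2 * y j / y i) (Finset.mem_univ i),
    ← Finset.mul_prod_erase Finset.univ (fun j => 1 - y j / (q ^ 2 * y i)) (Finset.mem_univ i),
    e1, e2]
  have e3 : ∀ j, q ^ 2 * y j / y i = y j / ((q ^ 2)⁻¹ * y i) := fun j => by
    field_simp
  have e4 : ∀ j, q ^ 2 * y j / (q ^ 2 * y i) = y j / y i := fun j => mul_div_mul_left _ _ hQ
  simp only [e3, e4, residueProd, Finset.prod_inv_distrib, div_eq_mul_inv, mul_inv]
  ring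

/-- `∏_{k ≠ i, j} (1 - y_k / t)⁻¹`. -/
def residueProd₂ (y : ι → ℂ) (i j : ι) (t : ℂ) : ℂ :=
  ∏ k ∈ (Finset.univ.erase i).erase j, (1 - y k / t)⁻¹

lemma residueProd_congr {y y' : ι → ℂ} {i : ι} (h : ∀ k, k ≠ i → y k = y' k) (t : ℂ) :
    residueProd y i t = residueProd y' i t :=
  Finset.prod_congr rfl fun k hk => by rw [h k (Finset.ne_of_mem_erase hk)]

/-- Isolating the factor of `j` leaves a product that does not change when only `y_j` is shifted.
The two-index relations thus reduce to scalar identities in `y_i` and `y_j`. -/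
lemma residueProd_eq {y y' : ι → ℂ} {i j : ι} (hij : i ≠ j) (h : ∀ k, k ≠ j → y k = y' k) (t : ℂ) :
    residueProd y i t = (1 - y j / t)⁻¹ * residueProd₂ y' i j t := by
  rw [residueProd, ← Finset.mul_prod_erase _ _ (Finset.mem_erase.2 ⟨hij.symm, Finset.mem_univ j⟩),
    residueProd₂]
  congr 1
  exact Finset.prod_congr rfl fun k hk => by rw [h k (Finset.ne_of_mem_erase hk)]

end Eigenvalues

/-! ## Gelfand-Tsetlin representations -/

section GelfandTsetlin

variable {ι : Type*} [Fintype ι] [DecidableEq ι] {q : ℂ} {β : ι → ℂ} {s : Multiset ℂ}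

variable (q β) in
/-- The spectrum `y_i = β_i q^{-2 n_i}` of `A(z) = ∏ (1 - y_i z)`. -/
def specVal (n : ι → ℤ) (i : ι) : ℂ := β i * (q ^ 2) ^ (-n i)

lemma specVal_zero : specVal q β 0 = β := by
  ext i
  simp [specVal]

lemma specVal_ne_zero (hq0 : q ≠ 0) (hβ : ∀ i, β i ≠ 0) (n : ι → ℤ) (i : ι) :
    specVal q β n i ≠ 0 := mul_ne_zero (hβ i) (zpow_ne_zero _ (pow_ne_zero 2 hq0))

lemma specVal_add_self (hq0 : q ≠ 0) (n : ι → ℤ) (i : ι) :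
    specVal q β (n + Pi.single i 1) i = (q ^ 2)⁻¹ * specVal q β n i := by
  have hQ : q ^ 2 ≠ 0 := pow_ne_zero 2 hq0
  simp only [specVal, Pi.add_apply, Pi.single_eq_same]
  rw [neg_add, zpow_add₀ hQ, zpow_neg_one]
  ring

lemma specVal_sub_self (hq0 : q ≠ 0) (n : ι → ℤ) (i : ι) :
    specVal q β (n + -Pi.single i 1) i = q ^ 2 * specVal q β n i := by
  have hQ : q ^ 2 ≠ 0 := pow_ne_zero 2 hq0
  have h := specVal_add_self (β := β) hq0 (n + -Pi.single i 1) i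
  rw [neg_add_cancel_right] at h
  rw [h, mul_inv_cancel_left₀ hQ]

lemma specVal_add_ne (n : ι → ℤ) {i j : ι} (h : j ≠ i) :
    specVal q β (n + Pi.single i 1) j = specVal q β n j := by
  simp [specVal, h]

lemma specVal_sub_ne (n : ι → ℤ) {i j : ι} (h : j ≠ i) :
    specVal q β (n + -Pi.single i 1) j = specVal q β n j := by
  simp [specVal, h]

lemma prod_specVal_add (hq0 : q ≠ 0) (n : ι → ℤ) (i : ι) :
    ∏ k, specVal q β (n + Pi.single i 1) k = (q ^ 2)⁻¹ * ∏ k, specVal q β n k := by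
  rw [← Finset.mul_prod_erase Finset.univ _ (Finset.mem_univ i), specVal_add_self hq0,
    ← Finset.mul_prod_erase Finset.univ (specVal q β n) (Finset.mem_univ i), mul_assoc]
  congr 2
  exact Finset.prod_congr rfl fun k hk => specVal_add_ne n (Finset.ne_of_mem_erase hk)

lemma prod_specVal_sub (hq0 : q ≠ 0) (n : ι → ℤ) (i : ι) :
    ∏ k, specVal q β (n + -Pi.single i 1) k = q ^ 2 * ∏ k, specVal q β n k := by
  have hQ : q ^ 2 ≠ 0 := pow_ne_zero 2 hq0
  have h := prod_specVal_add (β := β) hq0 (n + -Pi.single i 1) i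
  rw [neg_add_cancel_right] at h
  rw [h, mul_inv_cancel_left₀ hQ]

variable (q β) in
/-- No two of the parameters `β_i` differ by a power of `q²`. -/
def IsGeneric : Prop := ∀ i j, i ≠ j → ∀ k : ℤ, β i * (q ^ 2) ^ k ≠ β j

lemma IsGeneric.specVal_ne (hq0 : q ≠ 0) (h : IsGeneric q β) (n : ι → ℤ) {i j : ι} (hij : i ≠ j)
    (k : ℤ) : specVal q β n i ≠ (q ^ 2) ^ k * specVal q β n j := fun e => by
  have hQ : q ^ 2 ≠ 0 := pow_ne_zero 2 hq0
  apply h i j hij (-n i - k + n j)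
  rw [specVal, specVal] at e
  rw [zpow_add₀ hQ, zpow_sub₀ hQ, ← mul_assoc, ← mul_div_assoc, e]
  rw [zpow_neg]
  field_simp [zpow_ne_zero]

variable (q β s) in
/-- The coefficients of `x⁺`. -/
def plusCoeff (i : ι) (n : ι → ℤ) : ℂ :=
  ((q - q⁻¹) * (1 - q ^ 2))⁻¹ * (∏ k, specVal q β n k) * (linProd s).eval (specVal q β n i)⁻¹ *
    residueProd (specVal q β n) i ((q ^ 2)⁻¹ * specVal q β n i)

variable (q β) in
/-- The coefficients of `x⁻`. -/
def minusCoeff (i : ι) (n : ι → ℤ) : ℂ :=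
  residueProd (specVal q β n) i (q ^ 2 * specVal q β n i)

lemma inv_eq_div_of_mul_eq {x A B : ℂ} (hA : A ≠ 0) (h : x * A = B) : x⁻¹ = A / B := by
  rw [eq_div_of_mul_eq hA h, inv_div]

/-- The interaction of two eigenvalues `u`, `w` under successive raising: the outer factor `u - Q w`
cancels one denominator, and `w / (w - u)`, `u / (u - w)` supply the sign. -/
lemma plus_scalar_identity {Q u w : ℂ} (hQ : Q ≠ 0) (hu : u ≠ 0) (hw : w ≠ 0) (h1 : u ≠ Q * w)
    (h2 : w ≠ Q * u) :
    (1 - w / (Q⁻¹ * u))⁻¹ * (1 - Q⁻¹ * u / (Q⁻¹ * w))⁻¹ * (u - Q * w) =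
      -((1 - u / (Q⁻¹ * w))⁻¹ * (1 - Q⁻¹ * w / (Q⁻¹ * u))⁻¹ * (w - Q * u)) := by
  have e1 : (1 - w / (Q⁻¹ * u))⁻¹ = u / (u - Q * w) := by
    refine inv_eq_div_of_mul_eq hu ?_; field_simp
  have e2 : (1 - u / (Q⁻¹ * w))⁻¹ = w / (w - Q * u) := by
    refine inv_eq_div_of_mul_eq hw ?_; field_simp
  have e3 : (1 - Q⁻¹ * u / (Q⁻¹ * w))⁻¹ = w / (w - u) := by
    refine inv_eq_div_of_mul_eq hw ?_; field_simp
  have e4 : (1 - Q⁻¹ * w / (Q⁻¹ * u))⁻¹ = u / (u - w) := by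
    refine inv_eq_div_of_mul_eq hu ?_; field_simp
  have a1 : u / (u - Q * w) * (u - Q * w) = u := div_mul_cancel₀ _ (sub_ne_zero.2 h1)
  have a2 : w / (w - Q * u) * (w - Q * u) = w := div_mul_cancel₀ _ (sub_ne_zero.2 h2)
  have a3 : w / (w - u) = -(w / (u - w)) := by rw [← neg_sub, div_neg]
  rw [e1, e2, e3, e4]
  linear_combination w / (w - u) * a1 + u / (u - w) * a2 + u * a3

/-- Both sides have denominators `u - Q w` and `u - Q² w`, hence agree even where these vanish, with
`0⁻¹ = 0`. -/
lemma cross_scalar_identity {Q u w : ℂ} (hQ : Q ≠ 0) (hu : u ≠ 0) (hw : w ≠ 0) :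
    (1 - w / (Q⁻¹ * u))⁻¹ * (1 - Q⁻¹ * u / (Q * w))⁻¹ =
      Q * ((1 - u / (Q * w))⁻¹ * (1 - Q * w / (Q⁻¹ * u))⁻¹) := by
  have e1 : (1 - w / (Q⁻¹ * u))⁻¹ = u / (u - Q * w) := by
    refine inv_eq_div_of_mul_eq hu ?_; field_simp
  have e2 : (1 - Q⁻¹ * u / (Q * w))⁻¹ = -(Q ^ 2 * w) / (u - Q ^ 2 * w) := by
    refine inv_eq_div_of_mul_eq (neg_ne_zero.2 (mul_ne_zero (pow_ne_zero 2 hQ) hw)) ?_; field_simp; ring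
  have e3 : (1 - u / (Q * w))⁻¹ = -(Q * w) / (u - Q * w) := by
    refine inv_eq_div_of_mul_eq (neg_ne_zero.2 (mul_ne_zero hQ hw)) ?_; field_simp; ring
  have e4 : (1 - Q * w / (Q⁻¹ * u))⁻¹ = u / (u - Q ^ 2 * w) := by
    refine inv_eq_div_of_mul_eq hu ?_; field_simp
  rw [e1, e2, e3, e4]
  ring

/-- The shifts of `n_i` and `n_j` affect only the factors linking `i` and `j` and the overall
product of the `y_k`; what remains is `plus_scalar_identity` with `Q = q²`. -/
lemma plusCoeff_antisymm (hq0 : q ≠ 0) (hβ : ∀ i, β i ≠ 0) (hgen : IsGeneric q β) (i j : ι)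
    (n : ι → ℤ) (hij : i ≠ j) :
    plusCoeff q β s i n * plusCoeff q β s j (n + Pi.single i 1) *
        (specVal q β n i - q ^ 2 * specVal q β n j) =
      -(plusCoeff q β s j n * plusCoeff q β s i (n + Pi.single j 1) *
        (specVal q β n j - q ^ 2 * specVal q β n i)) := by
  have hQ : q ^ 2 ≠ 0 := pow_ne_zero 2 hq0
  have h1 := hgen.specVal_ne hq0 n hij 1
  have h2 := hgen.specVal_ne hq0 n hij.symm 1
  rw [zpow_one] at h1 h2
  have key := plus_scalar_identity hQ (specVal_ne_zero hq0 hβ n i) (specVal_ne_zero hq0 hβ n j)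
    h1 h2
  simp only [plusCoeff, prod_specVal_add hq0, specVal_add_ne n hij, specVal_add_ne n hij.symm]
  rw [residueProd_eq (y' := specVal q β n) hij (fun _ _ => rfl),
    residueProd_eq (y' := specVal q β n) hij.symm (fun _ _ => rfl),
    residueProd_eq (y := specVal q β (n + Pi.single i 1)) (y' := specVal q β n) hij.symm
      (fun k hk => specVal_add_ne n hk),
    residueProd_eq (y := specVal q β (n + Pi.single j 1)) (y' := specVal q β n) hij
      (fun k hk => specVal_add_ne n hk), specVal_add_self hq0, specVal_add_self hq0]
  generalize residueProd₂ (specVal q β n) i j _ = R1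
  generalize residueProd₂ (specVal q β n) j i _ = R2
  linear_combination (((q - q⁻¹) * (1 - q ^ 2))⁻¹ ^ 2 * (∏ k, specVal q β n k) ^ 2 * (q ^ 2)⁻¹ *
    eval (specVal q β n i)⁻¹ (linProd s) * eval (specVal q β n j)⁻¹ (linProd s) * R1 * R2) * key

/-- Lowering inverts the shift, so the same scalar identity applies with `Q = q⁻²`. -/
lemma minusCoeff_antisymm (hq0 : q ≠ 0) (hβ : ∀ i, β i ≠ 0) (hgen : IsGeneric q β) (i j : ι)
    (n : ι → ℤ) (hij : i ≠ j) :
    minusCoeff q β i n * minusCoeff q β j (n + -Pi.single i 1) *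
        (q ^ 2 * specVal q β n i - (q ^ 2)⁻¹ * (q ^ 2 * specVal q β n j)) =
      -(minusCoeff q β j n * minusCoeff q β i (n + -Pi.single j 1) *
        (q ^ 2 * specVal q β n j - (q ^ 2)⁻¹ * (q ^ 2 * specVal q β n i))) := by
  have hQ : q ^ 2 ≠ 0 := pow_ne_zero 2 hq0
  have h1 := hgen.specVal_ne hq0 n hij (-1)
  have h2 := hgen.specVal_ne hq0 n hij.symm (-1)
  rw [zpow_neg_one] at h1 h2
  have key := plus_scalar_identity (inv_ne_zero hQ) (specVal_ne_zero hq0 hβ n i)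
    (specVal_ne_zero hq0 hβ n j) h1 h2
  rw [inv_inv] at key
  simp only [minusCoeff, specVal_sub_ne n hij, specVal_sub_ne n hij.symm]
  rw [residueProd_eq (y' := specVal q β n) hij (fun _ _ => rfl),
    residueProd_eq (y' := specVal q β n) hij.symm (fun _ _ => rfl),
    residueProd_eq (y := specVal q β (n + -Pi.single i 1)) (y' := specVal q β n) hij.symm
      (fun k hk => specVal_sub_ne n hk),
    residueProd_eq (y := specVal q β (n + -Pi.single j 1)) (y' := specVal q β n) hij
      (fun k hk => specVal_sub_ne n hk), specVal_sub_self hq0, specVal_sub_self hq0]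
  generalize residueProd₂ (specVal q β n) i j _ = R1
  generalize residueProd₂ (specVal q β n) j i _ = R2
  linear_combination (q ^ 2 * R1 * R2) * key

/-- The factor `Q = q²` in the scalar identity is the one gained by `∏ y_k` when `n_j` is lowered;
this is why `plusCoeff` contains that product. -/
lemma plusCoeff_mul_minusCoeff (hq0 : q ≠ 0) (hβ : ∀ i, β i ≠ 0) (i j : ι)
    (n : ι → ℤ) (hij : i ≠ j) :
    plusCoeff q β s i n * minusCoeff q β j (n + Pi.single i 1) =
      minusCoeff q β j n * plusCoeff q β s i (n + -Pi.single j 1) := by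
  have hQ : q ^ 2 ≠ 0 := pow_ne_zero 2 hq0
  have key := cross_scalar_identity hQ (specVal_ne_zero hq0 hβ n i) (specVal_ne_zero hq0 hβ n j)
  simp only [plusCoeff, minusCoeff, prod_specVal_sub hq0, specVal_sub_ne n hij,
    specVal_add_ne n hij.symm]
  rw [residueProd_eq (y' := specVal q β n) hij (fun _ _ => rfl),
    residueProd_eq (y' := specVal q β n) hij.symm (fun _ _ => rfl),
    residueProd_eq (y := specVal q β (n + Pi.single i 1)) (y' := specVal q β n) hij.symm
      (fun k hk => specVal_add_ne n hk),
    residueProd_eq (y := specVal q β (n + -Pi.single j 1)) (y' := specVal q β n) hij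
      (fun k hk => specVal_sub_ne n hk), specVal_add_self hq0, specVal_sub_self hq0]
  generalize residueProd₂ (specVal q β n) i j _ = R1
  generalize residueProd₂ (specVal q β n) j i _ = R2
  linear_combination (((q - q⁻¹) * (1 - q ^ 2))⁻¹ * (∏ k, specVal q β n k) *
    eval (specVal q β n i)⁻¹ (linProd s) * R1 * R2) * key

/-- The residues attached to `y_i` are the diagonal terms of `x⁺ x⁻`, those attached to `q² y_i` the
diagonal terms of `x⁻ x⁺`. This is the relation that ties `plusCoeff` and `minusCoeff` to `Z`. -/
lemma phi_sub_eq_sum_coeff (hq0 : q ≠ 0) (hq1 : q ^ 2 ≠ 1)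
    (hβ : ∀ i, β i ≠ 0) (hgen : IsGeneric q β) (hs : ∀ b ∈ s, b ≠ 0) {μ : ℤ}
    (hμ : (Multiset.card s : ℤ) = μ + 2 * Fintype.card ι) (m : ℤ) (n : ι → ℤ) :
    (q - q⁻¹)⁻¹ * (phiPlusVal q (specVal q β n) s m - phiMinusVal q (specVal q β n) s μ m) =
      ∑ i, (plusCoeff q β s i n * minusCoeff q β i (n + Pi.single i 1) * specVal q β n i ^ m -
        minusCoeff q β i n * plusCoeff q β s i (n + -Pi.single i 1) *
          specVal q β (n + -Pi.single i 1) i ^ m) := by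
  have hQ : q ^ 2 ≠ 0 := pow_ne_zero 2 hq0
  rw [phiPlusVal_sub_phiMinusVal hq0 (specVal_ne_zero hq0 hβ n) hs hμ, Finset.mul_sum]
  · refine Finset.sum_congr rfl fun i _ => ?_
    simp only [plusCoeff, minusCoeff, prod_specVal_sub hq0, specVal_add_self hq0,
      specVal_sub_self hq0, mul_inv_cancel_left₀ hQ, inv_mul_cancel_left₀ hQ]
    rw [residueProd_congr (y := specVal q β (n + Pi.single i 1)) (y' := specVal q β n)
        (fun k hk => specVal_add_ne n hk),
      residueProd_congr (y := specVal q β (n + -Pi.single i 1)) (y' := specVal q β n)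
        (fun k hk => specVal_sub_ne n hk)]
    -- The sign is that of the commutator, and `q²` comes from the product of the `y_k` after
    -- lowering.
    have e : (1 - (q ^ 2)⁻¹)⁻¹ = -(q ^ 2) * (1 - q ^ 2)⁻¹ := by
      have : 1 - (q ^ 2)⁻¹ = -(1 - q ^ 2) * (q ^ 2)⁻¹ := by field_simp; ring
      rw [this, mul_inv, inv_inv, inv_neg]; ring
    rw [e, mul_inv (q - q⁻¹)]
    ring
  · intro i j h
    by_contra hij
    exact hgen.specVal_ne hq0 n hij 0 (by simpa using h)
  · intro i j h
    rcases eq_or_ne i j with rfl | hij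
    · apply hq1
      exact (mul_right_cancel₀ (specVal_ne_zero hq0 hβ n i) ((one_mul _).trans h)).symm
    · exact hgen.specVal_ne hq0 n hij 1 (by simpa using h)

end GelfandTsetlin

/-! ### Multiplication operators against difference operators -/

section LmulShift

variable {ι I : Type*} [Fintype ι] [AddCommGroup I]

lemma lmul_apply_apply (f φ : I → ℂ) (n : I) : Algebra.lmul ℂ (I → ℂ) f φ n = f n * φ n := rfl

lemma lmul_mul_shiftOp {σ : ι → I} {c : ι → I → ℂ} {f : I → ℂ} {k : ℂ}
    (h : ∀ i n, f n = k * f (n + σ i)) :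
    Algebra.lmul ℂ (I → ℂ) f * shiftOp σ c = k • (shiftOp σ c * Algebra.lmul ℂ (I → ℂ) f) := by
  refine LinearMap.ext fun φ => funext fun n => ?_
  simp only [Module.End.mul_apply, LinearMap.smul_apply, Pi.smul_apply, lmul_apply_apply,
    shiftOp_apply, smul_eq_mul, Finset.mul_sum]
  exact Finset.sum_congr rfl fun i _ => by rw [h i n]; ring

lemma lmul_shiftOp_commutator {σ : ι → I} {c d : ι → I → ℂ} {f : I → ℂ} {k : ℂ}
    (h : ∀ i n, (f n - f (n + σ i)) * c i n = k * d i n) :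
    Algebra.lmul ℂ (I → ℂ) f * shiftOp σ c - shiftOp σ c * Algebra.lmul ℂ (I → ℂ) f =
      k • shiftOp σ d := by
  refine LinearMap.ext fun φ => funext fun n => ?_
  simp only [Module.End.mul_apply, LinearMap.smul_apply, Pi.smul_apply, lmul_apply_apply,
    shiftOp_apply, smul_eq_mul, Finset.mul_sum, LinearMap.sub_apply, Pi.sub_apply,
    ← Finset.sum_sub_distrib]
  exact Finset.sum_congr rfl fun i _ => by linear_combination φ (n + σ i) * h i n

lemma coeff_expSeries_lmul (c : ℕ → I → ℂ) (m : ℕ) :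
    PowerSeries.coeff m (expSeries (positiveSeries fun k => Algebra.lmul ℂ (I → ℂ) (c k))) =
      Algebra.lmul ℂ (I → ℂ)
        fun n => PowerSeries.coeff m (expSeries (positiveSeries fun k => c k n)) := by
  rw [← coeff_expSeries_map (Algebra.lmul ℂ (I → ℂ))]
  congr 1
  ext n
  exact coeff_expSeries_map (Pi.evalAlgHom ℂ (fun _ : I => ℂ) n) c m

end LmulShift

/-! ### The relations for the Gelfand-Tsetlin operators -/

section Representation

variable {ι : Type*} [Fintype ι] [DecidableEq ι] {q : ℂ} {β : ι → ℂ} {s : Multiset ℂ} {μ : ℤ}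

lemma phiPlusVal_zero (y : ι → ℂ) : phiPlusVal q y s 0 = ∏ i, y i := by
  have : seqZero (expSeries (positiveSeries fun k => hVal q y s k)) 0 = 1 :=
    (seqZero_natCast _ 0).trans (coeff_zero_expSeries _)
  rw [phiPlusVal, this, mul_one]

lemma phiMinusVal_self (y : ι → ℂ) : phiMinusVal q y s μ μ =
    (s.map fun b => -b).prod / ((q ^ 2) ^ Fintype.card ι * ∏ i, y i) := by
  have h := seqInfty_sub μ (expSeries (positiveSeries fun k => -hVal q y s (-(k : ℤ)))) 0
  rw [Nat.cast_zero, sub_zero, coeff_zero_expSeries] at h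
  rw [phiMinusVal, h, mul_one]

variable (q β s μ) in
/-- The operators of the Gelfand-Tsetlin representation. -/
def gtOp : Gen → Module.End ℂ ((ι → ℤ) → ℂ)
  | .xPlus r => shiftOp (fun i => Pi.single i 1) fun i n => specVal q β n i ^ r * plusCoeff q β s i n
  | .xMinus r => shiftOp (fun i => -Pi.single i 1)
      fun i n => (q ^ 2 * specVal q β n i) ^ r * minusCoeff q β i n
  | .phiPlus m => Algebra.lmul ℂ _ fun n => phiPlusVal q (specVal q β n) s m
  | .phiMinus m => Algebra.lmul ℂ _ fun n => phiMinusVal q (specVal q β n) s μ m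
  | .h m => Algebra.lmul ℂ _ fun n => (q - q⁻¹)⁻¹ * hVal q (specVal q β n) s m
  | .phiPlusInv => Algebra.lmul ℂ _ fun n => (phiPlusVal q (specVal q β n) s 0)⁻¹
  | .phiMinusInv => Algebra.lmul ℂ _ fun n => (phiMinusVal q (specVal q β n) s μ μ)⁻¹

/-- One shift changes a single `y_i` to `q⁻² y_i`, and `(1 + q^{2m})(1 - q^{-2m}) = q^{2m} -
q^{-2m}`, the numerator of `[2m]_q`. -/
lemma hVal_sub_add (hq0 : q ≠ 0) (n : ι → ℤ) (i : ι) (m : ℤ) :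
    hVal q (specVal q β n) s m - hVal q (specVal q β (n + Pi.single i 1)) s m =
      ((q ^ 2) ^ m - (q ^ 2) ^ (-m)) / m * specVal q β n i ^ m := by
  have hQ : (q ^ 2) ^ m ≠ 0 := zpow_ne_zero _ (pow_ne_zero 2 hq0)
  have e : pSum (family (specVal q β n)) m - pSum (family (specVal q β (n + Pi.single i 1))) m =
      (1 - ((q ^ 2) ^ m)⁻¹) * specVal q β n i ^ m := by
    rw [pSum_family, pSum_family, ← Finset.sum_sub_distrib, Finset.sum_eq_single i]
    · rw [specVal_add_self hq0, mul_zpow, inv_zpow]; ring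
    · intro j _ hj
      rw [specVal_add_ne n hj, sub_self]
    · exact fun h => absurd (Finset.mem_univ i) h
  rw [hVal, hVal, ← sub_div, sub_sub_sub_cancel_right, ← mul_sub, e, zpow_neg]
  field_simp
  ring

lemma hVal_sub_sub (hq0 : q ≠ 0) (n : ι → ℤ) (i : ι) (m : ℤ) :
    hVal q (specVal q β n) s m - hVal q (specVal q β (n + -Pi.single i 1)) s m =
      -(((q ^ 2) ^ m - (q ^ 2) ^ (-m)) / m * (q ^ 2 * specVal q β n i) ^ m) := by
  have h := hVal_sub_add (β := β) (s := s) hq0 (n + -Pi.single i 1) i m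
  rw [neg_add_cancel_right, specVal_sub_self hq0] at h
  linear_combination -h

lemma qInt_two_mul (m : ℤ) :
    qInt q (2 * m) = (q - q⁻¹)⁻¹ * ((q ^ 2) ^ m - (q ^ 2) ^ (-m)) := by
  have h : ∀ k : ℤ, q ^ (2 * k) = (q ^ 2) ^ k := fun k => by
    rw [zpow_mul]; norm_cast
  rw [qInt, h, ← mul_neg, h, div_eq_inv_mul]

/-- The Gelfand-Tsetlin operators satisfy the relations of the shifted quantum affine algebra. -/
lemma gtOp_rel (hq0 : q ≠ 0) (hq : ∀ n : ℕ, 0 < n → q ^ n ≠ 1) (hβ : ∀ i, β i ≠ 0)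
    (hgen : IsGeneric q β) (hs : ∀ b ∈ s, b ≠ 0)
    (hμ : (Multiset.card s : ℤ) = μ + 2 * Fintype.card ι) {u v : FreeAlgebra ℂ Gen}
    (huv : Rel q μ u v) :
    FreeAlgebra.lift ℂ (gtOp q β s μ) u = FreeAlgebra.lift ℂ (gtOp q β s μ) v := by
  have hqq := q_sub_inv_ne_zero hq0 hq
  have hQ : q ^ 2 ≠ 0 := pow_ne_zero 2 hq0
  have hz : q ^ (2 : ℤ) = q ^ 2 := by norm_cast
  have hz' : q ^ (-2 : ℤ) = (q ^ 2)⁻¹ := by rw [zpow_neg, hz]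
  have hy := specVal_ne_zero (β := β) hq0 hβ
  have hP : ∀ n, phiPlusVal q (specVal q β n) s 0 ≠ 0 := fun n => by
    rw [phiPlusVal_zero]; exact Finset.prod_ne_zero_iff.2 fun i _ => hy n i
  have hM : ∀ n, phiMinusVal q (specVal q β n) s μ μ ≠ 0 := fun n => by
    rw [phiMinusVal_self]
    refine div_ne_zero (Multiset.prod_ne_zero ?_) (mul_ne_zero (pow_ne_zero _ hQ)
      (Finset.prod_ne_zero_iff.2 fun i _ => hy n i))
    simpa using fun h => hs 0 h rfl
  have hinv : ∀ f : (ι → ℤ) → ℂ, (∀ n, f n ≠ 0) → Algebra.lmul ℂ _ f * Algebra.lmul ℂ _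
      (fun n => (f n)⁻¹) = 1 := fun f hf => by
    rw [← map_mul, ← map_one (Algebra.lmul ℂ ((ι → ℤ) → ℂ))]
    congr 1
    exact funext fun n => mul_inv_cancel₀ (hf n)
  have hcomm : ∀ f g : (ι → ℤ) → ℂ, Algebra.lmul ℂ _ f * Algebra.lmul ℂ _ g =
      Algebra.lmul ℂ _ g * Algebra.lmul ℂ _ f := fun f g => by
    rw [← map_mul, mul_comm, map_mul]
  have hzero : ∀ f : (ι → ℤ) → ℂ, (∀ n, f n = 0) → Algebra.lmul ℂ _ f = 0 := fun f hf => by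
    rw [← map_zero (Algebra.lmul ℂ ((ι → ℤ) → ℂ))]
    exact congrArg _ (funext hf)
  cases huv with
  | h_zero =>
    rw [FreeAlgebra.lift_ι_apply, map_zero]
    exact hzero _ fun n => by simp [hVal]
  | phiPlus_inv_right =>
    simp only [map_mul, map_one, FreeAlgebra.lift_ι_apply]
    exact hinv _ hP
  | phiPlus_inv_left =>
    simp only [map_mul, map_one, FreeAlgebra.lift_ι_apply]
    exact (hcomm _ _).trans (hinv _ hP)
  | phiMinus_inv_right =>
    simp only [map_mul, map_one, FreeAlgebra.lift_ι_apply]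
    exact hinv _ hM
  | phiMinus_inv_left =>
    simp only [map_mul, map_one, FreeAlgebra.lift_ι_apply]
    exact (hcomm _ _).trans (hinv _ hM)
  | phiPlus_neg m hm =>
    rw [FreeAlgebra.lift_ι_apply, map_zero]
    exact hzero _ fun n => by rw [phiPlusVal, seqZero_neg _ hm, mul_zero]
  | phiPlus_exp m =>
    rw [map_mul, coeff_expSeries_map]
    simp only [map_smul, FreeAlgebra.lift_ι_apply, gtOp]
    simp only [← map_smul]
    rw [coeff_expSeries_lmul, ← map_mul]
    congr 1
    ext n
    simp only [Pi.mul_apply, Pi.smul_apply, smul_eq_mul, mul_inv_cancel_left₀ hqq]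
    rw [phiPlusVal_zero, phiPlusVal, seqZero_natCast]
  | phiMinus_big m hm =>
    rw [FreeAlgebra.lift_ι_apply, map_zero]
    exact hzero _ fun n => by rw [phiMinusVal, seqInfty_big _ _ hm, mul_zero]
  | phiMinus_exp m =>
    rw [map_mul, coeff_expSeries_map]
    simp only [map_smul, FreeAlgebra.lift_ι_apply, gtOp]
    simp only [← map_smul]
    rw [coeff_expSeries_lmul, ← map_mul]
    congr 1
    ext n
    simp only [Pi.mul_apply, Pi.smul_apply, smul_eq_mul, neg_mul, mul_inv_cancel_left₀ hqq]
    rw [phiMinusVal_self, phiMinusVal, seqInfty_sub]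
  | phiPlus_comm r s =>
    simp only [map_mul, FreeAlgebra.lift_ι_apply]
    exact hcomm _ _
  | phiMinus_comm r s =>
    simp only [map_mul, FreeAlgebra.lift_ι_apply]
    exact hcomm _ _
  | phiPlus_phiMinus_comm r s =>
    simp only [map_mul, FreeAlgebra.lift_ι_apply]
    exact hcomm _ _
  | phiPlus_xPlus r =>
    simp only [map_mul, map_smul, FreeAlgebra.lift_ι_apply]
    refine lmul_mul_shiftOp fun i n => ?_
    rw [phiPlusVal_zero, phiPlusVal_zero, prod_specVal_add hq0, hz, mul_inv_cancel_left₀ hQ]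
  | phiPlus_xMinus r =>
    simp only [map_mul, map_smul, FreeAlgebra.lift_ι_apply]
    refine lmul_mul_shiftOp fun i n => ?_
    rw [phiPlusVal_zero, phiPlusVal_zero, prod_specVal_sub hq0, hz', inv_mul_cancel_left₀ hQ]
  | phiMinus_xPlus r =>
    simp only [map_mul, map_smul, FreeAlgebra.lift_ι_apply]
    refine lmul_mul_shiftOp fun i n => ?_
    rw [phiMinusVal_self, phiMinusVal_self, prod_specVal_add hq0, hz']
    field_simp
  | phiMinus_xMinus r =>
    simp only [map_mul, map_smul, FreeAlgebra.lift_ι_apply]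
    refine lmul_mul_shiftOp fun i n => ?_
    rw [phiMinusVal_self, phiMinusVal_self, prod_specVal_sub hq0, hz]
    field_simp
  | h_xPlus m r hm =>
    simp only [map_sub, map_mul, map_smul, FreeAlgebra.lift_ι_apply]
    refine lmul_shiftOp_commutator fun i n => ?_
    rw [← mul_sub, hVal_sub_add hq0, qInt_two_mul, zpow_add₀ (hy n i)]
    ring
  | h_xMinus m r hm =>
    simp only [map_sub, map_mul, map_smul, FreeAlgebra.lift_ι_apply]
    refine lmul_shiftOp_commutator fun i n => ?_
    rw [← mul_sub, hVal_sub_sub hq0, qInt_two_mul, zpow_add₀ (mul_ne_zero hQ (hy n i))]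
    ring
  | xPlus_xMinus r t =>
    simp only [map_sub, map_mul, map_smul, FreeAlgebra.lift_ι_apply]
    refine (shiftOp_commutator (σ := fun i => Pi.single i 1) (c := plusCoeff q β s)
      (d := minusCoeff q β) (e := fun i n => specVal q β n i)
      (e' := fun i n => q ^ 2 * specVal q β n i)
      (f := fun m n => (q - q⁻¹)⁻¹ * (phiPlusVal q (specVal q β n) s m -
        phiMinusVal q (specVal q β n) s μ m)) (fun i j n hij => specVal_sub_ne n hij)
      (fun i j n hij => ?_) (fun i n => ?_) (fun i n => hy n i)
      (plusCoeff_mul_minusCoeff hq0 hβ) (phi_sub_eq_sum_coeff hq0 (hq 2 two_pos) hβ hgen hs hμ)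
      (x := fun r => gtOp q β s μ (.xPlus r)) (y := fun r => gtOp q β s μ (.xMinus r))
      (fun r => rfl) (fun r => rfl) r t).trans ?_
    · rw [specVal_add_ne n hij.symm]
    · rw [specVal_add_self hq0, mul_inv_cancel_left₀ hQ]
    · simp only [gtOp]
      rw [← map_sub, ← map_smul]
      rfl
  | xPlus_quad r t =>
    simp only [map_sub, map_mul, map_smul, FreeAlgebra.lift_ι_apply, hz]
    exact shiftOp_quadratic (σ := fun i => Pi.single i 1) (c := plusCoeff q β s)
      (e := fun i n => specVal q β n i) hQ (fun i n => hy n i)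
      (fun i n => specVal_add_self hq0 n i) (fun i j n hij => specVal_add_ne n hij.symm)
      (plusCoeff_antisymm hq0 hβ hgen) (x := fun r => gtOp q β s μ (.xPlus r)) (fun r => rfl) r t
  | xMinus_quad r t =>
    simp only [map_sub, map_mul, map_smul, FreeAlgebra.lift_ι_apply, hz']
    exact shiftOp_quadratic (σ := fun i => -Pi.single i 1) (c := minusCoeff q β)
      (e := fun i n => q ^ 2 * specVal q β n i) (inv_ne_zero hQ)
      (fun i n => mul_ne_zero hQ (hy n i))
      (fun i n => by rw [inv_inv, specVal_sub_self hq0])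
      (fun i j n hij => by rw [specVal_sub_ne n hij.symm])
      (minusCoeff_antisymm hq0 hβ hgen) (x := fun r => gtOp q β s μ (.xMinus r)) (fun r => rfl) r t

end Representation

/-! ### Truncation and the vacuum of a Gelfand-Tsetlin representation -/

section GTVacuum

variable {ι : Type*} [Fintype ι] [DecidableEq ι] {q : ℂ} {β : ι → ℂ} {s : Multiset ℂ} {μ : ℤ}

/-- The Gelfand-Tsetlin representation. -/
lemma exists_gtRep (hq0 : q ≠ 0) (hq : ∀ n : ℕ, 0 < n → q ^ n ≠ 1) (hβ : ∀ i, β i ≠ 0)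
    (hgen : IsGeneric q β) (hs : ∀ b ∈ s, b ≠ 0)
    (hμ : (Multiset.card s : ℤ) = μ + 2 * Fintype.card ι) :
    ∃ ρ : ShiftedAlg q μ →ₐ[ℂ] Module.End ℂ ((ι → ℤ) → ℂ),
      ∀ g, ρ (gen q μ g) = gtOp q β s μ g :=
  ⟨RingQuot.liftAlgHom ℂ ⟨FreeAlgebra.lift ℂ (gtOp q β s μ),
    fun _ _ h => gtOp_rel hq0 hq hβ hgen hs hμ h⟩, fun g => by
    refine (RingQuot.liftAlgHom_mkAlgHom_apply ℂ _ _ _).trans ?_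
    exact FreeAlgebra.lift_ι_apply _ _⟩

/-- The scalar `q^{-m} C̃(q^m) = (1 + q^{2m})⁻¹` undoes the factor in `hVal`, and the power sums of
`Z` cancel, so the exponent is `-∑ y_i^m / m`: the series is diagonal with a polynomial eigenvalue
of degree `a`. -/
lemma gtRep_aSeries (hq0 : q ≠ 0) (hq : ∀ n : ℕ, 0 < n → q ^ n ≠ 1)
    {ρ : ShiftedAlg q μ →ₐ[ℂ] Module.End ℂ ((ι → ℤ) → ℂ)}
    (hρ : ∀ g, ρ (gen q μ g) = gtOp q β s μ g) (k : ℕ) :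
    ρ (PowerSeries.coeff k (aSeries q μ (pSum s))) =
      Algebra.lmul ℂ _ fun n => (linProd (family (specVal q β n))).coeff k := by
  have hqq := q_sub_inv_ne_zero hq0 hq
  rw [aSeries, coeff_expSeries_map]
  have : ∀ m : ℕ, 0 < m → ρ ((-(q⁻¹ ^ m * invCartan q m)) •
      ((q - q⁻¹) • gen q μ (.h m) + algebraMap ℂ _ (pSum s m / m))) =
      Algebra.lmul ℂ _ fun n => -(pSum (family (specVal q β n)) m / m) := fun m hm => by
    rw [map_smul, map_add, map_smul, hρ, AlgHom.commutes, gtOp,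
      ← AlgHom.commutes (Algebra.lmul ℂ ((ι → ℤ) → ℂ)), ← map_smul, ← map_add, ← map_smul]
    congr 1
    ext n
    have h1 := one_add_q_sq_pow_ne_zero hq hm
    have h2 : q⁻¹ ^ m * invCartan q m = (1 + (q ^ 2) ^ m)⁻¹ := by
      rw [invCartan, inv_pow, ← mul_inv]
      congr 1
      have : q ^ m ≠ 0 := pow_ne_zero _ hq0
      field_simp
      ring
    rw [h2]
    simp only [Pi.smul_apply, Pi.add_apply, smul_eq_mul, Pi.algebraMap_apply, Algebra.algebraMap_self,
      RingHom.id_apply, mul_inv_cancel_left₀ hqq, hVal, zpow_natCast, Int.cast_natCast]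
    rw [← add_div, sub_add_cancel]
    field_simp
  rw [positiveSeries_congr this, coeff_expSeries_lmul]
  congr 1
  ext n
  rw [← coe_linProd, Polynomial.coeff_coe]

/-- At infinity the same cancellation leaves the power sums of the `y_i⁻¹`. -/
lemma gtRep_bSeries (hq0 : q ≠ 0) (hq : ∀ n : ℕ, 0 < n → q ^ n ≠ 1)
    {ρ : ShiftedAlg q μ →ₐ[ℂ] Module.End ℂ ((ι → ℤ) → ℂ)}
    (hρ : ∀ g, ρ (gen q μ g) = gtOp q β s μ g) (k : ℕ) :
    ρ (PowerSeries.coeff k (bSeries q μ (pSum s))) =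
      Algebra.lmul ℂ _ fun n =>
        (linProd ((family (specVal q β n)).map fun b => b⁻¹)).coeff k := by
  have hqq := q_sub_inv_ne_zero hq0 hq
  rw [bSeries, coeff_expSeries_map]
  have : ∀ m : ℕ, 0 < m → ρ ((q ^ m * invCartan q m) •
      ((q - q⁻¹) • gen q μ (.h (-(m : ℤ))) - algebraMap ℂ _ (pSum s (-(m : ℤ)) / m))) =
      Algebra.lmul ℂ _ fun n => -(pSum ((family (specVal q β n)).map fun b => b⁻¹) m / m) :=
      fun m hm => by
    rw [map_smul, map_sub, map_smul, hρ, AlgHom.commutes, gtOp,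
      ← AlgHom.commutes (Algebra.lmul ℂ ((ι → ℤ) → ℂ)), ← map_smul, ← map_sub, ← map_smul]
    congr 1
    ext n
    have h1 := one_add_q_sq_pow_ne_zero hq hm
    have h0 : (q ^ 2) ^ m ≠ 0 := pow_ne_zero _ (pow_ne_zero 2 hq0)
    have h2 : q ^ m * invCartan q m = (1 + ((q ^ 2) ^ m)⁻¹)⁻¹ := by
      rw [invCartan, ← inv_inv (q ^ m), ← mul_inv, inv_inv]
      congr 1
      have : q ^ m ≠ 0 := pow_ne_zero _ hq0
      field_simp
      ring
    have h3 : 1 + ((q ^ 2) ^ m)⁻¹ ≠ 0 := fun h => h1 (by field_simp at h; linear_combination h)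
    rw [h2, pSum_inv]
    simp only [Pi.smul_apply, Pi.sub_apply, smul_eq_mul, Pi.algebraMap_apply, Algebra.algebraMap_self,
      RingHom.id_apply, mul_inv_cancel_left₀ hqq, hVal, zpow_neg, zpow_natCast, Int.cast_natCast,
      Int.cast_neg]
    rw [div_neg, ← neg_div, ← sub_div, neg_sub, sub_sub_cancel_left, ← mul_neg, mul_div_assoc,
      inv_mul_cancel_left₀ h3, neg_div]
  rw [positiveSeries_congr this, coeff_expSeries_lmul]
  congr 1
  ext n
  rw [← coe_linProd, Polynomial.coeff_coe]

/-- From `∏ (1 - b z) = ∏ (-b z) ∏ (1 - b⁻¹ z⁻¹)`. This reversal is the source of the relation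
between `A⁺` and `A⁻`. -/
lemma coeff_linProd_eq (t : Multiset ℂ) (ht : ∀ b ∈ t, b ≠ 0) {k : ℕ} (hk : k ≤ Multiset.card t) :
    (linProd t).coeff k = (t.map fun b => -b).prod *
      (linProd (t.map fun b => b⁻¹)).coeff (Multiset.card t - k) := by
  have h1 := act_linProd_seqInfty t ht 0 1
  rw [seqInfty_zero_one, mul_one, zero_add] at h1
  have h2 := congrFun h1 k
  have e : (k : ℤ) = (Multiset.card t : ℤ) - ((Multiset.card t - k : ℕ) : ℤ) := by omega
  rw [act_unitSeq, Pi.smul_apply, e, seqInfty_sub, Polynomial.coeff_coe, smul_eq_mul] at h2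
  exact h2

/-- Functions supported on the nonnegative orthant. -/
def orthantSupported (ι : Type*) : Submodule ℂ ((ι → ℤ) → ℂ) where
  carrier := {φ | ∀ n, ¬ 0 ≤ n → φ n = 0}
  zero_mem' := fun _ _ => rfl
  add_mem' := fun ha hb n hn => by rw [Pi.add_apply, ha n hn, hb n hn, add_zero]
  smul_mem' := fun c φ hφ n hn => by rw [Pi.smul_apply, hφ n hn, smul_zero]

/-- The value of `x⁻ φ` at `n` uses `φ` at `n - e_i` only, and if that point is in the orthant then
so is `n`. -/
lemma gtRep_neg_mem {ρ : ShiftedAlg q μ →ₐ[ℂ] Module.End ℂ ((ι → ℤ) → ℂ)}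
    (hρ : ∀ g, ρ (gen q μ g) = gtOp q β s μ g) {x : ShiftedAlg q μ} (hx : x ∈ negAlg q μ) :
    ∀ φ ∈ orthantSupported ι, ρ x φ ∈ orthantSupported ι := by
  induction hx using Algebra.adjoin_induction with
  | mem y hy =>
    obtain ⟨r, rfl⟩ := hy
    intro φ hφ n hn
    rw [hρ, gtOp, shiftOp_apply]
    refine Finset.sum_eq_zero fun i _ => ?_
    rw [hφ, mul_zero]
    intro h
    refine hn (h.trans ?_)
    rw [add_le_iff_nonpos_right, neg_nonpos]
    exact Pi.single_nonneg.2 zero_le_one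
  | algebraMap c =>
    intro φ hφ
    rw [AlgHom.commutes]
    exact Submodule.smul_mem _ c hφ
  | add a b _ _ ha hb =>
    intro φ hφ
    rw [map_add]
    exact add_mem (ha φ hφ) (hb φ hφ)
  | mul a b _ _ ha hb =>
    intro φ hφ
    rw [map_mul]
    exact ha _ (hb φ hφ)

/-- The vacuum functional of a Gelfand-Tsetlin representation. -/
lemma exists_gtVacuum (hq0 : q ≠ 0) (hq : ∀ n : ℕ, 0 < n → q ^ n ≠ 1) (hβ : ∀ i, β i ≠ 0)
    (hgen : IsGeneric q β) (hs : ∀ b ∈ s, b ≠ 0)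
    (hμ : (Multiset.card s : ℤ) = μ + 2 * Fintype.card ι) (hsβ : ∀ i, q ^ 2 * β i ∈ s) :
    ∃ χ : ShiftedAlg q μ →ₗ[ℂ] ℂ, IsVacuum χ (phiPlusVal q β s) (phiMinusVal q β s μ) ∧
      (∀ k, Fintype.card ι < k → ∀ Y X,
        χ (Y * PowerSeries.coeff k (aSeries q μ (pSum s)) * X) = 0) ∧
      (∀ k, Fintype.card ι < k → ∀ Y X,
        χ (Y * PowerSeries.coeff k (bSeries q μ (pSum s)) * X) = 0) ∧
      ∀ k, k ≤ Fintype.card ι → ∀ Y X,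
        χ (Y * PowerSeries.coeff k (aSeries q μ (pSum s)) * X) = (-1) ^ Fintype.card ι *
          χ (Y * (gen q μ (.phiPlus 0) *
            PowerSeries.coeff (Fintype.card ι - k) (bSeries q μ (pSum s))) * X) := by
  obtain ⟨ρ, hρ⟩ := exists_gtRep hq0 hq hβ hgen hs hμ
  have hy := specVal_ne_zero (β := β) hq0 hβ
  have hQ : q ^ 2 ≠ 0 := pow_ne_zero 2 hq0
  let δ : (ι → ℤ) → ℂ := Pi.single 0 1
  have hδ : ∀ (f : (ι → ℤ) → ℂ), Algebra.lmul ℂ _ f δ = f 0 • δ := fun f => by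
    ext n
    rw [lmul_apply_apply, Pi.smul_apply, smul_eq_mul]
    rcases eq_or_ne n 0 with rfl | hn
    · rfl
    · simp [δ, Pi.single_eq_of_ne hn]
  have hδ' : δ ∈ orthantSupported ι := fun n hn => Pi.single_eq_of_ne (fun h => hn (by rw [h])) _
  let χ : ShiftedAlg q μ →ₗ[ℂ] ℂ :=
    ((LinearMap.proj 0 : ((ι → ℤ) → ℂ) →ₗ[ℂ] ℂ).comp (LinearMap.applyₗ δ)).comp ρ.toLinearMap
  have hχ : ∀ X, χ X = ρ X δ 0 := fun X => rfl
  have hmul : ∀ (g : Gen) (f : (ι → ℤ) → ℂ), gtOp q β s μ g = Algebra.lmul ℂ _ f → ∀ Y,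
      χ (Y * gen q μ g) = f 0 * χ Y := fun g f hg Y => by
    rw [hχ, hχ, map_mul, hρ, hg, Module.End.mul_apply, hδ, map_smul]
    rfl
  have hzero : ∀ y, ρ y = 0 → ∀ Y X, χ (Y * y * X) = 0 := fun y h Y X => by
    rw [hχ, map_mul, map_mul, h, mul_zero, zero_mul]
    rfl
  refine ⟨χ, ⟨?_, fun Y r => ?_, fun r n hn => ?_, fun Y m => ?_, fun Y m => ?_⟩,
    fun k hk => hzero _ ?_, fun k hk => hzero _ ?_, fun k hk Y X => ?_⟩
  · rw [hχ, map_one]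
    exact Pi.single_eq_same _ _
  -- The function `x⁺ δ` could only live at the points `-e_i`, where the `i`-th eigenvalue is `q²
  -- β_i` and the coefficient contains `Z((q² β_i)⁻¹) = 0`.
  · have h0 : ρ (gen q μ (.xPlus r)) δ = 0 := by
      ext n
      rw [hρ, gtOp, shiftOp_apply]
      refine Finset.sum_eq_zero fun i _ => ?_
      rcases eq_or_ne (n + Pi.single i 1) 0 with h | h
      · have hn : n = 0 + -Pi.single i 1 := by rw [zero_add]; exact eq_neg_of_add_eq_zero_left h
        have : (linProd s).eval (specVal q β n i)⁻¹ = 0 := by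
          rw [hn, specVal_sub_self hq0, specVal_zero]
          refine isRoot_of_mem_roots ?_
          rw [roots_linProd s hs]
          exact Multiset.mem_map_of_mem _ (hsβ i)
        rw [plusCoeff, this]
        ring
      · rw [show δ (n + Pi.single i 1) = 0 from Pi.single_eq_of_ne h _, mul_zero]
    rw [hχ, map_mul, Module.End.mul_apply, h0, map_zero]
    rfl
  · rw [hχ, map_mul, Module.End.mul_apply, hρ, gtOp, shiftOp_apply]
    refine Finset.sum_eq_zero fun i _ => ?_
    -- The value at `0` involves a function supported on the orthant at the point `-e_i`, outside
    -- it.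
    rw [gtRep_neg_mem hρ hn δ hδ', mul_zero]
    intro h
    have := h i
    simp at this
  · rw [hmul _ _ rfl, specVal_zero]
  · rw [hmul _ _ rfl, specVal_zero]
  · rw [gtRep_aSeries hq0 hq hρ, ← map_zero (Algebra.lmul ℂ ((ι → ℤ) → ℂ))]
    congr 1
    ext n
    refine coeff_eq_zero_of_natDegree_lt ?_
    rwa [natDegree_linProd _ (family_ne_zero (hy n)), card_family]
  · rw [gtRep_bSeries hq0 hq hρ, ← map_zero (Algebra.lmul ℂ ((ι → ℤ) → ℂ))]
    congr 1
    ext n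
    refine coeff_eq_zero_of_natDegree_lt ?_
    rwa [map_family, natDegree_linProd _ (family_ne_zero fun i => inv_ne_zero (hy n i)),
      card_family]
  -- An identity of diagonal operators: `∏ (-y_i) = (-1)^a ∏ y_i`, and `∏ y_i` is the eigenvalue of
  -- `φ⁺_0`.
  · have h0 : ρ (PowerSeries.coeff k (aSeries q μ (pSum s))) = (-1 : ℂ) ^ Fintype.card ι •
        ρ (gen q μ (.phiPlus 0) *
          PowerSeries.coeff (Fintype.card ι - k) (bSeries q μ (pSum s))) := by
      rw [map_mul, gtRep_aSeries hq0 hq hρ, gtRep_bSeries hq0 hq hρ, hρ, gtOp, ← map_mul,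
        ← map_smul]
      congr 1
      ext n
      rw [coeff_linProd_eq _ (family_ne_zero (hy n)) (by rwa [card_family]), card_family,
        prod_map_family, Pi.smul_apply, Pi.mul_apply, phiPlusVal_zero, smul_eq_mul, ← mul_assoc]
      congr 1
      rw [Finset.prod_neg, Finset.card_univ]
    rw [hχ, hχ, map_mul, map_mul, h0, map_mul (f := ρ) (x := Y * _), map_mul (f := ρ) (x := Y),
      mul_smul_comm, smul_mul_assoc]
    rfl

end GTVacuum

/-! ## Deformation to generic parameters -/

section Deformation

open Filter Topology

/-- Each coefficient of `exp F` is a polynomial in finitely many coefficients of `F`. -/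
lemma tendsto_coeff_expSeries {T : Type*} {l : Filter T} {F : T → PowerSeries ℂ}
    {F₀ : PowerSeries ℂ}
    (h : ∀ k, Tendsto (fun t => PowerSeries.coeff k (F t)) l (𝓝 (PowerSeries.coeff k F₀))) (m : ℕ) :
    Tendsto (fun t => PowerSeries.coeff m (expSeries (F t))) l
      (𝓝 (PowerSeries.coeff m (expSeries F₀))) := by
  have hp : ∀ n m, Tendsto (fun t => PowerSeries.coeff m (F t ^ n)) l
      (𝓝 (PowerSeries.coeff m (F₀ ^ n))) := fun n => by
    induction n with
    | zero => intro m; simp only [pow_zero]; exact tendsto_const_nhds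
    | succ n ih =>
      intro m
      simp only [pow_succ, PowerSeries.coeff_mul]
      exact tendsto_finsetSum _ fun i _ => (ih _).mul (h _)
  simp only [coeff_expSeries, smul_eq_mul]
  exact tendsto_finsetSum _ fun n _ => (hp n m).const_mul _

lemma tendsto_coeff_expSeries_positiveSeries {T : Type*} {l : Filter T} {c : T → ℕ → ℂ} {c₀ : ℕ → ℂ}
    (h : ∀ k, 0 < k → Tendsto (fun t => c t k) l (𝓝 (c₀ k))) (m : ℕ) :
    Tendsto (fun t => PowerSeries.coeff m (expSeries (positiveSeries (c t)))) l
      (𝓝 (PowerSeries.coeff m (expSeries (positiveSeries c₀)))) := by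
  refine tendsto_coeff_expSeries (fun k => ?_) m
  simp only [coeff_positiveSeries]
  split_ifs with hk
  · exact tendsto_const_nhds
  · exact h k (Nat.pos_of_ne_zero hk)

variable {a : ℕ} {q : ℂ} {β : Fin a → ℂ} {μ : ℤ}

/-- The deformed parameters. -/
def deform (β : Fin a → ℂ) (t : ℂ) (i : Fin a) : ℂ := β i * (1 + (i : ℕ) * t)

lemma tendsto_deform (β : Fin a → ℂ) (i : Fin a) :
    Tendsto (fun t => deform β t i) (𝓝 0) (𝓝 (β i)) := by
  have : Continuous fun t => deform β t i := by unfold deform; fun_prop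
  simpa [deform] using this.tendsto 0

/-- Each forbidden coincidence is an affine equation in `t`. It is never an identity: equality of
the parameters `β_i q^{2k}` and `β_j`, together with equal slopes, forces `i = j`, which is why the
slopes `β_i · i` have distinct multipliers. -/
lemma countable_not_generic (hβ : ∀ i, β i ≠ 0) :
    {t : ℂ | ¬ ((∀ i, deform β t i ≠ 0) ∧ IsGeneric q (deform β t))}.Countable := by
  have hlin : ∀ b c : ℂ, ¬ (b = 0 ∧ c = 0) → {t : ℂ | b + c * t = 0}.Countable := fun b c h => by
    refine Set.Subsingleton.countable fun t ht t' ht' => ?_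
    have hc : c ≠ 0 := fun hc => h ⟨by simpa [hc] using ht, hc⟩
    have : b + c * t = b + c * t' := ht.trans ht'.symm
    exact mul_left_cancel₀ hc (add_left_cancel this)
  have h1 : (⋃ i : Fin a, {t : ℂ | β i + β i * (i : ℕ) * t = 0}).Countable :=
    Set.countable_iUnion fun i => hlin _ _ fun h => hβ i h.1
  have h2 : (⋃ i : Fin a, ⋃ j : Fin a, ⋃ _ : i ≠ j, ⋃ k : ℤ,
      {t : ℂ | (β i * (q ^ 2) ^ k - β j) +
        (β i * (q ^ 2) ^ k * (i : ℕ) - β j * (j : ℕ)) * t = 0}).Countable :=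
    Set.countable_iUnion fun i => Set.countable_iUnion fun j => Set.countable_iUnion fun hij =>
      Set.countable_iUnion fun k => hlin _ _ fun ⟨e1, e2⟩ => hij <| by
        rw [sub_eq_zero.1 e1, ← mul_sub, mul_eq_zero, or_iff_right (hβ j), sub_eq_zero] at e2
        exact Fin.ext (by exact_mod_cast e2)
  refine (h1.union h2).mono fun t ht => ?_
  simp only [Set.mem_ofPred_eq, not_and_or, IsGeneric] at ht
  push Not at ht
  rcases ht with ⟨i, hi⟩ | ⟨i, j, hij, k, e⟩
  · refine Or.inl (Set.mem_iUnion.2 ⟨i, ?_⟩)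
    rw [Set.mem_ofPred_eq, ← hi, deform]
    ring
  · refine Or.inr ?_
    simp only [Set.mem_iUnion]
    refine ⟨i, j, hij, k, ?_⟩
    simp only [deform] at e
    rw [Set.mem_ofPred_eq]
    linear_combination e

variable (q β) in
/-- The inverses of the zeros of `Z(z) = W(q² z) R(z)`, where `W(z) = ∏ (1 - β_i z)`. -/
def zeroSet (r : Multiset ℂ) : Multiset ℂ := (family fun i => q ^ 2 * β i) + r

lemma zeroSet_ne_zero (hq0 : q ≠ 0) (hβ : ∀ i, β i ≠ 0) {r : Multiset ℂ} (hr : ∀ b ∈ r, b ≠ 0) :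
    ∀ b ∈ zeroSet q β r, b ≠ 0 := fun b hb => by
  rcases Multiset.mem_add.1 hb with h | h
  exacts [family_ne_zero (fun i => mul_ne_zero (pow_ne_zero 2 hq0) (hβ i)) b h, hr b h]

/-! ### Continuity of the eigenvalues in the parameters -/

section Limits

variable {T : Type*} {l : Filter T} {βt : T → Fin a → ℂ}

lemma tendsto_pSum_family (hβ : ∀ i, β i ≠ 0)
    (ht : ∀ i, Tendsto (fun t => βt t i) l (𝓝 (β i))) (m : ℤ) :
    Tendsto (fun t => pSum (family (βt t)) m) l (𝓝 (pSum (family β) m)) := by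
  simp only [pSum_family]
  exact tendsto_finsetSum _ fun i _ => (ht i).zpow₀ m (Or.inl (hβ i))

lemma tendsto_pSum_zeroSet (hβ : ∀ i, β i ≠ 0)
    (ht : ∀ i, Tendsto (fun t => βt t i) l (𝓝 (β i))) (r : Multiset ℂ) (m : ℤ) :
    Tendsto (fun t => pSum (zeroSet q (βt t) r) m) l (𝓝 (pSum (zeroSet q β r) m)) := by
  simp only [zeroSet, pSum_add, pSum_family_mul]
  exact ((tendsto_pSum_family hβ ht m).const_mul _).add_const _

lemma tendsto_hVal (hβ : ∀ i, β i ≠ 0)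
    (ht : ∀ i, Tendsto (fun t => βt t i) l (𝓝 (β i))) (r : Multiset ℂ) (m : ℤ) :
    Tendsto (fun t => hVal q (βt t) (zeroSet q (βt t) r) m) l
      (𝓝 (hVal q β (zeroSet q β r) m)) := by
  unfold hVal
  exact (((tendsto_pSum_family hβ ht m).const_mul _).sub
    (tendsto_pSum_zeroSet hβ ht r m)).div_const _

lemma tendsto_phiPlusVal (hβ : ∀ i, β i ≠ 0)
    (ht : ∀ i, Tendsto (fun t => βt t i) l (𝓝 (β i))) (r : Multiset ℂ) (m : ℤ) :
    Tendsto (fun t => phiPlusVal q (βt t) (zeroSet q (βt t) r) m) l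
      (𝓝 (phiPlusVal q β (zeroSet q β r) m)) := by
  unfold phiPlusVal seqZero
  refine (tendsto_finsetProd _ fun i _ => ht i).mul ?_
  split_ifs
  · exact tendsto_coeff_expSeries_positiveSeries (fun k _ => tendsto_hVal hβ ht r k) _
  · exact tendsto_const_nhds

lemma tendsto_phiMinusVal (hq0 : q ≠ 0) (hβ : ∀ i, β i ≠ 0)
    (ht : ∀ i, Tendsto (fun t => βt t i) l (𝓝 (β i)))
    (r : Multiset ℂ) (m : ℤ) :
    Tendsto (fun t => phiMinusVal q (βt t) (zeroSet q (βt t) r) μ m) l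
      (𝓝 (phiMinusVal q β (zeroSet q β r) μ m)) := by
  have hP : ∏ i, β i ≠ 0 := Finset.prod_ne_zero_iff.2 fun i _ => hβ i
  unfold phiMinusVal seqInfty
  refine Tendsto.mul (Tendsto.div ?_ ?_ ?_) ?_
  · simp only [zeroSet, Multiset.map_add, Multiset.prod_add, prod_map_family]
    exact (tendsto_finsetProd _ fun i _ => ((ht i).const_mul _).neg).mul_const _
  · exact (tendsto_finsetProd _ fun i _ => ht i).const_mul _
  · exact mul_ne_zero (pow_ne_zero _ (pow_ne_zero 2 hq0)) hP
  · split_ifs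
    · exact tendsto_coeff_expSeries_positiveSeries (fun k _ => (tendsto_hVal hβ ht r _).neg) _
    · exact tendsto_const_nhds

end Limits

/-- For all parameters there is a vacuum functional that satisfies the truncation relations. -/
theorem exists_truncated_vacuum (hq0 : q ≠ 0) (hq : ∀ n : ℕ, 0 < n → q ^ n ≠ 1)
    (hβ : ∀ i, β i ≠ 0) {r : Multiset ℂ} (hr : ∀ b ∈ r, b ≠ 0)
    (hμ : (Multiset.card r : ℤ) = μ + a) :
    ∃ χ : ShiftedAlg q μ →ₗ[ℂ] ℂ, IsVacuum χ (phiPlusVal q β (zeroSet q β r))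
        (phiMinusVal q β (zeroSet q β r) μ) ∧
      (∀ k, a < k → ∀ Y X,
        χ (Y * PowerSeries.coeff k (aSeries q μ (pSum (zeroSet q β r))) * X) = 0) ∧
      (∀ k, a < k → ∀ Y X,
        χ (Y * PowerSeries.coeff k (bSeries q μ (pSum (zeroSet q β r))) * X) = 0) ∧
      ∀ k, k ≤ a → ∀ Y X,
        χ (Y * PowerSeries.coeff k (aSeries q μ (pSum (zeroSet q β r))) * X) = (-1) ^ a *
          χ (Y * (gen q μ (.phiPlus 0) *
            PowerSeries.coeff (a - k) (bSeries q μ (pSum (zeroSet q β r)))) * X) := by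
  have hqq := q_sub_inv_ne_zero hq0 hq
  let T := {t : ℂ // (∀ i, deform β t i ≠ 0) ∧ IsGeneric q (deform β t)}
  let l : Filter T := comap Subtype.val (𝓝 0)
  have hdense : Dense {t : ℂ | (∀ i, deform β t i ≠ 0) ∧ IsGeneric q (deform β t)} := by
    have := (countable_not_generic (q := q) hβ).dense_compl ℝ
    convert this using 1
    ext t
    simp only [Set.mem_compl_iff, Set.mem_ofPred_eq, not_not]
  -- The parameter `0` need not be generic, but it is a limit of generic ones.
  have : l.NeBot := mem_closure_iff_comap_neBot.1 (hdense 0)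
  have hμ' : ∀ β' : Fin a → ℂ, (Multiset.card (zeroSet q β' r) : ℤ) = μ + 2 * Fintype.card (Fin a) :=
    fun β' => by
      rw [zeroSet, Multiset.card_add, card_family, Nat.cast_add, hμ, Fintype.card_fin]; ring
  have ht : ∀ i, Tendsto (fun t : T => deform β t.1 i) l (𝓝 (β i)) := fun i =>
    (tendsto_deform β i).comp tendsto_comap
  choose χ h1 h2 h3 h4 using fun t : T => exists_gtVacuum hq0 hq t.2.1 t.2.2
    (zeroSet_ne_zero hq0 t.2.1 hr) (hμ' (deform β t.1)) fun i =>
      Multiset.mem_add.2 (Or.inl (mem_family.2 ⟨i, rfl⟩))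
  simp only [Fintype.card_fin] at h2 h3 h4
  have hP : ∏ i, β i ≠ 0 := Finset.prod_ne_zero_iff.2 fun i _ => hβ i
  obtain ⟨χ₀, h0, hlim⟩ := IsVacuum.exists_limit hq0 hqq h1
    (fun m => tendsto_phiPlusVal hβ ht r m) (fun m => tendsto_phiMinusVal hq0 hβ ht r m)
    (by rwa [phiPlusVal_zero]) (by
      rw [phiMinusVal_self]
      refine div_ne_zero (Multiset.prod_ne_zero ?_) (mul_ne_zero (pow_ne_zero _
        (pow_ne_zero 2 hq0)) hP)
      simpa using fun h => zeroSet_ne_zero hq0 hβ hr 0 h rfl)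
  have ha : ∀ k Y X, Tendsto (fun t => χ t (Y * PowerSeries.coeff k
      (aSeries q μ (pSum (zeroSet q (deform β t.1) r))) * X)) l
      (𝓝 (χ₀ (Y * PowerSeries.coeff k (aSeries q μ (pSum (zeroSet q β r))) * X))) := by
    intro k Y X
    -- The element itself moves with `t` because `Z` does; factoring out the scalar series leaves
    -- fixed elements, to which the convergence of `χ t` applies.
    simp only [coeff_aSeries hqq (pSum _), Finset.mul_sum, Finset.sum_mul, mul_smul_comm,
      smul_mul_assoc, map_sum, map_smul, smul_eq_mul]
    refine tendsto_finsetSum _ fun i _ => Tendsto.mul ?_ (hlim _)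
    exact tendsto_coeff_expSeries_positiveSeries
      (fun k _ => ((tendsto_pSum_zeroSet hβ ht r k).div_const _).const_mul _) _
  have hb : ∀ k Y X, Tendsto (fun t => χ t (Y * PowerSeries.coeff k
      (bSeries q μ (pSum (zeroSet q (deform β t.1) r))) * X)) l
      (𝓝 (χ₀ (Y * PowerSeries.coeff k (bSeries q μ (pSum (zeroSet q β r))) * X))) := by
    intro k Y X
    simp only [coeff_bSeries hqq (pSum _), Finset.mul_sum, Finset.sum_mul, mul_smul_comm,
      smul_mul_assoc, map_sum, map_smul, smul_eq_mul]
    refine tendsto_finsetSum _ fun i _ => Tendsto.mul ?_ (hlim _)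
    exact tendsto_coeff_expSeries_positiveSeries
      (fun k _ => ((tendsto_pSum_zeroSet hβ ht r (-(k : ℤ))).div_const _).const_mul _) _
  refine ⟨χ₀, h0, fun k hk Y X => ?_, fun k hk Y X => ?_, fun k hk Y X => ?_⟩
  · exact tendsto_nhds_unique (ha k Y X)
      (tendsto_const_nhds.congr fun t => (h2 t k hk Y X).symm)
  · exact tendsto_nhds_unique (hb k Y X)
      (tendsto_const_nhds.congr fun t => (h3 t k hk Y X).symm)
  · have e : ∀ Y' y X' : ShiftedAlg q μ, Y' * (gen q μ (.phiPlus 0) * y) * X' =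
        Y' * gen q μ (.phiPlus 0) * y * X' := fun Y' y X' => by rw [← mul_assoc]
    refine tendsto_nhds_unique (ha k Y X) (Tendsto.congr (fun t => (h4 t k hk Y X).symm) ?_)
    simp only [e]
    exact (hb (a - k) _ X).const_mul _

end Deformation

/-! ## Functional calculus for a diagonalizable operator -/

section Calculus

variable {V : Type*} [AddCommGroup V] [Module ℂ V] {K : Type*}

/-- Functional calculus for a diagonalizable operator. -/
lemma exists_calculus (T : Module.End ℂ V) {d : K → ℂ} (hd : Function.Injective d)
    (hT : Submodule.span ℂ {x | ∃ k, T x = d k • x} = ⊤) (e : K → ℂ) :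
    ∃ B : Module.End ℂ V, ∀ k x, T x = d k • x → B x = e k • x := by
  classical
  have hind : iSupIndep fun k => T.eigenspace (d k) := T.eigenspaces_iSupIndep.comp hd
  have htop : ⨆ k, T.eigenspace (d k) = ⊤ := by
    rw [eq_top_iff, ← hT, Submodule.span_le]
    rintro x ⟨k, hk⟩
    exact Submodule.mem_iSup_of_mem k (Module.End.mem_eigenspace_iff.2 hk)
  have hint := DirectSum.isInternal_submodule_of_iSupIndep_of_iSup_eq_top hind htop
  let E := LinearEquiv.ofBijective (DirectSum.coeLinearMap fun k => T.eigenspace (d k)) hint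
  refine ⟨(DirectSum.toModule ℂ K V fun k => e k • (T.eigenspace (d k)).subtype).comp
    E.symm.toLinearMap, fun k x hx => ?_⟩
  have h1 : E.symm x = DirectSum.lof ℂ K (fun k => T.eigenspace (d k)) k
      ⟨x, Module.End.mem_eigenspace_iff.2 hx⟩ := by
    rw [LinearEquiv.symm_apply_eq]
    exact (DirectSum.coeLinearMap_lof (fun k => T.eigenspace (d k)) k
      ⟨x, Module.End.mem_eigenspace_iff.2 hx⟩).symm
  rw [LinearMap.comp_apply, LinearEquiv.coe_coe, h1, DirectSum.toModule_lof]
  rfl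

lemma end_ext_of_span {T : Module.End ℂ V} {d : K → ℂ}
    (hT : Submodule.span ℂ {x | ∃ k, T x = d k • x} = ⊤) {A B : Module.End ℂ V}
    (h : ∀ k x, T x = d k • x → A x = B x) : A = B :=
  LinearMap.ext_on hT fun x ⟨k, hk⟩ => h k x hk

end Calculus

/-! ## Modules that satisfy the truncation relations -/

section Truncated

variable {q : ℂ} {μ : ℤ} {V : Type*} [AddCommGroup V] [Module ℂ V] [Module (ShiftedAlg q μ) V]
  [IsScalarTower ℂ (ShiftedAlg q μ) V]

variable (q μ V) in
/-- The truncation relations, written without the generators `φ̄^±`. -/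
structure IsTruncated (a : ℕ) (p : ℤ → ℂ) : Prop where
  a_vanish : ∀ k, a < k → ∀ x : V, PowerSeries.coeff k (aSeries q μ p) • x = 0
  b_vanish : ∀ k, a < k → ∀ x : V, PowerSeries.coeff k (bSeries q μ p) • x = 0
  compare : ∀ k, k ≤ a → ∀ x : V, PowerSeries.coeff k (aSeries q μ p) • x =
    (-1 : ℂ) ^ a • gen q μ (.phiPlus 0) • PowerSeries.coeff (a - k) (bSeries q μ p) • x

/-- Every vector is some `X • v`, and `y X` annihilates `v` when it lies in the radical. The
two-sided form of the identity is exactly what this needs. -/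
lemma IsHighestVec.smul_eq_zero_of_vacuum [IsSimpleModule (ShiftedAlg q μ) V] (hq0 : q ≠ 0)
    (hq : ∀ n : ℕ, 0 < n → q ^ n ≠ 1) {v : V} {f g : ℤ → ℂ} (h : IsHighestVec q μ v f g)
    {χ : ShiftedAlg q μ →ₗ[ℂ] ℂ} (hχ : IsVacuum χ f g) {y : ShiftedAlg q μ}
    (hy : ∀ Y X, χ (Y * y * X) = 0) (x : V) : y • x = 0 := by
  obtain ⟨X, e⟩ := IsSimpleModule.toSpanSingleton_surjective (ShiftedAlg q μ) h.ne_zero x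
  rw [LinearMap.toSpanSingleton_apply] at e
  rw [← e, ← mul_smul, h.smul_eq_zero_iff hq0 hq hχ]
  intro Y
  rw [← mul_assoc]
  exact hy Y X

/-- A simple module whose vacuum functional satisfies the truncation relations satisfies them. -/
lemma IsHighestVec.isTruncated [IsSimpleModule (ShiftedAlg q μ) V] (hq0 : q ≠ 0)
    (hq : ∀ n : ℕ, 0 < n → q ^ n ≠ 1) {v : V} {f g : ℤ → ℂ} (h : IsHighestVec q μ v f g)
    {χ : ShiftedAlg q μ →ₗ[ℂ] ℂ} (hχ : IsVacuum χ f g) {a : ℕ} {p : ℤ → ℂ}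
    (h1 : ∀ k, a < k → ∀ Y X, χ (Y * PowerSeries.coeff k (aSeries q μ p) * X) = 0)
    (h2 : ∀ k, a < k → ∀ Y X, χ (Y * PowerSeries.coeff k (bSeries q μ p) * X) = 0)
    (h3 : ∀ k, k ≤ a → ∀ Y X, χ (Y * PowerSeries.coeff k (aSeries q μ p) * X) = (-1) ^ a *
      χ (Y * (gen q μ (.phiPlus 0) * PowerSeries.coeff (a - k) (bSeries q μ p)) * X)) :
    IsTruncated q μ V a p := by
  refine ⟨fun k hk => h.smul_eq_zero_of_vacuum hq0 hq hχ (h1 k hk),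
    fun k hk => h.smul_eq_zero_of_vacuum hq0 hq hχ (h2 k hk), fun k hk x => ?_⟩
  have := h.smul_eq_zero_of_vacuum hq0 hq hχ (y := PowerSeries.coeff k (aSeries q μ p) -
    algebraMap ℂ _ ((-1 : ℂ) ^ a) *
      (gen q μ (.phiPlus 0) * PowerSeries.coeff (a - k) (bSeries q μ p))) (fun Y X => by
    have e : ∀ y : ShiftedAlg q μ, Y * (algebraMap ℂ _ ((-1 : ℂ) ^ a) * y) * X =
        ((-1 : ℂ) ^ a) • (Y * y * X) := fun y => by
      rw [← Algebra.smul_def, mul_smul_comm, smul_mul_assoc]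
    rw [mul_sub, sub_mul, map_sub, h3 k hk, e, map_smul, smul_eq_mul, sub_self]) x
  rwa [sub_smul, mul_smul, mul_smul, algebraMap_smul, sub_eq_zero] at this

/-- The product of `φ⁺_0` and `φ⁻_μ` is central. -/
lemma commute_phiPlus_mul_phiMinus (hq0 : q ≠ 0) (hqq : q - q⁻¹ ≠ 0) (X : ShiftedAlg q μ) :
    Commute (gen q μ (.phiPlus 0) * gen q μ (.phiMinus μ)) X := by
  have key : ∀ {A : Type} [Ring A] [Algebra ℂ A] {s t x : A} {c : ℂ}, c ≠ 0 → s * x = c • (x * s) →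
      t * x = c⁻¹ • (x * t) → Commute (s * t) x := by
    intro A _ _ s t x c hc h1 h2
    change s * t * x = x * (s * t)
    rw [mul_assoc, h2, mul_smul_comm, ← mul_assoc, h1, smul_mul_assoc, smul_smul,
      inv_mul_cancel₀ hc, one_smul, mul_assoc]
  have hc : ∀ n : ℤ, q ^ n ≠ 0 := fun n => zpow_ne_zero n hq0
  have hX : X ∈ Algebra.adjoin ℂ (Set.range (gen q μ)) := by
    rw [adjoin_gen_eq_top]; exact Algebra.mem_top
  have hle : Algebra.adjoin ℂ (Set.range (gen q μ)) ≤ Subalgebra.centralizer ℂ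
      {gen q μ (.phiPlus 0) * gen q μ (.phiMinus μ)} := by
    refine Algebra.adjoin_le ?_
    rintro _ ⟨g, rfl⟩
    rw [SetLike.mem_coe, Subalgebra.mem_centralizer_iff]
    rintro _ rfl
    have hinv : ∀ {A : Type} [Ring A] {s t x : A}, t * s = 1 → s * t = 1 → Commute x s →
        Commute x t := by
      intro A _ s t x h1 h2 h3
      change x * t = t * x
      calc x * t = t * (s * x) * t := by rw [← mul_assoc t, h1, one_mul]
        _ = t * x := by rw [← h3.eq, mul_assoc, mul_assoc, h2, mul_one]
    have hP : ∀ m, Commute (gen q μ (.phiPlus 0) * gen q μ (.phiMinus μ)) (gen q μ (.phiPlus m)) :=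
      fun m => (commute_phiPlus 0 m).mul_left (commute_phiPlus_phiMinus m μ).symm
    have hM : ∀ m, Commute (gen q μ (.phiPlus 0) * gen q μ (.phiMinus μ)) (gen q μ (.phiMinus m)) :=
      fun m => (commute_phiPlus_phiMinus 0 m).mul_left (commute_phiMinus μ m)
    cases g with
    | xPlus m =>
      exact key (hc 2) (phiPlus_mul_xPlus m) (by rw [phiMinus_mul_xPlus, ← zpow_neg])
    | xMinus m =>
      exact key (hc (-2)) (phiPlus_mul_xMinus m) (by rw [phiMinus_mul_xMinus, ← zpow_neg, neg_neg])
    | phiPlus m => exact hP m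
    | phiMinus m => exact hM m
    | h m => exact (commute_phiPlus_h hqq 0 m).mul_left (commute_phiMinus_h hqq μ m)
    | phiPlusInv => exact hinv phiPlus_inv_mul phiPlus_mul_inv (hP 0)
    | phiMinusInv => exact hinv phiMinus_inv_mul phiMinus_mul_inv (hM μ)
  exact (Subalgebra.mem_centralizer_iff ℂ).1 (hle hX) _ rfl

/-- The element is central, so its value on `v` is its value on everything `v` generates. -/
lemma IsHighestVec.phiPlus_smul_phiMinus_smul (hq0 : q ≠ 0) (hqq : q - q⁻¹ ≠ 0) {v : V}
    {f g : ℤ → ℂ} (h : IsHighestVec q μ v f g) (X : ShiftedAlg q μ) :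
    gen q μ (.phiPlus 0) • gen q μ (.phiMinus μ) • X • v = (f 0 * g μ) • X • v := by
  rw [← mul_smul, ← mul_smul, (commute_phiPlus_mul_phiMinus hq0 hqq X).eq, mul_smul, mul_smul,
    h.phiMinus, smul_smul_comm', h.phiPlus, smul_smul, smul_smul_comm', mul_comm]

end Truncated

/-! ### Rebuilding the adjoint generators -/

section Descends

variable {q : ℂ} {μ : ℤ} {V : Type*} [AddCommGroup V] [Module ℂ V] [Module (ShiftedAlg q μ) V]
  [IsScalarTower ℂ (ShiftedAlg q μ) V]

variable (q μ) in
/-- Operators for the generators of the adjoint version: `B` for `φ̄⁺`, `B'` for its inverse and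
`κ B'` for `φ̄⁻`. -/
def adOp (B B' : Module.End ℂ V) (κ : ℂ) : AdGen → Module.End ℂ V
  | .base g => Algebra.lsmul ℂ ℂ V (gen q μ g)
  | .barPlus => B
  | .barMinus => κ • B'
  | .barPlusInv => B'
  | .barMinusInv => κ⁻¹ • B

lemma lift_adOp_incl (B B' : Module.End ℂ V) (κ : ℂ) (u : FreeAlgebra ℂ Gen) :
    FreeAlgebra.lift ℂ (adOp q μ B B' κ) (AdGen.incl u) =
      Algebra.lsmul ℂ ℂ V (RingQuot.mkAlgHom ℂ (Rel q μ) u) := by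
  have : (FreeAlgebra.lift ℂ (adOp q μ B B' κ)).comp AdGen.incl =
      (Algebra.lsmul ℂ ℂ V).comp (RingQuot.mkAlgHom ℂ (Rel q μ)) := by
    refine FreeAlgebra.hom_ext (funext fun g => ?_)
    simp only [Function.comp_apply, AlgHom.comp_apply, AdGen.incl, FreeAlgebra.lift_ι_apply]
    rfl
  exact DFunLike.congr_fun this u

/-- A module on which `φ⁺_0` is diagonalizable with eigenvalues in `ω q^{2ℤ}` and `φ⁺_0 φ⁻_μ` is
scalar extends to the adjoint version. -/
lemma exists_adRep (hq0 : q ≠ 0) (hq : ∀ n : ℕ, 0 < n → q ^ n ≠ 1) {c κ : ℂ} (hc : c ≠ 0)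
    (hκ : κ ≠ 0)
    (hspan : Submodule.span ℂ {x : V | ∃ k : ℤ,
      gen q μ (.phiPlus 0) • x = (c ^ 2 * q ^ (-2 * k)) • x} = ⊤)
    (hζ : ∀ x : V, gen q μ (.phiPlus 0) • gen q μ (.phiMinus μ) • x = κ ^ 2 • x) :
    ∃ (ρ : AdAlg q μ →ₐ[ℂ] Module.End ℂ V) (B B' : Module.End ℂ V),
      (∀ u, ρ (toAd q μ u) = Algebra.lsmul ℂ ℂ V u) ∧ B * B' = 1 ∧ B' * B = 1 ∧
      B ^ 2 = Algebra.lsmul ℂ ℂ V (gen q μ (.phiPlus 0)) ∧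
      ρ (adGen q μ .barPlusInv) = B' ∧ ρ (adGen q μ .barMinusInv) = κ⁻¹ • B := by
  set T : Module.End ℂ V := Algebra.lsmul ℂ ℂ V (gen q μ (.phiPlus 0)) with hTdef
  set d : ℤ → ℂ := fun k => c ^ 2 * q ^ (-2 * k) with hd
  have hdi : Function.Injective d := fun k k' h => by
    have := q_zpow_injective hq0 hq (mul_left_cancel₀ (pow_ne_zero 2 hc) h)
    omega
  have hT : Submodule.span ℂ {x | ∃ k, T x = d k • x} = ⊤ := hspan
  -- On the eigenvalue `c² q^{-2k}` the square root is `c q^{-k}`. Choosing it coherently along the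
  -- string is what makes `x^±` multiply it by `q^{±1}`.
  obtain ⟨B, hB⟩ := exists_calculus T hdi hT fun k => c * q ^ (-k)
  obtain ⟨B', hB'⟩ := exists_calculus T hdi hT fun k => c⁻¹ * q ^ k
  have ext : ∀ {A A' : Module.End ℂ V}, (∀ k x, T x = d k • x → A x = A' x) → A = A' :=
    fun h => end_ext_of_span hT h
  have hz : ∀ k : ℤ, q ^ k ≠ 0 := fun k => zpow_ne_zero k hq0
  have hee : ∀ k : ℤ, c * q ^ (-k) * (c⁻¹ * q ^ k) = 1 := fun k => by
    rw [zpow_neg]; field_simp [hz k]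
  have hBB' : B * B' = 1 := ext fun k x hx => by
    rw [Module.End.mul_apply, hB' k x hx, map_smul, hB k x hx, smul_smul, mul_comm, hee, one_smul]
    rfl
  have hB'B : B' * B = 1 := ext fun k x hx => by
    rw [Module.End.mul_apply, hB k x hx, map_smul, hB' k x hx, smul_smul, hee, one_smul]
    rfl
  have hBsq : B ^ 2 = T := ext fun k x hx => by
    rw [pow_two, Module.End.mul_apply, hB k x hx, map_smul, hB k x hx, smul_smul, hx, hd]
    congr 1
    have : q ^ (-2 * k) = q ^ (-k) * q ^ (-k) := by rw [← zpow_add₀ hq0]; congr 1; ring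
    simp only [this]
    ring
  -- an operator of weight `j` for `φ⁺_0`
  have hwt : ∀ {Y : Module.End ℂ V} {j : ℤ}, (∀ k x, T x = d k • x → T (Y x) = d (k + j) • Y x) →
      B * Y = q ^ (-j) • (Y * B) ∧ B' * Y = q ^ j • (Y * B') := by
    intro Y j hY
    refine ⟨ext fun k x hx => ?_, ext fun k x hx => ?_⟩
    · rw [Module.End.mul_apply, hB _ _ (hY k x hx), LinearMap.smul_apply, Module.End.mul_apply,
        hB k x hx, map_smul, smul_smul, neg_add, zpow_add₀ hq0]
      congr 1
      ring
    · rw [Module.End.mul_apply, hB' _ _ (hY k x hx), LinearMap.smul_apply, Module.End.mul_apply,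
        hB' k x hx, map_smul, smul_smul, zpow_add₀ hq0]
      congr 1
      ring
  have hcomm : ∀ y, Commute (gen q μ (.phiPlus 0)) y →
      Commute (Algebra.lsmul ℂ ℂ V y) B ∧ Commute (Algebra.lsmul ℂ ℂ V y) B' := fun y hy => by
    have := hwt (Y := Algebra.lsmul ℂ ℂ V y) (j := 0) fun k x hx => by
      change gen q μ (.phiPlus 0) • y • x = _
      rw [← mul_smul, hy.eq, mul_smul, add_zero]
      change y • T x = _
      rw [hx, smul_smul_comm']
      rfl
    rw [neg_zero, zpow_zero, one_smul, one_smul] at this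
    exact ⟨this.1.symm, this.2.symm⟩
  have hxP : ∀ r, B * Algebra.lsmul ℂ ℂ V (gen q μ (.xPlus r)) =
        q • (Algebra.lsmul ℂ ℂ V (gen q μ (.xPlus r)) * B) ∧
      B' * Algebra.lsmul ℂ ℂ V (gen q μ (.xPlus r)) =
        q⁻¹ • (Algebra.lsmul ℂ ℂ V (gen q μ (.xPlus r)) * B') := fun r => by
    have := hwt (Y := Algebra.lsmul ℂ ℂ V (gen q μ (.xPlus r))) (j := -1) fun k x hx =>
      phiPlus_smul_xPlus_smul hq0 hx r
    rwa [neg_neg, zpow_one, zpow_neg_one] at this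
  have hxM : ∀ r, B * Algebra.lsmul ℂ ℂ V (gen q μ (.xMinus r)) =
        q⁻¹ • (Algebra.lsmul ℂ ℂ V (gen q μ (.xMinus r)) * B) ∧
      B' * Algebra.lsmul ℂ ℂ V (gen q μ (.xMinus r)) =
        q • (Algebra.lsmul ℂ ℂ V (gen q μ (.xMinus r)) * B') := fun r => by
    have := hwt (Y := Algebra.lsmul ℂ ℂ V (gen q μ (.xMinus r))) (j := 1) fun k x hx =>
      phiPlus_smul_xMinus_smul hq0 hx r
    rwa [zpow_one, zpow_neg_one] at this
  -- `(κ B')² = κ² (φ⁺_0)⁻¹`, which is `φ⁻_μ` by the assumption on the central element.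
  have hM : (κ • B') ^ 2 = Algebra.lsmul ℂ ℂ V (gen q μ (.phiMinus μ)) := by
    have h1 : B ^ 2 * Algebra.lsmul ℂ ℂ V (gen q μ (.phiMinus μ)) = κ ^ 2 • 1 := by
      rw [hBsq]
      exact LinearMap.ext fun x => hζ x
    have h2 : B' ^ 2 * B ^ 2 = 1 := by
      rw [pow_two, pow_two, mul_assoc, ← mul_assoc B' B, hB'B, one_mul, hB'B]
    calc (κ • B') ^ 2 = B' ^ 2 * (κ ^ 2 • 1) := by rw [_root_.smul_pow, mul_smul_comm, mul_one]
      _ = _ := by rw [← h1, ← mul_assoc, h2, one_mul]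
  let φ := FreeAlgebra.lift ℂ (adOp q μ B B' κ)
  have hφ : ∀ g, φ (AdGen.el g) = adOp q μ B B' κ g := fun g => FreeAlgebra.lift_ι_apply _ _
  have hrel : ∀ ⦃u v⦄, AdRel q μ u v → φ u = φ v := by
    intro u v huv
    cases huv with
    | base h =>
      rw [lift_adOp_incl, lift_adOp_incl, RingQuot.mkAlgHom_rel ℂ h]
    | barPlus_inv_right =>
      simp only [map_mul, map_one, hφ]
      exact hBB'
    | barPlus_inv_left =>
      simp only [map_mul, map_one, hφ]
      exact hB'B
    | barMinus_inv_right =>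
      simp only [map_mul, map_one, hφ, adOp]
      rw [smul_mul_smul_comm, mul_inv_cancel₀ hκ, one_smul, hB'B]
    | barMinus_inv_left =>
      simp only [map_mul, map_one, hφ, adOp]
      rw [smul_mul_smul_comm, inv_mul_cancel₀ hκ, one_smul, hBB']
    | barPlus_sq =>
      simp only [map_pow, hφ]
      exact hBsq
    | barMinus_sq =>
      simp only [map_pow, hφ]
      exact hM
    | bar_comm =>
      simp only [map_mul, hφ, adOp]
      rw [mul_smul_comm, smul_mul_assoc, hBB', hB'B]
    | barPlus_phiPlus r =>
      simp only [map_mul, hφ]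
      exact (hcomm _ (commute_phiPlus 0 r)).1
    | barPlus_phiMinus r =>
      simp only [map_mul, hφ]
      exact (hcomm _ (commute_phiPlus_phiMinus 0 r)).1
    | barMinus_phiPlus r =>
      simp only [map_mul, hφ]
      exact (hcomm _ (commute_phiPlus 0 r)).2.smul_right κ
    | barMinus_phiMinus r =>
      simp only [map_mul, hφ]
      exact (hcomm _ (commute_phiPlus_phiMinus 0 r)).2.smul_right κ
    | barPlus_xPlus r =>
      simp only [map_mul, map_smul, hφ]
      exact (hxP r).1
    | barPlus_xMinus r =>
      simp only [map_mul, map_smul, hφ]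
      exact (hxM r).1
    | barMinus_xPlus r =>
      simp only [map_mul, map_smul, hφ, adOp]
      rw [smul_mul_assoc, (hxP r).2, mul_smul_comm, smul_comm]
    | barMinus_xMinus r =>
      simp only [map_mul, map_smul, hφ, adOp]
      rw [smul_mul_assoc, (hxM r).2, mul_smul_comm, smul_comm]
  have hρ : ∀ g, RingQuot.liftAlgHom ℂ ⟨φ, hrel⟩ (adGen q μ g) = adOp q μ B B' κ g := fun g =>
    (RingQuot.liftAlgHom_mkAlgHom_apply ℂ _ _ _).trans (hφ g)
  refine ⟨RingQuot.liftAlgHom ℂ ⟨φ, hrel⟩, B, B', fun u => ?_, hBB', hB'B, hBsq, hρ _, hρ _⟩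
  obtain ⟨u, rfl⟩ := RingQuot.mkAlgHom_surjective ℂ (Rel q μ) u
  have e : toAd q μ (RingQuot.mkAlgHom ℂ (Rel q μ) u) =
      RingQuot.mkAlgHom ℂ (AdRel q μ) (AdGen.incl u) :=
    RingQuot.liftAlgHom_mkAlgHom_apply ℂ _ _ _
  rw [e]
  exact (RingQuot.liftAlgHom_mkAlgHom_apply ℂ _ _ _).trans (lift_adOp_incl B B' κ u)

/-- The truncation relations imply that the module descends to the truncation. -/
theorem IsTruncated.descends (hq0 : q ≠ 0) (hq : ∀ n : ℕ, 0 < n → q ^ n ≠ 1) {c : ℂ} (hc : c ≠ 0)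
    {a N : ℕ} {zs : Fin N → ℂˣ} {z' : ℂˣ}
    (hspan : Submodule.span ℂ {x : V | ∃ k : ℤ,
      gen q μ (.phiPlus 0) • x = (c ^ 2 * q ^ (-2 * k)) • x} = ⊤)
    (hζ : ∀ x : V, gen q μ (.phiPlus 0) • gen q μ (.phiMinus μ) • x =
      ((z' : ℂ) / (-q) ^ a) ^ 2 • x)
    (ht : IsTruncated q μ V a (powerSum (Zrat q zs))) : Descends q μ V a zs z' := by
  have hqq := q_sub_inv_ne_zero hq0 hq
  have hqa : (-q) ^ a ≠ 0 := pow_ne_zero _ (neg_ne_zero.2 hq0)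
  -- With `φ̄⁻ = κ (φ̄⁺)⁻¹` the product `A⁺_0 A⁻_0` is `z' / κ`; setting it equal to `(-q)^a`
  -- determines `κ`.
  have hκ : (z' : ℂ) / (-q) ^ a ≠ 0 := div_ne_zero z'.ne_zero hqa
  obtain ⟨ρ, B, B', h1, h2, h3, h4, h5, h6⟩ := exists_adRep hq0 hq hc hκ hspan hζ
  have hA : ∀ k, ρ (PowerSeries.coeff k (APlus q μ zs)) = Algebra.lsmul ℂ ℂ V
      (PowerSeries.coeff k (aSeries q μ (powerSum (Zrat q zs)))) * B' := fun k => by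
    rw [coeff_APlus hqq, map_mul, h1, h5]
  have hAM : ∀ k, ρ (PowerSeries.coeff k (AMinus q μ zs z')) = (-q) ^ a • (Algebra.lsmul ℂ ℂ V
      (PowerSeries.coeff k (bSeries q μ (powerSum (Zrat q zs)))) * B) := fun k => by
    rw [coeff_AMinus hqq, map_smul, map_mul, h1, h6, mul_smul_comm, smul_smul]
    congr 1
    field_simp [z'.ne_zero]
  have hone : ∀ f : PowerSeries (ShiftedAlg q μ),
      Algebra.lsmul ℂ ℂ V (PowerSeries.coeff 0 (expSeries f)) = 1 := fun f => by
    rw [coeff_zero_expSeries, map_one]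
  have hrel : ∀ ⦃u v⦄, TruncRel q μ a zs z' u v → ρ u = ρ v := by
    intro u v huv
    cases huv with
    | plus_vanish r hr =>
      rw [hA, map_zero]
      exact LinearMap.ext fun x => ht.a_vanish r hr _
    | minus_vanish r hr =>
      have : Algebra.lsmul ℂ ℂ V (PowerSeries.coeff r (bSeries q μ (powerSum (Zrat q zs)))) = 0 :=
        LinearMap.ext fun x => ht.b_vanish r hr x
      rw [hAM, map_zero, this, zero_mul, smul_zero]
    | const =>
      rw [map_mul, hA, hAM, aSeries, bSeries, hone, hone, one_mul, one_mul, mul_smul_comm, h3,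
        AlgHom.commutes, Algebra.algebraMap_eq_smul_one]
    | compare r hr =>
      have h7 : Algebra.lsmul ℂ ℂ V (PowerSeries.coeff r (aSeries q μ (powerSum (Zrat q zs)))) =
          (-1 : ℂ) ^ a • (Algebra.lsmul ℂ ℂ V (gen q μ (.phiPlus 0)) * Algebra.lsmul ℂ ℂ V
            (PowerSeries.coeff (a - r) (bSeries q μ (powerSum (Zrat q zs))))) :=
        LinearMap.ext fun x => ht.compare r hr x
      have h8 : Commute (Algebra.lsmul ℂ ℂ V (gen q μ (.phiPlus 0))) (Algebra.lsmul ℂ ℂ V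
          (PowerSeries.coeff (a - r) (bSeries q μ (powerSum (Zrat q zs))))) :=
        (commute_bSeries (fun m => commute_phiPlus_h hqq 0 m) _ _).map _
      -- The factor `q^{-a}` in `A⁺(z) = (z q⁻¹)^a A⁻(z)` and the `(-q)^a` of the normalization
      -- leave the sign in `IsTruncated.compare`.
      have h9 : (q⁻¹ : ℂ) ^ a * (-q) ^ a = (-1) ^ a := by
        rw [← mul_pow, mul_neg, inv_mul_cancel₀ hq0]
      rw [map_smul, hA, hAM, h7, h8.eq, ← h4, pow_two, smul_mul_assoc, mul_assoc, mul_assoc, h2,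
        mul_one, smul_smul, h9]
  refine ⟨RingQuot.liftAlgHom ℂ ⟨ρ, hrel⟩, fun u x => ?_⟩
  have : RingQuot.liftAlgHom ℂ ⟨ρ, hrel⟩ (toTrunc q μ a zs z' u) = ρ (toAd q μ u) :=
    RingQuot.liftAlgHom_mkAlgHom_apply ℂ _ _ _
  rw [this, h1]
  rfl

end Descends

/-! ## Truncated highest weight modules are in category `𝒪` -/

section CategoryO

variable {q : ℂ} {μ : ℤ} {V : Type*} [AddCommGroup V] [Module ℂ V] [Module (ShiftedAlg q μ) V]
  [IsScalarTower ℂ (ShiftedAlg q μ) V]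

variable (q μ) in
/-- The span of the vectors `x⁻_{r_1} ⋯ x⁻_{r_k} v` with `0 ≤ r_i < a`. -/
def layer (a : ℕ) (v : V) : ℕ → Submodule ℂ V
  | 0 => Submodule.span ℂ {v}
  | k + 1 => ⨆ r : Fin a,
      (layer a v k).map (Algebra.lsmul ℂ ℂ V (gen q μ (.xMinus ((r : ℕ) : ℤ))))

lemma layer_finite (a : ℕ) (v : V) (k : ℕ) : FiniteDimensional ℂ (layer q μ a v k) := by
  induction k with
  | zero => exact FiniteDimensional.span_singleton ℂ v
  | succ k ih =>
    exact Submodule.finiteDimensional_iSup fun r : Fin a => (layer q μ a v k).map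
      (Algebra.lsmul ℂ ℂ V (gen q μ (.xMinus ((r : ℕ) : ℤ))))

lemma layer_succ_le {a k : ℕ} {v : V} {S : Submodule ℂ V}
    (h : ∀ r : Fin a, ∀ x ∈ layer q μ a v k, gen q μ (.xMinus ((r : ℕ) : ℤ)) • x ∈ S) :
    layer q μ a v (k + 1) ≤ S :=
  iSup_le fun r => Submodule.map_le_iff_le_comap.2 fun x hx => h r x hx

lemma xMinus_smul_mem_layer {a k : ℕ} {v : V} (r : Fin a) {x : V} (hx : x ∈ layer q μ a v k) :
    gen q μ (.xMinus ((r : ℕ) : ℤ)) • x ∈ layer q μ a v (k + 1) :=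
  (le_iSup (fun r : Fin a => (layer q μ a v k).map
    (Algebra.lsmul ℂ ℂ V (gen q μ (.xMinus ((r : ℕ) : ℤ))))) r)
    (Submodule.mem_map_of_mem hx)

lemma layer_weight (hq0 : q ≠ 0) {v : V} {f g : ℤ → ℂ} (h : IsHighestVec q μ v f g) (a k : ℕ) :
    ∀ x ∈ layer q μ a v k, gen q μ (.phiPlus 0) • x = (f 0 * q ^ (-2 * (k : ℤ))) • x := by
  have key : ∀ (k : ℕ) {x : V}, x ∈ Module.End.eigenspace
      (Algebra.lsmul ℂ ℂ V (gen q μ (.phiPlus 0))) (f 0 * q ^ (-2 * (k : ℤ))) ↔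
      gen q μ (.phiPlus 0) • x = (f 0 * q ^ (-2 * (k : ℤ))) • x :=
    fun k x => Module.End.mem_eigenspace_iff
  suffices hle : layer q μ a v k ≤ Module.End.eigenspace
      (Algebra.lsmul ℂ ℂ V (gen q μ (.phiPlus 0))) (f 0 * q ^ (-2 * (k : ℤ))) from
    fun x hx => (key k).1 (hle hx)
  induction k with
  | zero =>
    refine (Submodule.span_singleton_le_iff_mem _ _).2 ((key 0).2 ?_)
    simpa using h.phiPlus 0
  | succ k ih =>
    refine layer_succ_le fun r x hx => (key (k + 1)).2 ?_
    have := phiPlus_smul_xMinus_smul hq0 ((key k).1 (ih hx)) ((r : ℕ) : ℤ)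
    exact_mod_cast this

lemma coeff_aSeries_mem (p : ℤ → ℂ) (n : ℕ) :
    PowerSeries.coeff n (aSeries q μ p) ∈ zeroAlg q μ := by
  refine coeff_expSeries_mem _ n fun i _ => ?_
  rw [coeff_positiveSeries]
  split_ifs
  · exact zero_mem _
  · exact Subalgebra.smul_mem _ (add_mem (Subalgebra.smul_mem _ (cartan_mem (.h _)) _)
      (Subalgebra.algebraMap_mem _ _)) _

variable {a : ℕ} {p : ℤ → ℂ}

/-- At `k = a` the comparison meets `b_0 = 1`. The top coefficient therefore acts invertibly on each
eigenspace of `φ⁺_0` with non-zero eigenvalue. -/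
lemma IsTruncated.leading (ht : IsTruncated q μ V a p) (x : V) :
    PowerSeries.coeff a (aSeries q μ p) • x = (-1 : ℂ) ^ a • gen q μ (.phiPlus 0) • x := by
  have h := ht.compare a le_rfl x
  rw [Nat.sub_self] at h
  rw [h]
  simp only [bSeries, coeff_zero_expSeries, one_smul]

lemma coeff_zero_aSeries_smul (x : V) : PowerSeries.coeff 0 (aSeries q μ p) • x = x := by
  rw [aSeries, coeff_zero_expSeries, one_smul]

/-- The relation `∑ x⁻_{s-i} a_i = 0` is a recursion of length `a` in the modes. Since `a_0 = 1` it
runs upwards, and since `a_a` is a non-zero scalar on a layer it runs downwards; `a` consecutive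
modes suffice. -/
lemma IsTruncated.xMinus_smul_mem (hq0 : q ≠ 0) (hq : ∀ n : ℕ, 0 < n → q ^ n ≠ 1)
    (ht : IsTruncated q μ V a p) {v : V} {f g : ℤ → ℂ} (h : IsHighestVec q μ v f g) {k : ℕ}
    (hs : ∀ n, ∀ x ∈ layer q μ a v k, PowerSeries.coeff n (aSeries q μ p) • x ∈ layer q μ a v k)
    (r : ℤ) : ∀ x ∈ layer q μ a v k, gen q μ (.xMinus r) • x ∈ layer q μ a v (k + 1) := by
  have hrel := sum_xMinus_mul_aSeries (V := V) hq0 hq (ht.a_vanish (a + 1) (Nat.lt_succ_self a))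
  have hpos : ∀ m : ℕ, ∀ x ∈ layer q μ a v k,
      gen q μ (.xMinus m) • x ∈ layer q μ a v (k + 1) := by
    intro m
    induction m using Nat.strong_induction_on with
    | _ m ih =>
      intro x hx
      rcases lt_or_ge m a with hm | hm
      · exact xMinus_smul_mem_layer (⟨m, hm⟩ : Fin a) hx
      have e := hrel m x
      rw [Finset.sum_range_succ', Nat.cast_zero, sub_zero, coeff_zero_aSeries_smul,
        add_eq_zero_iff_neg_eq] at e
      rw [← e]
      refine neg_mem (sum_mem fun i hi => ?_)
      have hi' := Finset.mem_range.1 hi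
      have e' : (m : ℤ) - ((i + 1 : ℕ) : ℤ) = ((m - (i + 1) : ℕ) : ℤ) := by omega
      rw [e']
      exact ih _ (by omega) _ (hs _ x hx)
  have hneg : ∀ m : ℕ, ∀ x ∈ layer q μ a v k,
      gen q μ (.xMinus (-(m : ℤ))) • x ∈ layer q μ a v (k + 1) := by
    intro m
    induction m using Nat.strong_induction_on with
    | _ m ih =>
      intro x hx
      have hw : (-1 : ℂ) ^ a * (f 0 * q ^ (-2 * (k : ℤ))) ≠ 0 :=
        mul_ne_zero (pow_ne_zero _ (neg_ne_zero.2 one_ne_zero))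
          (mul_ne_zero h.f_zero_ne (zpow_ne_zero _ hq0))
      -- With this shift the term `i = a` is the mode `-m`; all the others have larger modes.
      have e := hrel (-(m : ℤ) + a) x
      rw [Finset.sum_range_succ, add_sub_cancel_right, ht.leading, layer_weight hq0 h a k x hx,
        smul_smul, smul_smul_comm', add_eq_zero_iff_eq_neg'] at e
      rw [← inv_smul_smul₀ hw (gen q μ (.xMinus (-(m : ℤ))) • x), e]
      refine Submodule.smul_mem _ _ (neg_mem (sum_mem fun i hi => ?_))
      have hi' := Finset.mem_range.1 hi
      rcases le_or_gt 0 (-(m : ℤ) + a - i) with h0 | h0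
      · have e' : -(m : ℤ) + a - i = (((-(m : ℤ) + a - i).toNat : ℕ) : ℤ) := by omega
        rw [e']
        exact hpos _ _ (hs _ x hx)
      · have e' : -(m : ℤ) + a - i = -((m - (a - i) : ℕ) : ℤ) := by omega
        rw [e']
        exact ih _ (by omega) _ (hs _ x hx)
  obtain ⟨m, rfl | rfl⟩ := Int.eq_nat_or_neg r
  exacts [hpos m, hneg m]

/-- Moving `a_n` past `x⁻_r` produces other modes of `x⁻`, which `IsTruncated.xMinus_smul_mem`
brings back into the layer. That lemma needs stability of the previous layer, hence the induction.
-/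
lemma IsTruncated.aSeries_smul_mem (hq0 : q ≠ 0) (hq : ∀ n : ℕ, 0 < n → q ^ n ≠ 1)
    (ht : IsTruncated q μ V a p) {v : V} {f g : ℤ → ℂ} (h : IsHighestVec q μ v f g) (k n : ℕ) :
    ∀ x ∈ layer q μ a v k, PowerSeries.coeff n (aSeries q μ p) • x ∈ layer q μ a v k := by
  induction k generalizing n with
  | zero =>
    intro x hx
    obtain ⟨c, rfl⟩ := Submodule.mem_span_singleton.1 hx
    obtain ⟨d, hd⟩ := h.cartan_le (q_sub_inv_ne_zero hq0 hq) (coeff_aSeries_mem p n)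
    rw [smul_smul_comm', hd]
    exact Submodule.smul_mem _ _ (Submodule.smul_mem _ _ (Submodule.mem_span_singleton_self v))
  | succ k ih =>
    have hx := ht.xMinus_smul_mem hq0 hq h ih
    suffices hle : layer q μ a v (k + 1) ≤ (layer q μ a v (k + 1)).comap
        (Algebra.lsmul ℂ ℂ V (PowerSeries.coeff n (aSeries q μ p))) from fun x hx => hle hx
    refine layer_succ_le fun r x hxk => ?_
    change PowerSeries.coeff n (aSeries q μ p) • gen q μ (.xMinus _) • x ∈ layer q μ a v (k + 1)
    rcases n with _ | n
    · rw [coeff_zero_aSeries_smul]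
      exact hx _ x hxk
    · rw [← mul_smul, aSeries_mul_xMinus hq0 hq, add_smul, mul_smul, smul_assoc, Finset.sum_smul]
      refine add_mem (hx _ _ (ih _ x hxk)) (Submodule.smul_mem _ _ (sum_mem fun i _ => ?_))
      rw [mul_smul]
      exact hx _ _ (ih _ x hxk)

lemma IsTruncated.iSup_layer (hq0 : q ≠ 0) (hq : ∀ n : ℕ, 0 < n → q ^ n ≠ 1)
    (ht : IsTruncated q μ V a p) {v : V} {f g : ℤ → ℂ} (h : IsHighestVec q μ v f g)
    (hgen : ∀ x : V, ∃ X : ShiftedAlg q μ, x = X • v) : ⨆ k, layer q μ a v k = ⊤ := by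
  have hqq := q_sub_inv_ne_zero hq0 hq
  have hstep : ∀ r, ∀ x ∈ ⨆ k, layer q μ a v k, gen q μ (.xMinus r) • x ∈ ⨆ k, layer q μ a v k := by
    intro r
    suffices hle : ⨆ k, layer q μ a v k ≤ (⨆ k, layer q μ a v k).comap
        (Algebra.lsmul ℂ ℂ V (gen q μ (.xMinus r))) from fun x hx => hle hx
    refine iSup_le fun k x hx => ?_
    exact Submodule.mem_iSup_of_mem (k + 1)
      (ht.xMinus_smul_mem hq0 hq h (ht.aSeries_smul_mem hq0 hq h k) r x hx)
  rw [eq_top_iff]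
  intro x _
  obtain ⟨X, rfl⟩ := hgen x
  obtain ⟨n, hn, e⟩ := h.exists_neg hq0 hqq X
  rw [e]
  have : ∀ x ∈ ⨆ k, layer q μ a v k, n • x ∈ ⨆ k, layer q μ a v k := by
    clear e
    induction hn using Algebra.adjoin_induction with
    | mem s hs =>
      obtain ⟨r, rfl⟩ := hs
      exact hstep r
    | algebraMap c => intro x hx; rw [algebraMap_smul]; exact Submodule.smul_mem _ _ hx
    | add a b _ _ ha hb => intro x hx; rw [add_smul]; exact add_mem (ha x hx) (hb x hx)
    | mul a b _ _ ha hb => intro x hx; rw [mul_smul]; exact ha _ (hb x hx)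
  exact this v (Submodule.mem_iSup_of_mem 0 (Submodule.mem_span_singleton_self v))

lemma mem_weightPlus {ω : ℂˣ} {x : V} :
    x ∈ weightPlus q μ V ω ↔ gen q μ (.phiPlus 0) • x = (ω : ℂ) • x :=
  Module.End.mem_eigenspace_iff

lemma mem_weightMinus {ω : ℂˣ} {x : V} :
    x ∈ weightMinus q μ V ω ↔ gen q μ (.phiMinus μ) • x = ((ω⁻¹ : ℂˣ) : ℂ) • x :=
  Module.End.mem_eigenspace_iff

lemma IsTruncated.weightPlus_le_layer (hq0 : q ≠ 0) (hq : ∀ n : ℕ, 0 < n → q ^ n ≠ 1)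
    (ht : IsTruncated q μ V a p) {v : V} {f g : ℤ → ℂ} (h : IsHighestVec q μ v f g)
    (hgen : ∀ x : V, ∃ X : ShiftedAlg q μ, x = X • v) {ω : ℂˣ} {k : ℕ}
    (hω : (ω : ℂ) = f 0 * q ^ (-2 * (k : ℤ))) : weightPlus q μ V ω ≤ layer q μ a v k := by
  have htop := ht.iSup_layer hq0 hq h hgen
  have hspan : Submodule.span ℂ {x : V | ∃ k : ℕ, Algebra.lsmul ℂ ℂ V (gen q μ (.phiPlus 0)) x =
      (f 0 * q ^ (-2 * (k : ℤ))) • x} = ⊤ := by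
    rw [eq_top_iff, ← htop]
    exact iSup_le fun k x hx => Submodule.subset_span ⟨k, layer_weight hq0 h a k x hx⟩
  have hinj : Function.Injective fun k : ℕ => f 0 * q ^ (-2 * (k : ℤ)) := fun i j hij => by
    have := q_zpow_injective hq0 hq (mul_left_cancel₀ h.f_zero_ne hij)
    omega
  -- `B` is the projection onto the `k`-th weight. It maps the sum of the layers, which is
  -- everything, into layer `k` and fixes the weight space.
  obtain ⟨B, hB⟩ := exists_calculus _ hinj hspan fun j => if j = k then 1 else 0
  have hle : ⨆ k, layer q μ a v k ≤ (layer q μ a v k).comap B := by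
    refine iSup_le fun j x hx => ?_
    rw [Submodule.mem_comap, hB j x (layer_weight hq0 h a j x hx)]
    split_ifs with hj
    · rw [one_smul, ← hj]; exact hx
    · rw [zero_smul]; exact zero_mem _
  intro x hx
  rw [mem_weightPlus, hω] at hx
  have h1 : B x = x := by rw [hB k x hx, if_pos rfl, one_smul]
  rw [← h1]
  exact hle (by rw [htop]; exact Submodule.mem_top)

/-- A truncated highest weight module is in category `𝒪`. -/
theorem IsTruncated.inCategoryO (hq0 : q ≠ 0) (hq : ∀ n : ℕ, 0 < n → q ^ n ≠ 1)
    (ht : IsTruncated q μ V a p) {v : V} {f g : ℤ → ℂ} (h : IsHighestVec q μ v f g)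
    (hgen : ∀ x : V, ∃ X : ShiftedAlg q μ, x = X • v) : InCategoryO q μ V := by
  have hqq := q_sub_inv_ne_zero hq0 hq
  have hζ : ∀ x : V, gen q μ (.phiPlus 0) • gen q μ (.phiMinus μ) • x = (f 0 * g μ) • x :=
    fun x => by obtain ⟨X, rfl⟩ := hgen x; exact h.phiPlus_smul_phiMinus_smul hq0 hqq X
  let ζ : ℂˣ := Units.mk0 (f 0 * g μ) (mul_ne_zero h.f_zero_ne h.g_mu_ne)
  -- As `φ⁺_0 φ⁻_μ` acts by the scalar `ζ`, the two families of eigenspaces coincide up to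
  -- relabelling, and only `φ⁺_0` needs study.
  have hminus : ∀ ω : ℂˣ, weightMinus q μ V ω = weightPlus q μ V (ζ * ω) := fun ω => by
    ext x
    rw [mem_weightMinus, mem_weightPlus]
    constructor
    · intro hx
      have := hζ x
      rw [hx, smul_smul_comm'] at this
      rw [← smul_inv_smul ω (gen q μ (.phiPlus 0) • x)]
      change (ω : ℂ) • ((ω⁻¹ : ℂˣ) : ℂ) • gen q μ (.phiPlus 0) • x = _
      rw [this, smul_smul, mul_comm]
      rfl
    · intro hx
      have := inv_smul_of_smul phiPlus_inv_mul (Units.ne_zero _) hx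
      have h2 : gen q μ (.phiMinus μ) • x = (f 0 * g μ) • gen q μ .phiPlusInv • x := by
        rw [← smul_smul_comm', ← hζ x, ← mul_smul, phiPlus_inv_mul, one_smul]
      rw [h2, this, smul_smul]
      congr 1
      have : (ζ : ℂ) = f 0 * g μ := rfl
      rw [Units.val_mul, this, mul_inv, Units.val_inv_eq_inv_val, mul_inv_cancel_left₀]
      exact mul_ne_zero h.f_zero_ne h.g_mu_ne
  have hwt : ∀ ω : ℂˣ, weightPlus q μ V ω ≠ ⊥ → ∃ k : ℕ, (ω : ℂ) = f 0 * q ^ (-2 * (k : ℤ)) := by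
    intro ω hω
    obtain ⟨x, hx, hx0⟩ := Submodule.exists_mem_ne_zero_of_ne_bot hω
    refine exists_weight_of_mem_lowerSum ?_ hx0 (mem_weightPlus.1 hx)
    obtain ⟨X, rfl⟩ := hgen x
    exact h.smul_mem_lowerSum hq0 hqq X
  have hfin : ∀ ω : ℂˣ, FiniteDimensional ℂ (weightPlus q μ V ω) := fun ω => by
    rcases eq_or_ne (weightPlus q μ V ω) ⊥ with h0 | h0
    · rw [h0]; infer_instance
    · obtain ⟨k, hk⟩ := hwt ω h0
      have := layer_finite (q := q) (μ := μ) a v k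
      exact Submodule.finiteDimensional_of_le (ht.weightPlus_le_layer hq0 hq h hgen hk)
  have hsum : ⨆ ω : ℂˣ, weightPlus q μ V ω = ⊤ := by
    rw [eq_top_iff, ← ht.iSup_layer hq0 hq h hgen]
    refine iSup_le fun k x hx => Submodule.mem_iSup_of_mem
      (Units.mk0 (f 0 * q ^ (-2 * (k : ℤ))) (mul_ne_zero h.f_zero_ne (zpow_ne_zero _ hq0))) ?_
    exact mem_weightPlus.2 (layer_weight hq0 h a k x hx)
  have hpow : ∀ k : ℕ, q ^ (-2 * (k : ℤ)) * (q ^ 2) ^ k = 1 := fun k => by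
    rw [← pow_mul, ← zpow_natCast, ← zpow_add₀ hq0]
    push_cast
    rw [neg_mul, neg_add_cancel, zpow_zero]
  let ω₀ : ℂˣ := Units.mk0 (f 0) h.f_zero_ne
  -- The two bounds are the highest weight `f 0` and its relabelling `ζ⁻¹ f 0` for the
  -- `φ⁻_μ`-weights.
  refine ⟨hsum, ?_, hfin, fun ω => hminus ω ▸ hfin _, {ω₀, ζ⁻¹ * ω₀}, fun ω hω => ?_⟩
  · rw [eq_top_iff, ← hsum]
    refine iSup_le fun ω => ?_
    have := hminus (ζ⁻¹ * ω)
    rw [mul_inv_cancel_left] at this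
    rw [← this]
    exact le_iSup (weightMinus q μ V) _
  · rcases hω with hω | hω
    · obtain ⟨k, hk⟩ := hwt ω hω
      refine ⟨ω₀, by simp, k, ?_⟩
      rw [hk, mul_assoc, hpow, mul_one]
      rfl
    · rw [hminus] at hω
      obtain ⟨k, hk⟩ := hwt _ hω
      refine ⟨ζ⁻¹ * ω₀, by simp, k, ?_⟩
      have h1 : (ω₀ : ℂ) = (ζ * ω : ℂˣ) * (q ^ 2) ^ k := by
        rw [hk, mul_assoc, hpow, mul_one]
        rfl
      rw [Units.val_mul, h1, Units.val_mul, mul_assoc, Units.inv_mul_cancel_left]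

end CategoryO

/-! ## The highest `ℓ`-weight of a truncated module -/

section Necessity

variable {q : ℂ} {μ : ℤ} {V : Type*} [AddCommGroup V] [Module ℂ V] [Module (ShiftedAlg q μ) V]
  [IsScalarTower ℂ (ShiftedAlg q μ) V]

/-- A module that descends to the truncation satisfies the truncation relations. -/
theorem Descends.isTruncated (hq0 : q ≠ 0) (hq : ∀ n : ℕ, 0 < n → q ^ n ≠ 1) {a N : ℕ}
    {zs : Fin N → ℂˣ} {z' : ℂˣ} (h : Descends q μ V a zs z') :
    IsTruncated q μ V a (powerSum (Zrat q zs)) := by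
  have hqq := q_sub_inv_ne_zero hq0 hq
  obtain ⟨ρ, hρ⟩ := h
  let σ : AdAlg q μ →ₐ[ℂ] Module.End ℂ V := ρ.comp (RingQuot.mkAlgHom ℂ (TruncRel q μ a zs z'))
  have hσ : ∀ u (x : V), σ (toAd q μ u) x = u • x := hρ
  have hσ' : ∀ u, σ (toAd q μ u) = Algebra.lsmul ℂ ℂ V u := fun u => LinearMap.ext (hσ u)
  have hrel : ∀ {u v}, TruncRel q μ a zs z' u v → σ u = σ v := fun huv =>
    congrArg ρ (RingQuot.mkAlgHom_rel ℂ huv)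
  set A := Algebra.lsmul ℂ ℂ V (A := ShiftedAlg q μ)
  set p := powerSum (Zrat q zs)
  set B := σ (adGen q μ .barPlus)
  set B' := σ (adGen q μ .barPlusInv)
  set D := σ (adGen q μ .barMinus)
  set D' := σ (adGen q μ .barMinusInv)
  have hB'B : B' * B = 1 := by
    rw [← map_mul, show adGen q μ .barPlusInv * adGen q μ .barPlus = 1 from
      (barPlusUnit q μ).inv_mul, map_one]
  have hD'D : D' * D = 1 := by
    rw [← map_mul, show adGen q μ .barMinusInv * adGen q μ .barMinus = 1 from
      (barMinusUnit q μ).inv_mul, map_one]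
  have hBsq : B ^ 2 = A (gen q μ (.phiPlus 0)) := by
    have := RingQuot.mkAlgHom_rel ℂ (AdRel.barPlus_sq (q := q) (μ := μ))
    rw [map_pow] at this
    rw [← map_pow, ← hσ', toAd_gen]
    exact congrArg σ this
  have hA : ∀ k, σ (PowerSeries.coeff k (APlus q μ zs)) =
      A (PowerSeries.coeff k (aSeries q μ p)) * B' := fun k => by
    rw [coeff_APlus hqq, map_mul, hσ']
  have hAM : ∀ k, σ (PowerSeries.coeff k (AMinus q μ zs z')) =
      (z' : ℂ) • (A (PowerSeries.coeff k (bSeries q μ p)) * D') := fun k => by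
    rw [coeff_AMinus hqq, map_smul, map_mul, hσ']
  have hA0 : A (PowerSeries.coeff 0 (aSeries q μ p)) = 1 := by
    rw [aSeries, coeff_zero_expSeries, map_one]
  have hA0' : A (PowerSeries.coeff 0 (bSeries q μ p)) = 1 := by
    rw [bSeries, coeff_zero_expSeries, map_one]
  -- `φ̄⁻` in terms of `φ̄⁺`
  have hconst : (z' : ℂ) • (B' * D') = ((-q) ^ a : ℂ) • (1 : Module.End ℂ V) := by
    have := hrel (TruncRel.const (q := q) (μ := μ) (a := a) (zs := zs) (z' := z'))
    rwa [map_mul, hA, hAM, hA0, hA0', one_mul, one_mul, mul_smul_comm, AlgHom.commutes,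
      Algebra.algebraMap_eq_smul_one] at this
  have hBB' : B * B' = 1 := by
    rw [← map_mul, show adGen q μ .barPlus * adGen q μ .barPlusInv = 1 from
      (barPlusUnit q μ).mul_inv, map_one]
  have hD'eq : (z' : ℂ) • D' = ((-q) ^ a : ℂ) • B := by
    calc (z' : ℂ) • D' = B * ((z' : ℂ) • (B' * D')) := by
          rw [mul_smul_comm, ← mul_assoc, hBB', one_mul]
      _ = _ := by rw [hconst, mul_smul_comm, mul_one]
  have cancel : ∀ Y : Module.End ℂ V, Y * B' = 0 → Y = 0 := fun Y hY => by
    rw [← mul_one Y, ← hB'B, ← mul_assoc, hY, zero_mul]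
  refine ⟨fun k hk x => ?_, fun k hk x => ?_, fun k hk x => ?_⟩
  · have := hrel (TruncRel.plus_vanish (q := q) (μ := μ) (a := a) (zs := zs) (z' := z') k hk)
    rw [hA, map_zero] at this
    exact LinearMap.congr_fun (cancel _ this) x
  · have := hrel (TruncRel.minus_vanish (q := q) (μ := μ) (a := a) (zs := zs) (z' := z') k hk)
    rw [hAM, map_zero, smul_eq_zero, or_iff_right z'.ne_zero] at this
    have h0 : A (PowerSeries.coeff k (bSeries q μ p)) = 0 := by
      rw [← mul_one (A _), ← hD'D, ← mul_assoc, this, zero_mul]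
    exact LinearMap.congr_fun h0 x
  · have := hrel (TruncRel.compare (q := q) (μ := μ) (a := a) (zs := zs) (z' := z') k hk)
    rw [map_smul, hA, hAM, ← mul_smul_comm, hD'eq, mul_smul_comm, smul_smul, ← mul_pow, mul_neg,
      inv_mul_cancel₀ hq0] at this
    have h8 : Commute (A (gen q μ (.phiPlus 0))) (A (PowerSeries.coeff (a - k) (bSeries q μ p))) :=
      (commute_bSeries (fun m => commute_phiPlus_h hqq 0 m) _ _).map _
    have h9 : A (PowerSeries.coeff k (aSeries q μ p)) = (-1 : ℂ) ^ a •
        (A (gen q μ (.phiPlus 0)) * A (PowerSeries.coeff (a - k) (bSeries q μ p))) := by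
      rw [h8.eq, ← hBsq, pow_two, ← mul_assoc, ← smul_mul_assoc, ← this, mul_assoc, hB'B, mul_one]
    exact LinearMap.congr_fun h9 x

lemma IsHighestVec.exists_eigenvalue (hqq : q - q⁻¹ ≠ 0) {v : V} {f g : ℤ → ℂ}
    (h : IsHighestVec q μ v f g) (m : ℤ) : ∃ c : ℂ, gen q μ (.h m) • v = c • v :=
  h.cartan_le hqq (cartan_mem (.h m))

/-- The eigenvalue of `φ̄⁺ A⁺(z)` on a highest weight vector. -/
lemma IsHighestVec.exists_series (hq0 : q ≠ 0) (hq : ∀ n : ℕ, 0 < n → q ^ n ≠ 1) {v : V}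
    {f g : ℤ → ℂ} (h : IsHighestVec q μ v f g) (s : Multiset ℂ) :
    ∃ S F : PowerSeries ℂ, PowerSeries.coeff 0 S = 1 ∧
      (∀ n, PowerSeries.coeff n (aSeries q μ (pSum s)) • v = PowerSeries.coeff n S • v) ∧
      f = seqZero F ∧ S * scaleArg (q ^ 2) S * F = f 0 • (linProd s : PowerSeries ℂ) := by
  have hqq := q_sub_inv_ne_zero hq0 hq
  choose η hη using h.exists_eigenvalue hqq
  have hF : ∀ n : ℕ, f n = f 0 * PowerSeries.coeff n
      (expSeries (positiveSeries fun m => (q - q⁻¹) * η m)) := fun n => by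
    have h1 := h.phiPlus n
    have h2 := expSeries_smul (f := hPlusSeries q μ)
      (η := positiveSeries fun m => (q - q⁻¹) * η m) (v := v) (fun i => by
        simp only [hPlusSeries, coeff_positiveSeries]
        split_ifs
        · rw [zero_smul, zero_smul]
        · rw [smul_assoc, hη, smul_smul]) n
    rw [gen_phiPlus_natCast, mul_smul, h2, smul_smul_comm', h.phiPlus, smul_smul] at h1
    have := sub_eq_zero.2 h1
    rw [← sub_smul, smul_eq_zero, or_iff_left h.ne_zero, sub_eq_zero] at this
    rw [← this, mul_comm]
  refine ⟨expSeries (positiveSeries fun m => (-(q⁻¹ ^ m * invCartan q m)) *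
      ((q - q⁻¹) * η m + pSum s m / m)),
    f 0 • expSeries (positiveSeries fun m => (q - q⁻¹) * η m), coeff_zero_expSeries _, ?_, ?_, ?_⟩
  · refine expSeries_smul fun i => ?_
    simp only [coeff_positiveSeries]
    split_ifs
    · rw [zero_smul, zero_smul]
    · rw [smul_assoc, add_smul, smul_assoc, hη, algebraMap_smul, smul_smul, ← add_smul, smul_smul]
  · refine seqZero_eq (fun m hm => h.f_neg hm) fun n => ?_
    rw [hF, PowerSeries.coeff_smul, smul_eq_mul]
  -- In each degree the exponents of `S(z)` and `S(q² z)` add up to `1 + q^{2m}` times that of `S`,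
  -- which cancels `q^{-m} C̃(q^m)`; the part from `h_m` cancels `F` and `Z` is left.
  · rw [mul_smul_comm]
    congr 1
    rw [scaleArg_expSeries, scaleArg_positiveSeries, ← expSeries_positiveSeries_add,
      ← expSeries_positiveSeries_add, coe_linProd]
    congr 1
    refine positiveSeries_congr fun m hm => ?_
    have h1 := one_add_q_sq_pow_ne_zero hq hm
    have h2 : q⁻¹ ^ m * invCartan q m = (1 + (q ^ 2) ^ m)⁻¹ := by
      rw [invCartan, inv_pow, ← mul_inv]
      congr 1
      have : q ^ m ≠ 0 := pow_ne_zero _ hq0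
      field_simp
      ring
    rw [h2, smul_eq_mul]
    field_simp
    ring

/-- Apply `x⁺_0` to `x⁻(z) A⁺(z) v = 0`: since `x⁺_0` kills `v`, only the commutator `φ⁺ - φ⁻`
survives. -/
lemma IsTruncated.act_sub (hq0 : q ≠ 0) (hq : ∀ n : ℕ, 0 < n → q ^ n ≠ 1) {a : ℕ} {p : ℤ → ℂ}
    (ht : IsTruncated q μ V a p) {v : V} {f g : ℤ → ℂ} (h : IsHighestVec q μ v f g) {W : ℂ[X]}
    (hWa : W.natDegree ≤ a)
    (hW : ∀ n, PowerSeries.coeff n (aSeries q μ p) • v = W.coeff n • v) :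
    act W f = act W g := by
  have hqq := q_sub_inv_ne_zero hq0 hq
  have hrel := sum_xMinus_mul_aSeries (V := V) hq0 hq (ht.a_vanish (a + 1) (Nat.lt_succ_self a))
  ext m
  have e := congrArg (fun x => gen q μ (.xPlus 0) • x) (hrel m v)
  simp only [smul_zero, Finset.smul_sum] at e
  have hterm : ∀ i ∈ Finset.range (a + 1), gen q μ (.xPlus 0) • gen q μ (.xMinus (m - i)) •
      PowerSeries.coeff i (aSeries q μ p) • v =
      ((q - q⁻¹)⁻¹ * (W.coeff i * f (m - i) - W.coeff i * g (m - i))) • v := fun i _ => by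
    rw [hW, smul_smul_comm', smul_smul_comm', ← mul_smul, xPlus_mul_xMinus, add_smul, mul_smul,
      h.xPlus, smul_zero, zero_add, smul_assoc, sub_smul, zero_add, h.phiPlus, h.phiMinus,
      ← sub_smul, smul_smul, smul_smul]
    congr 1
    ring
  rw [Finset.sum_congr rfl hterm, ← Finset.sum_smul, smul_eq_zero, or_iff_left h.ne_zero,
    ← Finset.mul_sum, mul_eq_zero, or_iff_right (inv_ne_zero hqq), Finset.sum_sub_distrib,
    sub_eq_zero] at e
  rw [act_apply hWa, act_apply hWa, e]

/-- The data of the highest `ℓ`-weight `Q / W` of a truncated module. -/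
structure IsFactor (q : ℂ) (a : ℕ) (s : Multiset ℂ) (f g : ℤ → ℂ) (W Q : ℂ[X]) : Prop where
  natDegree : W.natDegree = a
  coeff_zero : W.coeff 0 = 1
  coeff_top : W.coeff a = (-1) ^ a * f 0
  mul_eq : W.comp (C (q ^ 2) * X) * Q = C (f 0) * linProd s
  act_zero : act W f = act Q unitSeq
  act_infty : act W g = act Q unitSeq

/-- Truncation makes the eigenvalue of `a(z)` a polynomial `W`. Then `W f = W g` is bounded on both
sides, hence a polynomial `Q`, and `W(z) W(q² z) φ⁺(z) = f(0) Z(z)` turns into the factorization. -/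
theorem IsTruncated.exists_isFactor (hq0 : q ≠ 0) (hq : ∀ n : ℕ, 0 < n → q ^ n ≠ 1) {a : ℕ}
    {s : Multiset ℂ} (ht : IsTruncated q μ V a (pSum s)) {v : V} {f g : ℤ → ℂ}
    (h : IsHighestVec q μ v f g) :
    ∃ W Q : ℂ[X], IsFactor q a s f g W Q := by
  obtain ⟨S, F, hS0, hS, hF, hmul⟩ := h.exists_series hq0 hq s
  have hcoeff : ∀ n {c d : ℂ}, PowerSeries.coeff n (aSeries q μ (pSum s)) • v = c • v →
      PowerSeries.coeff n (aSeries q μ (pSum s)) • v = d • v → c = d := fun n c d h1 h2 => by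
    have := sub_eq_zero.2 (h1.symm.trans h2)
    rw [← sub_smul, smul_eq_zero, or_iff_left h.ne_zero] at this
    exact sub_eq_zero.1 this
  have hbig : ∀ n, a < n → PowerSeries.coeff n S = 0 := fun n hn =>
    hcoeff n (hS n) (by rw [zero_smul]; exact ht.a_vanish n hn v)
  let W : ℂ[X] := PowerSeries.trunc (a + 1) S
  have hWS : ∀ n, W.coeff n = PowerSeries.coeff n S := fun n => by
    rw [PowerSeries.coeff_trunc]
    split_ifs with hn
    · rfl
    · exact (hbig n (by omega)).symm
  have hWcoe : (W : PowerSeries ℂ) = S := by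
    ext n
    rw [Polynomial.coeff_coe, hWS]
  have htop : W.coeff a = (-1) ^ a * f 0 := by
    rw [hWS]
    exact hcoeff a (hS a) (by rw [ht.leading, h.phiPlus, smul_smul])
  have hdeg : W.natDegree = a := by
    -- The degree is exactly `a` because the top coefficient is `±f 0`, which is non-zero as `φ⁺_0`
    -- is invertible.
    refine le_antisymm (natDegree_le_iff_coeff_eq_zero.2 fun n hn => ?_) (le_natDegree_of_ne_zero ?_)
    · rw [hWS, hbig n hn]
    · rw [htop]
      exact mul_ne_zero (pow_ne_zero _ (neg_ne_zero.2 one_ne_zero)) h.f_zero_ne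
  have hW : ∀ n, PowerSeries.coeff n (aSeries q μ (pSum s)) • v = W.coeff n • v := fun n => by
    rw [hWS, hS]
  have hact := ht.act_sub hq0 hq h hdeg.le hW
  obtain ⟨Q, hQ⟩ := exists_polynomial (F := act W f)
    (act_support_nonneg W fun m hm => h.f_neg hm) (d := μ + W.natDegree) (by
      rw [hact]; exact act_support_le W fun m hm => h.g_big hm)
  refine ⟨W, Q, hdeg, by rw [hWS, hS0], htop, ?_, hQ.symm, by rw [← hact, hQ]⟩
  apply act_unitSeq_injective
  rw [act_mul, hQ, hF, ← act_mul, act_seqZero, act_unitSeq_eq]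
  congr 1
  rw [Polynomial.coe_mul, coe_comp_C_mul_X, hWcoe, mul_comm (scaleArg _ _), hmul, hF,
    Polynomial.coe_mul, Polynomial.coe_C, ← PowerSeries.smul_eq_C_mul]

end Necessity

/-! ## Existence of highest weight vectors -/

/-- A commuting family of operators has a common eigenvector in every non-zero finite-dimensional
stable subspace. -/
lemma exists_joint_eigenvector {V J : Type*} [AddCommGroup V] [Module ℂ V] (T : J → Module.End ℂ V)
    (hT : ∀ i j, Commute (T i) (T j)) (n : ℕ) : ∀ E : Submodule ℂ V, FiniteDimensional ℂ E →
    Module.finrank ℂ E = n → E ≠ ⊥ → (∀ j, ∀ x ∈ E, T j x ∈ E) →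
    ∃ v ∈ E, v ≠ 0 ∧ ∀ j, ∃ c : ℂ, T j v = c • v := by
  induction n using Nat.strong_induction_on with
  | _ n ih =>
    intro E hfin hn hE hstab
    -- If some operator is not scalar on `E`, one of its eigenspaces in `E` is proper, non-zero and
    -- stable under the family.
    by_cases hscalar : ∀ j, ∃ c : ℂ, ∀ x ∈ E, T j x = c • x
    · obtain ⟨v, hv, hv0⟩ := Submodule.exists_mem_ne_zero_of_ne_bot hE
      exact ⟨v, hv, hv0, fun j => (hscalar j).imp fun c hc => hc v hv⟩
    · push Not at hscalar
      obtain ⟨j, hj⟩ := hscalar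
      have : Nontrivial E := Submodule.nontrivial_iff_ne_bot.2 hE
      obtain ⟨c, hc⟩ := Module.End.exists_eigenvalue ((T j).restrict (hstab j))
      obtain ⟨w, hw⟩ := hc.exists_hasEigenvector
      have hw' : T j w = c • (w : V) := congrArg Subtype.val hw.apply_eq_smul
      have hlt : E ⊓ (T j).eigenspace c < E := by
        refine lt_of_le_of_ne inf_le_left fun h => ?_
        obtain ⟨x, hx, hne⟩ := hj c
        rw [← h] at hx
        exact hne (Module.End.mem_eigenspace_iff.1 hx.2)
      obtain ⟨v, hv, hv0, hv'⟩ := ih _ (hn ▸ Submodule.finrank_lt_finrank_of_lt hlt)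
        (E ⊓ (T j).eigenspace c) (Submodule.finiteDimensional_of_le inf_le_left) rfl
        (fun h => hw.2 (Subtype.ext ((Submodule.eq_bot_iff _).1 h w
          ⟨w.2, Module.End.mem_eigenspace_iff.2 hw'⟩)))
        fun i x hx => ⟨hstab i x hx.1, Module.End.mem_eigenspace_iff.2 (by
          rw [← Module.End.mul_apply, (hT j i).eq,
            Module.End.mul_apply, Module.End.mem_eigenspace_iff.1 hx.2, map_smul])⟩
      exact ⟨v, hv.1, hv0, hv'⟩

/-! ### Maximal weights in category `𝒪` -/

section Maximal

variable {q : ℂ} {μ : ℤ} {V : Type*} [AddCommGroup V] [Module ℂ V] [Module (ShiftedAlg q μ) V]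
  [IsScalarTower ℂ (ShiftedAlg q μ) V]

/-- Otherwise all `ω q^{2n}` are weights. Finitely many bounds serve infinitely many `n`, so one
bound equals `ω q^{2(n + m_n)}` for unboundedly many `n`, although it fixes `n + m_n`. -/
lemma InCategoryO.exists_maximal_weight (hq0 : q ≠ 0) (hq : ∀ n : ℕ, 0 < n → q ^ n ≠ 1)
    [Nontrivial V] (hO : InCategoryO q μ V) : ∃ ω : ℂˣ, weightPlus q μ V ω ≠ ⊥ ∧
      weightPlus q μ V (ω * Units.mk0 q hq0 ^ 2) = ⊥ := by
  obtain ⟨ω, hω⟩ : ∃ ω : ℂˣ, weightPlus q μ V ω ≠ ⊥ := by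
    by_contra! h
    have := hO.sum_plus
    simp only [h, iSup_bot] at this
    exact bot_ne_top this
  by_contra! hcon
  have hall : ∀ n : ℕ, weightPlus q μ V (ω * (Units.mk0 q hq0 ^ 2) ^ n) ≠ ⊥ := fun n => by
    induction n with
    | zero => simpa using hω
    | succ n ih =>
      rw [pow_succ, ← mul_assoc]
      exact hcon _ ih
  obtain ⟨S, hS⟩ := hO.bounded
  choose F hF m hm using fun n : ℕ => hS _ (Or.inl (hall n))
  obtain ⟨y, hy⟩ := Finite.exists_infinite_fiber fun n => (⟨F n, hF n⟩ : S)
  have hy' := Set.infinite_coe_iff.1 hy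
  obtain ⟨k, hk⟩ := hy'.nonempty
  -- An index beyond `k + m k` cannot satisfy `l + m l = k + m k`.
  obtain ⟨l, hl, hlt⟩ := hy'.exists_gt (k + m k)
  have e : F k = F l := congrArg Subtype.val (hk.trans hl.symm)
  have e2 : (ω : ℂ) * q ^ ((2 * (k + m k) : ℕ) : ℤ) = ω * q ^ ((2 * (l + m l) : ℕ) : ℤ) := by
    have := congrArg Units.val e
    rw [hm k, hm l] at this
    simp only [Units.val_mul, Units.val_pow_eq_pow_val, Units.val_mk0] at this
    rw [zpow_natCast, zpow_natCast, pow_mul, pow_mul, pow_add, pow_add, ← mul_assoc, ← mul_assoc,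
      this]
  have := q_zpow_injective hq0 hq (mul_left_cancel₀ ω.ne_zero e2)
  omega

/-- A non-zero module in category `𝒪` contains a highest weight vector. -/
theorem InCategoryO.exists_isHighestVec (hq0 : q ≠ 0) (hq : ∀ n : ℕ, 0 < n → q ^ n ≠ 1)
    [Nontrivial V] (hO : InCategoryO q μ V) : ∃ (v : V) (f g : ℤ → ℂ), IsHighestVec q μ v f g := by
  obtain ⟨ω, hω, hω'⟩ := hO.exists_maximal_weight hq0 hq
  let y : ℤ ⊕ ℤ → ShiftedAlg q μ :=
    Sum.elim (fun m => gen q μ (.phiPlus m)) fun m => gen q μ (.phiMinus m)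
  have hy : ∀ i j, Commute (y i) (y j) := by
    rintro (i | i) (j | j)
    · exact commute_phiPlus i j
    · exact commute_phiPlus_phiMinus i j
    · exact (commute_phiPlus_phiMinus j i).symm
    · exact commute_phiMinus i j
  -- The maximal weight space is finite-dimensional and stable under all `φ^±_m`, since these
  -- commute with `φ⁺_0`.
  obtain ⟨v, hv, hv0, hT⟩ := exists_joint_eigenvector (fun i => Algebra.lsmul ℂ ℂ V (y i))
    (fun i j => (hy i j).map (Algebra.lsmul ℂ ℂ V)) _ (weightPlus q μ V ω)
    (hO.finite_plus ω) rfl hω fun j x hx => by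
      rw [mem_weightPlus] at hx ⊢
      change gen q μ (.phiPlus 0) • y j • x = (ω : ℂ) • y j • x
      rw [← mul_smul, show gen q μ (.phiPlus 0) * y j = y j * gen q μ (.phiPlus 0) from
        (hy (Sum.inl 0) j).eq, mul_smul, hx, smul_smul_comm']
  choose c hc using hT
  refine ⟨v, fun m => c (Sum.inl m), fun m => c (Sum.inr m), hv0, fun m => ?_,
    fun m => hc (Sum.inl m), fun m => hc (Sum.inr m)⟩
  rw [mem_weightPlus] at hv
  -- `x⁺_m` raises the weight to `ω q²`, whose space is zero by maximality.
  have h1 := phiPlus_smul_xPlus_smul hq0 (w := ω) (k := 0) (x := v) (by simpa using hv) m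
  rw [← Submodule.mem_bot ℂ, ← hω', mem_weightPlus, h1]
  simp [zpow_ofNat]

end Maximal

/-! ## Truncated modules from divisors -/

/-- On all bi-infinite sequences, polynomials have torsion, for instance geometric sequences. On
those bounded on one side they do not, as these form a field of Laurent series. -/
lemma act_cancel_zero {p r : ℂ[X]} (hp : p ≠ 0) {u : ℤ → ℂ} (hu : ∀ m < 0, u m = 0)
    (h : act p u = act (p * r) unitSeq) : u = act r unitSeq :=
  (expandZero_div hp hu h).symm.trans
    (expandZero_div hp (fun _ hm => act_unitSeq_neg r hm) (act_mul p r unitSeq).symm)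

lemma act_cancel_infty {p r : ℂ[X]} (hp : p ≠ 0) {u : ℤ → ℂ} {d : ℤ} (hu : ∀ m, d < m → u m = 0)
    (h : act p u = act (p * r) unitSeq) : u = act r unitSeq := by
  have hu0 : ∀ m : ℤ, 0 < m → unitSeq m = 0 := fun m hm => by simp [unitSeq, hm.ne']
  ext m
  exact (expandInfty_div hp hu h m).symm.trans
    (expandInfty_div hp (act_support_le r hu0) (act_mul p r unitSeq).symm m)

lemma exists_family_eq {a : ℕ} (s : Multiset ℂ) (hs : Multiset.card s = a) :
    ∃ β : Fin a → ℂ, family β = s := by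
  subst hs
  induction s using Quotient.inductionOn with
  | _ l =>
    refine ⟨fun i => l.get i, ?_⟩
    rw [family, Fin.univ_val_map]
    exact congrArg _ (List.ofFn_get l)

lemma linProd_injOn {s t : Multiset ℂ} (hs : ∀ b ∈ s, b ≠ 0) (ht : ∀ b ∈ t, b ≠ 0)
    (h : linProd s = linProd t) : s = t := by
  have := congrArg Polynomial.roots h
  rw [roots_linProd s hs, roots_linProd t ht] at this
  exact Multiset.map_injective inv_injective this

lemma exists_eq_linProd {p : ℂ[X]} (hp : p.eval 0 = 1) :
    ∃ s : Multiset ℂ, (∀ b ∈ s, b ≠ 0) ∧ Multiset.card s = p.natDegree ∧ p = linProd s := by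
  have hne : p.eval 0 ≠ 0 := by rw [hp]; exact one_ne_zero
  refine ⟨p.roots.map fun b => b⁻¹, fun b hb => ?_, ?_, ?_⟩
  · obtain ⟨c, hc, rfl⟩ := Multiset.mem_map.1 hb
    refine inv_ne_zero ?_
    rintro rfl
    exact hne (isRoot_of_mem_roots hc)
  · rw [Multiset.card_map, ← (IsAlgClosed.splits p).natDegree_eq_card_roots]
  · have := eq_linProd_of_eval_zero_ne hne
    rwa [hp, C_1, one_mul] at this

/-! ### The zeros of `Z` -/

section Zeros

variable (q : ℂ) {N : ℕ} (zs : Fin N → ℂˣ)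

/-- The inverses of the zeros of `Z`. -/
def zSet : Multiset ℂ := family fun s => q * (zs s : ℂ)

lemma zSet_ne_zero (hq0 : q ≠ 0) : ∀ b ∈ zSet q zs, b ≠ 0 :=
  family_ne_zero fun s => mul_ne_zero hq0 (zs s).ne_zero

lemma Zpoly_eq_linProd : Zpoly q zs = linProd (zSet q zs) := (linProd_family _).symm

lemma powerSum_Zrat (hq0 : q ≠ 0) : powerSum (Zrat q zs) = pSum (zSet q zs) := by
  ext m
  rw [Zrat, Zpoly_eq_linProd, powerSum_linProd _ (zSet_ne_zero q zs hq0)]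

lemma card_zSet : Multiset.card (zSet q zs) = N := by rw [zSet, card_family, Fintype.card_fin]

lemma prod_neg_zSet : ((zSet q zs).map fun b => -b).prod = (-q) ^ N * ∏ s, (zs s : ℂ) := by
  rw [zSet, prod_map_family]
  simp only [← neg_mul, Finset.prod_mul_distrib, Finset.prod_const, Finset.card_univ,
    Fintype.card_fin]

end Zeros

lemma comp_C_mul_X_ne_zero {W : ℂ[X]} (hW : W.coeff 0 = 1) (c : ℂ) : W.comp (C c * X) ≠ 0 :=
  fun h => by
    have := congrArg (eval 0) h
    rw [eval_comp, eval_mul, eval_X, mul_zero, ← coeff_zero_eq_eval_zero, hW, eval_zero] at this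
    exact one_ne_zero this

lemma IsFactor.ne_zero {q : ℂ} {a : ℕ} {s : Multiset ℂ} {f g : ℤ → ℂ} {W Q : ℂ[X]}
    (h : IsFactor q a s f g W Q) : W ≠ 0 := fun h0 => by
  have := h.coeff_zero
  rw [h0, Polynomial.coeff_zero] at this
  exact zero_ne_one this

/-- The highest `ℓ`-weight is determined by the divisor. -/
lemma IsFactor.unique {q : ℂ} {a : ℕ} {s : Multiset ℂ} {f g f' g' : ℤ → ℂ} {W Q Q' : ℂ[X]} {d : ℤ}
    (h : IsFactor q a s f g W Q) (h' : IsFactor q a s f' g' W Q') (hf : ∀ m < 0, f m = 0)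
    (hf' : ∀ m < 0, f' m = 0) (hg : ∀ m, d < m → g m = 0) (hg' : ∀ m, d < m → g' m = 0) :
    f = f' ∧ g = g' := by
  have h0 : f 0 = f' 0 := by
    have := h.coeff_top.symm.trans h'.coeff_top
    exact mul_left_cancel₀ (pow_ne_zero _ (neg_ne_zero.2 one_ne_zero)) this
  have hQ : Q = Q' := mul_left_cancel₀ (comp_C_mul_X_ne_zero h.coeff_zero (q ^ 2))
    (by rw [h.mul_eq, h'.mul_eq, h0])
  subst hQ
  refine ⟨(expandZero_div h.ne_zero hf h.act_zero).symm.trans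
    (expandZero_div h.ne_zero hf' h'.act_zero), ?_⟩
  ext m
  exact (expandInfty_div h.ne_zero hg h.act_infty m).symm.trans
    (expandInfty_div h.ne_zero hg' h'.act_infty m)

section Divisor

variable {q : ℂ} {μ : ℤ} {N a : ℕ}

/-- Every divisor gives a truncated vacuum functional. -/
theorem exists_vacuum_of_dvd (hq0 : q ≠ 0) (hq : ∀ n : ℕ, 0 < n → q ^ n ≠ 1)
    (hμ : μ = (N : ℤ) - 2 * (a : ℤ)) {s : Multiset ℂ} (hs : ∀ b ∈ s, b ≠ 0)
    (hsN : Multiset.card s = N) {W : ℂ[X]} (hWa : W.natDegree = a) (hW0 : W.coeff 0 = 1)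
    (hdvd : W.comp (C (q ^ 2) * X) ∣ linProd s) :
    ∃ (f g : ℤ → ℂ) (Q : ℂ[X]) (χ : ShiftedAlg q μ →ₗ[ℂ] ℂ), IsVacuum χ f g ∧
      IsFactor q a s f g W Q ∧ f 0 * g μ = (s.map fun b => -b).prod / (q ^ 2) ^ a ∧
      (∀ k, a < k → ∀ Y X, χ (Y * PowerSeries.coeff k (aSeries q μ (pSum s)) * X) = 0) ∧
      (∀ k, a < k → ∀ Y X, χ (Y * PowerSeries.coeff k (bSeries q μ (pSum s)) * X) = 0) ∧
      ∀ k, k ≤ a → ∀ Y X, χ (Y * PowerSeries.coeff k (aSeries q μ (pSum s)) * X) = (-1) ^ a *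
        χ (Y * (gen q μ (.phiPlus 0) * PowerSeries.coeff (a - k) (bSeries q μ (pSum s))) * X) := by
  obtain ⟨t, ht, hta, rfl⟩ := exists_eq_linProd (p := W) (by rw [← coeff_zero_eq_eval_zero, hW0])
  obtain ⟨β, rfl⟩ := exists_family_eq t (hta.trans hWa)
  have hβ : ∀ i, β i ≠ 0 := fun i => ht _ (mem_family.2 ⟨i, rfl⟩)
  have hcomp : (linProd (family β)).comp (C (q ^ 2) * X) = linProd (family fun i => q ^ 2 * β i) := by
    rw [linProd_comp, map_family]
    simp only [mul_comm]
  -- The roots of the cofactor are the part of `Z` that stays fixed under deformation; the remaining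
  -- zeros follow `β`.
  obtain ⟨R, hR⟩ := hdvd
  have hR0 : R.eval 0 = 1 := by
    have := congrArg (eval 0) hR
    rwa [eval_zero_linProd, eval_mul, hcomp, eval_zero_linProd, one_mul, eq_comm] at this
  obtain ⟨r, hr, -, rfl⟩ := exists_eq_linProd hR0
  have hzs : s = zeroSet q β r := by
    refine linProd_injOn hs (zeroSet_ne_zero hq0 hβ hr) ?_
    rw [hR, hcomp, zeroSet, linProd_add]
  have hcard : (Multiset.card r : ℤ) = μ + a := by
    rw [hzs, zeroSet, Multiset.card_add, card_family, Fintype.card_fin] at hsN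
    omega
  obtain ⟨χ, hχ, h1, h2, h3⟩ := exists_truncated_vacuum (μ := μ) hq0 hq hβ hr hcard
  rw [← hzs] at hχ h1 h2 h3
  -- The eigenvalue functions expand `(∏ β_i) Z / (W(z) W(q² z))`; the common factor `W(q² z)`
  -- cancels against `Z` and leaves `Q / W`.
  have hden : denomPoly q β = (linProd (family β)).comp (C (q ^ 2) * X) * linProd (family β) := by
    rw [denomPoly, linProd_add, hcomp, mul_comm]
  have hnum : C (∏ i, β i) * linProd s =
      (linProd (family β)).comp (C (q ^ 2) * X) * (C (∏ i, β i) * linProd r) := by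
    rw [hR]; ring
  have hv := hχ.isHighestVec
  have hne := comp_C_mul_X_ne_zero hW0 (q ^ 2)
  refine ⟨_, _, C (∏ i, β i) * linProd r, χ, hχ, ⟨hWa, hW0, ?_, ?_, ?_, ?_⟩, ?_, h1, h2, h3⟩
  · have hl := leadingCoeff_linProd _ ht
    rwa [leadingCoeff, hWa, prod_map_family, Finset.prod_neg, Finset.card_univ, Fintype.card_fin,
      ← phiPlusVal_zero (s := s)] at hl
  · rw [phiPlusVal_zero, hnum]
  · refine act_cancel_zero hne (act_support_nonneg _ fun m hm => hv.f_neg hm) ?_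
    rw [← act_mul, ← hden, act_phiPlusVal, hnum]
  · refine act_cancel_infty hne (act_support_le _ fun m hm => hv.g_big hm) ?_
    rw [← act_mul, ← hden, act_phiMinusVal hq0 hβ hs (by rw [hsN, Fintype.card_fin]; omega), hnum]
  · rw [phiPlusVal_zero, phiMinusVal_self, Fintype.card_fin]
    have : ∏ i, β i ≠ 0 := Finset.prod_ne_zero_iff.2 fun i _ => hβ i
    have : (q ^ 2) ^ a ≠ 0 := pow_ne_zero _ (pow_ne_zero _ hq0)
    field_simp

variable {V : Type*} [AddCommGroup V] [Module ℂ V] [Module (ShiftedAlg q μ) V]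
  [IsScalarTower ℂ (ShiftedAlg q μ) V]

lemma IsHighestVec.exists_eq_smul [IsSimpleModule (ShiftedAlg q μ) V] {v : V} {f g : ℤ → ℂ}
    (h : IsHighestVec q μ v f g) (x : V) : ∃ X : ShiftedAlg q μ, x = X • v := by
  obtain ⟨X, hX⟩ := IsSimpleModule.toSpanSingleton_surjective (ShiftedAlg q μ) h.ne_zero x
  exact ⟨X, hX.symm⟩

lemma IsFactor.dvd {s : Multiset ℂ} {f g : ℤ → ℂ} {W Q : ℂ[X]} (h : IsFactor q a s f g W Q)
    (hf : f 0 ≠ 0) : W.comp (C (q ^ 2) * X) ∣ linProd s :=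
  ⟨C (f 0)⁻¹ * Q, by
    rw [mul_left_comm, h.mul_eq, ← mul_assoc, ← C_mul, inv_mul_cancel₀ hf, C_1, one_mul]⟩

/-- A simple highest weight module whose highest `ℓ`-weight comes from a divisor is in category `𝒪`
and descends to the truncation. -/
theorem IsFactor.descends (hq0 : q ≠ 0) (hq : ∀ n : ℕ, 0 < n → q ^ n ≠ 1)
    (hμ : μ = (N : ℤ) - 2 * (a : ℤ)) {zs : Fin N → ℂˣ} {z' : ℂˣ}
    (hz' : (z' : ℂ) ^ 2 = (-q) ^ N * ∏ s, (zs s : ℂ)) [IsSimpleModule (ShiftedAlg q μ) V]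
    {v : V} {f g : ℤ → ℂ} {W Q : ℂ[X]} (h : IsHighestVec q μ v f g)
    (hF : IsFactor q a (zSet q zs) f g W Q) :
    Descends q μ V a zs z' ∧ InCategoryO q μ V := by
  have hqq := q_sub_inv_ne_zero hq0 hq
  obtain ⟨f', g', Q', χ, hχ, hF', hfg, h1, h2, h3⟩ := exists_vacuum_of_dvd hq0 hq hμ
    (zSet_ne_zero q zs hq0) (card_zSet q zs) hF.natDegree hF.coeff_zero (hF.dvd h.f_zero_ne)
  obtain ⟨rfl, rfl⟩ := hF.unique hF' (fun m hm => h.f_neg hm)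
    (fun m hm => hχ.isHighestVec.f_neg hm) (fun m hm => h.g_big hm)
    fun m hm => hχ.isHighestVec.g_big hm
  have ht := h.isTruncated hq0 hq hχ h1 h2 h3
  refine ⟨?_, ht.inCategoryO hq0 hq h h.exists_eq_smul⟩
  -- Either square root of `f 0` will do as the eigenvalue of `φ̄⁺` on the highest weight vector.
  obtain ⟨c, hc⟩ := IsAlgClosed.exists_pow_nat_eq (f 0) two_pos
  have hc0 : c ≠ 0 := by
    rintro rfl
    exact h.f_zero_ne (by rw [← hc, zero_pow two_ne_zero])
  refine IsTruncated.descends hq0 hq hc0 ?_ (fun x => ?_) (by rwa [powerSum_Zrat q zs hq0])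
  · rw [eq_top_iff]
    rintro x -
    obtain ⟨X, rfl⟩ := h.exists_eq_smul x
    refine Submodule.span_mono ?_ (h.smul_mem_lowerSum hq0 hqq X)
    rintro y ⟨k, -, hk⟩
    exact ⟨k, by rw [hc, hk]⟩
  · obtain ⟨X, rfl⟩ := h.exists_eq_smul x
    -- The central scalar is `(-q)^N z_1 ⋯ z_N / q^{2a}`; it equals `(z' / (-q)^a)²` by the choice
    -- of `z'`.
    rw [h.phiPlus_smul_phiMinus_smul hq0 hqq, hfg, prod_neg_zSet, ← hz', div_pow, ← pow_mul,
      ← pow_mul, mul_comm a 2, pow_mul (-q), neg_sq, ← pow_mul]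

end Divisor

/-! ## The polynomiality condition -/

/-- After `z ↦ z q⁻¹` the weight in the exponent of `Ȳ⁺` is `(1 + q^{2m})⁻¹`, so multiplying by the
`q²`-shift leaves the expansion of `Θ` normalized at `0`. -/
lemma mul_scaleArg_YbarPlus {q : ℂ} (hq0 : q ≠ 0) (hq : ∀ n : ℕ, 0 < n → q ^ n ≠ 1)
    (Θ : RatFunc ℂ) :
    scaleArg q⁻¹ (YbarPlus q Θ) * scaleArg (q ^ 2) (scaleArg q⁻¹ (YbarPlus q Θ)) =
      expSeries (positiveSeries fun m => -(powerSum Θ m / (m : ℂ))) := by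
  rw [YbarPlus, scaleArg_expSeries, scaleArg_positiveSeries, scaleArg_expSeries,
    scaleArg_positiveSeries, ← expSeries_positiveSeries_add]
  congr 1
  refine positiveSeries_congr fun m hm => ?_
  have h1 := one_add_q_sq_pow_ne_zero hq hm
  have h2 : q⁻¹ ^ m * invCartan q m = (1 + (q ^ 2) ^ m)⁻¹ := by
    rw [invCartan, inv_pow, ← mul_inv]
    congr 1
    have : q ^ m ≠ 0 := pow_ne_zero _ hq0
    field_simp
    ring
  have h3 : q⁻¹ ^ m * -(invCartan q m * powerSum Θ m / (m : ℂ)) =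
      -((1 + (q ^ 2) ^ m)⁻¹ * powerSum Θ m / (m : ℂ)) := by rw [← h2]; ring
  rw [smul_eq_mul, smul_eq_mul, h3]
  field_simp
  ring

/-- The exponential is the expansion of `p / r` divided by its value at `0`; with denominators
cleared, this is an identity of power series. -/
lemma mul_expSeries_powerSum {p r : ℂ[X]} (hp : p.eval 0 ≠ 0) (hr : r.eval 0 ≠ 0) :
    (r : PowerSeries ℂ) * PowerSeries.C (p.eval 0) * expSeries (positiveSeries fun m =>
      -(powerSum (algebraMap ℂ[X] (RatFunc ℂ) p / algebraMap ℂ[X] (RatFunc ℂ) r) m / (m : ℂ))) =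
      (p : PowerSeries ℂ) * PowerSeries.C (r.eval 0) := by
  have hne : ∀ {p : ℂ[X]}, p.eval 0 ≠ 0 → p ≠ 0 := fun h h0 => h (by rw [h0, eval_zero])
  have h := linProd_mul_expSeries (s := r.roots.map fun b => b⁻¹) (t := p.roots.map fun b => b⁻¹)
    (c := fun m =>
      -(powerSum (algebraMap ℂ[X] (RatFunc ℂ) p / algebraMap ℂ[X] (RatFunc ℂ) r) m / (m : ℂ)))
    fun m _ => by
      rw [powerSum_div (hne hp) (hne hr), pSum, pSum, Multiset.map_map, Multiset.map_map]
      simp only [Function.comp_def]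
      ring
  have hp' := congrArg Polynomial.toPowerSeries (eq_linProd_of_eval_zero_ne hp)
  have hr' := congrArg Polynomial.toPowerSeries (eq_linProd_of_eval_zero_ne hr)
  rw [Polynomial.coe_mul, Polynomial.coe_C] at hp' hr'
  rw [hp', hr', ← h]
  ring

lemma coeff_zero_scaleArg_YbarPlus (q : ℂ) (Θ : RatFunc ℂ) :
    PowerSeries.coeff 0 (scaleArg q⁻¹ (YbarPlus q Θ)) = 1 := by
  rw [coeff_scaleArg, YbarPlus, coeff_zero_expSeries, pow_zero, one_smul]

lemma eval_zero_Zpoly (q : ℂ) {N : ℕ} (zs : Fin N → ℂˣ) : (Zpoly q zs).eval 0 = 1 := by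
  rw [Zpoly_eq_linProd, eval_zero_linProd]

lemma Zrat_div {q : ℂ} {N : ℕ} {zs : Fin N → ℂˣ} {Ψ : RatFunc ℂ} {W Q : ℂ[X]}
    (hΨ : Ψ = algebraMap ℂ[X] (RatFunc ℂ) Q / algebraMap ℂ[X] (RatFunc ℂ) W) :
    Zrat q zs / Ψ = algebraMap ℂ[X] (RatFunc ℂ) (Zpoly q zs * W) /
      algebraMap ℂ[X] (RatFunc ℂ) Q := by
  rw [hΨ, div_div_eq_mul_div, Zrat, map_mul]

lemma act_at_zero (p : ℂ[X]) {f : ℤ → ℂ} (hf : ∀ m < 0, f m = 0) : act p f 0 = p.coeff 0 * f 0 := by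
  rw [act_apply le_rfl, Finset.sum_range_succ', Finset.sum_eq_zero, zero_add]
  · simp
  · intro k _
    rw [hf _ (by push_cast; omega), mul_zero]

section Polynomiality

variable {q : ℂ} {μ : ℤ} {N a : ℕ}

lemma IsFactor.eval_zero {s : Multiset ℂ} {f g : ℤ → ℂ} {W Q : ℂ[X]}
    (h : IsFactor q a s f g W Q) : Q.eval 0 = f 0 := by
  have := congrArg (eval 0) h.mul_eq
  rwa [eval_mul, eval_mul, eval_comp, eval_mul, eval_X, mul_zero, ← coeff_zero_eq_eval_zero,
    h.coeff_zero, one_mul, eval_C, eval_zero_linProd, mul_one] at this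

lemma valueAtZero_mul {Ψ : RatFunc ℂ} {W Q : ℂ[X]} (hW : W.coeff 0 = 1)
    (hΨ : Ψ = algebraMap ℂ[X] (RatFunc ℂ) Q / algebraMap ℂ[X] (RatFunc ℂ) W) :
    Ψ.num.eval 0 = Q.eval 0 * Ψ.denom.eval 0 := by
  have hne : W ≠ 0 := fun h0 => by
    rw [h0, Polynomial.coeff_zero] at hW
    exact zero_ne_one hW
  have := congrArg (eval 0) (num_mul_eq hne hΨ)
  rwa [eval_mul, eval_mul, ← coeff_zero_eq_eval_zero W, hW, mul_one] at this

variable {V : Type*} [AddCommGroup V] [Module ℂ V] [Module (ShiftedAlg q μ) V]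
  [IsScalarTower ℂ (ShiftedAlg q μ) V]

lemma HasHighestLWeight.exists_isHighestVec [Nontrivial V] {Ψ : RatFunc ℂ}
    (h : HasHighestLWeight q μ V Ψ) : ∃ v : V, IsHighestVec q μ v (expandZero Ψ).coeff
      fun m => (expandInfty Ψ).coeff (-m) := by
  obtain ⟨v, hv, h1, h2, h3⟩ := h
  refine ⟨v, fun h0 => ?_, h1, h2, h3⟩
  rw [h0, Submodule.span_zero_singleton] at hv
  exact bot_ne_top hv

lemma Descends.exists_isFactor (hq0 : q ≠ 0) (hq : ∀ n : ℕ, 0 < n → q ^ n ≠ 1)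
    {zs : Fin N → ℂˣ} {z' : ℂˣ} (hD : Descends q μ V a zs z') {v : V} {f g : ℤ → ℂ}
    (h : IsHighestVec q μ v f g) : ∃ W Q : ℂ[X], IsFactor q a (zSet q zs) f g W Q := by
  have ht := hD.isTruncated hq0 hq
  rw [powerSum_Zrat q zs hq0] at ht
  exact ht.exists_isFactor hq0 hq h

/-- By the factorization, `W(z) W(q² z) = Ψ(0) Z(z) / Ψ(z)`, and `Ȳ⁺_{ZΨ⁻¹}(z q⁻¹)` satisfies the
same equation with the same constant term. The two agree, so `P = c⁻¹ W` and `P Ψ = c⁻¹ Q`. -/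
lemma IsFactor.polynomialityCondition (hq0 : q ≠ 0) (hq : ∀ n : ℕ, 0 < n → q ^ n ≠ 1)
    {zs : Fin N → ℂˣ} {Ψ : RatFunc ℂ} (hΨ : IsLWeight μ Ψ) {c : ℂ} (hc : c ^ 2 = valueAtZero Ψ)
    {g : ℤ → ℂ} {W Q : ℂ[X]} (hF : IsFactor q a (zSet q zs) (expandZero Ψ).coeff g W Q) :
    PolynomialityCondition q a zs Ψ c := by
  have hW0 : W.eval 0 = 1 := by rw [← coeff_zero_eq_eval_zero, hF.coeff_zero]
  have hΨ' := eq_div_of_expandZero hF.ne_zero hF.act_zero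
  set f0 := (expandZero Ψ).coeff 0 with hf0
  have hQ0 : Q.eval 0 = f0 := hF.eval_zero
  have hval : c ^ 2 = f0 := by
    rw [hc, valueAtZero, valueAtZero_mul hF.coeff_zero hΨ', hQ0, mul_div_cancel_right₀ _ hΨ.2.1]
  have hc0 : c ≠ 0 := by
    rintro rfl
    rw [zero_pow two_ne_zero, valueAtZero, eq_comm, div_eq_zero_iff] at hc
    exact hc.elim hΨ.1 hΨ.2.1
  have hf00 : f0 ≠ 0 := by rw [← hval]; exact pow_ne_zero _ hc0
  have hQne : (Q : PowerSeries ℂ) ≠ 0 := fun h0 => hf00 (by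
    rw [← hQ0, ← coeff_zero_eq_eval_zero, ← Polynomial.coeff_coe, h0, map_zero])
  have hS : (W : PowerSeries ℂ) = scaleArg q⁻¹ (YbarPlus q (Zrat q zs / Ψ)) := by
    refine eq_of_mul_scaleArg_eq (c := q ^ 2) (fun n hn => one_add_q_sq_pow_ne_zero hq hn) ?_ ?_ ?_
    · rw [coeff_zero_scaleArg_YbarPlus, Polynomial.coeff_coe, hF.coeff_zero]
    · rw [Polynomial.coeff_coe, hF.coeff_zero]; exact one_ne_zero
    · rw [mul_scaleArg_YbarPlus hq0 hq, Zrat_div hΨ']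
      have h1 := mul_expSeries_powerSum (p := Zpoly q zs * W) (r := Q)
        (by rw [eval_mul, eval_zero_Zpoly, hW0, mul_one]; exact one_ne_zero) (by rwa [hQ0])
      have h2 := congrArg Polynomial.toPowerSeries hF.mul_eq
      rw [Polynomial.coe_mul, Polynomial.coe_mul, coe_comp_C_mul_X, Polynomial.coe_C,
        ← Zpoly_eq_linProd] at h2
      rw [eval_mul, eval_zero_Zpoly, hW0, mul_one, map_one, mul_one, hQ0, Polynomial.coe_mul] at h1
      apply mul_left_cancel₀ hQne
      rw [h1, mul_right_comm, mul_comm _ (PowerSeries.C f0), ← h2]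
      ring
  refine ⟨C c⁻¹ * W, C c⁻¹ * Q, ?_, ?_, ?_, ?_⟩
  · rw [highestEigenvalue, ← hS, Polynomial.coe_mul, Polynomial.coe_C, PowerSeries.smul_eq_C_mul]
  · rw [hΨ', map_mul, map_mul, mul_assoc,
      mul_div_cancel₀ _ (RatFunc.algebraMap_ne_zero hF.ne_zero)]
  · rw [natDegree_C_mul (inv_ne_zero hc0), hF.natDegree]
  -- The leading coefficient is `c⁻¹ (-1)^a c² = (-1)^a c`, and `c = P(0)⁻¹`.
  · rw [leadingCoeff_mul, leadingCoeff_C, leadingCoeff, hF.natDegree, hF.coeff_top, ← hf0, ← hval,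
      eval_mul, eval_C, hW0]
    field_simp

/-- The data are `W = c P` and `Q = c P Ψ`; the factorization is the functional equation of `Ȳ⁺`
with denominators cleared. -/
lemma PolynomialityCondition.exists_isFactor (hq0 : q ≠ 0) (hq : ∀ n : ℕ, 0 < n → q ^ n ≠ 1)
    {zs : Fin N → ℂˣ} {Ψ : RatFunc ℂ} (hΨ : IsLWeight μ Ψ) {c : ℂ} (hc : c ^ 2 = valueAtZero Ψ)
    (hf : ∀ m < 0, (expandZero Ψ).coeff m = 0) (hg : ∀ m, μ < m → (expandInfty Ψ).coeff (-m) = 0)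
    (hP : PolynomialityCondition q a zs Ψ c) : ∃ W Q : ℂ[X],
      IsFactor q a (zSet q zs) (expandZero Ψ).coeff (fun m => (expandInfty Ψ).coeff (-m)) W Q := by
  obtain ⟨P, R, hP1, hP2, hP3, hP4⟩ := hP
  have hc0 : c ≠ 0 := by
    rintro rfl
    rw [zero_pow two_ne_zero, valueAtZero, eq_comm, div_eq_zero_iff] at hc
    exact hc.elim hΨ.1 hΨ.2.1
  have hS : ((C c * P : ℂ[X]) : PowerSeries ℂ) = scaleArg q⁻¹ (YbarPlus q (Zrat q zs / Ψ)) := by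
    rw [Polynomial.coe_mul, Polynomial.coe_C, hP1, highestEigenvalue, ← PowerSeries.smul_eq_C_mul,
      smul_smul, mul_inv_cancel₀ hc0, one_smul]
  have hW0 : (C c * P).coeff 0 = 1 := by
    rw [← Polynomial.coeff_coe, hS, coeff_zero_scaleArg_YbarPlus]
  have hWne : C c * P ≠ 0 := fun h0 => by
    rw [h0, Polynomial.coeff_zero] at hW0
    exact zero_ne_one hW0
  have hΨ' : Ψ = algebraMap ℂ[X] (RatFunc ℂ) (C c * R) / algebraMap ℂ[X] (RatFunc ℂ) (C c * P) := by
    rw [eq_div_iff (RatFunc.algebraMap_ne_zero hWne), map_mul, map_mul, hP2]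
    ring
  have hP0 : P.eval 0 = c⁻¹ := by
    rw [coeff_C_mul, coeff_zero_eq_eval_zero] at hW0
    exact eq_inv_of_mul_eq_one_right hW0
  have hdeg : (C c * P).natDegree = a := by rw [natDegree_C_mul hc0, hP3]
  have htop : (C c * P).coeff a = (-1) ^ a * c ^ 2 := by
    rw [coeff_C_mul, ← hP3, coeff_natDegree, hP4, hP0, hP3, inv_inv]
    ring
  generalize C c * P = W at hS hW0 hWne hΨ' hdeg htop
  generalize C c * R = Q at hΨ'
  have hW0' : W.eval 0 = 1 := by rw [← coeff_zero_eq_eval_zero, hW0]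
  have hnum := num_mul_eq hWne hΨ'
  have hQ0 : Q.eval 0 = c ^ 2 := by
    rw [hc, valueAtZero, valueAtZero_mul hW0 hΨ', mul_div_cancel_right₀ _ hΨ.2.1]
  have hc2 : c ^ 2 ≠ 0 := pow_ne_zero _ hc0
  have hact0 : act W (expandZero Ψ).coeff = act Q unitSeq := by
    refine act_cancel_zero (RatFunc.denom_ne_zero Ψ) (act_support_nonneg _ hf) ?_
    rw [← act_mul, mul_comm, act_mul, act_denom_expandZero, ← act_mul, mul_comm W, hnum, mul_comm]
  have hact1 : act W (fun m => (expandInfty Ψ).coeff (-m)) = act Q unitSeq := by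
    refine act_cancel_infty (RatFunc.denom_ne_zero Ψ) (act_support_le _ hg) ?_
    rw [← act_mul, mul_comm, act_mul, act_denom_expandInfty, ← act_mul, mul_comm W, hnum, mul_comm]
  have hf0 : (expandZero Ψ).coeff 0 = c ^ 2 := by
    have := congrFun hact0 0
    rw [act_at_zero _ hf, hW0, one_mul] at this
    rw [this, ← hQ0, ← coeff_zero_eq_eval_zero]
    exact act_unitSeq Q 0
  refine ⟨W, Q, hdeg, hW0, by rw [hf0, htop], ?_, hact0, hact1⟩
  have h1 := mul_expSeries_powerSum (p := Zpoly q zs * W) (r := Q)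
    (by rw [eval_mul, eval_zero_Zpoly, hW0', mul_one]; exact one_ne_zero) (by rwa [hQ0])
  rw [← Zrat_div hΨ', ← mul_scaleArg_YbarPlus hq0 hq, ← hS, ← coe_comp_C_mul_X, eval_mul,
    eval_zero_Zpoly, hW0', mul_one, map_one, mul_one, hQ0, ← Polynomial.coe_C, ← Polynomial.coe_mul,
    ← Polynomial.coe_mul, ← Polynomial.coe_mul, Polynomial.coe_inj] at h1
  rw [hf0, ← Zpoly_eq_linProd]
  -- The functional equation carries an extra factor `W`, since `Z / Ψ = Z W / Q`.
  apply mul_left_cancel₀ hWne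
  linear_combination h1

/-- A simple module descends to the truncation if and only if its highest `ℓ`-weight satisfies the
polynomiality condition. -/
theorem descends_iff (hq0 : q ≠ 0) (hq : ∀ n : ℕ, 0 < n → q ^ n ≠ 1)
    (hμ : μ = (N : ℤ) - 2 * (a : ℤ)) {zs : Fin N → ℂˣ} {z' : ℂˣ}
    (hz' : (z' : ℂ) ^ 2 = (-q) ^ N * ∏ s, (zs s : ℂ)) [IsSimpleModule (ShiftedAlg q μ) V]
    {Ψ : RatFunc ℂ} (hΨ : IsLWeight μ Ψ) (hV : HasHighestLWeight q μ V Ψ) {c : ℂ}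
    (hc : c ^ 2 = valueAtZero Ψ) :
    Descends q μ V a zs z' ↔ PolynomialityCondition q a zs Ψ c := by
  have := IsSimpleModule.nontrivial (ShiftedAlg q μ) V
  obtain ⟨v, hv⟩ := hV.exists_isHighestVec
  constructor
  · intro hD
    obtain ⟨W, Q, hF⟩ := hD.exists_isFactor hq0 hq hv
    exact hF.polynomialityCondition hq0 hq hΨ hc
  · intro hP
    obtain ⟨W, Q, hF⟩ := hP.exists_isFactor hq0 hq hΨ hc (fun m hm => hv.f_neg hm)
      fun m hm => hv.g_big hm
    exact (hF.descends hq0 hq hμ hz' hv).1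

lemma natDegree_comp_C_mul_X {c : ℂ} (hc : c ≠ 0) (W : ℂ[X]) :
    (W.comp (C c * X)).natDegree = W.natDegree := by
  rw [natDegree_comp, natDegree_C_mul_X c hc, mul_one]

/-- Degrees in `W(q² z) Q = f(0) Z`. That `N - a` is the degree of a polynomial gives `μ ⪰ -λ`. -/
lemma IsFactor.natDegree_add (hq0 : q ≠ 0) {zs : Fin N → ℂˣ} {f g : ℤ → ℂ} {W Q : ℂ[X]}
    (h : IsFactor q a (zSet q zs) f g W Q) (hf : f 0 ≠ 0) : a + Q.natDegree = N := by
  have hne : Q ≠ 0 := fun h0 => hf (by rw [← h.eval_zero, h0, Polynomial.eval_zero])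
  have := congrArg Polynomial.natDegree h.mul_eq
  rwa [natDegree_mul (comp_C_mul_X_ne_zero h.coeff_zero _) hne,
    natDegree_comp_C_mul_X (pow_ne_zero 2 hq0), h.natDegree, natDegree_C_mul hf,
    natDegree_linProd _ (zSet_ne_zero q zs hq0), card_zSet] at this

/-- The coweights `μ` for which the truncation has non-zero modules in category `𝒪`. -/
theorem Descends.coweightLE (hq0 : q ≠ 0) (hq : ∀ n : ℕ, 0 < n → q ^ n ≠ 1)
    (hμ : μ = (N : ℤ) - 2 * (a : ℤ)) {zs : Fin N → ℂˣ} {z' : ℂˣ} [Nontrivial V]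
    (hO : InCategoryO q μ V) (hD : Descends q μ V a zs z') :
    CoweightLE (-(N : ℤ)) μ ∧ CoweightLE μ (N : ℤ) := by
  obtain ⟨v, f, g, h⟩ := hO.exists_isHighestVec hq0 hq
  obtain ⟨W, Q, hF⟩ := hD.exists_isFactor hq0 hq h
  have := hF.natDegree_add hq0 h.f_zero_ne
  exact ⟨⟨Q.natDegree, by omega⟩, ⟨a, by omega⟩⟩

/-- The highest `ℓ`-weight attached to a divisor. -/
theorem IsFactor.hasHighestLWeight (hq0 : q ≠ 0) (hμ : μ = (N : ℤ) - 2 * (a : ℤ))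
    {zs : Fin N → ℂˣ} [IsSimpleModule (ShiftedAlg q μ) V] {v : V} {f g : ℤ → ℂ} {W Q : ℂ[X]}
    (h : IsHighestVec q μ v f g) (hF : IsFactor q a (zSet q zs) f g W Q) :
    ∃ Ψ : RatFunc ℂ, IsLWeight μ Ψ ∧ HasHighestLWeight q μ V Ψ ∧
      Ψ = divisorLWeight q zs W (valueAtZero Ψ) := by
  obtain ⟨Ψ, hΨ⟩ : ∃ Ψ, Ψ = algebraMap ℂ[X] (RatFunc ℂ) Q / algebraMap ℂ[X] (RatFunc ℂ) W :=
    ⟨_, rfl⟩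
  have hval := valueAtZero_mul hF.coeff_zero hΨ
  rw [hF.eval_zero] at hval
  -- As the value of the numerator at `0` is a multiple of that of the denominator, a zero there
  -- would be common to both, against coprimality.
  have hden : Ψ.denom.eval 0 ≠ 0 := fun h0 => by
    obtain ⟨x, y, hxy⟩ := RatFunc.isCoprime_num_denom Ψ
    have := congrArg (eval 0) hxy
    rw [eval_add, eval_mul, eval_mul, hval, h0, mul_zero, mul_zero, mul_zero, add_zero,
      eval_one] at this
    exact zero_ne_one this
  have hnum : Ψ.num.eval 0 ≠ 0 := by rw [hval]; exact mul_ne_zero h.f_zero_ne hden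
  have hv0 : valueAtZero Ψ = f 0 := by rw [valueAtZero, hval, mul_div_cancel_right₀ _ hden]
  have hQne : Q ≠ 0 := fun h0 => h.f_zero_ne (by rw [← hF.eval_zero, h0, Polynomial.eval_zero])
  refine ⟨Ψ, ⟨hnum, hden, ?_⟩, ⟨v, ?_, h.xPlus, fun m => ?_, fun m => ?_⟩, ?_⟩
  · have h1 := congrArg Polynomial.natDegree (num_mul_eq hF.ne_zero hΨ)
    have hnum' : Ψ.num ≠ 0 := fun h0 => hnum (by rw [h0, Polynomial.eval_zero])
    rw [natDegree_mul hnum' hF.ne_zero, natDegree_mul hQne (RatFunc.denom_ne_zero Ψ),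
      hF.natDegree] at h1
    have h2 := hF.natDegree_add hq0 h.f_zero_ne
    rw [RatFunc.intDegree]
    omega
  · rw [eq_top_iff]
    rintro x -
    obtain ⟨X, rfl⟩ := h.exists_eq_smul x
    exact Submodule.smul_mem _ _ (Submodule.mem_span_singleton_self v)
  · rw [hΨ, expandZero_div hF.ne_zero (fun m hm => h.f_neg hm) hF.act_zero, h.phiPlus]
  · rw [hΨ, expandInfty_div hF.ne_zero (fun m hm => h.g_big hm) hF.act_infty, h.phiMinus]
  -- Replacing `Ψ(0) Z` by `W(q² z) Q` makes the factor `W(q² z)` cancel and returns `Q / W`.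
  · rw [hv0, divisorLWeight, hΨ, Zrat, Zpoly_eq_linProd, ← RatFunc.algebraMap_C, ← map_mul,
      ← hF.mul_eq, map_mul, mul_div_mul_left]
    exact RatFunc.algebraMap_ne_zero (comp_C_mul_X_ne_zero hF.coeff_zero _)

end Polynomiality

/-! ## The parametrization of simple modules by divisors -/

section Classification

variable {q : ℂ} {μ : ℤ} {N a : ℕ} {V V' : Type*} [AddCommGroup V] [Module ℂ V]
  [Module (ShiftedAlg q μ) V] [IsScalarTower ℂ (ShiftedAlg q μ) V] [AddCommGroup V'] [Module ℂ V']
  [Module (ShiftedAlg q μ) V'] [IsScalarTower ℂ (ShiftedAlg q μ) V']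

lemma map_complex_smul (e : V ≃ₗ[ShiftedAlg q μ] V') (c : ℂ) (x : V) : e (c • x) = c • e x := by
  rw [← algebraMap_smul (ShiftedAlg q μ) c x, map_smul, algebraMap_smul]

lemma IsHighestVec.map (e : V ≃ₗ[ShiftedAlg q μ] V') {v : V} {f g : ℤ → ℂ}
    (h : IsHighestVec q μ v f g) : IsHighestVec q μ (e v) f g := by
  refine ⟨fun h0 => h.ne_zero (e.map_eq_zero_iff.1 h0), fun m => ?_, fun m => ?_, fun m => ?_⟩
  · rw [← map_smul, h.xPlus, map_zero]
  · rw [← map_smul, h.phiPlus, map_complex_smul]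
  · rw [← map_smul, h.phiMinus, map_complex_smul]

/-- Highest weight vectors of a simple module are proportional, so the eigenvalues depend on the
module only. -/
lemma IsHighestVec.weight_unique [IsSimpleModule (ShiftedAlg q μ) V] (hq0 : q ≠ 0)
    (hq : ∀ n : ℕ, 0 < n → q ^ n ≠ 1) {v v' : V} {f g f' g' : ℤ → ℂ} (h : IsHighestVec q μ v f g)
    (h' : IsHighestVec q μ v' f' g') : f = f' ∧ g = g' := by
  obtain ⟨c, -, rfl⟩ := h.proportional hq0 hq h'
  have key : ∀ {x : ShiftedAlg q μ} {s t : ℂ}, x • v = s • v → x • c • v = t • c • v → s = t := by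
    intro x s t h1 h2
    rw [smul_smul_comm', h1, smul_comm, ← sub_eq_zero, ← sub_smul, smul_eq_zero,
      or_iff_left h'.ne_zero, sub_eq_zero] at h2
    exact h2
  exact ⟨funext fun m => key (h.phiPlus m) (h'.phiPlus m),
    funext fun m => key (h.phiMinus m) (h'.phiMinus m)⟩

/-- The divisor is determined by the highest `ℓ`-weight. -/
lemma IsFactor.divisor_unique (hq : ∀ n : ℕ, 0 < n → q ^ n ≠ 1) {s : Multiset ℂ} {f g : ℤ → ℂ}
    {W W' Q Q' : ℂ[X]} (hf : f 0 ≠ 0) (h : IsFactor q a s f g W Q) (h' : IsFactor q a s f g W' Q') :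
    W = W' := by
  have hQ' : Q' ≠ 0 := fun h0 => hf (by rw [← h'.eval_zero, h0, Polynomial.eval_zero])
  have e1 : W' * Q = W * Q' := by
    apply act_unitSeq_injective
    rw [act_mul, ← h.act_zero, ← act_mul, mul_comm, act_mul, h'.act_zero, act_mul]
  have e2 := h.mul_eq.trans h'.mul_eq.symm
  -- Both sides are `f(0) Z W / Q` in the notation of either factorization; a power series with
  -- constant term `1` is recovered from such a product.
  have e3 : W * W.comp (C (q ^ 2) * X) = W' * W'.comp (C (q ^ 2) * X) := by
    apply mul_right_cancel₀ hQ'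
    linear_combination (-W.comp (C (q ^ 2) * X)) * e1 + W' * e2
  apply Polynomial.coe_injective
  refine eq_of_mul_scaleArg_eq (c := q ^ 2) (fun n hn => one_add_q_sq_pow_ne_zero hq hn) ?_ ?_ ?_
  · rw [Polynomial.coeff_coe, Polynomial.coeff_coe, h.coeff_zero, h'.coeff_zero]
  · rw [Polynomial.coeff_coe, h.coeff_zero]; exact one_ne_zero
  · rw [← coe_comp_C_mul_X, ← coe_comp_C_mul_X, ← Polynomial.coe_mul, e3, Polynomial.coe_mul]

lemma dvd_comp_iff (hq0 : q ≠ 0) {W Z : ℂ[X]} :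
    W ∣ Z.comp (C (q ^ (-2 : ℤ)) * X) ↔ W.comp (C (q ^ 2) * X) ∣ Z := by
  have h2 : q ^ 2 ≠ 0 := pow_ne_zero 2 hq0
  have h1 : q ^ (-2 : ℤ) = (q ^ 2)⁻¹ := by rw [zpow_neg, zpow_ofNat]
  have e1 : ∀ p : ℂ[X], (p.comp (C (q ^ (-2 : ℤ)) * X)).comp (C (q ^ 2) * X) = p := fun p => by
    rw [comp_assoc, mul_comp, C_comp, X_comp, ← mul_assoc, ← C_mul, h1, inv_mul_cancel₀ h2, C_1,
      one_mul, comp_X]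
  have e2 : ∀ p : ℂ[X], (p.comp (C (q ^ 2) * X)).comp (C (q ^ (-2 : ℤ)) * X) = p := fun p => by
    rw [comp_assoc, mul_comp, C_comp, X_comp, ← mul_assoc, ← C_mul, h1, mul_inv_cancel₀ h2, C_1,
      one_mul, comp_X]
  constructor
  · rintro ⟨R, hR⟩
    exact ⟨R.comp (C (q ^ 2) * X), by rw [← mul_comp, ← hR, e1]⟩
  · rintro ⟨R, hR⟩
    exact ⟨R.comp (C (q ^ (-2 : ℤ)) * X), by rw [hR, mul_comp, e2]⟩

/-- The divisor `W` describes the module `V`. -/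
def HasDivisor (q : ℂ) (μ : ℤ) (V : Type*) [AddCommGroup V] [Module ℂ V] [Module (ShiftedAlg q μ) V]
    (a : ℕ) (zs : Fin N → ℂˣ) (W : ℂ[X]) : Prop :=
  ∃ (v : V) (f g : ℤ → ℂ) (Q : ℂ[X]), IsHighestVec q μ v f g ∧
    IsFactor q a (zSet q zs) f g W Q

/-- An isomorphism transports highest weight vectors, the module fixes their eigenvalues, and the
eigenvalues fix the divisor. -/
lemma HasDivisor.unique [IsSimpleModule (ShiftedAlg q μ) V'] (hq0 : q ≠ 0)
    (hq : ∀ n : ℕ, 0 < n → q ^ n ≠ 1) (e : V ≃ₗ[ShiftedAlg q μ] V') {zs : Fin N → ℂˣ} {W W' : ℂ[X]}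
    (h : HasDivisor q μ V a zs W) (h' : HasDivisor q μ V' a zs W') : W = W' := by
  obtain ⟨v, f, g, Q, hv, hF⟩ := h
  obtain ⟨v', f', g', Q', hv', hF'⟩ := h'
  obtain ⟨rfl, rfl⟩ := (hv.map e).weight_unique hq0 hq hv'
  exact hF.divisor_unique hq hv.f_zero_ne hF'

/-- The top coefficient of `W` gives `f 0`, the factorization gives `Q`, and `Q / W` is the whole
`ℓ`-weight, on which the simple module depends. -/
lemma HasDivisor.nonempty_equiv [IsSimpleModule (ShiftedAlg q μ) V]
    [IsSimpleModule (ShiftedAlg q μ) V'] (hq0 : q ≠ 0) (hq : ∀ n : ℕ, 0 < n → q ^ n ≠ 1)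
    {zs : Fin N → ℂˣ} {W : ℂ[X]} (h : HasDivisor q μ V a zs W) (h' : HasDivisor q μ V' a zs W) :
    Nonempty (V ≃ₗ[ShiftedAlg q μ] V') := by
  obtain ⟨v, f, g, Q, hv, hF⟩ := h
  obtain ⟨v', f', g', Q', hv', hF'⟩ := h'
  obtain ⟨rfl, rfl⟩ := hF.unique hF' (fun m hm => hv.f_neg hm) (fun m hm => hv'.f_neg hm)
    (fun m hm => hv.g_big hm) fun m hm => hv'.g_big hm
  exact hv.nonempty_equiv hq0 hq hv'

lemma HasDivisor.mem (hq0 : q ≠ 0) {zs : Fin N → ℂˣ} {W : ℂ[X]} (h : HasDivisor q μ V a zs W) :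
    W ∣ (Zpoly q zs).comp (C (q ^ (-2 : ℤ)) * X) ∧ W.natDegree = a ∧ W.eval 0 = 1 := by
  obtain ⟨v, f, g, Q, hv, hF⟩ := h
  refine ⟨?_, hF.natDegree, by rw [← coeff_zero_eq_eval_zero, hF.coeff_zero]⟩
  rw [dvd_comp_iff hq0, Zpoly_eq_linProd]
  exact hF.dvd hv.f_zero_ne

lemma Descends.exists_hasDivisor (hq0 : q ≠ 0) (hq : ∀ n : ℕ, 0 < n → q ^ n ≠ 1) [Nontrivial V]
    {zs : Fin N → ℂˣ} {z' : ℂˣ} (hO : InCategoryO q μ V) (hD : Descends q μ V a zs z') :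
    ∃ W, HasDivisor q μ V a zs W := by
  obtain ⟨v, f, g, h⟩ := hO.exists_isHighestVec hq0 hq
  obtain ⟨W, Q, hF⟩ := hD.exists_isFactor hq0 hq h
  exact ⟨W, v, f, g, Q, h, hF⟩

/-- Every divisor is realized by a simple module, in any universe. -/
theorem exists_simpleObj (hq0 : q ≠ 0) (hq : ∀ n : ℕ, 0 < n → q ^ n ≠ 1)
    (hμ : μ = (N : ℤ) - 2 * (a : ℤ)) {zs : Fin N → ℂˣ} {z' : ℂˣ}
    (hz' : (z' : ℂ) ^ 2 = (-q) ^ N * ∏ s, (zs s : ℂ)) (W : Divisors q a zs) :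
    ∃ S : SimpleObj.{u} q μ a zs z', HasDivisor q μ S.V a zs W.1 := by
  obtain ⟨W, hdvd, hWa, hW0⟩ := W
  rw [dvd_comp_iff hq0, Zpoly_eq_linProd] at hdvd
  rw [← coeff_zero_eq_eval_zero] at hW0
  obtain ⟨f, g, Q, χ, hχ, hF, -, h1, h2, h3⟩ := exists_vacuum_of_dvd hq0 hq hμ
    (zSet_ne_zero q zs hq0) (card_zSet q zs) hWa hW0 hdvd
  have hsimple := hχ.isSimpleModule hq0 hq
  -- The quotient lives in the universe of the algebra and is lifted to the one over which the
  -- classification is stated.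
  let e : (ShiftedAlg q μ ⧸ radical χ) ≃ₗ[ShiftedAlg q μ] ULift.{u} (ShiftedAlg q μ ⧸ radical χ) :=
    ULift.moduleEquiv.symm
  have hv := hχ.isHighestVec.map e
  have : IsSimpleModule (ShiftedAlg q μ) (ULift.{u} (ShiftedAlg q μ ⧸ radical χ)) :=
    IsSimpleModule.congr e.symm
  obtain ⟨hD, hO⟩ := hF.descends hq0 hq hμ hz' hv
  exact ⟨{ V := ULift.{u} (ShiftedAlg q μ ⧸ radical χ)
           simple := this
           inO := hO
           descends := hD }, _, f, g, Q, hv, hF⟩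

/-- Simple modules in category `𝒪` that descend to the truncation are classified by divisors. -/
theorem exists_equiv_divisors (hq0 : q ≠ 0) (hq : ∀ n : ℕ, 0 < n → q ^ n ≠ 1)
    (hμ : μ = (N : ℤ) - 2 * (a : ℤ)) {zs : Fin N → ℂˣ} {z' : ℂˣ}
    (hz' : (z' : ℂ) ^ 2 = (-q) ^ N * ∏ s, (zs s : ℂ)) :
    ∃ e : SimpleClasses.{u} q μ a zs z' ≃ Divisors q a zs,
      ∀ S : SimpleObj.{u} q μ a zs z', HasDivisor q μ S.V a zs (e (Quotient.mk _ S)).1 := by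
  have hex : ∀ S : SimpleObj.{u} q μ a zs z', ∃ W, HasDivisor q μ S.V a zs W := fun S => by
    have := S.simple
    have := IsSimpleModule.nontrivial (ShiftedAlg q μ) S.V
    exact S.descends.exists_hasDivisor hq0 hq S.inO
  choose F hF using hex
  have hresp : ∀ S T : SimpleObj.{u} q μ a zs z', S ≈ T → F S = F T := fun S T ⟨e⟩ => by
    have := T.simple
    exact (hF S).unique hq0 hq e (hF T)
  let G : SimpleClasses.{u} q μ a zs z' → Divisors q a zs :=
    Quotient.lift (fun S => ⟨F S, (hF S).mem hq0⟩) fun S T h => Subtype.ext (hresp S T h)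
  have hG : Function.Bijective G := by
    constructor
    · intro x y
      refine Quotient.inductionOn₂ x y fun S T h => Quotient.sound ?_
      have := S.simple
      have := T.simple
      have e : F S = F T := congrArg Subtype.val h
      exact (hF S).nonempty_equiv hq0 hq (e ▸ hF T)
    · intro W
      obtain ⟨S, hS⟩ := exists_simpleObj.{u} hq0 hq hμ hz' W
      have := S.simple
      exact ⟨Quotient.mk _ S, Subtype.ext ((hF S).unique hq0 hq (LinearEquiv.refl _ _) hS)⟩
  exact ⟨Equiv.ofBijective G hG, hF⟩

end Classification

end ShiftedSl2
end

/-! ### The three assertions together -/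

open ShiftedSl2 in
theorem mainTheorem10 (q : ℂ) (hq0 : q ≠ 0) (hq : ∀ n : ℕ, 0 < n → q ^ n ≠ 1)
    (N a : ℕ) (μ : ℤ) (hμ : μ = (N : ℤ) - 2 * (a : ℤ))
    (zs : Fin N → ℂˣ) (z' : ℂˣ) (hz' : (z' : ℂ) ^ 2 = (-q) ^ N * ∏ s, (zs s : ℂ)) :
    (∀ Ψ : RatFunc ℂ, IsLWeight μ Ψ →
      ∀ (V : Type u) [AddCommGroup V] [Module ℂ V] [Module (ShiftedAlg q μ) V]
        [IsScalarTower ℂ (ShiftedAlg q μ) V],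
        IsSimpleModule (ShiftedAlg q μ) V → InCategoryO q μ V → HasHighestLWeight q μ V Ψ →
        ∀ c : ℂ, c ^ 2 = valueAtZero Ψ →
          (Descends q μ V a zs z' ↔ PolynomialityCondition q a zs Ψ c)) ∧
    (∀ (V : Type u) [AddCommGroup V] [Module ℂ V] [Module (ShiftedAlg q μ) V]
        [IsScalarTower ℂ (ShiftedAlg q μ) V],
        Nontrivial V → InCategoryO q μ V → Descends q μ V a zs z' →
          CoweightLE (-(N : ℤ)) μ ∧ CoweightLE μ (N : ℤ)) ∧
    (∃ e : SimpleClasses.{u} q μ a zs z' ≃ Divisors q a zs,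
      ∀ S : SimpleObj.{u} q μ a zs z',
        ∃ Ψ : RatFunc ℂ, IsLWeight μ Ψ ∧ HasHighestLWeight q μ S.V Ψ ∧
          Ψ = divisorLWeight q zs (e (Quotient.mk _ S)).1 (valueAtZero Ψ)) := by
  refine ⟨fun Ψ hΨ V _ _ _ _ hV _ hw c hc => descends_iff hq0 hq hμ hz' hΨ hw hc,
    fun V _ _ _ _ _ hO hD => hD.coweightLE hq0 hq hμ hO, ?_⟩
  obtain ⟨e, he⟩ := exists_equiv_divisors.{u} hq0 hq hμ hz'
  refine ⟨e, fun S => ?_⟩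
  obtain ⟨v, f, g, Q, hv, hF⟩ := he S
  have := S.simple
  exact hF.hasHighestLWeight hq0 hμ hv
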